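/- **Setting.** Consider a POMDP with measurable state and measurement spaces $\mathcal X,\mathcal Z$, a finite non-empty action set $\mathcal A$, transition kernels $t(x,a,dx')$, a measurement likelihood $p(z\mid x)$ that is a density with respect to a $\sigma$-finite measure $\nu$ on $\mathcal Z$, a bounded measurable reward $r(x,a,x')$, an initial belief $b_0$ and a discount factor $\gamma\in(0,1)$, all accessible through a generative model driven by uniform random numbers. Fix $\epsilon>0$, let $H$ be the least $d$ with $\gamma^d<\epsilon$ (episodes end at depth $H$), and fix an arbitrary measurable, uniformly bounded rollout procedure. **Algorithm (POMCP++).** Each episode draws a group of $K$ samples $x_0^i$ from $b_0$ and sends it down the search tree from the root, with weights $w^i=1$ initially. If the reached node is not yet expanded, it is expanded, and the rollout procedure gives a return for each sample. At an expanded belief node $h$ an action $a$ is chosen $\epsilon_a$-greedily, i.e. with probability $1-\epsilon_a$ as the maximiser of the action values (see below), and uniformly otherwise. All samples are propagated with $a$. If the belief-action node $ha$ has $n$ measurement branches, then with probability $(n+1)^{\epsilon_z}$ a new branch is created, whose measurement is sampled from the likelihood of one of the propagated samples drawn with probability proportional to $w^i$; otherwise one of the $n$ branches is chosen uniformly. The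 weights are multiplied by the likelihoods of the selected measurement. The *importance-weighted discounted return* of the episode at the traversed nodes $h$ and $ha$ is $$\tilde V=\frac1\eta\sum_i w_h^i\,p(Z\mid X^i)\,R^i,\qquad \eta=\sum_i w_h^i\,p(Z\mid X^i),$$ where $w_h^i$ is the weight of the $i$-th sample on arrival at $h$ (so that the weighted samples represent the belief at $h$), $p(Z\mid X^i)$ is the likelihood of the measurements selected from $h$ onwards, and $R^i$ is the discounted sum of the rewards from $h$ onwards (including the rollout return). The tree keeps the running mean $V(ha)$ of these returns. **Policy and values.** The action values that steer the $\epsilon_a$-greedy choice are either the running estimates $V(ha)$ of the tree, or prescribed values $Q(h,a)$ that depend measurably on the history $h$ of actions and measurements. Correspondingly, $\pi$ is the policy that is $\epsilon_a$-greedy with respect to its own action values, or with respect to $Q$. For a history $h$ of length less than $H$, let $V_\pi(h)$ be the expected discounted sum of the rewards up to depth $H$ when the state has the posterior law given $h$ and $\pi$ is followed, and $V_\pi(ha)$ the same when $a$ is executed first. **Theorem.** Assume $0<\epsilon_a<1$ and $-1\le\epsilon_z<0$. Consider any node of the tree, addressed by the actions and the numbers of the measurement branches (in the order of their creation) on the path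 from the root, at depth less than $H$. 1. For every $K\ge1$, almost surely, for all sufficiently large $N$ the node exists in the tree after $N$ episodes, and the next episode traverses it, and each of its belief-action nodes $ha$, with positive probability. 2. (Belief nodes.) Let $h_N$ be the history of actions and measurements that the node $h$ represents in the tree $\mathcal T_N$ after $N$ episodes, and let $G_N(h)=\mathbb E[\tilde V\mid\mathcal T_N,\ \text{the next episode traverses } h]$. Then the estimate is asymptotically unbiased as $N\to\infty$ and then $K\to\infty$: for every $\delta>0$, $$\lim_{K\to\infty}\mathbb P\big(|G_N(h)-V_\pi(h_N)|<\delta\ \text{ for all sufficiently large } N\big)=1 .$$ 3. (Belief-action nodes.) Likewise, for every action $a$ and $\delta>0$, with $G_N(ha)=\mathbb E[\tilde V\mid\mathcal T_N,\ \text{the next episode traverses } ha]$, $$\lim_{K\to\infty}\mathbb P\big(|G_N(ha)-V_\pi(h_Na)|<\delta\ \text{ for all sufficiently large } N\big)=1 .$$ -/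

import Mathlib

open MeasureTheory ProbabilityTheory Filter Topology
open scoped NNReal ENNReal

noncomputable section

/-! ### Partially observable Markov decision processes -/

/-- A history: the executed actions, each followed by the acquired measurement, in
chronological order. -/
abbrev Hist (A Z : Type*) := List (A × Z)

/-- A stochastic policy: the probability of every action after every history. -/
abbrev Policy (A Z : Type*) := Hist A Z → A → ℝ

/-- A POMDP with finitely many actions (motion primitives). `o x z` is the measurement
likelihood `p(z | x)`, a density with respect to the reference measure `ν` on measurements. -/
structure POMDP (X A Z : Type*) [MeasurableSpace X] [MeasurableSpace Z] where
  t : A → Kernel X X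
  markov : ∀ a, IsMarkovKernel (t a)
  ν : Measure Z
  sigmaFinite : SigmaFinite ν
  o : X → Z → ℝ≥0
  measurable_o : Measurable (Function.uncurry o)
  lintegral_o : ∀ x, ∫⁻ z, (o x z : ℝ≥0∞) ∂ν = 1
  r : X → A → X → ℝ
  measurable_r : ∀ a, Measurable fun p : X × X => r p.1 a p.2
  bounded_r : ∃ C : ℝ, ∀ x a x', |r x a x'| ≤ C
  b₀ : Measure X
  prob_b₀ : IsProbabilityMeasure b₀
  γ : ℝ
  γ_pos : 0 < γ
  γ_lt_one : γ < 1

attribute [instance] POMDP.markov POMDP.sigmaFinite POMDP.prob_b₀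

namespace POMDP

variable {X A Z : Type*} [MeasurableSpace X] [MeasurableSpace Z]

/-- The law of the measurement acquired in the state `x`. -/
def obs (M : POMDP X A Z) (x : X) : Measure Z :=
  M.ν.withDensity fun z => (M.o x z : ℝ≥0∞)

/-- The joint "law" of the history and the current state, as an unnormalised measure on states:
`β_{haz}(dx') = p(z | x') ∫ t(x, a, dx') β_h(dx)`. -/
def unnormBelief (M : POMDP X A Z) (h : Hist A Z) : Measure X :=
  h.foldl (fun β az => (β.bind (M.t az.1)).withDensity fun x => (M.o x az.2 : ℝ≥0∞)) M.b₀

/-- The belief after the history `h`: the posterior law of the current state. -/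
def belief (M : POMDP X A Z) (h : Hist A Z) : Measure X :=
  (M.unnormBelief h Set.univ)⁻¹ • M.unnormBelief h

/-- Expected discounted sum of the next `k` stage rewards, from the state `x` after the history
`h`, when `a` is executed first and `π` is followed afterwards. -/
def expReturn [Fintype A] (M : POMDP X A Z) (π : Policy A Z) : ℕ → Hist A Z → A → X → ℝ
  | 0, _, _, _ => 0
  | k + 1, h, a, x =>
      ∫ x', (M.r x a x' + M.γ * ∫ z, (∑ a', π (h ++ [(a, z)]) a' *
        expReturn M π k (h ++ [(a, z)]) a' x') ∂(M.obs x')) ∂(M.t a x)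

/-- The value `V_π(h a)` of a belief-action node, for episodes that end at depth `H`. -/
def actionValue [Fintype A] (M : POMDP X A Z) (H : ℕ) (π : Policy A Z) (h : Hist A Z) (a : A) :
    ℝ :=
  ∫ x, M.expReturn π (H - h.length) h a x ∂(M.belief h)

/-- The value `V_π(h)` of a belief node, for episodes that end at depth `H`. -/
def value [Fintype A] (M : POMDP X A Z) (H : ℕ) (π : Policy A Z) (h : Hist A Z) : ℝ :=
  ∑ a, π h a * M.actionValue H π h a

end POMDP

/-- A generative model of a POMDP: initial states, successor states and measurements are computed
from independent random numbers, uniform on the unit interval. -/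
structure Simulator {X A Z : Type*} [MeasurableSpace X] [MeasurableSpace Z]
    (M : POMDP X A Z) where
  start : unitInterval → X
  move : X → A → unitInterval → X
  sense : X → unitInterval → Z
  measurable_start : Measurable start
  measurable_move : ∀ a, Measurable fun p : X × unitInterval => move p.1 a p.2
  measurable_sense : Measurable (Function.uncurry sense)
  map_start : (volume : Measure unitInterval).map start = M.b₀
  map_move : ∀ x a, (volume : Measure unitInterval).map (move x a) = M.t a x
  map_sense : ∀ x, (volume : Measure unitInterval).map (sense x) = M.obs x

/-! ### Action choice -/

section Actions

variable {A : Type*} [Fintype A] [Nonempty A]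

/-- The maximisers of `v`, as positions in a fixed enumeration of the actions. -/
def maximisers (v : A → ℝ) : Finset (Fin (Fintype.card A)) :=
  open Classical in
  Finset.univ.filter fun i => ∀ b, v b ≤ v ((Fintype.equivFin A).symm i)

theorem maximisers_nonempty (v : A → ℝ) : (maximisers v).Nonempty := by
  obtain ⟨a, ha⟩ := Finite.exists_max v
  exact ⟨Fintype.equivFin A a, by simpa [maximisers] using ha⟩

/-- `argmax_a v a`, ties being broken by a fixed enumeration of the actions. -/
def greedy (v : A → ℝ) : A :=
  (Fintype.equivFin A).symm ((maximisers v).min' (maximisers_nonempty v))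

/-- The action that a random number selects when actions are chosen uniformly. -/
def uniformAction (u : unitInterval) : A :=
  (Fintype.equivFin A).symm
    ⟨min ⌊(u : ℝ) * Fintype.card A⌋₊ (Fintype.card A - 1),
      lt_of_le_of_lt (min_le_right _ _) (Nat.sub_lt Fintype.card_pos one_pos)⟩

/-- `ε`-greedy action selection with the random numbers `u` and `u'`. -/
def selectAction (εa : ℝ) (v : A → ℝ) (u u' : unitInterval) : A :=
  open Classical in
  if εa < (u : ℝ) then greedy v else uniformAction u'

/-- The `ε`-greedy action probabilities for the action values `v`. -/
def epsGreedy (εa : ℝ) (v : A → ℝ) (a : A) : ℝ :=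
  open Classical in
  (1 - εa) * (if a = greedy v then 1 else 0) + εa / Fintype.card A

end Actions

/-- The action values with respect to which the tree policy is `ε`-greedy:
* `running`: the current estimates `V(ha)` kept in the tree (policy evaluation interleaved with
  policy improvement);
* `frozen Q`: prescribed values `Q` (pure evaluation of a given `ε`-greedy policy). -/
inductive Steering (A Z : Type*) [MeasurableSpace Z]
  | running : Steering A Z
  | frozen (Q : Hist A Z → A → ℝ)
      (measurable_Q : ∀ (as : List A) (a : A), Measurable fun z : Fin as.length → Z =>
        Q (List.ofFn fun i => (as.get i, z i)) a) : Steering A Z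

/-- `π` is the policy of the search tree: `ε`-greedy with respect to its own action values if the
tree is steered by its running estimates, and with respect to `Q` if it is steered by `Q`. -/
def IsTreePolicy {X A Z : Type*} [MeasurableSpace X] [MeasurableSpace Z] [Fintype A] [Nonempty A]
    (M : POMDP X A Z) (H : ℕ) (εa : ℝ) (s : Steering A Z) (π : Policy A Z) : Prop :=
  match s with
  | .running => ∀ h : Hist A Z, h.length < H → π h = epsGreedy εa (M.actionValue H π h)
  | .frozen Q _ => ∀ h : Hist A Z, h.length < H → π h = epsGreedy εa (Q h)

theorem expReturn_congr {X A Z : Type*} [MeasurableSpace X] [MeasurableSpace Z] [Fintype A]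
    (M : POMDP X A Z) (π π' : Policy A Z) (H : ℕ) (k : ℕ) (h : Hist A Z) (hk : h.length + k ≤ H)
    (hπ : ∀ g : Hist A Z, h.length < g.length → g.length < H → π g = π' g) (a : A) (x : X) :
    M.expReturn π k h a x = M.expReturn π' k h a x := by
  induction k generalizing h a x with
  | zero => rfl
  | succ k ih =>
    simp only [POMDP.expReturn]
    have key : ∀ (z : Z) (a' : A) (x' : X),
        π (h ++ [(a, z)]) a' * M.expReturn π k (h ++ [(a, z)]) a' x' =
          π' (h ++ [(a, z)]) a' * M.expReturn π' k (h ++ [(a, z)]) a' x' := by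
      intro z a' x'
      rcases Nat.eq_zero_or_pos k with rfl | hpos
      · simp [POMDP.expReturn]
      · rw [hπ _ (by simp) (by simp; omega), ih _ (by simp; omega)
          (fun g h1 h2 => hπ g (by simp at h1; omega) h2)]
    simp only [key]

/-- There is a tree policy for either way of steering the tree. -/
theorem exists_isTreePolicy {X A Z : Type*} [MeasurableSpace X] [MeasurableSpace Z] [Fintype A]
    [Nonempty A] (M : POMDP X A Z) (H : ℕ) (εa : ℝ) (s : Steering A Z) :
    ∃ π : Policy A Z, IsTreePolicy M H εa s π := by
  cases s with
  | frozen Q hQ => exact ⟨fun h => epsGreedy εa (Q h), fun h _ => rfl⟩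
  | running =>
    let F : Policy A Z → Policy A Z := fun π h => epsGreedy εa (M.actionValue H π h)
    have key : ∀ (π π' : Policy A Z) (n : ℕ),
        (∀ g : Hist A Z, H ≤ g.length + n → g.length < H → π g = π' g) →
        ∀ g : Hist A Z, H ≤ g.length + (n + 1) → g.length < H → F π g = F π' g := by
      intro π π' n hn g hg hg'
      have : M.actionValue H π g = M.actionValue H π' g := by
        funext a
        unfold POMDP.actionValue
        congr 1
        funext x
        exact expReturn_congr M π π' H _ g (by omega) (fun g' h1 h2 => hn g' (by omega) h2) a x
      simp only [F, this]
    have iter : ∀ (n : ℕ) (g : Hist A Z), H ≤ g.length + n → g.length < H →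
        F (F^[n] fun _ _ => 0) g = (F^[n] fun _ _ => 0) g := by
      intro n
      induction n with
      | zero => intro g h1 h2; omega
      | succ n ih =>
        intro g h1 h2
        rw [Function.iterate_succ_apply']
        exact key _ _ n ih g h1 h2
    exact ⟨F^[H] fun _ _ => 0, fun h hh => (iter H h (by omega) hh).symm⟩

/-! ### The search tree -/

/-- The address of a belief node: the actions and the numbers of the measurement branches that
lead to it from the root `[]`. The belief-action node `ha` is given by the pair of `h` and `a`. -/
abbrev Node (A : Type*) := List (A × ℕ)

/-- A search tree: the expanded (non-NULL) belief nodes, the measurements of the branches below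
each belief-action node in the order of their creation, visit numbers `N(ha)` and values `V(ha)`. -/
structure SearchTree (A Z : Type*) where
  nodes : Set (Node A)
  branches : Node A → A → List Z
  visits : Node A → A → ℕ
  value : Node A → A → ℝ

namespace SearchTree

variable {A Z : Type*}

/-- The actions and measurements along the path `l` that starts at the node `p`, if all its
branches exist. -/
def historyFrom (T : SearchTree A Z) : Node A → Node A → Option (Hist A Z)
  | _, [] => some []
  | p, (a, j) :: l =>
      ((T.branches p a)[j]?).bind fun z =>
        (T.historyFrom (p ++ [(a, j)]) l).map fun g => (a, z) :: g

/-- The history of actions and measurements that a belief node stands for. -/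
def history (T : SearchTree A Z) (h : Node A) : Option (Hist A Z) := T.historyFrom [] h

/-- Expansion of a NULL node. -/
def expand (T : SearchTree A Z) (h : Node A) : SearchTree A Z := { T with nodes := insert h T.nodes }

/-- Replace the list of the branches below `ha`. -/
def setBranches (T : SearchTree A Z) (h : Node A) (a : A) (l : List Z) : SearchTree A Z :=
  open Classical in
  { T with branches := fun h' a' => if h' = h ∧ a' = a then l else T.branches h' a' }

/-- `N(ha) ← N(ha) + 1`, then `V(ha) ← V(ha) + (r - V(ha)) / N(ha)`. -/
def backup (T : SearchTree A Z) (h : Node A) (a : A) (r : ℝ) : SearchTree A Z :=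
  open Classical in
  { T with
    visits := fun h' a' => if h' = h ∧ a' = a then T.visits h a + 1 else T.visits h' a'
    value := fun h' a' =>
      if h' = h ∧ a' = a then T.value h a + (r - T.value h a) / ((T.visits h a + 1 : ℕ) : ℝ)
      else T.value h' a' }

end SearchTree

/-! ### One simulation episode with `K + 1` samples -/

/-- The names of the random numbers consumed by one episode (`d` is the depth). -/
inductive Seed (K : ℕ)
  | start (i : Fin (K + 1))
  | explore (d : ℕ)
  | action (d : ℕ)
  | move (d : ℕ) (i : Fin (K + 1))
  | spawn (d : ℕ)
  | branch (d : ℕ)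
  | sample (d : ℕ)
  | sense (d : ℕ)
  | rollout (j : ℕ)

/-- The random numbers of one episode. -/
abbrev Noise (K : ℕ) := Seed K → unitInterval

/-- The law of the random numbers of one episode: independent, uniform on the unit interval. -/
def noiseLaw (K : ℕ) : Measure (Noise K) :=
  Measure.infinitePi fun _ : Seed K => (volume : Measure unitInterval)

instance (K : ℕ) : IsProbabilityMeasure (noiseLaw K) := by
  unfold noiseLaw; infer_instance

/-- The law of the random numbers of all episodes. -/
def runLaw (K : ℕ) : Measure (ℕ → Noise K) :=
  Measure.infinitePi fun _ : ℕ => noiseLaw K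

/-- The remaining parameters of the algorithm: the initial statistics of a node, the threshold
`ε` that ends an episode at the first depth `d` with `γ ^ d < ε`, and the rollout procedure, which
maps the samples, their weights, the depth and random numbers to one bounded return per sample. -/
structure Settings (X : Type*) [MeasurableSpace X] where
  visitsInit : ℕ
  valueInit : ℝ
  ε : ℝ
  ε_pos : 0 < ε
  rollout : (K : ℕ) → ℕ → (Fin (K + 1) → X) → (Fin (K + 1) → ℝ) → (ℕ → unitInterval) →
    Fin (K + 1) → ℝ
  measurable_rollout : ∀ K d, Measurable
    fun p : (Fin (K + 1) → X) × (Fin (K + 1) → ℝ) × (ℕ → unitInterval) =>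
      rollout K d p.1 p.2.1 p.2.2
  bounded_rollout : ∃ C : ℝ, ∀ K d x w u i, |rollout K d x w u i| ≤ C

/-- The depth at which episodes end: the least `d` with `γ ^ d < ε`. -/
def horizon (γ ε : ℝ) : ℕ := sInf {d : ℕ | γ ^ d < ε}

/-- Draw the number of a sample with probabilities proportional to the weights `w`, by inversion
of the cumulative weights (the last sample, if all weights vanish). -/
def drawSample {K : ℕ} (w : Fin (K + 1) → ℝ) (u : unitInterval) : Fin (K + 1) :=
  open Classical in
  ⟨min (Finset.univ.filter fun i : Fin (K + 1) =>
      ∑ j ∈ Finset.Iic i, w j ≤ (u : ℝ) * ∑ j, w j).card K,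
    Nat.lt_succ_of_le (min_le_right _ _)⟩

/-- Measurement selection at a belief-action node with the measurement branches `l`. With
probability `(|l| + 1) ^ εz`, a new branch is created for the freshly sampled measurement `z`;
otherwise an existing branch is chosen uniformly. The result consists of the number of the
selected branch, its measurement, and the updated list of branches. -/
def selectMeasurement {Z : Type*} (εz : ℝ) (l : List Z) (z : Z) (u u' : unitInterval) :
    ℕ × Z × List Z :=
  open Classical in
  let j := if (u : ℝ) < ((l.length : ℝ) + 1) ^ εz then l.length else ⌊(u' : ℝ) * l.length⌋₊
  match l[j]? with
  | some z' => (j, z', l)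
  | none => (l.length, z, l ++ [z])

/-- The outcome of a simulation from a node: the updated tree, for each sample the discounted
return and the likelihood of the selected measurements, and, for each belief node `h` that has
been traversed, the selected action together with the importance-weighted return at `h`. -/
structure Outcome (A Z : Type*) (K : ℕ) where
  tree : SearchTree A Z
  ret : Fin (K + 1) → ℝ
  lik : Fin (K + 1) → ℝ
  est : Node A → Option (A × ℝ)

section Algorithm

variable {X A Z : Type*} [MeasurableSpace X] [MeasurableSpace Z] [Fintype A] [Nonempty A]

/-- The action values that steer the action choice at the node `h` with history `g`. -/
def steeringValues (s : Steering A Z) (T : SearchTree A Z) (h : Node A) (g : Hist A Z) : A → ℝ :=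
  match s with
  | .running => T.value h
  | .frozen Q _ => Q g

/-- The recursive simulation from the node `h` with history `g` at depth `d`, with samples `x` of
weights `w`; the first argument after `ξ` is the number of steps until the episode ends. -/
def simulate {M : POMDP X A Z} (sim : Simulator M) (S : Settings X) (s : Steering A Z)
    (εa εz : ℝ) {K : ℕ} (ξ : Noise K) : ℕ → SearchTree A Z → Node A → Hist A Z → ℕ →
      (Fin (K + 1) → X) → (Fin (K + 1) → ℝ) → Outcome A Z K
  | 0, T, _, _, _, _, _ =>
      { tree := T, ret := fun _ => 0, lik := fun _ => 1, est := fun _ => none }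
  | k + 1, T, h, g, d, x, w =>
      open Classical in
      if h ∈ T.nodes then
        let a := selectAction εa (steeringValues s T h g) (ξ (.explore d)) (ξ (.action d))
        let x' := fun i => sim.move (x i) a (ξ (.move d i))
        let m := selectMeasurement εz (T.branches h a)
          (sim.sense (x' (drawSample w (ξ (.sample d)))) (ξ (.sense d)))
          (ξ (.spawn d)) (ξ (.branch d))
        let ws := fun i => (M.o (x' i) m.2.1 : ℝ)
        let out := simulate sim S s εa εz ξ k (T.setBranches h a m.2.2) (h ++ [(a, m.1)])
          (g ++ [(a, m.2.1)]) (d + 1) x' (fun i => w i * ws i)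
        let ret := fun i => M.r (x i) a (x' i) + M.γ * out.ret i
        let lik := fun i => ws i * out.lik i
        let est := (∑ i, w i * lik i * ret i) / ∑ i, w i * lik i
        { tree := out.tree.backup h a est
          ret := ret
          lik := lik
          est := fun h' => if h' = h then some (a, est) else out.est h' }
      else
        { tree := T.expand h
          ret := S.rollout K d x w fun j => ξ (.rollout j)
          lik := fun _ => 1
          est := fun _ => none }

/-- One episode: `K + 1` samples are drawn from the initial belief and simulated from the root. -/
def episode {M : POMDP X A Z} (sim : Simulator M) (S : Settings X) (s : Steering A Z)
    (εa εz : ℝ) {K : ℕ} (T : SearchTree A Z) (ξ : Noise K) : Outcome A Z K :=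
  simulate sim S s εa εz ξ (horizon M.γ S.ε) T [] [] 0 (fun i => sim.start (ξ (.start i)))
    fun _ => 1

/-- The search tree after `N` episodes. -/
def treeAfter {M : POMDP X A Z} (sim : Simulator M) (S : Settings X) (s : Steering A Z)
    (εa εz : ℝ) {K : ℕ} (ω : ℕ → Noise K) : ℕ → SearchTree A Z
  | 0 => { nodes := ∅, branches := fun _ _ => [], visits := fun _ _ => S.visitsInit,
           value := fun _ _ => S.valueInit }
  | N + 1 => (episode sim S s εa εz (treeAfter sim S s εa εz ω N) (ω N)).tree

/-- The event that an episode run on the tree `T` traverses the belief node `h`. -/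
def traversesNode {M : POMDP X A Z} (sim : Simulator M) (S : Settings X) (s : Steering A Z)
    (εa εz : ℝ) (K : ℕ) (T : SearchTree A Z) (h : Node A) : Set (Noise K) :=
  {ξ | ∃ a r, (episode sim S s εa εz T ξ).est h = some (a, r)}

/-- The event that an episode run on the tree `T` traverses the belief-action node `ha`. -/
def traversesActionNode {M : POMDP X A Z} (sim : Simulator M) (S : Settings X)
    (s : Steering A Z) (εa εz : ℝ) (K : ℕ) (T : SearchTree A Z) (h : Node A) (a : A) :
    Set (Noise K) :=
  {ξ | ∃ r, (episode sim S s εa εz T ξ).est h = some (a, r)}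

/-- The importance-weighted discounted return at `h` of an episode run on the tree `T`. -/
def estimateAt {M : POMDP X A Z} (sim : Simulator M) (S : Settings X) (s : Steering A Z)
    (εa εz : ℝ) {K : ℕ} (T : SearchTree A Z) (h : Node A) (ξ : Noise K) : ℝ :=
  (((episode sim S s εa εz T ξ).est h).map Prod.snd).getD 0

/-- Expectation of the importance-weighted return at the belief node `h`, for an episode run on
the tree `T` with fresh random numbers, given that it traverses `h`. -/
def meanAtNode {M : POMDP X A Z} (sim : Simulator M) (S : Settings X) (s : Steering A Z)
    (εa εz : ℝ) (K : ℕ) (T : SearchTree A Z) (h : Node A) : ℝ :=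
  ∫ ξ, estimateAt sim S s εa εz T h ξ
    ∂(ProbabilityTheory.cond (noiseLaw K) (traversesNode sim S s εa εz K T h))

/-- Expectation of the importance-weighted return at the belief-action node `ha`, for an episode
run on the tree `T` with fresh random numbers, given that it traverses `ha`. -/
def meanAtActionNode {M : POMDP X A Z} (sim : Simulator M) (S : Settings X) (s : Steering A Z)
    (εa εz : ℝ) (K : ℕ) (T : SearchTree A Z) (h : Node A) (a : A) : ℝ :=
  ∫ ξ, estimateAt sim S s εa εz T h ξ
    ∂(ProbabilityTheory.cond (noiseLaw K) (traversesActionNode sim S s εa εz K T h a))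

end Algorithm

end

/-! ### Asymptotic consistency of POMCP++ -/

/-! Everything is reduced to one kind of random iteration: a pair of a history `g` and the search
tree below it, updated by `localStep`. A simulation below a node reads and writes only that subtree
(`simulate_relocates`), so the subtree of a branch evolves by the same iteration, one level shorter,
at exactly those episodes that take the branch, and stands still otherwise (`kid_stepTo_self`,
`kid_stepTo_of_ne`). The random numbers behind the choices at one depth are independent of those
that move the samples, so taking an existing branch does not bias the samples. Given its
measurements, the return is a self-normalised importance sampling average over independent samples.

The core is an induction on the number `k` of remaining steps (`consistent`): for a history of
finite positive mass, the mean return of a freshly expanded tree is eventually close to its limit,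
almost surely in `N` once `K` is large. Returns are measured from an arbitrary depth `d ≤ |g|`, not
only from the node itself, because the weighted average at an ancestor does not split into an
average of rewards before the node and one after it. With no steps left the tree plays no role and
the claim is the strong law of large numbers for numerator and denominator (`consistent_zero`).

For the inductive step, the mean return of an action differs from the average of the mean returns of
its branches only by the probability of opening a new branch, which vanishes. Each branch was opened
with a measurement whose law, as `K` grows, tends to the predictive law, and the predictive mean of
the limits below is the limit at the node (`integral_nodeMean`). What remains is to show that most
branches are close to their limits. They are adaptively visited and in different stages of
convergence, so no law of large numbers applies directly. Instead, nonnegative supermartingales are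
used. The probability `ψ` that a branch is ever bad at a late stage is superharmonic along the
evolution of the branch, so the product of the `1 + θ ψ` over the branches, divided by `(1 + θ
p)^n`, is a supermartingale, where `p` bounds the mean of `ψ` over a new branch. Its boundedness
gives an average of `ψ` of at most `p + η` (`ae_eventually_kidSum_le`). A second potential shows
that branches in an early stage are a vanishing fraction (`ae_eventually_kidSum_clock_le`).

If the tree is steered by its own estimates, `V(ha)` must also converge. The product of visits and
`V(ha) - c` is a random walk with the centred returns as increments, and an exponential
supermartingale transfers the bounds on the conditional means to `V(ha)` (`ae_eventually_value_le`).
The greedy action may fail to converge when there are ties, but a nearly correct greedy choice has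
nearly optimal value (`abs_branchMean_greedy_sub_le`).

Every branch, and every new branch, is taken with probability at least a constant over `n + 1`,
where `n` is the number of branches and grows by at most one per episode. The harmonic series
diverges, so every branch is opened and taken infinitely often (`ae_tendsto_atTop_of_prob_ge`).
Finally, statements about fresh trees are carried to arbitrary addresses: a branch fails with
probability at most the mean failure probability of a tree started at a random new measurement
(`prob_kid_le`). The expectation given that a node is traversed is the local mean there, since the
choices along the path contribute a common factor that cancels (`exists_est_factor`, `cond_est`). -/

noncomputable section

set_option linter.unusedSectionVars false

/-! ### Independent sequences and random iterations -/

section Iteration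

variable {E 𝒯 : Type*} [MeasurableSpace E] [MeasurableSpace 𝒯]

/-- Replace the coordinates in `S` of the second family by those of the first. -/
def mixOn {ι : Type*} (S : Set ι) (p : (ι → E) × (ι → E)) : ι → E :=
  open Classical in fun i => if i ∈ S then p.1 i else p.2 i

theorem measurable_mixOn {ι : Type*} (S : Set ι) :
    Measurable (mixOn S : (ι → E) × (ι → E) → ι → E) := by
  classical
  refine measurable_pi_lambda _ fun i => ?_
  by_cases hi : i ∈ S
  · simpa [mixOn, hi, Function.comp_def] using (measurable_pi_apply i).comp measurable_fst
  · simpa [mixOn, hi, Function.comp_def] using (measurable_pi_apply i).comp measurable_snd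

/-- Independence in the form used below: pulled back along `mixOn S`, a functional of the
coordinates in `S` sees only the first copy and a functional of the others only the second, so
Fubini applies. The preimage of a cylinder is a rectangle whose two partial products multiply to the
full product. -/
theorem measurePreserving_mixOn {ι : Type*} (S : Set ι) (μ : ι → Measure E)
    [∀ i, IsProbabilityMeasure (μ i)] :
    MeasurePreserving (mixOn S) ((Measure.infinitePi μ).prod (Measure.infinitePi μ))
      (Measure.infinitePi μ) := by
  classical
  refine ⟨measurable_mixOn S, Measure.eq_infinitePi _ fun s t ht => ?_⟩
  rw [Measure.map_apply (measurable_mixOn S) (MeasurableSet.pi s.countable_toSet fun i _ => ht i)]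
  have : mixOn S ⁻¹' (Set.pi (s : Set ι) t) =
      (Set.pi (s.filter (· ∈ S) : Finset ι) t) ×ˢ (Set.pi (s.filter (· ∉ S) : Finset ι) t) := by
    ext p
    simp only [Set.mem_preimage, Set.mem_pi, Set.mem_prod, Finset.coe_filter, Set.mem_ofPred_eq,
      mixOn, Finset.mem_coe]
    constructor
    · intro h
      exact ⟨fun i hi => by simpa [hi.2] using h i hi.1, fun i hi => by simpa [hi.2] using h i hi.1⟩
    · rintro ⟨h1, h2⟩ i hi
      by_cases hS : i ∈ S
      · simpa [hS] using h1 i ⟨hi, hS⟩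
      · simpa [hS] using h2 i ⟨hi, hS⟩
  rw [this, Measure.prod_prod, Measure.infinitePi_pi _ fun i _ => ht i,
    Measure.infinitePi_pi _ fun i _ => ht i, Finset.prod_filter_mul_prod_filter_not]

/-- Prepend a term to a sequence. -/
def consSeq (p : E × (ℕ → E)) : ℕ → E
  | 0 => p.1
  | n + 1 => p.2 n

theorem measurable_consSeq : Measurable (consSeq : E × (ℕ → E) → ℕ → E) := by
  refine measurable_pi_lambda _ fun i => ?_
  cases i with
  | zero => exact measurable_fst
  | succ n => exact (measurable_pi_apply n).comp measurable_snd

/-- The law of a sequence of independent random elements with law `ρ`. -/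
abbrev seqLaw (ρ : Measure E) [IsProbabilityMeasure ρ] : Measure (ℕ → E) :=
  Measure.infinitePi fun _ : ℕ => ρ

variable (ρ : Measure E) [IsProbabilityMeasure ρ]

theorem measurePreserving_consSeq :
    MeasurePreserving consSeq (ρ.prod (seqLaw ρ)) (seqLaw ρ) := by
  classical
  refine ⟨measurable_consSeq, Measure.eq_infinitePi _ fun s t ht => ?_⟩
  rw [Measure.map_apply measurable_consSeq (MeasurableSet.pi s.countable_toSet fun i _ => ht i)]
  set s' : Finset ℕ := s.preimage Nat.succ (Nat.succ_injective.injOn) with hs'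
  have : consSeq ⁻¹' (Set.pi (s : Set ℕ) t) =
      (if 0 ∈ s then t 0 else Set.univ) ×ˢ (Set.pi (s' : Set ℕ) fun n => t (n + 1)) := by
    ext p
    simp only [Set.mem_preimage, Set.mem_pi, Set.mem_prod, Finset.mem_coe, hs',
      Finset.mem_preimage]
    constructor
    · intro h
      refine ⟨?_, fun n hn => h (n + 1) hn⟩
      split_ifs with h0
      · exact h 0 h0
      · trivial
    · rintro ⟨h1, h2⟩ i hi
      cases i with
      | zero => simpa [hi, consSeq] using h1
      | succ n => exact h2 n hi
  rw [this, Measure.prod_prod, Measure.infinitePi_pi _ fun i _ => ht _]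
  have himg : s'.image Nat.succ = s.filter (· ≠ 0) := by
    ext i
    simp only [hs', Finset.mem_image, Finset.mem_preimage, Finset.mem_filter]
    constructor
    · rintro ⟨n, hn, rfl⟩; exact ⟨hn, Nat.succ_ne_zero n⟩
    · rintro ⟨hi, h0⟩
      obtain ⟨n, rfl⟩ := Nat.exists_eq_succ_of_ne_zero h0
      exact ⟨n, hi, rfl⟩
  have h2 : ∏ i ∈ s', ρ (t (i + 1)) = ∏ i ∈ s.filter (· ≠ 0), ρ (t i) := by
    rw [← himg, Finset.prod_image fun a _ b _ h => Nat.succ_injective h]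
  rw [h2, ← Finset.prod_filter_mul_prod_filter_not s (· ≠ 0), mul_comm]
  congr 1
  by_cases h0 : 0 ∈ s
  · have : s.filter (fun i => ¬ i ≠ 0) = {0} := by ext i; simp; rintro rfl; exact h0
    rw [this]; simp [h0]
  · have : s.filter (fun i => ¬ i ≠ 0) = ∅ := by
      ext i; simp; rintro hi rfl; exact h0 hi
    rw [this]; simp [h0]

/-- First-step analysis: an independent sequence is a first term followed by an independent copy of
itself. Together with `chain_consSeq` this takes the place of filtrations and conditional
expectations in the trajectory estimates of this section. -/
theorem seqLaw_eq_lintegral {S : Set (ℕ → E)} (hS : MeasurableSet S) :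
    seqLaw ρ S = ∫⁻ ξ, seqLaw ρ {ω | consSeq (ξ, ω) ∈ S} ∂ρ := by
  rw [← (measurePreserving_consSeq ρ).measure_preimage hS.nullMeasurableSet,
    Measure.prod_apply (measurable_consSeq hS)]
  rfl

/-- The iteration of the random map `F`, driven by the sequence `ω`. -/
def chain (F : 𝒯 → E → 𝒯) (s : 𝒯) (ω : ℕ → E) : ℕ → 𝒯
  | 0 => s
  | n + 1 => F (chain F s ω n) (ω n)

theorem chain_consSeq (F : 𝒯 → E → 𝒯) (s : 𝒯) (ξ : E) (ω : ℕ → E) (n : ℕ) :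
    chain F s (consSeq (ξ, ω)) (n + 1) = chain F (F s ξ) ω n := by
  induction n with
  | zero => rfl
  | succ n ih => rw [chain, ih]; rfl

theorem chain_add (F : 𝒯 → E → 𝒯) (s : 𝒯) (ω : ℕ → E) (i n : ℕ) :
    chain F s ω (i + n) = chain F (chain F s ω i) (fun m => ω (i + m)) n := by
  induction n with
  | zero => rfl
  | succ n ih => rw [← add_assoc, chain, ih]; rfl

theorem measurable_chain {F : 𝒯 → E → 𝒯} (hF : Measurable (Function.uncurry F)) (n : ℕ) :
    Measurable fun p : 𝒯 × (ℕ → E) => chain F p.1 p.2 n := by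
  induction n with
  | zero => exact measurable_fst
  | succ n ih => exact hF.comp (ih.prodMk ((measurable_pi_apply n).comp measurable_snd))

theorem measurable_chain_right {F : 𝒯 → E → 𝒯} (hF : Measurable (Function.uncurry F)) (s : 𝒯)
    (n : ℕ) : Measurable fun ω : ℕ → E => chain F s ω n :=
  (measurable_chain hF n).comp measurable_prodMk_left

theorem chain_induction {F : 𝒯 → E → 𝒯} {I : 𝒯 → Prop} (hI : ∀ s, I s → ∀ ξ, I (F s ξ)) {s : 𝒯}
    (hs : I s) (ω : ℕ → E) (n : ℕ) : I (chain F s ω n) := by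
  induction n with
  | zero => exact hs
  | succ n ih => exact hI _ ih _

theorem measurableSet_exists_chain {F : 𝒯 → E → 𝒯} (hF : Measurable (Function.uncurry F))
    {B : Set 𝒯} (hB : MeasurableSet B) :
    MeasurableSet {p : 𝒯 × (ℕ → E) | ∃ n, chain F p.1 p.2 n ∈ B} := by
  simp only [Set.ofPred_exists]
  exact MeasurableSet.iUnion fun n => measurable_chain hF n hB

/-- An almost sure property of the driving sequence holds at every time. -/
theorem ae_forall_chain {F : 𝒯 → E → 𝒯} (hF : Measurable (Function.uncurry F)) {I : 𝒯 → Prop}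
    (hI : ∀ s, I s → ∀ ξ, I (F s ξ)) {P : 𝒯 → (ℕ → E) → Prop}
    (hP : MeasurableSet {p : 𝒯 × (ℕ → E) | P p.1 p.2})
    (h : ∀ s, I s → ∀ᵐ ω ∂seqLaw ρ, P s ω) {s : 𝒯} (hs : I s) :
    ∀ᵐ ω ∂seqLaw ρ, ∀ i, P (chain F s ω i) fun m => ω (i + m) := by
  rw [ae_all_iff]
  intro i
  induction i generalizing s with
  | zero => simpa [chain] using h s hs
  | succ i ih =>
    have hm : MeasurableSet {p : 𝒯 × (ℕ → E) | ¬ P (chain F p.1 p.2 (i + 1))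
        fun m => p.2 (i + 1 + m)} := by
      have : Measurable fun p : 𝒯 × (ℕ → E) =>
          (chain F p.1 p.2 (i + 1), fun m => p.2 (i + 1 + m)) :=
        (measurable_chain hF (i + 1)).prodMk
          (measurable_pi_lambda _ fun m => (measurable_pi_apply _).comp measurable_snd)
      exact this hP.compl
    have hm' : MeasurableSet {ω : ℕ → E | ¬ P (chain F s ω (i + 1)) fun m => ω (i + 1 + m)} :=
      measurable_prodMk_left (x := s) hm
    -- Conditioning on the first step turns time `i + 1` from `s` into time `i` from `F s ξ`, to
    -- which the induction hypothesis applies because `I` is preserved.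
    rw [ae_iff, seqLaw_eq_lintegral ρ hm']
    refine (lintegral_congr fun ξ => ?_).trans lintegral_zero
    have := ih (hI s hs ξ)
    rw [ae_iff] at this
    rw [← this]
    congr 1
    ext ω
    simp only [Set.mem_ofPred_eq, chain_consSeq]
    have : (fun m => consSeq (ξ, ω) (i + 1 + m)) = fun m => ω (i + m) := by
      funext m; rw [show i + 1 + m = (i + m) + 1 by ring]; rfl
    rw [this]

/-- Ville's maximal inequality for a nonnegative supermartingale that is stopped when the trajectory
leaves `G`. For a bounded time horizon it follows by induction, conditioning on the first step; the
horizon is then removed by continuity of the measure along increasing unions. -/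
theorem prob_exists_le_of_superharmonic {F : 𝒯 → E → 𝒯} (hF : Measurable (Function.uncurry F))
    {I : 𝒯 → Prop} (hI : ∀ s, I s → ∀ ξ, I (F s ξ)) {Ψ : 𝒯 → ℝ≥0∞} (hΨ : Measurable Ψ) {G : Set 𝒯}
    (hG : MeasurableSet G) (h : ∀ s, I s → s ∈ G → ∫⁻ ξ, Ψ (F s ξ) ∂ρ ≤ Ψ s) {C : ℝ≥0∞}
    (hC0 : C ≠ 0) (hC : C ≠ ∞) {s : 𝒯} (hs : I s) :
    seqLaw ρ {ω | ∃ n, C ≤ Ψ (chain F s ω n) ∧ ∀ i < n, chain F s ω i ∈ G} ≤ Ψ s / C := by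
  have key : ∀ (N : ℕ) (s : 𝒯), I s →
      seqLaw ρ {ω | ∃ n ≤ N, C ≤ Ψ (chain F s ω n) ∧ ∀ i < n, chain F s ω i ∈ G} ≤ Ψ s / C := by
    intro N
    induction N with
    | zero =>
      intro s hs
      by_cases hCs : C ≤ Ψ s
      · exact prob_le_one.trans (by rwa [ENNReal.le_div_iff_mul_le (.inl hC0) (.inl hC), one_mul])
      · have : {ω : ℕ → E | ∃ n ≤ 0, C ≤ Ψ (chain F s ω n) ∧ ∀ i < n, chain F s ω i ∈ G} = ∅ := by
          ext ω; simp [chain, hCs]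
        rw [this]; simp
    | succ N ih =>
      intro s hs
      by_cases hCs : C ≤ Ψ s
      · exact prob_le_one.trans (by rwa [ENNReal.le_div_iff_mul_le (.inl hC0) (.inl hC), one_mul])
      by_cases hGs : s ∈ G
      swap
      -- Below level `C` and outside `G` the event is empty: time `0` fails by the level, and any
      -- later time would require the starting point to lie in `G`.
      · have : {ω : ℕ → E | ∃ n ≤ N + 1, C ≤ Ψ (chain F s ω n) ∧ ∀ i < n, chain F s ω i ∈ G}
            = ∅ := by
          ext ω
          simp only [Set.mem_ofPred_eq, Set.mem_empty_iff_false, iff_false, not_exists, not_and]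
          rintro (_ | n) _ h1 h2
          · exact hCs h1
          · exact hGs (h2 0 (Nat.succ_pos n))
        simp [this]
      have hm : MeasurableSet {p : 𝒯 × (ℕ → E) | ∃ n ≤ N + 1, C ≤ Ψ (chain F p.1 p.2 n) ∧
          ∀ i < n, chain F p.1 p.2 i ∈ G} := by
        have : {p : 𝒯 × (ℕ → E) | ∃ n ≤ N + 1, C ≤ Ψ (chain F p.1 p.2 n) ∧
          ∀ i < n, chain F p.1 p.2 i ∈ G} = ⋃ n, ⋃ (_ : n ≤ N + 1),
            ({p | C ≤ Ψ (chain F p.1 p.2 n)} ∩ ⋂ i, ⋂ (_ : i < n), {p | chain F p.1 p.2 i ∈ G}) := by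
          ext p; simp [and_left_comm]
        rw [this]
        exact MeasurableSet.iUnion fun n => MeasurableSet.iUnion fun _ =>
          (measurableSet_le measurable_const (hΨ.comp (measurable_chain hF n))).inter
            (MeasurableSet.iInter fun i => MeasurableSet.iInter fun _ => measurable_chain hF i hG)
      have hm' : MeasurableSet {ω : ℕ → E | ∃ n ≤ N + 1, C ≤ Ψ (chain F s ω n) ∧
          ∀ i < n, chain F s ω i ∈ G} := measurable_prodMk_left (x := s) hm
      rw [seqLaw_eq_lintegral ρ hm']
      calc _ ≤ ∫⁻ ξ, Ψ (F s ξ) / C ∂ρ := by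
            refine lintegral_mono fun ξ => (measure_mono ?_).trans (ih (F s ξ) (hI s hs ξ))
            rintro ω ⟨n, hn, h1, h2⟩
            cases n with
            | zero => exact absurd h1 hCs
            | succ n =>
              rw [chain_consSeq] at h1
              exact ⟨n, by omega, h1, fun i hi => by
                have := h2 (i + 1) (by omega)
                rwa [chain_consSeq] at this⟩
        _ = (∫⁻ ξ, Ψ (F s ξ) ∂ρ) / C := by
            simp only [div_eq_mul_inv]
            rw [lintegral_mul_const]
            exact hΨ.comp (hF.comp measurable_prodMk_left)
        _ ≤ Ψ s / C := by gcongr; exact h s hs hGs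
  have : {ω : ℕ → E | ∃ n, C ≤ Ψ (chain F s ω n) ∧ ∀ i < n, chain F s ω i ∈ G} =
      ⋃ N : ℕ, {ω | ∃ n ≤ N, C ≤ Ψ (chain F s ω n) ∧ ∀ i < n, chain F s ω i ∈ G} := by
    ext ω
    simp only [Set.mem_ofPred_eq, Set.mem_iUnion]
    exact ⟨fun ⟨n, h⟩ => ⟨n, n, le_rfl, h⟩, fun ⟨_, n, _, h⟩ => ⟨n, h⟩⟩
  rw [this, Monotone.measure_iUnion]
  · exact iSup_le fun N => key N s hs
  · rintro N N' hN ω ⟨n, hn, h⟩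
    exact ⟨n, hn.trans hN, h⟩

/-- A nonnegative function which is superharmonic on `G` stays bounded along every trajectory that
eventually remains in `G`. -/
theorem ae_bounded_of_superharmonic {F : 𝒯 → E → 𝒯} (hF : Measurable (Function.uncurry F))
    {I : 𝒯 → Prop} (hI : ∀ s, I s → ∀ ξ, I (F s ξ)) {Ψ : 𝒯 → ℝ≥0∞} (hΨ : Measurable Ψ)
    (hfin : ∀ s, I s → Ψ s ≠ ∞) {G : Set 𝒯} (hG : MeasurableSet G)
    (h : ∀ s, I s → s ∈ G → ∫⁻ ξ, Ψ (F s ξ) ∂ρ ≤ Ψ s) {s : 𝒯} (hs : I s) :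
    ∀ᵐ ω ∂seqLaw ρ, (∀ᶠ n in atTop, chain F s ω n ∈ G) →
      ∃ C : ℝ≥0, ∀ᶠ n in atTop, Ψ (chain F s ω n) ≤ C := by
  -- Trajectories that never leave `G` come first; those that remain in `G` from some time on are
  -- reduced to them by restarting at that time.
  have h1 : ∀ s, I s → ∀ᵐ ω ∂seqLaw ρ, (∀ n, chain F s ω n ∈ G) →
      ∃ C : ℕ, ∀ n, Ψ (chain F s ω n) ≤ C := by
    intro s hs
    rw [ae_iff]
    refine le_antisymm (ENNReal.le_of_forall_pos_le_add fun ε hε _ => ?_) zero_le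
    obtain ⟨C, hC⟩ := exists_nat_gt (Ψ s / ε).toReal
    have hεtop : Ψ s / (ε : ℝ≥0∞) ≠ ∞ :=
      ENNReal.div_ne_top (hfin s hs) (by simpa using hε.ne')
    have hC' : Ψ s / (ε : ℝ≥0∞) ≤ C := by
      rw [← ENNReal.ofReal_toReal hεtop, ← ENNReal.ofReal_natCast]
      exact ENNReal.ofReal_le_ofReal hC.le
    have hCpos : (C : ℝ≥0∞) ≠ 0 := by
      have : (0 : ℝ) < C := lt_of_le_of_lt ENNReal.toReal_nonneg hC
      exact_mod_cast this.ne'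
    refine le_trans (measure_mono ?_) ((prob_exists_le_of_superharmonic ρ hF hI hΨ hG h hCpos
      (ENNReal.natCast_ne_top C) hs).trans ?_)
    · intro ω hω
      simp only [Set.mem_ofPred_eq, Classical.not_imp, not_exists, not_forall, not_le] at hω
      obtain ⟨hG', hω⟩ := hω
      obtain ⟨n, hn⟩ := hω C
      exact ⟨n, hn.le, fun i _ => hG' i⟩
    · rw [zero_add]
      refine ENNReal.div_le_of_le_mul ?_
      rw [mul_comm]
      exact (ENNReal.div_le_iff_le_mul (.inl (by simpa using hε.ne')) (.inl (by simp))).1 hC'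
  have hm : MeasurableSet {p : 𝒯 × (ℕ → E) | (∀ n, chain F p.1 p.2 n ∈ G) →
      ∃ C : ℕ, ∀ n, Ψ (chain F p.1 p.2 n) ≤ C} := by
    have : {p : 𝒯 × (ℕ → E) | (∀ n, chain F p.1 p.2 n ∈ G) →
      ∃ C : ℕ, ∀ n, Ψ (chain F p.1 p.2 n) ≤ C} = (⋂ n, {p | chain F p.1 p.2 n ∈ G})ᶜ ∪
        ⋃ C : ℕ, ⋂ n, {p | Ψ (chain F p.1 p.2 n) ≤ C} := by
      ext p; simp [imp_iff_not_or]
    rw [this]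
    exact (MeasurableSet.iInter fun n => measurable_chain hF n hG).compl.union
      (MeasurableSet.iUnion fun C => MeasurableSet.iInter fun n =>
        measurableSet_le (hΨ.comp (measurable_chain hF n)) measurable_const)
  filter_upwards [ae_forall_chain ρ hF hI hm h1 hs] with ω hω hev
  obtain ⟨i, hi⟩ := eventually_atTop.1 hev
  obtain ⟨C, hC⟩ := hω i fun n => by rw [← chain_add]; exact hi _ (Nat.le_add_right i n)
  refine ⟨C, eventually_atTop.2 ⟨i, fun n hn => ?_⟩⟩
  obtain ⟨m, rfl⟩ := Nat.exists_eq_add_of_le hn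
  rw [chain_add]
  exact_mod_cast hC m

/-- From `1 - x ≤ exp (-x)` and the divergence of the harmonic series. Truncation by
`ENNReal.ofReal` covers the initial factors, which may be negative. -/
theorem tendsto_prod_one_sub_div (c : ℝ) (hc : 0 < c) (q : ℕ) :
    Tendsto (fun M : ℕ => ∏ i ∈ Finset.range M, ENNReal.ofReal (1 - c / ((q + i : ℕ) + 1)))
      atTop (𝓝 0) := by
  have hsum : Tendsto (fun M : ℕ => ∑ i ∈ Finset.range M, c / (((q + i : ℕ) : ℝ) + 1))
      atTop atTop := by
    refine (not_summable_iff_tendsto_nat_atTop_of_nonneg fun i => by positivity).1 ?_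
    intro hs
    have h1 : Summable fun i : ℕ => 1 / (((i + (q + 1) : ℕ)) : ℝ) := by
      have := hs.mul_left c⁻¹
      refine this.congr fun i => ?_
      push_cast
      field_simp
      ring
    rw [summable_nat_add_iff (f := fun n : ℕ => 1 / (n : ℝ)) (q + 1)] at h1
    exact Real.not_summable_one_div_natCast h1
  have h2 : Tendsto (fun M : ℕ => ENNReal.ofReal
      (Real.exp (-∑ i ∈ Finset.range M, c / (((q + i : ℕ) : ℝ) + 1)))) atTop (𝓝 0) := by
    have := ENNReal.tendsto_ofReal
      (Real.tendsto_exp_neg_atTop_nhds_zero.comp hsum)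
    simpa using this
  refine tendsto_of_tendsto_of_tendsto_of_le_of_le tendsto_const_nhds h2 (fun _ => zero_le)
    fun M => ?_
  simp only
  rw [← Finset.sum_neg_distrib, Real.exp_sum, ENNReal.ofReal_prod_of_nonneg
    fun i _ => (Real.exp_pos _).le]
  refine Finset.prod_le_prod' fun i _ => ENNReal.ofReal_le_ofReal ?_
  have := Real.add_one_le_exp (-(c / (((q + i : ℕ) : ℝ) + 1)))
  linarith

/-- A counter that grows with probability at least `c / (σ + 1)` at each step, where `σ` grows by
at most `1` per step, tends to infinity. -/
theorem ae_tendsto_atTop_of_prob_ge {F : 𝒯 → E → 𝒯} (hF : Measurable (Function.uncurry F))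
    {I : 𝒯 → Prop} (hI : ∀ s, I s → ∀ ξ, I (F s ξ)) {N : 𝒯 → ℕ} (hN : Measurable N) (σ : 𝒯 → ℕ)
    {c : ℝ} (hc : 0 < c) (hmono : ∀ s, I s → ∀ ξ, N s ≤ N (F s ξ))
    (hσ : ∀ s, I s → ∀ ξ, σ (F s ξ) ≤ σ s + 1)
    (h : ∀ s, I s → ρ {ξ | N (F s ξ) = N s} ≤ ENNReal.ofReal (1 - c / (σ s + 1))) {s : 𝒯}
    (hs : I s) : ∀ᵐ ω ∂seqLaw ρ, Tendsto (fun n => N (chain F s ω n)) atTop atTop := by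
  have hmono' : ∀ s, I s → ∀ ω : ℕ → E, Monotone fun n => N (chain F s ω n) := fun s hs ω =>
    monotone_nat_of_le_succ fun n => hmono _ (chain_induction hI hs ω n) _
  -- The probability that the counter stands still for `M` steps. After `i` steps `σ` is at most `q
  -- + i`, which bounds the `i`-th factor.
  have key : ∀ (M q : ℕ) (s : 𝒯), I s → σ s ≤ q →
      seqLaw ρ {ω | N (chain F s ω M) = N s} ≤
        ∏ i ∈ Finset.range M, ENNReal.ofReal (1 - c / ((q + i : ℕ) + 1)) := by
    intro M
    induction M with
    | zero => intro q s _ _; simpa using prob_le_one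
    | succ M ih =>
      intro q s hs hq
      have hm : MeasurableSet {ω : ℕ → E | N (chain F s ω (M + 1)) = N s} :=
        (hN.comp (measurable_chain_right hF s (M + 1))) (measurableSet_singleton (N s))
      have hm2 : MeasurableSet {ξ : E | N (F s ξ) = N s} :=
        (hN.comp (hF.comp measurable_prodMk_left)) (measurableSet_singleton (N s))
      rw [seqLaw_eq_lintegral ρ hm, Finset.prod_range_succ']
      calc _ ≤ ∫⁻ ξ, Set.indicator {ξ : E | N (F s ξ) = N s} (fun _ =>
              ∏ i ∈ Finset.range M, ENNReal.ofReal (1 - c / ((q + (i + 1) : ℕ) + 1))) ξ ∂ρ := by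
            refine lintegral_mono fun ξ => ?_
            by_cases hξ : N (F s ξ) = N s
            · rw [Set.indicator_of_mem (by exact hξ)]
              have := ih (q + 1) (F s ξ) (hI s hs ξ) ((hσ s hs ξ).trans (by omega))
              refine le_trans (measure_mono fun ω hω => ?_) (this.trans_eq ?_)
              · simp only [Set.mem_ofPred_eq, chain_consSeq] at hω ⊢
                rw [hω, hξ]
              · refine Finset.prod_congr rfl fun i _ => ?_
                rw [show q + 1 + i = q + (i + 1) by ring]
            · rw [Set.indicator_of_notMem (by exact hξ)]
              -- Once it has grown, the monotone counter cannot return to its initial value.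
              have : {ω : ℕ → E | consSeq (ξ, ω) ∈ {ω : ℕ → E | N (chain F s ω (M + 1)) = N s}}
                  = ∅ := by
                ext ω
                simp only [Set.mem_ofPred_eq, chain_consSeq, Set.mem_empty_iff_false, iff_false]
                intro h2
                have h3 := hmono s hs ξ
                have h4 := hmono' (F s ξ) (hI s hs ξ) ω (Nat.zero_le M)
                simp only [chain] at h4
                omega
              rw [this, measure_empty]
        _ = (∏ i ∈ Finset.range M, ENNReal.ofReal (1 - c / ((q + (i + 1) : ℕ) + 1))) *
              ρ {ξ : E | N (F s ξ) = N s} := by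
            rw [lintegral_indicator_const hm2]
        _ ≤ _ := by
            gcongr
            refine (h s hs).trans (ENNReal.ofReal_le_ofReal ?_)
            have : (σ s : ℝ) ≤ q := by exact_mod_cast hq
            push_cast
            rw [add_zero]
            gcongr
  have h1 : ∀ s, I s → ∀ᵐ ω ∂seqLaw ρ, ∃ M, N (chain F s ω M) ≠ N s := by
    intro s hs
    rw [ae_iff]
    refine le_antisymm ?_ zero_le
    refine ge_of_tendsto' (tendsto_prod_one_sub_div c hc (σ s)) fun M =>
      (measure_mono fun ω hω => ?_).trans (key M (σ s) s hs le_rfl)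
    simp only [ne_eq, not_exists, not_not, Set.mem_ofPred_eq] at hω ⊢
    exact hω M
  have hm : MeasurableSet {p : 𝒯 × (ℕ → E) | ∃ M, N (chain F p.1 p.2 M) ≠ N p.1} := by
    simp only [Set.ofPred_exists]
    exact MeasurableSet.iUnion fun M =>
      (measurableSet_eq_fun (hN.comp (measurable_chain hF M)) (hN.comp measurable_fst)).compl
  filter_upwards [ae_forall_chain ρ hF hI hm h1 hs] with ω hω
  refine tendsto_atTop_atTop_of_monotone (hmono' s hs ω) fun b => ?_
  induction b with
  | zero => exact ⟨0, Nat.zero_le _⟩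
  | succ b ih =>
    obtain ⟨i, hi⟩ := ih
    obtain ⟨M, hM⟩ := hω i
    rw [← chain_add] at hM
    exact ⟨i + M, by have := hmono' s hs ω (Nat.le_add_right i M); simp only at this; omega⟩

/-- The probability that the iteration started at `s` ever reaches `B`. -/
def hitProb (F : 𝒯 → E → 𝒯) (B : Set 𝒯) (s : 𝒯) : ℝ≥0∞ :=
  seqLaw ρ {ω | ∃ n, chain F s ω n ∈ B}

theorem hitProb_le_one (F : 𝒯 → E → 𝒯) (B : Set 𝒯) (s : 𝒯) : hitProb ρ F B s ≤ 1 := prob_le_one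

theorem hitProb_of_mem (F : 𝒯 → E → 𝒯) {B : Set 𝒯} {s : 𝒯} (hs : s ∈ B) : hitProb ρ F B s = 1 := by
  have : {ω : ℕ → E | ∃ n, chain F s ω n ∈ B} = Set.univ := by
    ext ω; simpa using ⟨0, hs⟩
  rw [hitProb, this, measure_univ]

theorem measurable_hitProb {F : 𝒯 → E → 𝒯} (hF : Measurable (Function.uncurry F)) {B : Set 𝒯}
    (hB : MeasurableSet B) : Measurable (hitProb ρ F B) :=
  measurable_measure_prodMk_left (measurableSet_exists_chain hF hB)

/-- Reaching `B` after the first step is one way of reaching `B`. This makes the hitting probability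
of a set of bad states a bounded superharmonic functional, equal to `1` on that set. -/
theorem lintegral_hitProb_le {F : 𝒯 → E → 𝒯} (hF : Measurable (Function.uncurry F)) {B : Set 𝒯}
    (hB : MeasurableSet B) (s : 𝒯) : ∫⁻ ξ, hitProb ρ F B (F s ξ) ∂ρ ≤ hitProb ρ F B s := by
  have hm : MeasurableSet {ω : ℕ → E | ∃ n, chain F s ω n ∈ B} :=
    measurable_prodMk_left (x := s) (measurableSet_exists_chain hF hB)
  rw [hitProb, seqLaw_eq_lintegral ρ hm]
  refine lintegral_mono fun ξ => measure_mono ?_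
  rintro ω ⟨n, hn⟩
  exact ⟨n + 1, by rwa [chain_consSeq]⟩

end Iteration

/-! ### Measurability for lists and search trees -/

section Lists

variable {α β Ω : Type*} [MeasurableSpace α] [MeasurableSpace β] [MeasurableSpace Ω]

/-- The σ-algebra on lists: the disjoint union of the powers of `α`. -/
instance List.instMeasurableSpaceOfFn : MeasurableSpace (List α) :=
  ⨅ n : ℕ, MeasurableSpace.map (fun v : Fin n → α => List.ofFn v) inferInstance

theorem measurableSet_list {S : Set (List α)} :
    MeasurableSet S ↔ ∀ n, MeasurableSet {v : Fin n → α | List.ofFn v ∈ S} := by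
  rw [List.instMeasurableSpaceOfFn, MeasurableSpace.measurableSet_iInf]
  rfl

theorem measurable_list_iff {f : List α → β} :
    Measurable f ↔ ∀ n, Measurable fun v : Fin n → α => f (List.ofFn v) := by
  constructor
  · intro h n S hS
    exact measurableSet_list.1 (h hS) n
  · intro h S hS
    exact measurableSet_list.2 fun n => h n hS

theorem measurable_ofFn (n : ℕ) : Measurable fun v : Fin n → α => List.ofFn v :=
  measurable_list_iff.1 measurable_id n

theorem measurable_length : Measurable (List.length : List α → ℕ) :=
  measurable_list_iff.2 fun n => by simp

theorem measurable_getD (i : ℕ) (b : α) : Measurable fun l : List α => l.getD i b := by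
  refine measurable_list_iff.2 fun n => ?_
  by_cases hi : i < n
  · have : (fun v : Fin n → α => (List.ofFn v).getD i b) = fun v => v ⟨i, hi⟩ := by
      funext v; simp [List.getD_eq_getElem?_getD, hi]
    rw [this]; exact measurable_pi_apply _
  · have : (fun v : Fin n → α => (List.ofFn v).getD i b) = fun v => b := by
      funext v; simp [List.getD_eq_getElem?_getD, hi]
    rw [this]; exact measurable_const

/-- Joint measurability can be tested on each length separately. The entries are recovered with
`getD`, which needs a default value; if `α` is empty, the empty list is the only list. -/
theorem measurable_list_prod {f : List α × Ω → β}
    (h : ∀ n, Measurable fun p : (Fin n → α) × Ω => f (List.ofFn p.1, p.2)) : Measurable f := by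
  rcases isEmpty_or_nonempty α with hα | ⟨⟨b⟩⟩
  · have : f = fun p => f ([], p.2) := by
      funext ⟨l, w⟩; cases l with
      | nil => rfl
      | cons a _ => exact isEmptyElim a
    rw [this]
    have h0 := (h 0).comp (measurable_prodMk_left (x := (Fin.elim0 : Fin 0 → α)))
    simpa [Function.comp_def] using h0.comp (measurable_snd (α := List α) (β := Ω))
  · intro S hS
    have : f ⁻¹' S = ⋃ n : ℕ, ({p | p.1.length = n} ∩
        (fun p : List α × Ω => ((fun i : Fin n => p.1.getD i b), p.2)) ⁻¹'
          ((fun p : (Fin n → α) × Ω => f (List.ofFn p.1, p.2)) ⁻¹' S)) := by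
      ext ⟨l, w⟩
      have hl : List.ofFn (fun i : Fin l.length => l.getD i b) = l := by
        refine List.ext_getElem (by simp) fun i h1 h2 => by simp
      simp only [Set.mem_preimage, Set.mem_iUnion, Set.mem_inter_iff, Set.mem_ofPred_eq]
      constructor
      · intro h1; exact ⟨l.length, rfl, by rw [hl]; exact h1⟩
      · rintro ⟨n, rfl, h2⟩; rw [hl] at h2; exact h2
    rw [this]
    refine MeasurableSet.iUnion fun n => MeasurableSet.inter ?_ ?_
    · exact (measurable_length.comp measurable_fst) (measurableSet_singleton n)
    · exact ((measurable_pi_lambda _ fun i => (measurable_getD i.1 b).comp measurable_fst).prodMk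
        measurable_snd) (h n hS)

theorem measurable_append_singleton : Measurable fun p : List α × α => p.1 ++ [p.2] := by
  refine measurable_list_prod fun n => ?_
  have : (fun p : (Fin n → α) × α => List.ofFn p.1 ++ [p.2]) =
      fun p => List.ofFn (fun i : Fin (n + 1) => if h : i.1 < n then p.1 ⟨i, h⟩ else p.2) := by
    funext p
    refine List.ext_getElem (by simp) fun i h1 h2 => ?_
    simp only [List.length_append, List.length_ofFn, List.length_singleton] at h1
    by_cases hi : i < n
    · rw [List.getElem_ofFn, List.getElem_append_left (by simpa using hi)]
      simp [hi]
    · have : i = n := by omega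
      subst this
      rw [List.getElem_ofFn]
      simp
  rw [this]
  refine (measurable_ofFn (n + 1)).comp (measurable_pi_lambda _ fun i => ?_)
  by_cases hi : i.1 < n
  · simpa [hi, Function.comp_def] using (measurable_pi_apply (⟨i, hi⟩ : Fin n)).comp measurable_fst
  · simpa [hi] using measurable_snd

theorem measurable_getD_prod (i : ℕ) : Measurable fun p : List α × α => p.1.getD i p.2 := by
  refine measurable_list_prod fun n => ?_
  by_cases hi : i < n
  · have : (fun p : (Fin n → α) × α => (List.ofFn p.1).getD i p.2) = fun p => p.1 ⟨i, hi⟩ := by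
      funext v; simp [List.getD_eq_getElem?_getD, hi]
    rw [this]; exact (measurable_pi_apply _).comp measurable_fst
  · have : (fun p : (Fin n → α) × α => (List.ofFn p.1).getD i p.2) = fun p => p.2 := by
      funext v; simp [List.getD_eq_getElem?_getD, hi]
    rw [this]; exact measurable_snd

theorem measurable_foldl {σ : Type*} [MeasurableSpace σ] {φ : Ω → σ → α → σ} {b : Ω → σ}
    (hφ : Measurable fun p : Ω × σ × α => φ p.1 p.2.1 p.2.2) (hb : Measurable b) :
    Measurable fun p : List α × Ω => p.1.foldl (φ p.2) (b p.2) := by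
  refine measurable_list_prod fun n => ?_
  -- The accumulator is made a free argument, so that the induction on the length can absorb the
  -- first letter into it.
  have : ∀ n, Measurable fun p : (Fin n → α) × Ω × σ => (List.ofFn p.1).foldl (φ p.2.1) p.2.2 := by
    intro n
    induction n with
    | zero => simpa using measurable_snd.snd
    | succ n ih =>
      simp only [List.ofFn_succ, List.foldl_cons]
      have h1 : Measurable fun p : (Fin (n + 1) → α) × Ω × σ =>
          ((fun i : Fin n => p.1 i.succ), p.2.1, φ p.2.1 p.2.2 (p.1 0)) := by
        refine Measurable.prodMk (measurable_pi_lambda _ fun i =>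
          (measurable_pi_apply _).comp measurable_fst) (Measurable.prodMk
            (measurable_fst.comp measurable_snd) ?_)
        exact hφ.comp ((measurable_fst.comp measurable_snd).prodMk
          ((measurable_snd.comp measurable_snd).prodMk ((measurable_pi_apply _).comp measurable_fst)))
      exact ih.comp h1
  exact (this n).comp (measurable_fst.prodMk (measurable_snd.prodMk (hb.comp measurable_snd)))

/-- Measurability of a function that depends on a measurable choice from a countable type. -/
theorem measurable_of_countable_choice {ι : Type*} [Countable ι] [MeasurableSpace ι]
    [MeasurableSingletonClass ι] {c : Ω → ι} (hc : Measurable c) {f : ι → Ω → β}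
    (hf : ∀ i, Measurable (f i)) : Measurable fun x => f (c x) x := by
  intro S hS
  have : (fun x => f (c x) x) ⁻¹' S = ⋃ i, (c ⁻¹' {i} ∩ f i ⁻¹' S) := by
    ext x; simp
  rw [this]
  exact MeasurableSet.iUnion fun i => (hc (measurableSet_singleton i)).inter (hf i hS)

end Lists

namespace SearchTree

variable {A Z Ω : Type*} [MeasurableSpace Z] [MeasurableSpace Ω]

/-- The σ-algebra on search trees generated by all node statistics. -/
instance : MeasurableSpace (SearchTree A Z) :=
  MeasurableSpace.comap (fun T : SearchTree A Z =>
    ((fun h => h ∈ T.nodes : Node A → Prop), T.branches, T.visits, T.value)) inferInstance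

theorem measurable_mk_iff {f : Ω → SearchTree A Z} :
    Measurable f ↔ (∀ h, MeasurableSet {x | h ∈ (f x).nodes}) ∧
      (∀ h a, Measurable fun x => (f x).branches h a) ∧
      (∀ h a, Measurable fun x => (f x).visits h a) ∧
      ∀ h a, Measurable fun x => (f x).value h a := by
  rw [measurable_comap_iff]
  constructor
  · intro h
    have h2 := h.snd
    exact ⟨fun p => measurableSet_setOfPred.2 ((measurable_pi_apply p).comp h.fst),
      fun p a => (measurable_pi_apply a).comp ((measurable_pi_apply p).comp h2.fst),
      fun p a => (measurable_pi_apply a).comp ((measurable_pi_apply p).comp h2.snd.fst),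
      fun p a => (measurable_pi_apply a).comp ((measurable_pi_apply p).comp h2.snd.snd)⟩
  · rintro ⟨h1, h2, h3, h4⟩
    exact (measurable_pi_lambda _ fun p => measurableSet_setOfPred.1 (h1 p)).prodMk
      ((measurable_pi_lambda _ fun p => measurable_pi_lambda _ fun a => h2 p a).prodMk
        ((measurable_pi_lambda _ fun p => measurable_pi_lambda _ fun a => h3 p a).prodMk
          (measurable_pi_lambda _ fun p => measurable_pi_lambda _ fun a => h4 p a)))

theorem measurableSet_mem_nodes (h : Node A) :
    MeasurableSet {T : SearchTree A Z | h ∈ T.nodes} := (measurable_mk_iff.1 measurable_id).1 h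

theorem measurable_branches (h : Node A) (a : A) :
    Measurable fun T : SearchTree A Z => T.branches h a := (measurable_mk_iff.1 measurable_id).2.1 h a

theorem measurable_visits (h : Node A) (a : A) :
    Measurable fun T : SearchTree A Z => T.visits h a :=
  (measurable_mk_iff.1 measurable_id).2.2.1 h a

theorem measurable_value (h : Node A) (a : A) :
    Measurable fun T : SearchTree A Z => T.value h a :=
  (measurable_mk_iff.1 measurable_id).2.2.2 h a

/-- The part of the tree below the node `h`, with `h` as its root. -/
def sub (T : SearchTree A Z) (h : Node A) : SearchTree A Z where
  nodes := {l | h ++ l ∈ T.nodes}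
  branches l a := T.branches (h ++ l) a
  visits l a := T.visits (h ++ l) a
  value l a := T.value (h ++ l) a

theorem sub_sub (T : SearchTree A Z) (h l : Node A) : (T.sub h).sub l = T.sub (h ++ l) := by
  simp [sub]

@[simp] theorem sub_nil (T : SearchTree A Z) : T.sub [] = T := rfl

theorem measurable_sub (h : Node A) : Measurable fun T : SearchTree A Z => T.sub h :=
  measurable_mk_iff.2 ⟨fun l => measurableSet_mem_nodes (h ++ l), fun l => measurable_branches (h ++ l),
    fun l => measurable_visits (h ++ l), fun l => measurable_value (h ++ l)⟩

/-- The tree that is obtained from `T` when an episode with return `e` takes the branch `j` of the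
action `a`: `l` is the new list of the branches of `a`, and `C` the new subtree below the branch. -/
def graft (T : SearchTree A Z) (a : A) (l : List Z) (j : ℕ) (C : SearchTree A Z) (e : ℝ) :
    SearchTree A Z :=
  open Classical in
  { nodes := {p | match p with
      | [] => [] ∈ T.nodes
      | (b, i) :: p => if (b, i) = (a, j) then p ∈ C.nodes else (b, i) :: p ∈ T.nodes}
    branches := fun p b => match p with
      | [] => if b = a then l else T.branches [] b
      | (c, i) :: p => if (c, i) = (a, j) then C.branches p b else T.branches ((c, i) :: p) b
    visits := fun p b => match p with
      | [] => if b = a then T.visits [] a + 1 else T.visits [] b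
      | (c, i) :: p => if (c, i) = (a, j) then C.visits p b else T.visits ((c, i) :: p) b
    value := fun p b => match p with
      | [] => if b = a then T.value [] a + (e - T.value [] a) / ((T.visits [] a + 1 : ℕ) : ℝ)
          else T.value [] b
      | (c, i) :: p => if (c, i) = (a, j) then C.value p b else T.value ((c, i) :: p) b }

theorem sub_graft_self (T : SearchTree A Z) (a : A) (l : List Z) (j : ℕ) (C : SearchTree A Z)
    (e : ℝ) : (T.graft a l j C e).sub [(a, j)] = C := by
  simp [graft, sub]

theorem sub_graft_of_ne (T : SearchTree A Z) (a : A) (l : List Z) (j : ℕ) (C : SearchTree A Z)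
    (e : ℝ) {b : A} {i : ℕ} (h : (b, i) ≠ (a, j)) :
    (T.graft a l j C e).sub [(b, i)] = T.sub [(b, i)] := by
  have hn : {q : Node A | [(b, i)] ++ q ∈ (T.graft a l j C e).nodes} = {q | [(b, i)] ++ q ∈ T.nodes} := by
    ext p
    simp [graft, h]
  unfold sub
  rw [hn]
  simp [graft, h]

theorem measurable_graft {T C : Ω → SearchTree A Z} {l : Ω → List Z} {e : Ω → ℝ} (hT : Measurable T)
    (hC : Measurable C) (hl : Measurable l) (he : Measurable e) (a : A) (j : ℕ) :
    Measurable fun x => (T x).graft a (l x) j (C x) (e x) := by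
  classical
  refine measurable_mk_iff.2 ⟨fun p => ?_, fun p b => ?_, fun p b => ?_, fun p b => ?_⟩
  · rcases p with _ | ⟨⟨c, i⟩, p⟩
    · exact hT (measurableSet_mem_nodes [])
    · by_cases h : (c, i) = (a, j)
      · simpa [graft, h] using hC (measurableSet_mem_nodes p)
      · have := hT (measurableSet_mem_nodes ((c, i) :: p))
        simp only [graft, h, if_false, Set.mem_ofPred_eq]
        exact this
  · rcases p with _ | ⟨⟨c, i⟩, p⟩
    · by_cases h : b = a
      · simpa [graft, h] using hl
      · simpa [graft, h, Function.comp_def] using (measurable_branches [] b).comp hT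
    · by_cases h : (c, i) = (a, j)
      · simpa [graft, h, Function.comp_def] using (measurable_branches p b).comp hC
      · simp only [graft, h, if_false]
        exact (measurable_branches _ b).comp hT
  · rcases p with _ | ⟨⟨c, i⟩, p⟩
    · by_cases h : b = a
      · simpa [graft, h, Function.comp_def] using ((measurable_visits [] a).comp hT).add_const 1
      · simpa [graft, h, Function.comp_def] using (measurable_visits [] b).comp hT
    · by_cases h : (c, i) = (a, j)
      · simpa [graft, h, Function.comp_def] using (measurable_visits p b).comp hC
      · simp only [graft, h, if_false]
        exact (measurable_visits _ b).comp hT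
  · rcases p with _ | ⟨⟨c, i⟩, p⟩
    · have h1 := (measurable_value [] a).comp hT
      have h2 := (measurable_visits [] a).comp hT
      by_cases h : b = a
      · simp only [graft, h, if_true]
        refine h1.add ((he.sub h1).div ?_)
        exact (measurable_from_nat (f := fun n : ℕ => ((n + 1 : ℕ) : ℝ))).comp h2
      · simpa [graft, h, Function.comp_def] using (measurable_value [] b).comp hT
    · by_cases h : (c, i) = (a, j)
      · simpa [graft, h, Function.comp_def] using (measurable_value p b).comp hC
      · simp only [graft, h, if_false]
        exact (measurable_value _ b).comp hT

end SearchTree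

/-! ### Simulations relative to a subtree -/

namespace SearchTree

variable {A Z : Type*}

theorem ext_fields {T T' : SearchTree A Z} (h1 : ∀ p, p ∈ T.nodes ↔ p ∈ T'.nodes)
    (h2 : ∀ p a, T.branches p a = T'.branches p a) (h3 : ∀ p a, T.visits p a = T'.visits p a)
    (h4 : ∀ p a, T.value p a = T'.value p a) : T = T' := by
  cases T; cases T'
  simp only [SearchTree.mk.injEq]
  exact ⟨Set.ext h1, funext fun p => funext (h2 p), funext fun p => funext (h3 p),
    funext fun p => funext (h4 p)⟩

/-- The trees `T` and `T'` agree outside the subtree below `h`. -/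
structure AgreeOff (h : Node A) (T T' : SearchTree A Z) : Prop where
  nodes : ∀ p, ¬ h <+: p → (p ∈ T.nodes ↔ p ∈ T'.nodes)
  branches : ∀ p, ¬ h <+: p → ∀ a, T.branches p a = T'.branches p a
  visits : ∀ p, ¬ h <+: p → ∀ a, T.visits p a = T'.visits p a
  value : ∀ p, ¬ h <+: p → ∀ a, T.value p a = T'.value p a

theorem AgreeOff.refl (h : Node A) (T : SearchTree A Z) : AgreeOff h T T :=
  ⟨fun _ _ => Iff.rfl, fun _ _ _ => rfl, fun _ _ _ => rfl, fun _ _ _ => rfl⟩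

theorem AgreeOff.trans {h : Node A} {T T' T'' : SearchTree A Z} (h1 : AgreeOff h T T')
    (h2 : AgreeOff h T' T'') : AgreeOff h T T'' :=
  ⟨fun p hp => (h1.nodes p hp).trans (h2.nodes p hp),
    fun p hp a => (h1.branches p hp a).trans (h2.branches p hp a),
    fun p hp a => (h1.visits p hp a).trans (h2.visits p hp a),
    fun p hp a => (h1.value p hp a).trans (h2.value p hp a)⟩

theorem AgreeOff.of_append {h l : Node A} {T T' : SearchTree A Z} (h1 : AgreeOff (h ++ l) T T') :
    AgreeOff h T T' :=
  have key : ∀ p, ¬ h <+: p → ¬ (h ++ l) <+: p := fun _ hp h2 =>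
    hp ((List.prefix_append h l).trans h2)
  ⟨fun p hp => h1.nodes p (key p hp), fun p hp => h1.branches p (key p hp),
    fun p hp => h1.visits p (key p hp), fun p hp => h1.value p (key p hp)⟩

end SearchTree

section Equivariance

theorem node_append_eq_self {A : Type*} (h p : Node A) : h ++ p = h ↔ p = [] :=
  List.append_right_eq_self

open SearchTree

variable {X A Z : Type*} [MeasurableSpace X] [MeasurableSpace Z] [Fintype A] [Nonempty A]

theorem sub_setBranches_append (T : SearchTree A Z) (h l : Node A) (hl : l ≠ []) (a : A)
    (b : List Z) : (T.setBranches h a b).sub (h ++ l) = T.sub (h ++ l) := by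
  refine ext_fields (fun _ => Iff.rfl) (fun p b => ?_) (fun _ _ => rfl) fun _ _ => rfl
  simp [sub, setBranches, hl]

theorem sub_setBranches (T : SearchTree A Z) (h : Node A) (a : A) (b : List Z) :
    (T.setBranches h a b).sub h = (T.sub h).setBranches [] a b := by
  refine ext_fields (fun _ => Iff.rfl) (fun p b => ?_) (fun _ _ => rfl) fun _ _ => rfl
  by_cases hp : p = []
  · subst hp; by_cases hb : b = a <;> simp [sub, setBranches, hb]
  · have : h ++ p ≠ h := fun h' => hp ((node_append_eq_self h p).1 h')
    simp [sub, setBranches, hp]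

theorem sub_backup (T : SearchTree A Z) (h : Node A) (a : A) (r : ℝ) :
    (T.backup h a r).sub h = (T.sub h).backup [] a r := by
  refine ext_fields (fun _ => Iff.rfl) (fun _ _ => rfl) (fun p b => ?_) fun p b => ?_
  all_goals
    by_cases hp : p = []
    · subst hp; by_cases hb : b = a <;> simp [sub, backup, hb]
    · have : h ++ p ≠ h := fun h' => hp ((node_append_eq_self h p).1 h')
      simp [sub, backup, hp]

theorem sub_expand (T : SearchTree A Z) (h : Node A) :
    (T.expand h).sub h = (T.sub h).expand [] := by
  refine ext_fields (fun p => ?_) (fun _ _ => rfl) (fun _ _ => rfl) fun _ _ => rfl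
  simp [sub, expand]

theorem agreeOff_setBranches (T : SearchTree A Z) (h : Node A) (a : A) (b : List Z) :
    AgreeOff h (T.setBranches h a b) T :=
  ⟨fun _ _ => Iff.rfl, fun p hp c => by
    have : p ≠ h := by rintro rfl; exact hp (List.prefix_refl _)
    simp [setBranches, this], fun _ _ _ => rfl, fun _ _ _ => rfl⟩

theorem agreeOff_backup (T : SearchTree A Z) (h : Node A) (a : A) (r : ℝ) :
    AgreeOff h (T.backup h a r) T := by
  have key : ∀ p, ¬ h <+: p → p ≠ h := by rintro p hp rfl; exact hp (List.prefix_refl _)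
  exact ⟨fun _ _ => Iff.rfl, fun p hp c => rfl, fun p hp c => by simp [backup, key p hp],
    fun p hp c => by simp [backup, key p hp]⟩

theorem agreeOff_expand (T : SearchTree A Z) (h : Node A) : AgreeOff h (T.expand h) T := by
  have key : ∀ p, ¬ h <+: p → p ≠ h := by rintro p hp rfl; exact hp (List.prefix_refl _)
  exact ⟨fun p hp => by simp [expand, key p hp], fun _ _ _ => rfl, fun _ _ _ => rfl,
    fun _ _ _ => rfl⟩

/-- The outcome `o` of a simulation from the node `h` of the tree `T` corresponds to the outcome
`o'` of a simulation from the root of the subtree below `h`. -/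
structure Outcome.Relocates {K : ℕ} (h : Node A) (T : SearchTree A Z) (o o' : Outcome A Z K) :
    Prop where
  ret : o.ret = o'.ret
  lik : o.lik = o'.lik
  est : ∀ l, o.est (h ++ l) = o'.est l
  est_off : ∀ p, ¬ h <+: p → o.est p = none
  sub_tree : o.tree.sub h = o'.tree
  off : AgreeOff h o.tree T

/-- A simulation from `h` consults and changes only statistics at addresses that extend `h`; the
history, depth, samples and weights are passed along as arguments. Hence a node may always be
regarded as the root of its own tree. -/
theorem simulate_relocates {M : POMDP X A Z} (sim : Simulator M) (S : Settings X)
    (s : Steering A Z) (εa εz : ℝ) {K : ℕ} (ξ : Noise K) (k : ℕ) (T : SearchTree A Z) (h : Node A)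
    (g : Hist A Z) (d : ℕ) (x : Fin (K + 1) → X) (w : Fin (K + 1) → ℝ) :
    Outcome.Relocates h T (simulate sim S s εa εz ξ k T h g d x w)
      (simulate sim S s εa εz ξ k (T.sub h) [] g d x w) := by
  classical
  induction k generalizing T h g d x w with
  | zero => exact ⟨rfl, rfl, fun _ => rfl, fun _ _ => rfl, rfl, AgreeOff.refl _ _⟩
  | succ k ih =>
    by_cases hT : h ∈ T.nodes
    swap
    · have hT' : [] ∉ (T.sub h).nodes := by simpa [sub] using hT
      simp only [simulate, hT, hT', if_false]
      exact ⟨rfl, rfl, fun _ => rfl, fun _ _ => rfl, sub_expand T h, agreeOff_expand T h⟩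
    have hT' : [] ∈ (T.sub h).nodes := by simpa [sub] using hT
    simp only [simulate, hT, hT', if_true]
    have hsv : steeringValues s (T.sub h) [] g = steeringValues s T h g := by
      cases s <;> simp [steeringValues, sub]
    have hbr : ∀ a, (T.sub h).branches [] a = T.branches h a := by simp [sub]
    simp only [hsv, hbr, List.nil_append]
    set a := selectAction εa (steeringValues s T h g) (ξ (.explore d)) (ξ (.action d))
    set x' := fun i => sim.move (x i) a (ξ (.move d i))
    set m := selectMeasurement εz (T.branches h a)
          (sim.sense (x' (drawSample w (ξ (.sample d)))) (ξ (.sense d)))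
          (ξ (.spawn d)) (ξ (.branch d))
    -- The induction hypothesis is used twice, since the two recursive calls run in different trees.
    -- Both are compared with the simulation at the root of the same subtree below `h ++ [(a,
    -- m.1)]`, which the change of the branch list at `h` leaves untouched.
    have c1 := ih (T.setBranches h a m.2.2) (h ++ [(a, m.1)]) (g ++ [(a, m.2.1)]) (d + 1) x'
      (fun i => w i * (M.o (x' i) m.2.1 : ℝ))
    have c2 := ih ((T.sub h).setBranches [] a m.2.2) [(a, m.1)] (g ++ [(a, m.2.1)]) (d + 1) x'
      (fun i => w i * (M.o (x' i) m.2.1 : ℝ))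
    have e1 : (T.setBranches h a m.2.2).sub (h ++ [(a, m.1)]) = T.sub (h ++ [(a, m.1)]) :=
      sub_setBranches_append T h _ (by simp) a _
    have e2 : ((T.sub h).setBranches [] a m.2.2).sub [(a, m.1)] = T.sub (h ++ [(a, m.1)]) := by
      rw [← SearchTree.sub_sub]
      exact sub_setBranches_append (T.sub h) [] [(a, m.1)] (by simp) a _
    rw [e1] at c1
    rw [e2] at c2
    set o1 := simulate sim S s εa εz ξ k (T.setBranches h a m.2.2) (h ++ [(a, m.1)])
      (g ++ [(a, m.2.1)]) (d + 1) x' (fun i => w i * (M.o (x' i) m.2.1 : ℝ))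
    set o2 := simulate sim S s εa εz ξ k ((T.sub h).setBranches [] a m.2.2) [(a, m.1)]
      (g ++ [(a, m.2.1)]) (d + 1) x' (fun i => w i * (M.o (x' i) m.2.1 : ℝ))
    have hret : o1.ret = o2.ret := c1.ret.trans c2.ret.symm
    have hlik : o1.lik = o2.lik := c1.lik.trans c2.lik.symm
    have htree : o1.tree.sub h = o2.tree := by
      have key : ∀ p : Node A, ¬ [(a, m.1)] <+: p → ¬ (h ++ [(a, m.1)]) <+: (h ++ p) := by
        intro p hp h2
        exact hp ((List.prefix_append_right_inj h).1 h2)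
      have hs : o1.tree.sub (h ++ [(a, m.1)]) = o2.tree.sub [(a, m.1)] :=
        c1.sub_tree.trans c2.sub_tree.symm
      have hb := sub_setBranches T h a m.2.2
      refine ext_fields (fun p => ?_) (fun p b => ?_) (fun p b => ?_) fun p b => ?_
      · by_cases hp : [(a, m.1)] <+: p
        · obtain ⟨q, rfl⟩ := hp
          have : q ∈ (o1.tree.sub (h ++ [(a, m.1)])).nodes ↔ q ∈ (o2.tree.sub [(a, m.1)]).nodes := by
            rw [hs]
          simpa [sub] using this
        · rw [c2.off.nodes p hp, ← hb]
          exact c1.off.nodes _ (key p hp)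
      · by_cases hp : [(a, m.1)] <+: p
        · obtain ⟨q, rfl⟩ := hp
          have := congrArg (fun T : SearchTree A Z => T.branches q) hs
          simpa [sub] using congrFun this b
        · rw [c2.off.branches p hp, ← hb]
          exact c1.off.branches _ (key p hp) b
      · by_cases hp : [(a, m.1)] <+: p
        · obtain ⟨q, rfl⟩ := hp
          have := congrArg (fun T : SearchTree A Z => T.visits q) hs
          simpa [sub] using congrFun this b
        · rw [c2.off.visits p hp, ← hb]
          exact c1.off.visits _ (key p hp) b
      · by_cases hp : [(a, m.1)] <+: p
        · obtain ⟨q, rfl⟩ := hp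
          have := congrArg (fun T : SearchTree A Z => T.value q) hs
          simpa [sub] using congrFun this b
        · rw [c2.off.value p hp, ← hb]
          exact c1.off.value _ (key p hp) b
    refine ⟨?_, ?_, ?_, ?_, ?_, ?_⟩
    · simp only [hret]
    · simp only [hlik]
    · intro l
      simp only [hret, hlik, node_append_eq_self]
      by_cases hl : l = []
      · simp [hl]
      · simp only [hl, if_false]
        by_cases hp : [(a, m.1)] <+: l
        · obtain ⟨q, rfl⟩ := hp
          have e1 := c1.est q
          have e2 := c2.est q
          rw [← List.append_assoc, e1, ← e2]
        · rw [c2.est_off l hp, c1.est_off]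
          intro h2
          exact hp ((List.prefix_append_right_inj h).1 h2)
    · intro p hp
      have h1 : p ≠ h := by rintro rfl; exact hp (List.prefix_refl _)
      simp only [h1, if_false]
      exact c1.est_off p fun h2 => hp ((List.prefix_append h _).trans h2)
    · rw [sub_backup, htree]
      simp only [hret, hlik]
    · exact (agreeOff_backup _ _ _ _).trans
        ((c1.off.of_append).trans (agreeOff_setBranches T h a m.2.2))

end Equivariance

/-! ### Episodes from the root of a subtree -/

/-- A POMDP with a simulator and the parameters of the search. -/
structure Planner (X A Z : Type*) [MeasurableSpace X] [MeasurableSpace Z] where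
  M : POMDP X A Z
  sim : Simulator M
  S : Settings X
  s : Steering A Z
  εa : ℝ
  εz : ℝ
  εa_pos : 0 < εa
  εa_lt : εa < 1
  εz_ge : -1 ≤ εz
  εz_neg : εz < 0

/-- The random numbers consumed by the sample `i`: the first one draws the initial state, the
others the transitions. -/
def particleNoise {K : ℕ} (ξ : Noise K) (i : Fin (K + 1)) : ℕ → unitInterval
  | 0 => ξ (.start i)
  | e + 1 => ξ (.move e i)

/-- The branch selected among `n` branches; `n` stands for a new branch. -/
def branchIndex (εz : ℝ) (n : ℕ) (u u' : unitInterval) : ℕ :=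
  open Classical in if (u : ℝ) < ((n : ℝ) + 1) ^ εz then n else ⌊(u' : ℝ) * n⌋₊

theorem branchIndex_le (εz : ℝ) (n : ℕ) (u u' : unitInterval) : branchIndex εz n u u' ≤ n := by
  unfold branchIndex
  split_ifs
  · exact le_rfl
  · refine Nat.floor_le_of_le ?_
    exact mul_le_of_le_one_left (Nat.cast_nonneg n) u'.2.2

/-- The index `|l|` always stands for a new branch. This also covers the exceptional value `u' = 1`,
where the rounded index leaves the list and the algorithm opens a new branch as well. -/
theorem selectMeasurement_eq {Z : Type*} (εz : ℝ) (l : List Z) (z : Z) (u u' : unitInterval) :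
    selectMeasurement εz l z u u' =
      (branchIndex εz l.length u u', l.getD (branchIndex εz l.length u u') z,
        if branchIndex εz l.length u u' < l.length then l else l ++ [z]) := by
  have hle := branchIndex_le εz l.length u u'
  have h : selectMeasurement εz l z u u' = match l[branchIndex εz l.length u u']? with
      | some z' => (branchIndex εz l.length u u', z', l)
      | none => (l.length, z, l ++ [z]) := rfl
  rw [h]
  by_cases hj : branchIndex εz l.length u u' < l.length
  · simp [hj]
  · have : branchIndex εz l.length u u' = l.length := by omega
    simp [this]

namespace Planner

variable {X A Z : Type*} [MeasurableSpace X] [MeasurableSpace Z]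

/-! ### Weighted trajectories of single samples. -/

section Particles

variable (P : Planner X A Z)

/-- One step of the weighted trajectory of a sample. The components are the depth, the state, the
weight and the discounted rewards collected from each depth onwards. -/
def advance (u : ℕ → unitInterval) (q : ℕ × X × ℝ≥0 × (ℕ → ℝ)) (az : A × Z) :
    ℕ × X × ℝ≥0 × (ℕ → ℝ) :=
  (q.1 + 1, P.sim.move q.2.1 az.1 (u (q.1 + 1)),
    q.2.2.1 * P.M.o (P.sim.move q.2.1 az.1 (u (q.1 + 1))) az.2,
    fun d => q.2.2.2 d + if d ≤ q.1 then P.M.γ ^ (q.1 - d) *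
      P.M.r q.2.1 az.1 (P.sim.move q.2.1 az.1 (u (q.1 + 1))) else 0)

/-- The weighted trajectory of a sample along the history `g`. -/
def traj (g : Hist A Z) (u : ℕ → unitInterval) : ℕ × X × ℝ≥0 × (ℕ → ℝ) :=
  g.foldl (P.advance u) (0, P.sim.start (u 0), 1, fun _ => 0)

/-- The state of a sample after the history `g`. -/
def pos (g : Hist A Z) (u : ℕ → unitInterval) : X := (P.traj g u).2.1

/-- The weight of a sample after the history `g`. -/
def wt (g : Hist A Z) (u : ℕ → unitInterval) : ℝ≥0 := (P.traj g u).2.2.1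

/-- The discounted rewards that a sample has collected along the history `g` from the depth `d`
onwards. -/
def acc (g : Hist A Z) (u : ℕ → unitInterval) (d : ℕ) : ℝ := (P.traj g u).2.2.2 d

/-- The successor state of a sample after the history `g` and the action `a`. -/
def nextPos (g : Hist A Z) (a : A) (u : ℕ → unitInterval) : X :=
  P.sim.move (P.pos g u) a (u (g.length + 1))

theorem traj_fst (g : Hist A Z) (u : ℕ → unitInterval) : (P.traj g u).1 = g.length := by
  induction g using List.reverseRecOn with
  | nil => rfl
  | append_singleton g az ih =>
    rw [traj, List.foldl_append, ← traj]
    simp [advance, ih]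

@[simp] theorem pos_nil (u : ℕ → unitInterval) : P.pos [] u = P.sim.start (u 0) := rfl

@[simp] theorem wt_nil (u : ℕ → unitInterval) : P.wt [] u = 1 := rfl

theorem pos_snoc (g : Hist A Z) (a : A) (z : Z) (u : ℕ → unitInterval) :
    P.pos (g ++ [(a, z)]) u = P.nextPos g a u := by
  rw [pos, traj, List.foldl_append, ← traj]
  simp [advance, traj_fst, nextPos, pos]

theorem wt_snoc (g : Hist A Z) (a : A) (z : Z) (u : ℕ → unitInterval) :
    P.wt (g ++ [(a, z)]) u = P.wt g u * P.M.o (P.nextPos g a u) z := by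
  rw [wt, traj, List.foldl_append, ← traj]
  simp [advance, traj_fst, nextPos, pos, wt]

theorem acc_snoc (g : Hist A Z) (a : A) (z : Z) (u : ℕ → unitInterval) {d : ℕ}
    (hd : d ≤ g.length) : P.acc (g ++ [(a, z)]) u d =
      P.acc g u d + P.M.γ ^ (g.length - d) * P.M.r (P.pos g u) a (P.nextPos g a u) := by
  rw [acc, traj, List.foldl_append, ← traj]
  simp [advance, traj_fst, nextPos, pos, acc, hd]

theorem acc_of_length_le (g : Hist A Z) (u : ℕ → unitInterval) {d : ℕ} (hd : g.length ≤ d) :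
    P.acc g u d = 0 := by
  induction g using List.reverseRecOn with
  | nil => rfl
  | append_singleton g az ih =>
    simp only [List.length_append, List.length_singleton] at hd
    rw [acc, traj, List.foldl_append, ← traj]
    have h1 := ih (by omega)
    have h2 : ¬ d ≤ g.length := by omega
    rw [acc] at h1
    simp [advance, traj_fst, h1, h2]

end Particles

/-! ### One episode at the root of a subtree and its one-step recursion. -/

section Run

variable [Fintype A] [Nonempty A] (P : Planner X A Z) {K : ℕ}

/-- An episode of `k` further steps from the root of `T`, whose samples have been sent along the
history `g`. -/
def run (k : ℕ) (g : Hist A Z) (T : SearchTree A Z) (ξ : Noise K) : Outcome A Z K :=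
  simulate P.sim P.S P.s P.εa P.εz ξ k T [] g g.length (fun i => P.pos g (particleNoise ξ i))
    fun i => (P.wt g (particleNoise ξ i) : ℝ)

/-- The weighted average of the returns from depth `d` of an outcome after the history `g`. -/
def wavg (g : Hist A Z) (d : ℕ) (o : Outcome A Z K) (ξ : Noise K) : ℝ :=
  (∑ i, P.wt g (particleNoise ξ i) * o.lik i *
    (P.acc g (particleNoise ξ i) d + P.M.γ ^ (g.length - d) * o.ret i)) /
  ∑ i, P.wt g (particleNoise ξ i) * o.lik i

/-- The action chosen at the root. -/
def pick (g : Hist A Z) (T : SearchTree A Z) (ξ : Noise K) : A :=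
  selectAction P.εa (steeringValues P.s T [] g) (ξ (.explore g.length)) (ξ (.action g.length))

/-- The branch chosen at the root, if the action is `a`. -/
def pickBranch (g : Hist A Z) (T : SearchTree A Z) (a : A) (ξ : Noise K) : ℕ :=
  branchIndex P.εz (T.branches [] a).length (ξ (.spawn g.length)) (ξ (.branch g.length))

/-- The measurement for a new branch of the action `a`. -/
def newMeas (g : Hist A Z) (a : A) (ξ : Noise K) : Z :=
  P.sim.sense (P.nextPos g a (particleNoise ξ
    (drawSample (fun i => (P.wt g (particleNoise ξ i) : ℝ)) (ξ (.sample g.length)))))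
    (ξ (.sense g.length))

/-- The measurement of the branch `j` of the action `a`. -/
def measAt (g : Hist A Z) (T : SearchTree A Z) (a : A) (j : ℕ) (ξ : Noise K) : Z :=
  (T.branches [] a).getD j (P.newMeas g a ξ)

/-- The branches of the action `a`, after the branch `j` has been selected. -/
def branchesAt (g : Hist A Z) (T : SearchTree A Z) (a : A) (j : ℕ) (ξ : Noise K) : List Z :=
  if j < (T.branches [] a).length then T.branches [] a else T.branches [] a ++ [P.newMeas g a ξ]

/-- The continuation of an episode from the branch `j` of the action `a`. -/
def child (k : ℕ) (g : Hist A Z) (T : SearchTree A Z) (a : A) (j : ℕ) (ξ : Noise K) :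
    Outcome A Z K :=
  P.run k (g ++ [(a, P.measAt g T a j ξ)]) (T.sub [(a, j)]) ξ

/-- The return from depth `d` of an episode that takes the branch `j` of the action `a`. -/
def returnAt (k : ℕ) (g : Hist A Z) (d : ℕ) (T : SearchTree A Z) (a : A) (j : ℕ) (ξ : Noise K) :
    ℝ :=
  P.wavg (g ++ [(a, P.measAt g T a j ξ)]) d (P.child k g T a j ξ) ξ

/-- The tree after an episode that takes the branch `j` of the action `a`. -/
def stepAt (k : ℕ) (g : Hist A Z) (T : SearchTree A Z) (a : A) (j : ℕ) (ξ : Noise K) :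
    SearchTree A Z :=
  T.graft a (P.branchesAt g T a j ξ) j (P.child k g T a j ξ).tree
    (P.returnAt k g g.length T a j ξ)

theorem run_zero (g : Hist A Z) (T : SearchTree A Z) (ξ : Noise K) :
    P.run 0 g T ξ =
      { tree := T, ret := fun _ => 0, lik := fun _ => 1, est := fun _ => none } := rfl

theorem run_of_not_mem (k : ℕ) (g : Hist A Z) {T : SearchTree A Z} (hT : [] ∉ T.nodes)
    (ξ : Noise K) : P.run (k + 1) g T ξ =
      { tree := T.expand []
        ret := P.S.rollout K g.length (fun i => P.pos g (particleNoise ξ i))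
          (fun i => (P.wt g (particleNoise ξ i) : ℝ)) fun j => ξ (.rollout j)
        lik := fun _ => 1
        est := fun _ => none } := by
  simp only [run, simulate, hT, if_false]

/-- One level of the recursion, with the continuation relocated to the root of the subtree of the
chosen branch and the result grafted back. Choice and continuation enter as variables with
equations, so that the later statements can fix `a` and `j` and treat them as constants. -/
theorem run_succ_aux (k : ℕ) (g : Hist A Z) {T : SearchTree A Z} (hT : [] ∈ T.nodes)
    (ξ : Noise K) (a : A) (j : ℕ) (C : Outcome A Z K) (ha : P.pick g T ξ = a)
    (hj : P.pickBranch g T a ξ = j) (hC : P.child k g T a j ξ = C) :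
    (P.run (k + 1) g T ξ).ret = (fun i => P.M.r (P.pos g (particleNoise ξ i)) a
        (P.nextPos g a (particleNoise ξ i)) + P.M.γ * C.ret i) ∧
      (P.run (k + 1) g T ξ).lik = (fun i => (P.M.o (P.nextPos g a (particleNoise ξ i))
        (P.measAt g T a j ξ) : ℝ) * C.lik i) ∧
      (P.run (k + 1) g T ξ).tree = T.graft a (P.branchesAt g T a j ξ) j C.tree
        (P.wavg g g.length (P.run (k + 1) g T ξ) ξ) ∧
      (P.run (k + 1) g T ξ).est [] = some (a, P.wavg g g.length (P.run (k + 1) g T ξ) ξ) ∧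
      (∀ p, (P.run (k + 1) g T ξ).est ((a, j) :: p) = C.est p) ∧
      ∀ b i p, (b, i) ≠ (a, j) → (P.run (k + 1) g T ξ).est ((b, i) :: p) = none := by
  classical
  set z := P.measAt g T a j ξ with hz
  set out := simulate P.sim P.S P.s P.εa P.εz ξ k (T.setBranches [] a (P.branchesAt g T a j ξ))
    [(a, j)] (g ++ [(a, z)]) (g.length + 1) (fun i => P.nextPos g a (particleNoise ξ i))
    (fun i => (P.wt g (particleNoise ξ i) : ℝ) * (P.M.o (P.nextPos g a (particleNoise ξ i)) z : ℝ))
    with hout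
  set ret : Fin (K + 1) → ℝ := fun i => P.M.r (P.pos g (particleNoise ξ i)) a
        (P.nextPos g a (particleNoise ξ i)) + P.M.γ * out.ret i with hret
  set lik : Fin (K + 1) → ℝ := fun i => (P.M.o (P.nextPos g a (particleNoise ξ i)) z : ℝ) *
    out.lik i with hlik
  set e := (∑ i, (P.wt g (particleNoise ξ i) : ℝ) * lik i * ret i) /
    ∑ i, (P.wt g (particleNoise ξ i) : ℝ) * lik i with he
  have h0 : P.run (k + 1) g T ξ =
      { tree := out.tree.backup [] a e, ret := ret, lik := lik
        est := fun h' => if h' = [] then some (a, e) else out.est h' } := by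
    have hsel := selectMeasurement_eq P.εz (T.branches [] a) (P.newMeas g a ξ) (ξ (.spawn g.length))
      (ξ (.branch g.length))
    have hj' : branchIndex P.εz (T.branches [] a).length (ξ (.spawn g.length))
      (ξ (.branch g.length)) = j := hj
    rw [hj'] at hsel
    simp only [newMeas] at hsel
    have ha' : selectAction P.εa (steeringValues P.s T [] g) (ξ (.explore g.length))
      (ξ (.action g.length)) = a := ha
    simp only [run, simulate, hT, if_true, ha']
    have hnp : ∀ i, P.sim.move (P.pos g (particleNoise ξ i)) a (ξ (.move g.length i)) =
        P.nextPos g a (particleNoise ξ i) := fun i => rfl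
    simp only [hnp, hsel]
    rfl
  have hrel := simulate_relocates P.sim P.S P.s P.εa P.εz ξ k
    (T.setBranches [] a (P.branchesAt g T a j ξ)) [(a, j)] (g ++ [(a, z)]) (g.length + 1)
    (fun i => P.nextPos g a (particleNoise ξ i))
    (fun i => (P.wt g (particleNoise ξ i) : ℝ) * (P.M.o (P.nextPos g a (particleNoise ξ i)) z : ℝ))
  have hC' : simulate P.sim P.S P.s P.εa P.εz ξ k
      ((T.setBranches [] a (P.branchesAt g T a j ξ)).sub [(a, j)]) [] (g ++ [(a, z)])
      (g.length + 1) (fun i => P.nextPos g a (particleNoise ξ i))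
      (fun i => (P.wt g (particleNoise ξ i) : ℝ) *
        (P.M.o (P.nextPos g a (particleNoise ξ i)) z : ℝ)) = C := by
    rw [← hC, child, run]
    have := sub_setBranches_append T [] [(a, j)] (by simp) a (P.branchesAt g T a j ξ)
    rw [List.nil_append] at this
    rw [this]
    simp only [pos_snoc, wt_snoc, List.length_append, List.length_singleton, NNReal.coe_mul, ← hz]
  rw [hC', ← hout] at hrel
  -- Measured from the depth of the node itself nothing has been accumulated and the discount
  -- exponent is `0`, so `wavg` is the estimate that the algorithm backs up.
  have hwavg : P.wavg g g.length (P.run (k + 1) g T ξ) ξ = e := by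
    rw [h0]
    simp only [wavg, P.acc_of_length_le g _ le_rfl, Nat.sub_self, pow_zero, one_mul, zero_add, he]
  rw [hwavg, h0]
  refine ⟨?_, ?_, ?_, ?_, ?_, ?_⟩
  · simp only [hret, hrel.ret]
  · simp only [hlik, hrel.lik]
  · have hoff := hrel.off
    have hsub := hrel.sub_tree
    refine SearchTree.ext_fields (fun p => ?_) (fun p b => ?_) (fun p b => ?_) fun p b => ?_
    · rcases p with _ | ⟨⟨c, i⟩, p⟩
      · exact hoff.nodes [] (by simp)
      · by_cases h : (c, i) = (a, j)
        · rw [h, ← hsub]; simp [SearchTree.graft, SearchTree.backup, SearchTree.sub]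
        · have := hoff.nodes ((c, i) :: p) (by
            rw [List.cons_prefix_cons]; exact fun h' => h h'.1.symm)
          simp only [SearchTree.graft, SearchTree.backup, h, if_false, Set.mem_ofPred_eq]
          exact this
    · rcases p with _ | ⟨⟨c, i⟩, p⟩
      · have := hoff.branches [] (by simp) b
        simpa [SearchTree.graft, SearchTree.backup, SearchTree.setBranches] using this
      · by_cases h : (c, i) = (a, j)
        · rw [h, ← hsub]; simp [SearchTree.graft, SearchTree.backup, SearchTree.sub]
        · have := hoff.branches ((c, i) :: p) (by
            rw [List.cons_prefix_cons]; exact fun h' => h h'.1.symm) b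
          simp only [SearchTree.graft, SearchTree.backup, h, if_false]
          rw [this]; simp [SearchTree.setBranches]
    · rcases p with _ | ⟨⟨c, i⟩, p⟩
      · have h1 := hoff.visits [] (by simp) b
        have h2 := hoff.visits [] (by simp) a
        by_cases h : b = a
        · subst h
          simpa [SearchTree.graft, SearchTree.backup, SearchTree.setBranches] using h1
        · simpa [SearchTree.graft, SearchTree.backup, SearchTree.setBranches, h] using h1
      · by_cases h : (c, i) = (a, j)
        · rw [h, ← hsub]; simp [SearchTree.graft, SearchTree.backup, SearchTree.sub]
        · have := hoff.visits ((c, i) :: p) (by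
            rw [List.cons_prefix_cons]; exact fun h' => h h'.1.symm) b
          simp only [SearchTree.graft, SearchTree.backup, h, if_false]
          simp only [List.cons_ne_nil, false_and, if_false]
          rw [this]; simp [SearchTree.setBranches]
    · rcases p with _ | ⟨⟨c, i⟩, p⟩
      · have h1 := hoff.value [] (by simp) b
        have h2 := hoff.visits [] (by simp) a
        by_cases h : b = a
        · subst h
          simp only [SearchTree.setBranches] at h1 h2
          simp [SearchTree.graft, SearchTree.backup, h1, h2]
        · simpa [SearchTree.graft, SearchTree.backup, SearchTree.setBranches, h] using h1
      · by_cases h : (c, i) = (a, j)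
        · rw [h, ← hsub]; simp [SearchTree.graft, SearchTree.backup, SearchTree.sub]
        · have := hoff.value ((c, i) :: p) (by
            rw [List.cons_prefix_cons]; exact fun h' => h h'.1.symm) b
          simp only [SearchTree.graft, SearchTree.backup, h, if_false]
          simp only [List.cons_ne_nil, false_and, if_false]
          rw [this]; simp [SearchTree.setBranches]
  · simp
  · intro p
    simpa using hrel.est p
  · intro b i p h
    simp only [List.cons_ne_nil, if_false]
    exact hrel.est_off _ (by rw [List.cons_prefix_cons]; exact fun h' => h h'.1.symm)

/-- Moving one step from the simulated future into the history changes nothing: the likelihood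
passes into the weight and the reward into the accumulated sum. Thus the return from a fixed depth
can be followed down the tree without leaving the form of a single weighted average. -/
theorem wavg_run_succ (k : ℕ) (g : Hist A Z) {d : ℕ} (hd : d ≤ g.length) {T : SearchTree A Z}
    (hT : [] ∈ T.nodes) (ξ : Noise K) : P.wavg g d (P.run (k + 1) g T ξ) ξ =
      P.returnAt k g d T (P.pick g T ξ) (P.pickBranch g T (P.pick g T ξ) ξ) ξ := by
  obtain ⟨hret, hlik, -⟩ := P.run_succ_aux k g hT ξ _ _ _ rfl rfl rfl
  set a := P.pick g T ξ
  set j := P.pickBranch g T a ξ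
  rw [returnAt, wavg, wavg, hret, hlik]
  congr 1
  · refine Finset.sum_congr rfl fun i _ => ?_
    rw [wt_snoc, P.acc_snoc _ _ _ _ hd]
    simp only [List.length_append, List.length_singleton, NNReal.coe_mul]
    rw [Nat.succ_sub hd, pow_succ]
    ring
  · refine Finset.sum_congr rfl fun i _ => ?_
    rw [wt_snoc]
    push_cast
    ring

theorem run_tree_succ (k : ℕ) (g : Hist A Z) {T : SearchTree A Z} (hT : [] ∈ T.nodes)
    (ξ : Noise K) : (P.run (k + 1) g T ξ).tree =
      P.stepAt k g T (P.pick g T ξ) (P.pickBranch g T (P.pick g T ξ) ξ) ξ := by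
  obtain ⟨-, -, h, -⟩ := P.run_succ_aux k g hT ξ _ _ _ rfl rfl rfl
  rw [h, P.wavg_run_succ k g le_rfl hT]
  rfl

theorem run_est_nil (k : ℕ) (g : Hist A Z) {T : SearchTree A Z} (hT : [] ∈ T.nodes)
    (ξ : Noise K) : (P.run (k + 1) g T ξ).est [] = some (P.pick g T ξ,
      P.returnAt k g g.length T (P.pick g T ξ) (P.pickBranch g T (P.pick g T ξ) ξ) ξ) := by
  obtain ⟨-, -, -, h, -⟩ := P.run_succ_aux k g hT ξ _ _ _ rfl rfl rfl
  rw [h, P.wavg_run_succ k g le_rfl hT]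

theorem run_est_cons (k : ℕ) (g : Hist A Z) {T : SearchTree A Z} (hT : [] ∈ T.nodes)
    (ξ : Noise K) (a : A) (j : ℕ) (p : Node A) : (P.run (k + 1) g T ξ).est ((a, j) :: p) =
      open Classical in
      if P.pick g T ξ = a ∧ P.pickBranch g T a ξ = j then (P.child k g T a j ξ).est p else none := by
  obtain ⟨-, -, -, -, h1, h2⟩ := P.run_succ_aux k g hT ξ _ _ _ rfl rfl rfl
  split_ifs with h
  · obtain ⟨rfl, rfl⟩ := h
    exact h1 p
  · refine h2 a j p fun h' => h ?_
    obtain ⟨rfl, rfl⟩ := Prod.mk.inj h'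
    exact ⟨rfl, rfl⟩

end Run

end Planner

/-! ### Measurability of the simulation -/

theorem measurable_of_cases {α β : Type*} [MeasurableSpace α] [MeasurableSpace β] {s : Set α}
    (hs : MeasurableSet s) {f g e : α → β} (hf : Measurable f) (hg : Measurable g)
    (h1 : ∀ x ∈ s, e x = f x) (h2 : ∀ x ∉ s, e x = g x) : Measurable e := by
  classical
  have : e = fun x => if x ∈ s then f x else g x := by
    funext x
    by_cases hx : x ∈ s
    · rw [if_pos hx, h1 x hx]
    · rw [if_neg hx, h2 x hx]
  rw [this]
  exact Measurable.ite hs hf hg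

/-! ### Measurability of the random choices. -/

section Actions

variable {A : Type*} [Fintype A] [Nonempty A]

/-- Expresses the selection, including the tie-breaking rule, by finitely many comparisons of
coordinates; measurability of `greedy` is read off from it. -/
theorem greedy_eq_iff (v : A → ℝ) (a : A) : greedy v = a ↔
    (∀ b, v b ≤ v a) ∧ ∀ c, (∀ b, v b ≤ v c) → Fintype.equivFin A a ≤ Fintype.equivFin A c := by
  classical
  have hmem : ∀ i, i ∈ maximisers v ↔ ∀ b, v b ≤ v ((Fintype.equivFin A).symm i) := by
    intro i; simp [maximisers]
  constructor
  · rintro rfl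
    constructor
    · exact (hmem _).1 (Finset.min'_mem _ (maximisers_nonempty v))
    · intro c hc
      rw [greedy, Equiv.apply_symm_apply]
      exact Finset.min'_le _ _ ((hmem _).2 (by simpa using hc))
  · rintro ⟨h1, h2⟩
    rw [greedy, Equiv.symm_apply_eq]
    refine le_antisymm (Finset.min'_le _ _ ((hmem _).2 (by simpa using h1))) ?_
    refine Finset.le_min' _ _ _ fun i hi => ?_
    have := h2 _ ((hmem i).1 hi)
    simpa using this

theorem le_greedy (v : A → ℝ) (b : A) : v b ≤ v (greedy v) :=
  ((greedy_eq_iff v _).1 rfl).1 b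

variable [MeasurableSpace A] [DiscreteMeasurableSpace A]

theorem measurable_greedy : Measurable (greedy : (A → ℝ) → A) := by
  refine measurable_to_countable' fun a => ?_
  have : greedy ⁻¹' {a} = (⋂ b, {v : A → ℝ | v b ≤ v a}) ∩
      ⋂ c, ((⋂ b, {v : A → ℝ | v b ≤ v c})ᶜ ∪
        {_v | Fintype.equivFin A a ≤ Fintype.equivFin A c}) := by
    ext v
    simp only [Set.mem_preimage, Set.mem_singleton_iff, greedy_eq_iff, Set.mem_inter_iff,
      Set.mem_iInter, Set.mem_ofPred_eq, Set.mem_union, Set.mem_compl_iff, imp_iff_not_or]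
  rw [this]
  have h : ∀ b c : A, MeasurableSet {v : A → ℝ | v b ≤ v c} := fun b c =>
    measurableSet_le (measurable_pi_apply b) (measurable_pi_apply c)
  exact (MeasurableSet.iInter fun b => h b a).inter (MeasurableSet.iInter fun c =>
    (MeasurableSet.iInter fun b => h b c).compl.union (MeasurableSet.const _))

theorem measurable_uniformAction : Measurable (uniformAction : unitInterval → A) := by
  have h1 : Measurable fun u : unitInterval => ⌊(u : ℝ) * Fintype.card A⌋₊ :=
    Nat.measurable_floor.comp (measurable_subtype_coe.mul_const _)
  exact (measurable_from_top (f := fun n : ℕ => (Fintype.equivFin A).symm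
    ⟨min n (Fintype.card A - 1),
      lt_of_le_of_lt (min_le_right _ _) (Nat.sub_lt Fintype.card_pos one_pos)⟩)).comp h1

theorem measurable_selectAction (εa : ℝ) : Measurable fun p : (A → ℝ) × unitInterval × unitInterval =>
    selectAction εa p.1 p.2.1 p.2.2 := by
  unfold selectAction
  refine Measurable.ite ?_ (measurable_greedy.comp measurable_fst)
    (measurable_uniformAction.comp measurable_snd.snd)
  exact measurableSet_lt measurable_const (measurable_subtype_coe.comp measurable_snd.fst)

end Actions

theorem measurable_drawSample {K : ℕ} :
    Measurable fun p : (Fin (K + 1) → ℝ) × unitInterval => drawSample p.1 p.2 := by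
  classical
  have h1 : Measurable fun p : (Fin (K + 1) → ℝ) × unitInterval =>
      (Finset.univ.filter fun i : Fin (K + 1) =>
        ∑ j ∈ Finset.Iic i, p.1 j ≤ (p.2 : ℝ) * ∑ j, p.1 j).card := by
    simp only [Finset.card_filter]
    refine Finset.measurable_sum _ fun i _ => Measurable.ite ?_ measurable_const measurable_const
    refine measurableSet_le (Finset.measurable_sum _ fun j _ => (measurable_pi_apply j).comp
      measurable_fst) ?_
    exact (measurable_subtype_coe.comp measurable_snd).mul (Finset.measurable_sum _ fun j _ =>
      (measurable_pi_apply j).comp measurable_fst)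
  have h2 := (measurable_from_top (f := fun n : ℕ => (⟨min n K, Nat.lt_succ_of_le
    (min_le_right _ _)⟩ : Fin (K + 1)))).comp h1
  convert h2 using 1
  funext p
  simp only [drawSample, Function.comp]

theorem measurable_branchIndex (εz : ℝ) : Measurable fun p : ℕ × unitInterval × unitInterval =>
    branchIndex εz p.1 p.2.1 p.2.2 := by
  unfold branchIndex
  have h1 : Measurable fun p : ℕ × unitInterval × unitInterval => ((p.1 : ℝ)) :=
    (measurable_from_top (f := fun n : ℕ => (n : ℝ))).comp measurable_fst
  refine Measurable.ite (measurableSet_lt (measurable_subtype_coe.comp measurable_snd.fst) ?_)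
    measurable_fst ?_
  · exact (measurable_from_top (f := fun n : ℕ => ((n : ℝ) + 1) ^ εz)).comp measurable_fst
  · exact Nat.measurable_floor.comp ((measurable_subtype_coe.comp measurable_snd.snd).mul h1)

theorem measurable_particleNoise {K : ℕ} (i : Fin (K + 1)) :
    Measurable fun ξ : Noise K => particleNoise ξ i := by
  refine measurable_pi_lambda _ fun e => ?_
  cases e with
  | zero => exact measurable_pi_apply (Seed.start i)
  | succ e => exact measurable_pi_apply (Seed.move e i)

section SteeringMeasurable

variable {A Z : Type*} [MeasurableSpace Z] [Fintype A] [MeasurableSpace A]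
  [DiscreteMeasurableSpace A]

/-- There are only countably many action sequences, so measurability in the measurements for each
fixed sequence is enough. This is the form in which prescribed values `Q` are assumed to be
measurable. -/
theorem measurable_hist_of_actions {β : Type*} [MeasurableSpace β] {f : Hist A Z → β}
    (h : ∀ as : List A, Measurable fun z : Fin as.length → Z =>
      f (List.ofFn fun i => (as.get i, z i))) : Measurable f := by
  refine measurable_list_iff.2 fun n => ?_
  have key := measurable_of_countable_choice (Ω := Fin n → A × Z) (ι := Fin n → A)
    (c := fun v i => (v i).1) (f := fun α v => f (List.ofFn fun i => (α i, (v i).2)))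
    (measurable_pi_lambda _ fun i => measurable_fst.comp (measurable_pi_apply i)) ?_
  · exact key
  · intro α
    have hlen : (List.ofFn α).length = n := List.length_ofFn
    have h1 := (h (List.ofFn α)).comp (f := fun (v : Fin n → A × Z)
      (i : Fin (List.ofFn α).length) => (v (i.cast hlen)).2)
      (measurable_pi_lambda _ fun i => measurable_snd.comp (measurable_pi_apply _))
    convert h1 using 1
    funext v
    simp only [Function.comp]
    congr 1
    refine List.ext_getElem (by simp) fun i h2 h3 => by simp

theorem measurable_steeringValues (s : Steering A Z) :
    Measurable fun p : SearchTree A Z × Hist A Z => steeringValues s p.1 [] p.2 := by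
  refine measurable_pi_lambda _ fun a => ?_
  cases s with
  | running => exact (SearchTree.measurable_value [] a).comp measurable_fst
  | frozen Q hQ => exact (measurable_hist_of_actions (f := fun g => Q g a) fun as => hQ as a).comp measurable_snd

end SteeringMeasurable

namespace Planner

variable {X A Z : Type*} [MeasurableSpace X] [MeasurableSpace Z] [Fintype A] [Nonempty A]
  [MeasurableSpace A] [DiscreteMeasurableSpace A] (P : Planner X A Z)

theorem measurable_move : Measurable fun p : X × A × unitInterval =>
    P.sim.move p.1 p.2.1 p.2.2 :=
  measurable_of_countable_choice (c := fun p : X × A × unitInterval => p.2.1)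
    (f := fun a p => P.sim.move p.1 a p.2.2) measurable_snd.fst
    fun a => (P.sim.measurable_move a).comp (measurable_fst.prodMk measurable_snd.snd)

theorem measurable_reward : Measurable fun p : X × A × X => P.M.r p.1 p.2.1 p.2.2 :=
  measurable_of_countable_choice (c := fun p : X × A × X => p.2.1)
    (f := fun a p => P.M.r p.1 a p.2.2) measurable_snd.fst
    fun a => (P.M.measurable_r a).comp (measurable_fst.prodMk measurable_snd.snd)

theorem measurable_lik : Measurable fun p : X × Z => P.M.o p.1 p.2 := P.M.measurable_o

theorem measurable_eval_nat {α : Type*} [MeasurableSpace α] :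
    Measurable fun p : ℕ × (ℕ → α) => p.2 p.1 :=
  measurable_of_countable_choice (c := fun p : ℕ × (ℕ → α) => p.1) (f := fun n p => p.2 n)
    measurable_fst fun n => (measurable_pi_apply n).comp measurable_snd

theorem measurable_traj :
    Measurable fun p : Hist A Z × (ℕ → unitInterval) => P.traj p.1 p.2 := by
  unfold traj
  refine measurable_foldl (φ := fun u => P.advance u)
    (b := fun u => (0, P.sim.start (u 0), 1, fun _ => 0)) ?_ ?_
  · unfold advance
    let Q := (ℕ → unitInterval) × (ℕ × X × ℝ≥0 × (ℕ → ℝ)) × A × Z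
    have hd : Measurable fun p : Q => p.2.1.1 := measurable_snd.fst.fst
    have hx : Measurable fun p : Q => p.2.1.2.1 := measurable_snd.fst.snd.fst
    have hw : Measurable fun p : Q => p.2.1.2.2.1 := measurable_snd.fst.snd.snd.fst
    have hR : Measurable fun p : Q => p.2.1.2.2.2 := measurable_snd.fst.snd.snd.snd
    have ha : Measurable fun p : Q => p.2.2.1 := measurable_snd.snd.fst
    have hz : Measurable fun p : Q => p.2.2.2 := measurable_snd.snd.snd
    have hu : Measurable fun p : Q => p.1 (p.2.1.1 + 1) :=
      measurable_eval_nat.comp ((hd.add_const 1).prodMk measurable_fst)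
    have hm : Measurable fun p : Q => P.sim.move p.2.1.2.1 p.2.2.1 (p.1 (p.2.1.1 + 1)) :=
      P.measurable_move.comp (hx.prodMk (ha.prodMk hu))
    refine (hd.add_const 1).prodMk (hm.prodMk ((hw.mul (P.measurable_lik.comp
      (hm.prodMk hz))).prodMk (measurable_pi_lambda _ fun d => ?_)))
    refine ((measurable_pi_apply d).comp hR).add (Measurable.ite ?_ ?_ measurable_const)
    · exact measurableSet_le measurable_const hd
    · refine Measurable.mul ?_ (P.measurable_reward.comp (hx.prodMk (ha.prodMk hm)))
      exact (measurable_from_top (f := fun n : ℕ => P.M.γ ^ (n - d))).comp hd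
  · exact measurable_const.prodMk ((P.sim.measurable_start.comp (measurable_pi_apply 0)).prodMk
      (measurable_const.prodMk measurable_const))

theorem measurable_pos : Measurable fun p : Hist A Z × (ℕ → unitInterval) => P.pos p.1 p.2 :=
  P.measurable_traj.snd.fst

theorem measurable_wt : Measurable fun p : Hist A Z × (ℕ → unitInterval) => P.wt p.1 p.2 :=
  P.measurable_traj.snd.snd.fst

theorem measurable_acc (d : ℕ) :
    Measurable fun p : Hist A Z × (ℕ → unitInterval) => P.acc p.1 p.2 d :=
  (measurable_pi_apply d).comp P.measurable_traj.snd.snd.snd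

theorem measurable_nextPos (a : A) :
    Measurable fun p : Hist A Z × (ℕ → unitInterval) => P.nextPos p.1 a p.2 :=
  P.measurable_move.comp (P.measurable_pos.prodMk (measurable_const.prodMk
    (measurable_eval_nat.comp (((measurable_length.comp measurable_fst).add_const 1).prodMk
      measurable_snd))))

section Run

variable {K : ℕ}

/-- The histories, trees and random numbers on which an episode depends. -/
abbrev RunInput (A Z : Type*) (K : ℕ) := Hist A Z × SearchTree A Z × Noise K

theorem measurable_hist_noise (i : Fin (K + 1)) :
    Measurable fun p : RunInput A Z K => (p.1, particleNoise p.2.2 i) :=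
  measurable_fst.prodMk ((measurable_particleNoise i).comp measurable_snd.snd)

theorem measurable_seed (c : ℕ → Seed K) :
    Measurable fun p : RunInput A Z K => p.2.2 (c p.1.length) :=
  measurable_of_countable_choice (c := fun p : RunInput A Z K => p.1.length)
    (f := fun n p => p.2.2 (c n)) (measurable_length.comp measurable_fst)
    fun n => (measurable_pi_apply (c n)).comp measurable_snd.snd

theorem measurable_pick : Measurable fun p : RunInput A Z K => P.pick p.1 p.2.1 p.2.2 :=
  (measurable_selectAction P.εa).comp (((measurable_steeringValues P.s).comp
    (measurable_snd.fst.prodMk measurable_fst)).prodMk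
      ((measurable_seed .explore).prodMk (measurable_seed .action)))

theorem measurable_pickBranch (a : A) :
    Measurable fun p : RunInput A Z K => P.pickBranch p.1 p.2.1 a p.2.2 :=
  (measurable_branchIndex P.εz).comp ((measurable_length.comp
    ((SearchTree.measurable_branches [] a).comp measurable_snd.fst)).prodMk
      ((measurable_seed .spawn).prodMk (measurable_seed .branch)))

theorem measurable_newMeas (a : A) :
    Measurable fun p : RunInput A Z K => P.newMeas p.1 a p.2.2 := by
  have hw : Measurable fun p : RunInput A Z K =>
      ((fun i => (P.wt p.1 (particleNoise p.2.2 i) : ℝ)), p.2.2 (.sample p.1.length)) :=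
    (measurable_pi_lambda _ fun i =>
      (P.measurable_wt.comp (measurable_hist_noise i)).coe_nnreal_real).prodMk
        (measurable_seed .sample)
  have hx := measurable_of_countable_choice (measurable_drawSample.comp hw)
    (f := fun i (p : RunInput A Z K) => P.nextPos p.1 a (particleNoise p.2.2 i))
    fun i => (P.measurable_nextPos a).comp (measurable_hist_noise i)
  exact P.sim.measurable_sense.comp (hx.prodMk (measurable_seed .sense))

theorem measurable_measAt (a : A) (j : ℕ) :
    Measurable fun p : RunInput A Z K => P.measAt p.1 p.2.1 a j p.2.2 :=
  (measurable_getD_prod j).comp (((SearchTree.measurable_branches [] a).comp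
    measurable_snd.fst).prodMk (P.measurable_newMeas a))

theorem measurable_branchesAt (a : A) (j : ℕ) :
    Measurable fun p : RunInput A Z K => P.branchesAt p.1 p.2.1 a j p.2.2 := by
  have h := (SearchTree.measurable_branches (Z := Z) [] a).comp
    (measurable_snd.fst : Measurable fun p : RunInput A Z K => p.2.1)
  refine Measurable.ite ?_ h (measurable_append_singleton.comp
    (h.prodMk (P.measurable_newMeas a)))
  exact measurableSet_lt measurable_const (measurable_length.comp h)

theorem measurable_snoc_measAt (a : A) (j : ℕ) :
    Measurable fun p : RunInput A Z K => p.1 ++ [(a, P.measAt p.1 p.2.1 a j p.2.2)] :=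
  measurable_append_singleton.comp (measurable_fst.prodMk
    (measurable_const.prodMk (P.measurable_measAt a j)))

theorem measurable_wavg {Ω : Type*} [MeasurableSpace Ω] {g : Ω → Hist A Z} {ξ : Ω → Noise K}
    {o : Ω → Outcome A Z K} (hg : Measurable g) (hξ : Measurable ξ)
    (hr : ∀ i, Measurable fun x => (o x).ret i) (hl : ∀ i, Measurable fun x => (o x).lik i)
    (d : ℕ) : Measurable fun x => P.wavg (g x) d (o x) (ξ x) := by
  unfold wavg
  have hp : ∀ i, Measurable fun x => (g x, particleNoise (ξ x) i) := fun i =>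
    hg.prodMk ((measurable_particleNoise i).comp hξ)
  have hw : ∀ i, Measurable fun x => ((P.wt (g x) (particleNoise (ξ x) i) : ℝ)) * (o x).lik i :=
    fun i => ((P.measurable_wt.comp (hp i)).coe_nnreal_real).mul (hl i)
  refine Measurable.div (Finset.measurable_sum _ fun i _ => (hw i).mul
    (((P.measurable_acc d).comp (hp i)).add (Measurable.mul ?_ (hr i))))
    (Finset.measurable_sum _ fun i _ => hw i)
  exact (measurable_from_top (f := fun n : ℕ => P.M.γ ^ (n - d))).comp (measurable_length.comp hg)

theorem measurable_run (k : ℕ) :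
    (∀ i, Measurable fun p : RunInput A Z K => (P.run k p.1 p.2.1 p.2.2).ret i) ∧
    (∀ i, Measurable fun p : RunInput A Z K => (P.run k p.1 p.2.1 p.2.2).lik i) ∧
    Measurable fun p : RunInput A Z K => (P.run k p.1 p.2.1 p.2.2).tree := by
  classical
  induction k with
  | zero => exact ⟨fun i => measurable_const, fun i => measurable_const, measurable_snd.fst⟩
  | succ k ih =>
    obtain ⟨ih1, ih2, ih3⟩ := ih
    have hroot : MeasurableSet {p : RunInput A Z K | [] ∈ p.2.1.nodes} :=
      measurable_snd.fst (SearchTree.measurableSet_mem_nodes [])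
    have hin : ∀ a j, Measurable fun p : RunInput A Z K =>
        ((p.1 ++ [(a, P.measAt p.1 p.2.1 a j p.2.2)], p.2.1.sub [(a, j)], p.2.2) :
          RunInput A Z K) := fun a j =>
      (P.measurable_snoc_measAt a j).prodMk (((SearchTree.measurable_sub _).comp
        measurable_snd.fst).prodMk measurable_snd.snd)
    -- The chosen action and branch take countably many values, so it suffices to treat each fixed
    -- pair.
    have hchoice : ∀ {β : Type} [MeasurableSpace β] (f : A → ℕ → RunInput A Z K → β),
        (∀ a j, Measurable (f a j)) → Measurable fun p : RunInput A Z K =>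
          f (P.pick p.1 p.2.1 p.2.2) (P.pickBranch p.1 p.2.1 (P.pick p.1 p.2.1 p.2.2) p.2.2) p :=
      fun f hf => measurable_of_countable_choice (f := fun a p => f a _ p) P.measurable_pick
        fun a => measurable_of_countable_choice (f := fun j p => f a j p)
          (P.measurable_pickBranch a) (hf a)
    have htree : Measurable fun p : RunInput A Z K =>
        P.stepAt k p.1 p.2.1 (P.pick p.1 p.2.1 p.2.2)
          (P.pickBranch p.1 p.2.1 (P.pick p.1 p.2.1 p.2.2) p.2.2) p.2.2 := by
      refine measurable_of_countable_choice (f := fun a (p : RunInput A Z K) =>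
        P.stepAt k p.1 p.2.1 a (P.pickBranch p.1 p.2.1 a p.2.2) p.2.2) P.measurable_pick
        fun a => measurable_of_countable_choice (f := fun j (p : RunInput A Z K) =>
          P.stepAt k p.1 p.2.1 a j p.2.2) (P.measurable_pickBranch a) fun j => ?_
      refine SearchTree.measurable_graft measurable_snd.fst (ih3.comp (hin a j))
        (P.measurable_branchesAt a j) ?_ a j
      refine measurable_of_countable_choice (c := fun p : RunInput A Z K => p.1.length)
        (f := fun d p => P.returnAt k p.1 d p.2.1 a j p.2.2)
        (measurable_length.comp measurable_fst) fun d => ?_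
      exact P.measurable_wavg (P.measurable_snoc_measAt a j) measurable_snd.snd
        (fun i => (ih1 i).comp (hin a j)) (fun i => (ih2 i).comp (hin a j)) d
    refine ⟨fun i => ?_, fun i => ?_, ?_⟩
    · have hf : ∀ a j, Measurable fun p : RunInput A Z K =>
          P.M.r (P.pos p.1 (particleNoise p.2.2 i)) a (P.nextPos p.1 a (particleNoise p.2.2 i)) +
            P.M.γ * (P.child k p.1 p.2.1 a j p.2.2).ret i := fun a j =>
        (P.measurable_reward.comp ((P.measurable_pos.comp (measurable_hist_noise i)).prodMk
          (measurable_const.prodMk ((P.measurable_nextPos a).comp (measurable_hist_noise i))))).add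
          (((ih1 i).comp (hin a j)).const_mul _)
      have hroll : Measurable fun p : RunInput A Z K => P.S.rollout K p.1.length
          (fun i => P.pos p.1 (particleNoise p.2.2 i))
          (fun i => (P.wt p.1 (particleNoise p.2.2 i) : ℝ)) (fun j => p.2.2 (.rollout j)) i := by
        refine measurable_of_countable_choice (c := fun p : RunInput A Z K => p.1.length)
          (f := fun d (p : RunInput A Z K) => P.S.rollout K d
            (fun i => P.pos p.1 (particleNoise p.2.2 i))
            (fun i => (P.wt p.1 (particleNoise p.2.2 i) : ℝ)) (fun j => p.2.2 (.rollout j)) i)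
          (measurable_length.comp measurable_fst) fun d => ?_
        have hm : Measurable fun p : RunInput A Z K =>
            ((fun i => P.pos p.1 (particleNoise p.2.2 i)),
              (fun i => (P.wt p.1 (particleNoise p.2.2 i) : ℝ)), fun j => p.2.2 (.rollout j)) :=
          (measurable_pi_lambda _ fun i => P.measurable_pos.comp
          (measurable_hist_noise i)).prodMk ((measurable_pi_lambda _ fun i =>
          (P.measurable_wt.comp (measurable_hist_noise i)).coe_nnreal_real).prodMk
          (measurable_pi_lambda _ fun j => (measurable_pi_apply _).comp measurable_snd.snd))
        exact (measurable_pi_apply i).comp ((P.S.measurable_rollout K d).comp hm)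
      refine measurable_of_cases hroot (hchoice _ hf) hroll (fun p hT => ?_) fun p hT => ?_
      · rw [(P.run_succ_aux k p.1 hT p.2.2 _ _ _ rfl rfl rfl).1]
      · rw [P.run_of_not_mem k p.1 (by exact hT)]
    · have hf : ∀ a j, Measurable fun p : RunInput A Z K =>
          (P.M.o (P.nextPos p.1 a (particleNoise p.2.2 i)) (P.measAt p.1 p.2.1 a j p.2.2) : ℝ) *
            (P.child k p.1 p.2.1 a j p.2.2).lik i := fun a j =>
        ((P.measurable_lik.comp (((P.measurable_nextPos a).comp (measurable_hist_noise i)).prodMk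
          (P.measurable_measAt a j))).coe_nnreal_real).mul ((ih2 i).comp (hin a j))
      refine measurable_of_cases hroot (hchoice _ hf) (measurable_const (a := (1 : ℝ)))
        (fun p hT => ?_) fun p hT => ?_
      · rw [(P.run_succ_aux k p.1 hT p.2.2 _ _ _ rfl rfl rfl).2.1]
      · rw [P.run_of_not_mem k p.1 (by exact hT)]
    · have hT : Measurable fun p : RunInput A Z K => p.2.1 := measurable_snd.fst
      have hexp : Measurable fun p : RunInput A Z K => p.2.1.expand [] := by
        refine SearchTree.measurable_mk_iff.2 ⟨fun q => ?_, fun q b =>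
          show Measurable fun p : RunInput A Z K => p.2.1.branches q b from
          (SearchTree.measurable_branches q b).comp hT, fun q b =>
          show Measurable fun p : RunInput A Z K => p.2.1.visits q b from
          (SearchTree.measurable_visits q b).comp hT, fun q b =>
          show Measurable fun p : RunInput A Z K => p.2.1.value q b from
          (SearchTree.measurable_value q b).comp hT⟩
        have : {p : RunInput A Z K | q ∈ (p.2.1.expand []).nodes} =
            {_p | q = []} ∪ {p | q ∈ p.2.1.nodes} := by
          ext p; simp [SearchTree.expand]
        rw [this]
        exact (MeasurableSet.const _).union
          (measurable_snd.fst (SearchTree.measurableSet_mem_nodes q))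
      refine measurable_of_cases hroot htree hexp (fun p hT => ?_) fun p hT => ?_
      · rw [P.run_tree_succ k p.1 hT]
      · rw [P.run_of_not_mem k p.1 (by exact hT)]

theorem measurable_returnAt (k d : ℕ) (a : A) (j : ℕ) :
    Measurable fun p : RunInput A Z K => P.returnAt k p.1 d p.2.1 a j p.2.2 := by
  have hin : Measurable fun p : RunInput A Z K =>
      ((p.1 ++ [(a, P.measAt p.1 p.2.1 a j p.2.2)], p.2.1.sub [(a, j)], p.2.2) :
        RunInput A Z K) :=
    (P.measurable_snoc_measAt a j).prodMk (((SearchTree.measurable_sub _).comp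
      measurable_snd.fst).prodMk measurable_snd.snd)
  exact P.measurable_wavg (P.measurable_snoc_measAt a j) measurable_snd.snd
    (fun i => ((P.measurable_run k).1 i).comp hin)
    (fun i => ((P.measurable_run k).2.1 i).comp hin) d

theorem measurable_wavg_run (k d : ℕ) :
    Measurable fun p : RunInput A Z K => P.wavg p.1 d (P.run k p.1 p.2.1 p.2.2) p.2.2 :=
  P.measurable_wavg measurable_fst measurable_snd.snd (P.measurable_run k).1
    (P.measurable_run k).2.1 d

/-- One episode of `k` steps, as a random map on pairs of a history and a tree. -/
def localStep (K k : ℕ) (q : Hist A Z × SearchTree A Z) (ξ : Noise K) :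
    Hist A Z × SearchTree A Z :=
  (q.1, (P.run k q.1 q.2 ξ).tree)

theorem measurable_localStep (k : ℕ) : Measurable (Function.uncurry (P.localStep K k)) :=
  measurable_fst.fst.prodMk ((P.measurable_run k).2.2.comp
    (measurable_fst.fst.prodMk (measurable_fst.snd.prodMk measurable_snd)))

end Run

end Planner

/-! ### Which random numbers a continuation reads. -/

section Congruence

variable {X A Z : Type*} [MeasurableSpace X] [MeasurableSpace Z] [Fintype A] [Nonempty A]

/-- The random numbers `ξ` and `ξ'` agree, except for the choices made at depths below `d`. -/
structure AgreeFrom {K : ℕ} (d : ℕ) (ξ ξ' : Noise K) : Prop where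
  start : ∀ i, ξ (.start i) = ξ' (.start i)
  move : ∀ e i, ξ (.move e i) = ξ' (.move e i)
  rollout : ∀ j, ξ (.rollout j) = ξ' (.rollout j)
  explore : ∀ e, d ≤ e → ξ (.explore e) = ξ' (.explore e)
  action : ∀ e, d ≤ e → ξ (.action e) = ξ' (.action e)
  spawn : ∀ e, d ≤ e → ξ (.spawn e) = ξ' (.spawn e)
  branch : ∀ e, d ≤ e → ξ (.branch e) = ξ' (.branch e)
  sample : ∀ e, d ≤ e → ξ (.sample e) = ξ' (.sample e)
  sense : ∀ e, d ≤ e → ξ (.sense e) = ξ' (.sense e)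

theorem AgreeFrom.mono {K : ℕ} {d d' : ℕ} {ξ ξ' : Noise K} (h : AgreeFrom d ξ ξ') (hd : d ≤ d') :
    AgreeFrom d' ξ ξ' :=
  ⟨h.start, h.move, h.rollout, fun e he => h.explore e (hd.trans he),
    fun e he => h.action e (hd.trans he), fun e he => h.spawn e (hd.trans he),
    fun e he => h.branch e (hd.trans he), fun e he => h.sample e (hd.trans he),
    fun e he => h.sense e (hd.trans he)⟩

theorem AgreeFrom.particleNoise {K : ℕ} {d : ℕ} {ξ ξ' : Noise K} (h : AgreeFrom d ξ ξ')
    (i : Fin (K + 1)) : particleNoise ξ i = particleNoise ξ' i := by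
  funext e
  cases e with
  | zero => exact h.start i
  | succ e => exact h.move e i

/-- A simulation that starts at depth `d` never looks at the choice seeds of smaller depths. This
makes the continuation below a fixed branch independent of the choice of that branch. -/
theorem simulate_congr {M : POMDP X A Z} (sim : Simulator M) (S : Settings X) (s : Steering A Z)
    (εa εz : ℝ) {K : ℕ} (k : ℕ) {d : ℕ} {ξ ξ' : Noise K} (hξ : AgreeFrom d ξ ξ')
    (T : SearchTree A Z) (h : Node A) (g : Hist A Z) (x : Fin (K + 1) → X)
    (w : Fin (K + 1) → ℝ) :
    simulate sim S s εa εz ξ k T h g d x w = simulate sim S s εa εz ξ' k T h g d x w := by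
  induction k generalizing d T h g x w with
  | zero => rfl
  | succ k ih =>
    simp only [simulate, hξ.explore d le_rfl, hξ.action d le_rfl, hξ.move, hξ.sample d le_rfl,
      hξ.sense d le_rfl, hξ.spawn d le_rfl, hξ.branch d le_rfl, hξ.rollout,
      ih (hξ.mono (Nat.le_succ d))]

theorem Planner.run_congr (P : Planner X A Z) {K : ℕ} (k : ℕ) (g : Hist A Z) (T : SearchTree A Z)
    {ξ ξ' : Noise K} (hξ : AgreeFrom g.length ξ ξ') : P.run k g T ξ = P.run k g T ξ' := by
  unfold Planner.run
  simp only [hξ.particleNoise]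
  exact simulate_congr _ _ _ _ _ k hξ T [] g _ _

end Congruence

/-! ### The law of the choices of one episode -/

section Independence

variable {E ι : Type*} [MeasurableSpace E] (S : Set ι) (μ : ι → Measure E)
  [∀ i, IsProbabilityMeasure (μ i)]

/-- The two invariance hypotheses say that `B` depends only on the coordinates in `S` and `Φ` only
on the others; after resampling by `mixOn` the integrand is a product over two independent copies.
-/
theorem lintegral_indicator_of_mixOn {B : Set (ι → E)} (hB : MeasurableSet B)
    (hB' : ∀ p, mixOn S p ∈ B ↔ p.1 ∈ B) {Φ : (ι → E) → ℝ≥0∞} (hΦ : Measurable Φ)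
    (hΦ' : ∀ p, Φ (mixOn S p) = Φ p.2) :
    ∫⁻ ξ, B.indicator Φ ξ ∂Measure.infinitePi μ =
      Measure.infinitePi μ B * ∫⁻ ξ, Φ ξ ∂Measure.infinitePi μ := by
  rw [← (measurePreserving_mixOn S μ).lintegral_comp (hΦ.indicator hB)]
  have : ∀ p, B.indicator Φ (mixOn S p) = B.indicator 1 p.1 * Φ p.2 := by
    intro p
    by_cases h : p.1 ∈ B
    · rw [Set.indicator_of_mem ((hB' p).2 h), Set.indicator_of_mem h, hΦ' p, Pi.one_apply, one_mul]
    · rw [Set.indicator_of_notMem (fun h' => h ((hB' p).1 h')), Set.indicator_of_notMem h, zero_mul]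
  simp_rw [this]
  rw [lintegral_prod_mul ((measurable_one.indicator hB).aemeasurable) hΦ.aemeasurable,
    lintegral_indicator_one hB]

theorem integral_indicator_of_mixOn {B : Set (ι → E)} (hB : MeasurableSet B)
    (hB' : ∀ p, mixOn S p ∈ B ↔ p.1 ∈ B) {Φ : (ι → E) → ℝ} (hΦ : Measurable Φ)
    (hΦ' : ∀ p, Φ (mixOn S p) = Φ p.2) :
    ∫ ξ, B.indicator Φ ξ ∂Measure.infinitePi μ =
      (Measure.infinitePi μ).real B * ∫ ξ, Φ ξ ∂Measure.infinitePi μ := by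
  have h1 := integral_map (measurable_mixOn S).aemeasurable
    (μ := (Measure.infinitePi μ).prod (Measure.infinitePi μ))
    (f := B.indicator Φ) (hΦ.indicator hB).aestronglyMeasurable
  rw [(measurePreserving_mixOn S μ).map_eq] at h1
  rw [h1]
  have : ∀ p, B.indicator Φ (mixOn S p) = B.indicator 1 p.1 * Φ p.2 := by
    intro p
    by_cases h : p.1 ∈ B
    · rw [Set.indicator_of_mem ((hB' p).2 h), Set.indicator_of_mem h, hΦ' p, Pi.one_apply, one_mul]
    · rw [Set.indicator_of_notMem (fun h' => h ((hB' p).1 h')), Set.indicator_of_notMem h, zero_mul]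
  simp_rw [this]
  rw [integral_prod_mul (fun ξ => B.indicator (1 : (ι → E) → ℝ) ξ) Φ, integral_indicator_one hB]

theorem measure_inter_of_mixOn {B C : Set (ι → E)} (hB : MeasurableSet B)
    (hB' : ∀ p, mixOn S p ∈ B ↔ p.1 ∈ B) (hC : MeasurableSet C)
    (hC' : ∀ p, mixOn S p ∈ C ↔ p.2 ∈ C) :
    Measure.infinitePi μ (B ∩ C) = Measure.infinitePi μ B * Measure.infinitePi μ C := by
  rw [← (measurePreserving_mixOn S μ).measure_preimage (hB.inter hC).nullMeasurableSet]
  have : mixOn S ⁻¹' (B ∩ C) = B ×ˢ C := by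
    ext p
    simp only [Set.mem_preimage, Set.mem_inter_iff, hB', hC', Set.mem_prod]
  rw [this, Measure.prod_prod]

end Independence

theorem volume_floor_mul_eq {n j : ℕ} (hj : j < n) :
    (volume : Measure unitInterval) {u | ⌊(u : ℝ) * n⌋₊ = j} = ENNReal.ofReal (1 / n) := by
  have hn : (0 : ℝ) < n := by exact_mod_cast (Nat.zero_le j).trans_lt hj
  have h0 : (j : ℝ) / n ∈ unitInterval :=
    ⟨by positivity, (div_le_one hn).2 (by exact_mod_cast hj.le)⟩
  have h1 : ((j : ℝ) + 1) / n ∈ unitInterval :=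
    ⟨by positivity, (div_le_one hn).2 (by exact_mod_cast hj)⟩
  have : {u : unitInterval | ⌊(u : ℝ) * n⌋₊ = j} =
      Set.Ico ⟨(j : ℝ) / n, h0⟩ ⟨((j : ℝ) + 1) / n, h1⟩ := by
    ext u
    simp only [Set.mem_ofPred_eq, Set.mem_Ico, ← Subtype.coe_le_coe, ← Subtype.coe_lt_coe]
    rw [Nat.floor_eq_iff (mul_nonneg u.2.1 hn.le), div_le_iff₀ hn, lt_div_iff₀ hn]
  rw [this, unitInterval.volume_Ico]
  congr 1
  field_simp
  ring

/-- The probability that the branch `j` is selected among `n` branches. -/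
def branchProb (εz : ℝ) (n j : ℕ) : ℝ :=
  if j < n then (1 - ((n : ℝ) + 1) ^ εz) / n else ((n : ℝ) + 1) ^ εz

theorem spawnProb_mem {εz : ℝ} (h : εz < 0) (n : ℕ) :
    ((n : ℝ) + 1) ^ εz ∈ Set.Icc (0 : ℝ) 1 :=
  ⟨by positivity, Real.rpow_le_one_of_one_le_of_nonpos (by linarith [(Nat.cast_nonneg n : (0:ℝ) ≤ n)]) h.le⟩

theorem branchProb_nonneg {εz : ℝ} (h : εz < 0) (n j : ℕ) : 0 ≤ branchProb εz n j := by
  have := spawnProb_mem h n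
  unfold branchProb
  split_ifs
  · exact div_nonneg (by linarith [this.2]) (Nat.cast_nonneg n)
  · exact this.1

theorem volume_branchIndex {εz : ℝ} (hεz : εz < 0) {n j : ℕ} (hj : j ≤ n) :
    ((volume : Measure unitInterval).prod volume) {p | branchIndex εz n p.1 p.2 = j} =
      ENNReal.ofReal (branchProb εz n j) := by
  obtain ⟨hq0, hq1⟩ := spawnProb_mem hεz n
  set q := ((n : ℝ) + 1) ^ εz with hq
  have hlt : MeasurableSet {u : unitInterval | (u : ℝ) < q} :=
    measurableSet_lt measurable_subtype_coe measurable_const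
  have hvlt : (volume : Measure unitInterval) {u : unitInterval | (u : ℝ) < q} = ENNReal.ofReal q := by
    have : {u : unitInterval | (u : ℝ) < q} = Set.Iio ⟨q, hq0, hq1⟩ := by
      ext u; simp [← Subtype.coe_lt_coe]
    rw [this, unitInterval.volume_Iio]
  by_cases hjn : j < n
  · have : {p : unitInterval × unitInterval | branchIndex εz n p.1 p.2 = j} =
        {u : unitInterval | (u : ℝ) < q}ᶜ ×ˢ {u : unitInterval | ⌊(u : ℝ) * n⌋₊ = j} := by
      ext p
      simp only [branchIndex, Set.mem_ofPred_eq, Set.mem_prod, Set.mem_compl_iff, ← hq]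
      split_ifs with h
      · simp [h]; omega
      · simp [h]
    rw [this, Measure.prod_prod, prob_compl_eq_one_sub hlt, hvlt, volume_floor_mul_eq hjn,
      branchProb, if_pos hjn, ← hq, ← ENNReal.ofReal_one, ← ENNReal.ofReal_sub _ hq0,
      ← ENNReal.ofReal_mul (by linarith)]
    congr 1
    ring
  · obtain rfl : j = n := by omega
    -- A new branch also results if the rounding reaches `n`, which happens only at the endpoint `1`
    -- when `n` is positive, a null set. If there are no branches, the spawn probability is `1`.
    have hae : {p : unitInterval × unitInterval | branchIndex εz j p.1 p.2 = j} =ᵐ[(volume : Measure unitInterval).prod volume]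
        {u : unitInterval | (u : ℝ) < q} ×ˢ (Set.univ : Set unitInterval) := by
      have h1 : ∀ᵐ p : unitInterval × unitInterval ∂(volume.prod volume), p.1 ≠ (1 : unitInterval) ∧
          p.2 ≠ (1 : unitInterval) := by
        have hs : ∀ᵐ u ∂(volume : Measure unitInterval), u ≠ 1 := by
          rw [ae_iff]; simp
        exact (Measure.quasiMeasurePreserving_fst.ae hs).and
          (Measure.quasiMeasurePreserving_snd.ae hs)
      filter_upwards [h1] with p hp
      have e1 : (p.1 : ℝ) < 1 := lt_of_le_of_ne p.1.2.2 fun h => hp.1 (Subtype.ext h)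
      have e2 : (p.2 : ℝ) < 1 := lt_of_le_of_ne p.2.2.2 fun h => hp.2 (Subtype.ext h)
      apply propext
      change p ∈ {p : unitInterval × unitInterval | branchIndex εz j p.1 p.2 = j} ↔
        p ∈ {u : unitInterval | (u : ℝ) < q} ×ˢ (Set.univ : Set unitInterval)
      simp only [branchIndex, Set.mem_ofPred_eq, Set.mem_prod, Set.mem_univ, and_true, ← hq]
      split_ifs with h
      · simp [h]
      · simp only [h, iff_false]
        rcases Nat.eq_zero_or_pos j with rfl | hpos
        · exact absurd (by simpa [hq] using e1) h
        · refine (Nat.floor_lt (mul_nonneg p.2.2.1 (Nat.cast_nonneg j))).2 ?_ |>.ne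
          have : (0 : ℝ) < j := by exact_mod_cast hpos
          nlinarith
    rw [measure_congr hae, Measure.prod_prod, hvlt, measure_univ, mul_one, branchProb,
      if_neg (lt_irrefl j)]

/-! ### The law of the action choice. -/

section Actions

variable {A : Type*} [Fintype A] [Nonempty A]

theorem volume_uniformAction (a : A) :
    (volume : Measure unitInterval) {u | uniformAction u = a} =
      ENNReal.ofReal (1 / Fintype.card A) := by
  have hc : 0 < Fintype.card A := Fintype.card_pos
  rw [← volume_floor_mul_eq (Fintype.equivFin A a).2]
  refine measure_congr ?_
  have hs : ∀ᵐ u ∂(volume : Measure unitInterval), u ≠ 1 := by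
    rw [ae_iff]; simp
  filter_upwards [hs] with u hu
  have e1 : (u : ℝ) < 1 := lt_of_le_of_ne u.2.2 fun h => hu (Subtype.ext h)
  apply propext
  change u ∈ {u | uniformAction u = a} ↔ u ∈ {u : unitInterval |
    ⌊(u : ℝ) * (Fintype.card A : ℕ)⌋₊ = (Fintype.equivFin A a : ℕ)}
  simp only [Set.mem_ofPred_eq, uniformAction, Equiv.symm_apply_eq, Fin.ext_iff]
  have h2 : ⌊(u : ℝ) * (Fintype.card A : ℕ)⌋₊ < Fintype.card A := by
    refine (Nat.floor_lt (mul_nonneg u.2.1 (Nat.cast_nonneg _))).2 ?_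
    have : (0 : ℝ) < Fintype.card A := by exact_mod_cast hc
    nlinarith
  rw [min_eq_left (by omega)]

theorem epsGreedy_ge {εa : ℝ} (h1 : εa ≤ 1) (v : A → ℝ) (a : A) :
    εa / Fintype.card A ≤ epsGreedy εa v a := by
  unfold epsGreedy
  have : 0 ≤ (1 - εa) * (open Classical in if a = greedy v then (1 : ℝ) else 0) :=
    mul_nonneg (by linarith) (by split_ifs <;> norm_num)
  linarith

theorem epsGreedy_nonneg {εa : ℝ} (h0 : 0 ≤ εa) (h1 : εa ≤ 1) (v : A → ℝ) (a : A) :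
    0 ≤ epsGreedy εa v a := (by positivity : 0 ≤ εa / Fintype.card A).trans (epsGreedy_ge h1 v a)

theorem sum_epsGreedy (εa : ℝ) (v : A → ℝ) : ∑ a, epsGreedy εa v a = 1 := by
  classical
  have hc : (Fintype.card A : ℝ) ≠ 0 := by exact_mod_cast Fintype.card_ne_zero
  simp only [epsGreedy, Finset.sum_add_distrib, ← Finset.mul_sum]
  rw [Finset.sum_const, Finset.card_univ, nsmul_eq_mul]
  have : ∑ i, (if i = greedy v then (1 : ℝ) else 0) = 1 := by simp
  rw [show (∑ i, open Classical in if i = greedy v then (1 : ℝ) else 0) = 1 by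
    convert this, mul_one]
  field_simp
  ring

theorem sum_epsGreedy_mul (εa : ℝ) (v f : A → ℝ) : ∑ a, epsGreedy εa v a * f a =
    (1 - εa) * f (greedy v) + εa / Fintype.card A * ∑ a, f a := by
  classical
  simp only [epsGreedy, add_mul, Finset.sum_add_distrib, ← Finset.mul_sum, mul_assoc]
  congr 2
  rw [Finset.sum_eq_single (greedy v)]
  · simp
  · intro b _ hb; simp [hb]
  · simp

theorem volume_selectAction {εa : ℝ} (h0 : 0 ≤ εa) (h1 : εa ≤ 1) (v : A → ℝ) (a : A) :
    ((volume : Measure unitInterval).prod volume) {p | selectAction εa v p.1 p.2 = a} =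
      ENNReal.ofReal (epsGreedy εa v a) := by
  classical
  have hIoi : {u : unitInterval | εa < (u : ℝ)} = Set.Ioi ⟨εa, h0, h1⟩ := by
    ext u; simp [← Subtype.coe_lt_coe]
  have hIic : {u : unitInterval | εa < (u : ℝ)}ᶜ = Set.Iic ⟨εa, h0, h1⟩ := by
    ext u; simp [← Subtype.coe_le_coe]
  have : {p : unitInterval × unitInterval | selectAction εa v p.1 p.2 = a} =
      ({u : unitInterval | εa < (u : ℝ)} ×ˢ {_u : unitInterval | a = greedy v}) ∪
      ({u : unitInterval | εa < (u : ℝ)}ᶜ ×ˢ {u | uniformAction u = a}) := by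
    ext p
    simp only [selectAction, Set.mem_ofPred_eq, Set.mem_union, Set.mem_prod, Set.mem_compl_iff]
    split_ifs with h
    · simp [h, eq_comm]
    · simp [h]
  have hd : Disjoint ({u : unitInterval | εa < (u : ℝ)} ×ˢ {_u : unitInterval | a = greedy v})
      ({u : unitInterval | εa < (u : ℝ)}ᶜ ×ˢ {u | uniformAction u = a}) :=
    Set.disjoint_left.2 fun p h h' => h'.1 h.1
  have hm : MeasurableSet ({u : unitInterval | εa < (u : ℝ)} ×ˢ {_u : unitInterval | a = greedy v}) :=
    (measurableSet_lt measurable_const measurable_subtype_coe).prod (MeasurableSet.const _)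
  rw [this, measure_union' hd hm, Measure.prod_prod, Measure.prod_prod, volume_uniformAction, hIic,
    hIoi, unitInterval.volume_Ioi, unitInterval.volume_Iic, epsGreedy, ENNReal.ofReal_add,
    ENNReal.ofReal_mul (by linarith)]
  · congr 1
    · congr 1
      by_cases h : a = greedy v <;> simp [h]
    · rw [← ENNReal.ofReal_mul h0]
      congr 1
      simp [div_eq_mul_inv]
  · exact mul_nonneg (by linarith) (by split_ifs <;> norm_num)
  · positivity

end Actions

/-- The random numbers on which the choices of the action and the branch at depth `d` depend. -/
def choiceSeeds (K d : ℕ) : Set (Seed K) := {.explore d, .action d, .spawn d, .branch d}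

/-- Resampling the four choice seeds of depth `d` is invisible to the samples and to everything
simulated from depth `d + 1` on. -/
theorem agreeFrom_mixOn {K d : ℕ} (p : Noise K × Noise K) :
    AgreeFrom (d + 1) (mixOn (choiceSeeds K d) p) p.2 := by
  have hne : ∀ e, d + 1 ≤ e → e ≠ d := fun e he => by omega
  constructor
  case start => intro i; simp [mixOn, choiceSeeds]
  case move => intro e i; simp [mixOn, choiceSeeds]
  case rollout => intro j; simp [mixOn, choiceSeeds]
  all_goals intro e he; simp [mixOn, choiceSeeds, hne e he]

namespace Planner

variable {X A Z : Type*} [MeasurableSpace X] [MeasurableSpace Z] [Fintype A] [Nonempty A]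
  [MeasurableSpace A] [DiscreteMeasurableSpace A] (P : Planner X A Z) {K : ℕ}

theorem newMeas_mixOn (g : Hist A Z) (a : A) (p : Noise K × Noise K) :
    P.newMeas g a (mixOn (choiceSeeds K g.length) p) = P.newMeas g a p.2 := by
  have h1 : ∀ i, particleNoise (mixOn (choiceSeeds K g.length) p) i = particleNoise p.2 i :=
    fun i => (agreeFrom_mixOn p).particleNoise i
  have h2 : mixOn (choiceSeeds K g.length) p (.sample g.length) = p.2 (.sample g.length) := by
    simp [mixOn, choiceSeeds]
  have h3 : mixOn (choiceSeeds K g.length) p (.sense g.length) = p.2 (.sense g.length) := by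
    simp [mixOn, choiceSeeds]
  simp only [newMeas, h1, h2, h3]

theorem measAt_mixOn (g : Hist A Z) (T : SearchTree A Z) (a : A) (j : ℕ) (p : Noise K × Noise K) :
    P.measAt g T a j (mixOn (choiceSeeds K g.length) p) = P.measAt g T a j p.2 := by
  simp only [measAt, newMeas_mixOn]

theorem child_mixOn (k : ℕ) (g : Hist A Z) (T : SearchTree A Z) (a : A) (j : ℕ)
    (p : Noise K × Noise K) :
    P.child k g T a j (mixOn (choiceSeeds K g.length) p) = P.child k g T a j p.2 := by
  rw [child, measAt_mixOn, child]
  refine P.run_congr k _ _ ?_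
  rw [List.length_append, List.length_singleton]
  exact agreeFrom_mixOn p

theorem returnAt_mixOn (k : ℕ) (g : Hist A Z) (d : ℕ) (T : SearchTree A Z) (a : A) (j : ℕ)
    (p : Noise K × Noise K) :
    P.returnAt k g d T a j (mixOn (choiceSeeds K g.length) p) = P.returnAt k g d T a j p.2 := by
  simp only [returnAt, measAt_mixOn, child_mixOn, wavg, (agreeFrom_mixOn p).particleNoise]

theorem stepAt_mixOn (k : ℕ) (g : Hist A Z) (T : SearchTree A Z) (a : A) (j : ℕ)
    (p : Noise K × Noise K) :
    P.stepAt k g T a j (mixOn (choiceSeeds K g.length) p) = P.stepAt k g T a j p.2 := by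
  simp only [stepAt, child_mixOn, returnAt_mixOn, branchesAt, newMeas_mixOn]

/-- The event that the action `a` and its branch `j` are chosen. -/
def choiceEvent (g : Hist A Z) (T : SearchTree A Z) (a : A) (j : ℕ) : Set (Noise K) :=
  {ξ | P.pick g T ξ = a ∧ P.pickBranch g T a ξ = j}

theorem measurableSet_choiceEvent (g : Hist A Z) (T : SearchTree A Z) (a : A) (j : ℕ) :
    MeasurableSet (P.choiceEvent (K := K) g T a j) := by
  have hin : Measurable fun ξ : Noise K => ((g, T, ξ) : RunInput A Z K) :=
    measurable_const.prodMk (measurable_const.prodMk measurable_id)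
  exact ((P.measurable_pick.comp hin) (measurableSet_singleton a)).inter
    (((P.measurable_pickBranch a).comp hin) (measurableSet_singleton j))

theorem mixOn_mem_choiceEvent (g : Hist A Z) (T : SearchTree A Z) (a : A) (j : ℕ)
    (p : Noise K × Noise K) : mixOn (choiceSeeds K g.length) p ∈ P.choiceEvent g T a j ↔
      p.1 ∈ P.choiceEvent g T a j := by
  simp [choiceEvent, pick, pickBranch, mixOn, choiceSeeds]

theorem measurable_event_mixOn_pair (s s' : Seed K) {B : Set (unitInterval × unitInterval)}
    (hB : MeasurableSet B) : MeasurableSet {ξ : Noise K | (ξ s, ξ s') ∈ B} :=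
  ((measurable_pi_apply s).prodMk (measurable_pi_apply s')) hB

theorem noiseLaw_pair {s s' : Seed K} (h : s ≠ s') {B : Set (unitInterval × unitInterval)}
    (hB : MeasurableSet B) :
    noiseLaw K {ξ : Noise K | (ξ s, ξ s') ∈ B} = ((volume : Measure unitInterval).prod volume) B := by
  have := Measure.infinitePi_map_eval_prod (P := fun _ : Seed K => (volume : Measure unitInterval)) h
  rw [← this, Measure.map_apply ((measurable_pi_apply s).prodMk (measurable_pi_apply s')) hB]
  rfl

/-- The action and the branch are determined by two disjoint pairs of seeds, so the probabilities
multiply. -/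
theorem noiseLaw_choiceEvent (g : Hist A Z) (T : SearchTree A Z) (a : A) {j : ℕ}
    (hj : j ≤ (T.branches [] a).length) :
    noiseLaw K (P.choiceEvent g T a j) =
      ENNReal.ofReal (epsGreedy P.εa (steeringValues P.s T [] g) a) *
        ENNReal.ofReal (branchProb P.εz (T.branches [] a).length j) := by
  set B1 : Set (unitInterval × unitInterval) :=
    {p | selectAction P.εa (steeringValues P.s T [] g) p.1 p.2 = a} with hB1
  set B2 : Set (unitInterval × unitInterval) :=
    {p | branchIndex P.εz (T.branches [] a).length p.1 p.2 = j} with hB2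
  have m1 : MeasurableSet B1 :=
    ((measurable_selectAction P.εa).comp measurable_prodMk_left) (measurableSet_singleton a)
  have m2 : MeasurableSet B2 :=
    ((measurable_branchIndex P.εz).comp measurable_prodMk_left) (measurableSet_singleton j)
  have hset : P.choiceEvent (K := K) g T a j =
      {ξ | (ξ (.explore g.length), ξ (.action g.length)) ∈ B1} ∩
        {ξ | (ξ (.spawn g.length), ξ (.branch g.length)) ∈ B2} := by
    ext ξ; rfl
  rw [hset, noiseLaw, measure_inter_of_mixOn {Seed.explore g.length, Seed.action g.length} _
    (measurable_event_mixOn_pair _ _ m1) (fun p => by simp [mixOn])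
    (measurable_event_mixOn_pair _ _ m2) (fun p => by simp [mixOn]), ← noiseLaw,
    noiseLaw_pair (by simp) m1, noiseLaw_pair (by simp) m2,
    volume_selectAction P.εa_pos.le P.εa_lt.le, volume_branchIndex P.εz_neg hj]

/-- Exactly one pair of an action and a branch is chosen, and the branch index never exceeds the
number of branches. In each summand `a` and `j` are constants, so the choice event and the
functional can be separated by independence. -/
theorem sum_choice_indicator {M : Type*} [AddCommMonoid M] (g : Hist A Z) (T : SearchTree A Z)
    (Φ : A → ℕ → Noise K → M) (ξ : Noise K) :
    Φ (P.pick g T ξ) (P.pickBranch g T (P.pick g T ξ) ξ) ξ =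
      ∑ a, ∑ j ∈ Finset.range ((T.branches [] a).length + 1),
        (P.choiceEvent g T a j).indicator (Φ a j) ξ := by
  rw [Finset.sum_eq_single (P.pick g T ξ), Finset.sum_eq_single (P.pickBranch g T (P.pick g T ξ) ξ)]
  · rw [Set.indicator_of_mem (show ξ ∈ P.choiceEvent g T _ _ from ⟨rfl, rfl⟩)]
  · intro j _ hj
    exact Set.indicator_of_notMem (fun h => hj h.2.symm) _
  · intro h
    exact absurd (Finset.mem_range.2 (Nat.lt_succ_of_le (branchIndex_le _ _ _ _))) h
  · intro b _ hb
    exact Finset.sum_eq_zero fun j _ => Set.indicator_of_notMem (fun h => hb h.1.symm) _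
  · simp

/-- The expectation of a functional of an episode, conditionally on its first choices. -/
theorem lintegral_choice (g : Hist A Z) (T : SearchTree A Z) {Φ : A → ℕ → Noise K → ℝ≥0∞}
    (hΦ : ∀ a j, Measurable (Φ a j))
    (hinv : ∀ a j p, Φ a j (mixOn (choiceSeeds K g.length) p) = Φ a j p.2) :
    ∫⁻ ξ, Φ (P.pick g T ξ) (P.pickBranch g T (P.pick g T ξ) ξ) ξ ∂noiseLaw K =
      ∑ a, ENNReal.ofReal (epsGreedy P.εa (steeringValues P.s T [] g) a) *
        ∑ j ∈ Finset.range ((T.branches [] a).length + 1),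
          ENNReal.ofReal (branchProb P.εz (T.branches [] a).length j) * ∫⁻ ξ, Φ a j ξ ∂noiseLaw K := by
  simp_rw [P.sum_choice_indicator g T Φ]
  rw [lintegral_finsetSum _ fun a _ => Finset.measurable_sum _ fun j _ =>
    (hΦ a j).indicator (P.measurableSet_choiceEvent g T a j)]
  refine Finset.sum_congr rfl fun a _ => ?_
  rw [lintegral_finsetSum _ fun j _ => (hΦ a j).indicator (P.measurableSet_choiceEvent g T a j),
    Finset.mul_sum]
  refine Finset.sum_congr rfl fun j hj => ?_
  rw [noiseLaw, lintegral_indicator_of_mixOn (choiceSeeds K g.length) _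
    (P.measurableSet_choiceEvent g T a j) (P.mixOn_mem_choiceEvent g T a j) (hΦ a j) (hinv a j),
    ← noiseLaw, P.noiseLaw_choiceEvent g T a (Nat.lt_succ_iff.1 (Finset.mem_range.1 hj)), mul_assoc]

theorem integral_choice (g : Hist A Z) (T : SearchTree A Z) {Φ : A → ℕ → Noise K → ℝ}
    (hΦ : ∀ a j, Measurable (Φ a j)) {C : ℝ} (hC : ∀ a j ξ, |Φ a j ξ| ≤ C)
    (hinv : ∀ a j p, Φ a j (mixOn (choiceSeeds K g.length) p) = Φ a j p.2) :
    ∫ ξ, Φ (P.pick g T ξ) (P.pickBranch g T (P.pick g T ξ) ξ) ξ ∂noiseLaw K =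
      ∑ a, epsGreedy P.εa (steeringValues P.s T [] g) a *
        ∑ j ∈ Finset.range ((T.branches [] a).length + 1),
          branchProb P.εz (T.branches [] a).length j * ∫ ξ, Φ a j ξ ∂noiseLaw K := by
  have hint : ∀ a j, Integrable ((P.choiceEvent (K := K) g T a j).indicator (Φ a j)) (noiseLaw K) :=
    fun a j => (Integrable.of_bound (hΦ a j).aestronglyMeasurable C
      (Eventually.of_forall fun ξ => hC a j ξ)).indicator (P.measurableSet_choiceEvent g T a j)
  simp_rw [P.sum_choice_indicator g T Φ]
  rw [integral_finsetSum _ fun a _ => integrable_finsetSum _ fun j _ => hint a j]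
  refine Finset.sum_congr rfl fun a _ => ?_
  rw [integral_finsetSum _ fun j _ => hint a j, Finset.mul_sum]
  refine Finset.sum_congr rfl fun j hj => ?_
  rw [noiseLaw, integral_indicator_of_mixOn (choiceSeeds K g.length) _
    (P.measurableSet_choiceEvent g T a j) (P.mixOn_mem_choiceEvent g T a j) (hΦ a j) (hinv a j),
    ← noiseLaw, Measure.real,
    P.noiseLaw_choiceEvent g T a (Nat.lt_succ_iff.1 (Finset.mem_range.1 hj)),
    ENNReal.toReal_mul, ENNReal.toReal_ofReal (epsGreedy_nonneg P.εa_pos.le P.εa_lt.le _ _),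
    ENNReal.toReal_ofReal (branchProb_nonneg P.εz_neg _ _), mul_assoc]

end Planner

/-! ### Self-normalised importance sampling -/

/-- The law of the random numbers of one sample. -/
def particleLaw : Measure (ℕ → unitInterval) :=
  Measure.infinitePi fun _ : ℕ => (volume : Measure unitInterval)

instance : IsProbabilityMeasure particleLaw := by unfold particleLaw; infer_instance

/-- The seeds of the samples. -/
def particleSeed {K : ℕ} (p : Fin (K + 1) × ℕ) : Seed K :=
  match p.2 with
  | 0 => .start p.1
  | e + 1 => .move e p.1

theorem particleSeed_injective {K : ℕ} : Function.Injective (particleSeed (K := K)) := by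
  rintro ⟨i, e⟩ ⟨i', e'⟩ h
  cases e <;> cases e' <;> simp_all [particleSeed]

/-- The seeds of the samples are an injectively indexed subfamily of independent uniform seeds,
hence the noises of different samples are independent with the common law `particleLaw`. -/
theorem map_particleNoise (K : ℕ) :
    (noiseLaw K).map (fun ξ (i : Fin (K + 1)) => particleNoise ξ i) =
      Measure.infinitePi fun _ : Fin (K + 1) => particleLaw := by
  have h1 := Measure.map_infinitePi_infinitePi_of_inj
    (P := fun _ : Seed K => (volume : Measure unitInterval)) particleSeed_injective
  have h2 := Measure.infinitePi_map_curry (ι := Fin (K + 1)) (κ := ℕ)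
    (X := unitInterval) fun _ _ => (volume : Measure unitInterval)
  have hm : Measurable fun (ξ : Noise K) (p : Fin (K + 1) × ℕ) => ξ (particleSeed p) :=
    measurable_pi_lambda _ fun p => measurable_pi_apply _
  rw [← h1, Measure.map_map (by fun_prop) hm] at h2
  unfold particleLaw
  rw [← h2]
  congr 1
  funext ξ i e
  cases e <;> rfl

theorem map_samples (K : ℕ) :
    (seqLaw particleLaw).map (fun U (i : Fin (K + 1)) => U i) =
      Measure.infinitePi fun _ : Fin (K + 1) => particleLaw :=
  Measure.map_infinitePi_infinitePi_of_inj (P := fun _ : ℕ => particleLaw) Fin.val_injective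

/-- For every `K` the samples may be taken as the first `K + 1` terms of one infinite sequence. This
puts all `K` on one probability space, where almost sure convergence in `K` makes sense. -/
theorem integral_particles {K : ℕ} {f : (Fin (K + 1) → ℕ → unitInterval) → ℝ} (hf : Measurable f) :
    ∫ ξ, f (fun i => particleNoise ξ i) ∂noiseLaw K =
      ∫ U, f (fun i => U i) ∂seqLaw particleLaw := by
  have h1 := integral_map (μ := noiseLaw K) (f := f)
    (φ := fun ξ (i : Fin (K + 1)) => particleNoise ξ i)
    (measurable_pi_lambda _ fun i => measurable_particleNoise i).aemeasurable
    hf.aestronglyMeasurable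
  have h2 := integral_map (μ := seqLaw particleLaw) (f := f)
    (φ := fun U (i : Fin (K + 1)) => U i)
    (measurable_pi_lambda _ fun i => measurable_pi_apply _).aemeasurable
    hf.aestronglyMeasurable
  rw [← h1, ← h2, map_particleNoise, map_samples]

theorem ae_tendsto_sample_mean {f : (ℕ → unitInterval) → ℝ} (hf : Measurable f)
    (hint : Integrable f particleLaw) :
    ∀ᵐ U ∂seqLaw particleLaw, Tendsto (fun K : ℕ => (∑ i : Fin (K + 1), f (U i)) / ((K : ℝ) + 1))
      atTop (𝓝 (∫ u, f u ∂particleLaw)) := by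
  have hev : ∀ i : ℕ, MeasurePreserving (fun U : ℕ → ℕ → unitInterval => U i)
      (seqLaw particleLaw) particleLaw := fun i =>
    measurePreserving_eval_infinitePi (fun _ : ℕ => particleLaw) i
  have hmean : ∫ U, f (U 0) ∂seqLaw particleLaw = ∫ u, f u ∂particleLaw := by
    have h := integral_map (μ := seqLaw particleLaw) (hev 0).aemeasurable (f := f)
      hf.aestronglyMeasurable
    rw [(hev 0).map_eq] at h
    exact h.symm
  have h := strong_law_ae_real (μ := seqLaw particleLaw) (fun i U => f (U i))
    ((hev 0).integrable_comp_of_integrable hint)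
    (fun i j hij => (iIndepFun_infinitePi (P := fun _ : ℕ => particleLaw)
      (X := fun _ => f) fun _ => hf).indepFun hij)
    (fun i => ⟨(hf.comp (hev i).measurable).aemeasurable, (hf.comp (hev 0).measurable).aemeasurable,
      by
        change Measure.map (f ∘ fun U : ℕ → ℕ → unitInterval => U i) _ =
          Measure.map (f ∘ fun U : ℕ → ℕ → unitInterval => U 0) _
        rw [← Measure.map_map hf (hev i).measurable, ← Measure.map_map hf (hev 0).measurable,
          (hev i).map_eq, (hev 0).map_eq]⟩)
  filter_upwards [h] with U hU
  rw [hmean] at hU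
  have := hU.comp (tendsto_add_atTop_nat 1)
  refine this.congr fun K => ?_
  simp only [Function.comp]
  rw [Finset.sum_range]
  push_cast
  rfl

/-- The weighted average of `F` over `K + 1` samples. -/
def snis {K : ℕ} (w : (ℕ → unitInterval) → ℝ≥0) (F : (ℕ → unitInterval) → ℝ)
    (U : Fin (K + 1) → ℕ → unitInterval) : ℝ :=
  (∑ i, (w (U i) : ℝ) * F (U i)) / ∑ i, (w (U i) : ℝ)

/-- A convex combination stays within the bound. If all weights vanish the quotient is `0 / 0 = 0`,
which is why `0 ≤ C` is required. -/
theorem abs_weighted_avg_le {ι : Type*} (s : Finset ι) {w f : ι → ℝ} (hw : ∀ i, 0 ≤ w i) {C : ℝ}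
    (hf : ∀ i, |f i| ≤ C) (hC : 0 ≤ C) : |(∑ i ∈ s, w i * f i) / ∑ i ∈ s, w i| ≤ C := by
  rw [abs_div, abs_of_nonneg (Finset.sum_nonneg fun i _ => hw i)]
  refine div_le_of_le_mul₀ (Finset.sum_nonneg fun i _ => hw i) hC ?_
  refine (Finset.abs_sum_le_sum_abs _ _).trans ?_
  rw [Finset.mul_sum]
  refine Finset.sum_le_sum fun i _ => ?_
  rw [abs_mul, abs_of_nonneg (hw i), mul_comm]
  exact mul_le_mul_of_nonneg_right (hf i) (hw i)

theorem measurable_snis {K : ℕ} {w : (ℕ → unitInterval) → ℝ≥0} (hw : Measurable w)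
    {F : (ℕ → unitInterval) → ℝ} (hF : Measurable F) : Measurable (snis (K := K) w F) := by
  have h1 : ∀ i : Fin (K + 1), Measurable fun U : Fin (K + 1) → ℕ → unitInterval => (w (U i) : ℝ) :=
    fun i => (hw.comp (measurable_pi_apply i)).coe_nnreal_real
  exact (Finset.measurable_sum _ fun i _ => (h1 i).mul (hF.comp (measurable_pi_apply i))).div
    (Finset.measurable_sum _ fun i _ => h1 i)

/-- The strong law for the numerator and for the denominator; the factors `K + 1` cancel, and
positive total mass keeps the limit of the denominator away from `0`. Only integrability of the
weights is needed, as `F` is bounded. -/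
theorem ae_tendsto_snis {w : (ℕ → unitInterval) → ℝ≥0} (hw : Measurable w)
    (hint : Integrable (fun u => (w u : ℝ)) particleLaw) (hpos : 0 < ∫ u, (w u : ℝ) ∂particleLaw)
    {F : (ℕ → unitInterval) → ℝ} (hF : Measurable F) {C : ℝ} (hC : ∀ u, |F u| ≤ C) :
    ∀ᵐ U ∂seqLaw particleLaw, Tendsto (fun K : ℕ => snis w F fun i : Fin (K + 1) => U i) atTop
      (𝓝 ((∫ u, w u * F u ∂particleLaw) / ∫ u, (w u : ℝ) ∂particleLaw)) := by
  have hint' : Integrable (fun u => (w u : ℝ) * F u) particleLaw :=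
    hint.mul_bdd (c := C) hF.aestronglyMeasurable (Eventually.of_forall fun u => hC u)
  filter_upwards [ae_tendsto_sample_mean (hw.coe_nnreal_real.mul hF) hint',
    ae_tendsto_sample_mean hw.coe_nnreal_real hint] with U h1 h2
  refine (h1.div h2 hpos.ne').congr fun K => ?_
  have : ((K : ℝ) + 1) ≠ 0 := by positivity
  simp only [snis, Pi.div_apply]
  rw [div_div_div_cancel_right₀ this]
  rfl

theorem tendsto_integral_snis {w : (ℕ → unitInterval) → ℝ≥0} (hw : Measurable w)
    (hint : Integrable (fun u => (w u : ℝ)) particleLaw) (hpos : 0 < ∫ u, (w u : ℝ) ∂particleLaw)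
    {F : (ℕ → unitInterval) → ℝ} (hF : Measurable F) {C : ℝ} (hC : ∀ u, |F u| ≤ C) :
    Tendsto (fun K : ℕ => ∫ ξ, snis w F (fun i => particleNoise ξ i) ∂noiseLaw K) atTop
      (𝓝 ((∫ u, w u * F u ∂particleLaw) / ∫ u, (w u : ℝ) ∂particleLaw)) := by
  simp_rw [integral_particles (measurable_snis hw hF)]
  have hC0 : 0 ≤ C := (abs_nonneg _).trans (hC fun _ => 0)
  have h := tendsto_integral_of_dominated_convergence (μ := seqLaw particleLaw) (fun _ => C)
    (F := fun (K : ℕ) U => snis w F fun i : Fin (K + 1) => U i)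
    (f := fun _ => (∫ u, w u * F u ∂particleLaw) / ∫ u, (w u : ℝ) ∂particleLaw)
    (fun K => ((measurable_snis hw hF).comp (measurable_pi_lambda _ fun i =>
      measurable_pi_apply _)).aestronglyMeasurable) (integrable_const C)
    (fun K => Eventually.of_forall fun U => by
      rw [Real.norm_eq_abs]
      exact abs_weighted_avg_le _ (fun i => NNReal.coe_nonneg _) (fun i => hC _) hC0)
    (ae_tendsto_snis hw hint hpos hF hC)
  simpa using h

/-! ### Inversion sampling from the weights. -/

section DrawSample

/-- The number of cumulative weights that are at most `u W` is the index of the cell containing `u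
W`, and the `i`-th cell has length `w i`. The endpoint `u = 1` is exceptional and null. -/
theorem volume_drawSample {K : ℕ} {w : Fin (K + 1) → ℝ} (hw : ∀ i, 0 ≤ w i)
    (hpos : 0 < ∑ i, w i) (i : Fin (K + 1)) :
    (volume : Measure unitInterval) {u | drawSample w u = i} =
      ENNReal.ofReal (w i / ∑ j, w j) := by
  classical
  set W := ∑ j, w j with hW
  set c : Fin (K + 1) → ℝ := fun i => ∑ j ∈ Finset.Iic i, w j with hc
  have hmono : Monotone c := fun a b hab =>
    Finset.sum_le_sum_of_subset_of_nonneg (Finset.Iic_subset_Iic.2 hab) fun j _ _ => hw j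
  have hcW : ∀ i, c i ≤ W := fun i =>
    Finset.sum_le_sum_of_subset_of_nonneg (Finset.subset_univ _) fun j _ _ => hw j
  have hc_eq : ∀ i : Fin (K + 1), ∑ j ∈ Finset.Iio i, w j = c i - w i := by
    intro i
    have : Finset.Iic i = insert i (Finset.Iio i) := by
      ext j; simp [le_iff_eq_or_lt]
    simp only [hc, this]
    rw [Finset.sum_insert (by simp)]
    ring
  have hb0 : ∀ i, 0 ≤ c i - w i := fun i => by
    rw [← hc_eq]; exact Finset.sum_nonneg fun j _ => hw j
  have m0 : (c i - w i) / W ∈ unitInterval :=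
    ⟨div_nonneg (hb0 i) hpos.le, (div_le_one hpos).2 (by linarith [hcW i, hw i])⟩
  have m1 : c i / W ∈ unitInterval :=
    ⟨div_nonneg (by linarith [hb0 i, hw i]) hpos.le, (div_le_one hpos).2 (hcW i)⟩
  have key : ∀ u : unitInterval, (u : ℝ) < 1 →
      (drawSample w u = i ↔ c i - w i ≤ u * W ∧ u * W < c i) := by
    intro u hu
    have huW : (u : ℝ) * W < W := by nlinarith
    set D := Finset.univ.filter fun k : Fin (K + 1) => c k ≤ (u : ℝ) * W with hD
    have hmemD : ∀ k, k ∈ D ↔ c k ≤ u * W := fun k => by simp [hD]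
    have hdraw : (drawSample w u).val = min D.card K := by
      simp only [drawSample, hD]
      congr!
    have hlast : Fin.last K ∉ D := by
      simp only [hD, Finset.mem_filter, Finset.mem_univ, true_and, not_le]
      have : c (Fin.last K) = W := by
        simp only [hc, hW]
        congr 1
        ext j; simp [Fin.le_last]
      rw [this]; exact huW
    have hlower : ∀ a b, a ≤ b → b ∈ D → a ∈ D := by
      intro a b hab hb
      simp only [hD, Finset.mem_filter, Finset.mem_univ, true_and] at hb ⊢
      exact (hmono hab).trans hb
    -- `D` is a lower set of a finite linear order, hence an initial segment determined by its
    -- cardinality.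
    have hcard : ∀ k : Fin (K + 1), k ∈ D ↔ (k : ℕ) < D.card := by
      intro k
      constructor
      · intro hk
        have : Finset.Iic k ⊆ D := fun a ha => hlower a k (Finset.mem_Iic.1 ha) hk
        have := Finset.card_le_card this
        rw [Fin.card_Iic] at this
        omega
      · intro hk
        by_contra hkD
        have : D ⊆ Finset.Iio k := fun a ha => Finset.mem_Iio.2 (by
          by_contra h; exact hkD (hlower k a (not_lt.1 h) ha))
        have := Finset.card_le_card this
        rw [Fin.card_Iio] at this
        omega
    have hDK : D.card ≤ K := by
      have := (hcard (Fin.last K)).not.1 hlast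
      simpa using this
    rw [Fin.ext_iff, hdraw, min_eq_left hDK]
    have hi1 : u * W < c i ↔ D.card ≤ i := by
      rw [← not_le, ← hmemD i, hcard i, not_lt]
    have hi2 : c i - w i ≤ u * W ↔ (i : ℕ) ≤ D.card := by
      rcases Nat.eq_zero_or_pos (i : ℕ) with h0 | h0
      · have hi0 : i = 0 := Fin.ext h0
        have : c i - w i = 0 := by
          rw [← hc_eq, hi0]
          have : Finset.Iio (0 : Fin (K + 1)) = ∅ := by ext j; simp
          rw [this]; rfl
        rw [this, h0]
        simp only [Nat.zero_le, iff_true]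
        exact mul_nonneg u.2.1 hpos.le
      · set i' : Fin (K + 1) := ⟨i - 1, by omega⟩ with hi'
        have : c i - w i = c i' := by
          rw [← hc_eq]
          simp only [hc]
          congr 1
          ext j
          simp only [Finset.mem_Iio, Finset.mem_Iic, Fin.lt_def, Fin.le_def, hi']
          omega
        rw [this, ← hmemD i', hcard i']
        simp only [hi']
        omega
    rw [hi1, hi2]
    omega
  have hs : ∀ᵐ u ∂(volume : Measure unitInterval), u ≠ 1 := by
    rw [ae_iff]; simp
  have hae : {u : unitInterval | drawSample w u = i} =ᵐ[volume]
      Set.Ico (⟨(c i - w i) / W, m0⟩ : unitInterval) ⟨c i / W, m1⟩ := by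
    filter_upwards [hs] with u hu
    have e1 : (u : ℝ) < 1 := lt_of_le_of_ne u.2.2 fun h => hu (Subtype.ext h)
    apply propext
    change u ∈ {u : unitInterval | drawSample w u = i} ↔
      u ∈ Set.Ico (⟨(c i - w i) / W, m0⟩ : unitInterval) ⟨c i / W, m1⟩
    simp only [Set.mem_ofPred_eq, key u e1, Set.mem_Ico, ← Subtype.coe_le_coe,
      ← Subtype.coe_lt_coe]
    rw [div_le_iff₀ hpos, lt_div_iff₀ hpos]
  rw [measure_congr hae, unitInterval.volume_Ico]
  congr 1
  field_simp
  ring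

theorem integral_drawSample {K : ℕ} {w : Fin (K + 1) → ℝ} (hw : ∀ i, 0 ≤ w i)
    (hpos : 0 < ∑ i, w i) (f : Fin (K + 1) → ℝ) :
    ∫ u, f (drawSample w u) ∂(volume : Measure unitInterval) =
      (∑ i, w i * f i) / ∑ i, w i := by
  have hm : ∀ i, MeasurableSet {u : unitInterval | drawSample w u = i} := fun i =>
    (measurable_drawSample.comp measurable_prodMk_left) (measurableSet_singleton i)
  have : ∀ u, f (drawSample w u) = ∑ i, {u | drawSample w u = i}.indicator (fun _ => f i) u := by
    intro u
    rw [Finset.sum_eq_single (drawSample w u)]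
    · rw [Set.indicator_of_mem]; rfl
    · intro i _ hi
      exact Set.indicator_of_notMem (fun h => hi h.symm) _
    · simp
  simp_rw [this]
  rw [integral_finsetSum _ fun i _ => (integrable_const _).indicator (hm i), Finset.sum_div]
  refine Finset.sum_congr rfl fun i _ => ?_
  rw [integral_indicator_const _ (hm i), Measure.real, volume_drawSample hw hpos,
    ENNReal.toReal_ofReal (div_nonneg (hw i) hpos.le), smul_eq_mul]
  ring

end DrawSample

/-! ### The predictive law of a measurement -/

instance {X A Z : Type*} [MeasurableSpace X] [MeasurableSpace Z] (M : POMDP X A Z) (x : X) :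
    IsProbabilityMeasure (M.obs x) :=
  ⟨by rw [POMDP.obs, withDensity_apply _ MeasurableSet.univ, setLIntegral_univ, M.lintegral_o]⟩

namespace Planner

variable {X A Z : Type*} [MeasurableSpace X] [MeasurableSpace Z] [Fintype A] [Nonempty A]
  [MeasurableSpace A] [DiscreteMeasurableSpace A] (P : Planner X A Z) {K : ℕ}

theorem measurable_snoc (g : Hist A Z) (a : A) : Measurable fun z : Z => g ++ [(a, z)] :=
  measurable_append_singleton.comp (measurable_const.prodMk (measurable_const.prodMk measurable_id))

theorem measurable_wt_right (g : Hist A Z) : Measurable (P.wt g) :=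
  P.measurable_wt.comp measurable_prodMk_left

theorem measurable_nextPos_right (g : Hist A Z) (a : A) : Measurable (P.nextPos g a) :=
  (P.measurable_nextPos a).comp measurable_prodMk_left

/-- The total mass of the weights after the history `g`. -/
def mass (g : Hist A Z) : ℝ≥0∞ := ∫⁻ u, P.wt g u ∂particleLaw

theorem measurable_mass : Measurable P.mass :=
  P.measurable_wt.coe_nnreal_ennreal.lintegral_prod_right'

/-- A history with a well-defined belief. -/
def Nondegenerate (g : Hist A Z) : Prop := P.mass g ≠ 0 ∧ P.mass g ≠ ∞

theorem nondegenerate_nil : P.Nondegenerate [] := by simp [Nondegenerate, mass]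

theorem integrable_wt {g : Hist A Z} (hg : P.mass g ≠ ∞) :
    Integrable (fun u => (P.wt g u : ℝ)) particleLaw := by
  refine ⟨(P.measurable_wt_right g).coe_nnreal_real.aestronglyMeasurable, ?_⟩
  rw [hasFiniteIntegral_iff_ofReal (Eventually.of_forall fun u => NNReal.coe_nonneg _)]
  simpa [mass, lt_top_iff_ne_top] using hg

theorem integral_wt (g : Hist A Z) : ∫ u, (P.wt g u : ℝ) ∂particleLaw = (P.mass g).toReal := by
  rw [integral_eq_lintegral_of_nonneg_ae (Eventually.of_forall fun u => NNReal.coe_nonneg _)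
    (P.measurable_wt_right g).coe_nnreal_real.aestronglyMeasurable]
  simp [mass]

/-- The predictive law of the measurement after the history `g` and the action `a`. -/
def pred (g : Hist A Z) (a : A) : Measure Z :=
  P.M.ν.withDensity fun z => P.mass (g ++ [(a, z)]) / P.mass g

/-- Tonelli, since the weight is multiplied by the likelihood, which is the density of `obs`. For `f
= 1` the mass is preserved on integrating out the next measurement, so the ratio of masses is a
predictive density. -/
theorem lintegral_mass_snoc (g : Hist A Z) (a : A) {f : Z → ℝ≥0∞} (hf : Measurable f) :
    ∫⁻ z, P.mass (g ++ [(a, z)]) * f z ∂P.M.ν =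
      ∫⁻ u, P.wt g u * ∫⁻ z, f z ∂P.M.obs (P.nextPos g a u) ∂particleLaw := by
  have hm : Measurable fun p : Z × (ℕ → unitInterval) =>
      (P.wt g p.2 : ℝ≥0∞) * (P.M.o (P.nextPos g a p.2) p.1 * f p.1) :=
    ((P.measurable_wt_right g).comp measurable_snd).coe_nnreal_ennreal.mul
      ((P.measurable_lik.comp (((P.measurable_nextPos_right g a).comp measurable_snd).prodMk
        measurable_fst)).coe_nnreal_ennreal.mul (hf.comp measurable_fst))
  have ho : ∀ x, Measurable fun z => (P.M.o x z : ℝ≥0∞) := fun x =>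
    (P.measurable_lik.comp measurable_prodMk_left).coe_nnreal_ennreal
  calc ∫⁻ z, P.mass (g ++ [(a, z)]) * f z ∂P.M.ν
      = ∫⁻ z, ∫⁻ u, P.wt g u * (P.M.o (P.nextPos g a u) z * f z) ∂particleLaw ∂P.M.ν := by
        refine lintegral_congr fun z => ?_
        rw [mass, ← lintegral_mul_const _ (P.measurable_wt_right _).coe_nnreal_ennreal]
        refine lintegral_congr fun u => ?_
        rw [P.wt_snoc, ENNReal.coe_mul, mul_assoc]
    _ = ∫⁻ u, ∫⁻ z, P.wt g u * (P.M.o (P.nextPos g a u) z * f z) ∂P.M.ν ∂particleLaw :=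
        lintegral_lintegral_swap hm.aemeasurable
    _ = _ := by
        refine lintegral_congr fun u => ?_
        rw [POMDP.obs, lintegral_withDensity_eq_lintegral_mul _ (ho _) hf]
        exact lintegral_const_mul _ ((ho _).mul hf)

theorem lintegral_pred (g : Hist A Z) (a : A) {f : Z → ℝ≥0∞} (hf : Measurable f) :
    ∫⁻ z, f z ∂P.pred g a =
      (∫⁻ u, P.wt g u * ∫⁻ z, f z ∂P.M.obs (P.nextPos g a u) ∂particleLaw) / P.mass g := by
  have hm : Measurable fun z => P.mass (g ++ [(a, z)]) := P.measurable_mass.comp (measurable_snoc g a)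
  rw [pred, lintegral_withDensity_eq_lintegral_mul _ (hm.div_const _) hf, ← P.lintegral_mass_snoc g a hf,
    div_eq_mul_inv]
  refine Eq.trans ?_ (lintegral_mul_const _ (hm.mul hf))
  refine lintegral_congr fun z => ?_
  simp only [Pi.mul_apply, div_eq_mul_inv]
  ring

theorem isProbabilityMeasure_pred {g : Hist A Z} (hg : P.Nondegenerate g) (a : A) :
    IsProbabilityMeasure (P.pred g a) := by
  refine ⟨?_⟩
  have := P.lintegral_pred g a (f := fun _ => 1) measurable_const
  simp only [lintegral_one, measure_univ, mul_one] at this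
  rw [this]
  exact ENNReal.div_self hg.1 hg.2

/-- The new mass is finite almost everywhere because its integral is the finite old mass, and it is
positive where the predictive density is. Hence the induction on histories only ever meets
well-defined beliefs. -/
theorem ae_nondegenerate {g : Hist A Z} (hg : P.Nondegenerate g) (a : A) :
    ∀ᵐ z ∂P.pred g a, P.Nondegenerate (g ++ [(a, z)]) := by
  have hm : Measurable fun z => P.mass (g ++ [(a, z)]) := P.measurable_mass.comp (measurable_snoc g a)
  rw [pred, ae_withDensity_iff (hm.div_const _)]
  have h1 := P.lintegral_mass_snoc g a (f := fun _ => 1) measurable_const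
  simp only [lintegral_one, measure_univ, mul_one] at h1
  filter_upwards [ae_lt_top hm (h1.trans_ne hg.2)] with z hz hz0
  exact ⟨fun h => hz0 (by rw [h, ENNReal.zero_div]), hz.ne⟩

theorem integral_obs (x : X) {f : Z → ℝ} (hf : Measurable f) :
    ∫ z, f z ∂P.M.obs x = ∫ v, f (P.sim.sense x v) ∂(volume : Measure unitInterval) := by
  have hs : Measurable (P.sim.sense x) := P.sim.measurable_sense.comp measurable_prodMk_left
  rw [← P.sim.map_sense, integral_map hs.aemeasurable hf.aestronglyMeasurable]

theorem measurable_integral_obs {f : Z → ℝ} (hf : Measurable f) (g : Hist A Z) (a : A) :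
    Measurable fun u => ∫ z, f z ∂P.M.obs (P.nextPos g a u) := by
  simp_rw [P.integral_obs _ hf]
  have : Measurable fun p : (ℕ → unitInterval) × unitInterval =>
      f (P.sim.sense (P.nextPos g a p.1) p.2) :=
    hf.comp (P.sim.measurable_sense.comp
      (((P.measurable_nextPos_right g a).comp measurable_fst).prodMk measurable_snd))
  exact this.stronglyMeasurable.integral_prod_right'.measurable

theorem integral_mem_unit {α : Type*} [MeasurableSpace α] (μ : Measure α) [IsProbabilityMeasure μ]
    {f : α → ℝ} (hf : Measurable f) (h0 : ∀ x, 0 ≤ f x) (h1 : ∀ x, f x ≤ 1) :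
    0 ≤ ∫ x, f x ∂μ ∧ ∫ x, f x ∂μ ≤ 1 := by
  refine ⟨integral_nonneg h0, ?_⟩
  have := integral_mono (μ := μ) (Integrable.of_bound hf.aestronglyMeasurable 1
    (Eventually.of_forall fun x => by rw [Real.norm_eq_abs, abs_of_nonneg (h0 x)]; exact h1 x))
    (integrable_const 1) h1
  simpa using this

/-- Brings the predictive mean into the form of the limit in `tendsto_integral_snis`. Functions with
values in the unit interval suffice; general bounded ones are rescaled in
`tendsto_integral_newMeas`. -/
theorem integral_pred {g : Hist A Z} (a : A) {f : Z → ℝ} (hf : Measurable f)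
    (h0 : ∀ z, 0 ≤ f z) (h1 : ∀ z, f z ≤ 1) : ∫ z, f z ∂P.pred g a =
      (∫ u, P.wt g u * ∫ z, f z ∂P.M.obs (P.nextPos g a u) ∂particleLaw) /
        ∫ u, (P.wt g u : ℝ) ∂particleLaw := by
  have hφ := P.measurable_integral_obs hf g a
  have hφ0 : ∀ u, 0 ≤ ∫ z, f z ∂P.M.obs (P.nextPos g a u) := fun u => integral_nonneg h0
  rw [integral_eq_lintegral_of_nonneg_ae (Eventually.of_forall h0) hf.aestronglyMeasurable,
    P.lintegral_pred g a hf.ennreal_ofReal, ENNReal.toReal_div, P.integral_wt]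
  congr 1
  rw [integral_eq_lintegral_of_nonneg_ae
    (Eventually.of_forall fun u => mul_nonneg (NNReal.coe_nonneg _) (hφ0 u))
    ((P.measurable_wt_right g).coe_nnreal_real.mul hφ).aestronglyMeasurable]
  congr 1
  refine lintegral_congr fun u => ?_
  rw [ENNReal.ofReal_mul (NNReal.coe_nonneg _), ENNReal.ofReal_coe_nnreal,
    ofReal_integral_eq_lintegral_ofReal _ (Eventually.of_forall h0)]
  exact Integrable.of_bound hf.aestronglyMeasurable 1
    (Eventually.of_forall fun x => by rw [Real.norm_eq_abs, abs_of_nonneg (h0 x)]; exact h1 x)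

theorem measurable_newMeas_right (g : Hist A Z) (a : A) :
    Measurable fun ξ : Noise K => P.newMeas g a ξ :=
  (P.measurable_newMeas a).comp ((measurable_const (a := g)).prodMk
    -- `newMeas` does not depend on the tree, so an arbitrary one fills the slot.
    ((measurable_const (a := (⟨∅, fun _ _ => [], fun _ _ => 0, fun _ _ => 0⟩ : SearchTree A Z))).prodMk
      measurable_id))

/-- The random numbers from which the measurement of a new branch at depth `d` is drawn. -/
def measSeeds (K d : ℕ) : Set (Seed K) := {.sample d, .sense d}

/-- With the samples frozen in `ξ'`, only the seeds for the drawn index and for the sensor are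
integrated out; these two are independent. -/
theorem integral_newMeas_mixOn (g : Hist A Z) (a : A) {f : Z → ℝ} (hf : Measurable f)
    (h0 : ∀ z, 0 ≤ f z) (h1 : ∀ z, f z ≤ 1) (ξ' : Noise K) :
    ∫ ξ, f (P.newMeas g a (mixOn (measSeeds K g.length) (ξ, ξ'))) ∂noiseLaw K =
      ∫ u, (∫ z, f z ∂P.M.obs (P.nextPos g a (particleNoise ξ'
        (drawSample (fun i => (P.wt g (particleNoise ξ' i) : ℝ)) u)))) ∂(volume : Measure unitInterval) := by
  set w : Fin (K + 1) → ℝ := fun i => (P.wt g (particleNoise ξ' i) : ℝ) with hw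
  have hnew : ∀ ξ, P.newMeas g a (mixOn (measSeeds K g.length) (ξ, ξ')) =
      P.sim.sense (P.nextPos g a (particleNoise ξ' (drawSample w (ξ (.sample g.length)))))
        (ξ (.sense g.length)) := by
    intro ξ
    have e1 : ∀ i, particleNoise (mixOn (measSeeds K g.length) (ξ, ξ')) i = particleNoise ξ' i := by
      intro i
      funext e
      cases e <;> simp [particleNoise, mixOn, measSeeds]
    have e2 : mixOn (measSeeds K g.length) (ξ, ξ') (.sample g.length) = ξ (.sample g.length) := by
      simp [mixOn, measSeeds]
    have e3 : mixOn (measSeeds K g.length) (ξ, ξ') (.sense g.length) = ξ (.sense g.length) := by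
      simp [mixOn, measSeeds]
    simp only [newMeas, e1, e2, e3, hw]
  simp_rw [hnew]
  have hd : Measurable fun p : unitInterval × unitInterval => (drawSample w p.1, p.2) :=
    ((measurable_drawSample.comp measurable_prodMk_left).comp measurable_fst).prodMk measurable_snd
  have hF : Measurable fun p : unitInterval × unitInterval =>
      f (P.sim.sense (P.nextPos g a (particleNoise ξ' (drawSample w p.1))) p.2) :=
    hf.comp (P.sim.measurable_sense.comp (((measurable_of_countable
      fun i => P.nextPos g a (particleNoise ξ' i)).comp (measurable_fst.comp hd)).prodMk
        measurable_snd))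
  have hpair := Measure.infinitePi_map_eval_prod
    (P := fun _ : Seed K => (volume : Measure unitInterval))
    (i := Seed.sample g.length) (j := Seed.sense g.length) (by simp)
  have := integral_map (μ := noiseLaw K)
    (φ := fun ξ : Noise K => (ξ (.sample g.length), ξ (.sense g.length)))
    ((measurable_pi_apply _).prodMk (measurable_pi_apply _)).aemeasurable
    hF.aestronglyMeasurable
  rw [← this]
  rw [noiseLaw, hpair, integral_prod]
  · refine integral_congr_ae (Eventually.of_forall fun u => ?_)
    simp only
    rw [P.integral_obs _ hf]
  · refine Integrable.of_bound hF.aestronglyMeasurable 1 (Eventually.of_forall fun p => ?_)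
    rw [Real.norm_eq_abs, abs_of_nonneg (h0 _)]
    exact h1 _

theorem abs_integral_drawSample_le (w ψ : Fin (K + 1) → ℝ) (h0 : ∀ i, 0 ≤ ψ i)
    (h1 : ∀ i, ψ i ≤ 1) : |∫ u, ψ (drawSample w u) ∂(volume : Measure unitInterval)| ≤ 1 := by
  have hd : Measurable fun u : unitInterval => drawSample w u :=
    measurable_to_countable' fun i =>
      (measurable_drawSample.comp measurable_prodMk_left) (measurableSet_singleton i)
  have hm : Measurable fun u : unitInterval => ψ (drawSample w u) := (measurable_of_countable ψ).comp hd
  obtain ⟨i0, i1⟩ := integral_mem_unit (volume : Measure unitInterval) hm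
    (fun u => h0 _) (fun u => h1 _)
  rw [abs_of_nonneg i0]
  exact i1

/-- Given the samples, the mean of `f` at the new measurement is exactly the self-normalised average
of the sensor means, unless all weights vanish. In that case the average is `0` by convention and
the error is at most `1`. The average of the constant `1` is the indicator of the complementary
case, so the right-hand side is the probability of vanishing weights. -/
theorem abs_integral_newMeas_sub_le (g : Hist A Z) (a : A) {f : Z → ℝ} (hf : Measurable f)
    (h0 : ∀ z, 0 ≤ f z) (h1 : ∀ z, f z ≤ 1) :
    |∫ ξ, f (P.newMeas g a ξ) ∂noiseLaw K -
      ∫ ξ, snis (P.wt g) (fun u => ∫ z, f z ∂P.M.obs (P.nextPos g a u))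
        (fun i => particleNoise ξ i) ∂noiseLaw K| ≤
      1 - ∫ ξ, snis (P.wt g) (fun _ => 1) (fun i => particleNoise ξ i) ∂noiseLaw K := by
  set φ : (ℕ → unitInterval) → ℝ := fun u => ∫ z, f z ∂P.M.obs (P.nextPos g a u) with hφ
  have hφm : Measurable φ := P.measurable_integral_obs hf g a
  have hφ01 : ∀ u, 0 ≤ φ u ∧ φ u ≤ 1 := fun u => integral_mem_unit _ hf h0 h1
  have hpn : Measurable fun (ξ : Noise K) (i : Fin (K + 1)) => particleNoise ξ i :=
    measurable_pi_lambda _ fun i => measurable_particleNoise i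
  have hsn : ∀ F : (ℕ → unitInterval) → ℝ, Measurable F → (∀ u, |F u| ≤ 1) →
      Integrable (fun ξ : Noise K => snis (P.wt g) F (fun i => particleNoise ξ i)) (noiseLaw K) :=
    fun F hF hF1 => Integrable.of_bound
      ((measurable_snis (P.measurable_wt_right g) hF).comp hpn).aestronglyMeasurable 1
      (Eventually.of_forall fun ξ => abs_weighted_avg_le _ (fun i => NNReal.coe_nonneg _)
        (fun i => hF1 _) zero_le_one)
  have hi1 := hsn φ hφm fun u => abs_le.2 ⟨by linarith [(hφ01 u).1], (hφ01 u).2⟩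
  have hi2 := hsn (fun _ => 1) measurable_const (by simp)
  have hfm : Measurable fun ξ : Noise K => f (P.newMeas g a ξ) := hf.comp (P.measurable_newMeas_right g a)
  have hmix : Measurable fun p : Noise K × Noise K =>
      f (P.newMeas g a (mixOn (measSeeds K g.length) p)) := hfm.comp (measurable_mixOn _)
  have hb : ∀ z, ‖f z‖ ≤ 1 := fun z => by rw [Real.norm_eq_abs, abs_of_nonneg (h0 z)]; exact h1 z
  have e1 : ∫ ξ, f (P.newMeas g a ξ) ∂noiseLaw K =
      ∫ ξ', ∫ ξ, f (P.newMeas g a (mixOn (measSeeds K g.length) (ξ, ξ'))) ∂noiseLaw K ∂noiseLaw K := by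
    have hmp := measurePreserving_mixOn (measSeeds K g.length)
      (fun _ : Seed K => (volume : Measure unitInterval))
    have := integral_map (μ := (noiseLaw K).prod (noiseLaw K)) hmp.measurable.aemeasurable
      (f := fun ξ => f (P.newMeas g a ξ)) hfm.aestronglyMeasurable
    rw [← integral_prod_symm _ (Integrable.of_bound hmix.aestronglyMeasurable 1
      (Eventually.of_forall fun p => hb _)), ← this]
    congr 1
    exact hmp.map_eq.symm
  have hJ : Integrable (fun ξ' => ∫ ξ, f (P.newMeas g a (mixOn (measSeeds K g.length) (ξ, ξ')))
      ∂noiseLaw K) (noiseLaw K) := by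
    refine Integrable.of_bound (hmix.stronglyMeasurable.integral_prod_left'.aestronglyMeasurable) 1
      (Eventually.of_forall fun ξ' => ?_)
    refine (norm_integral_le_of_norm_le_const (Eventually.of_forall fun ξ => hb _)).trans ?_
    simp
  rw [e1, ← integral_sub hJ hi1]
  have hone : 1 - ∫ ξ : Noise K, snis (P.wt g) (fun _ => 1) (fun i => particleNoise ξ i) ∂noiseLaw K =
      ∫ ξ : Noise K, (1 - snis (P.wt g) (fun _ => 1) (fun i => particleNoise ξ i)) ∂noiseLaw K := by
    rw [integral_sub (integrable_const 1) hi2]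
    simp
  rw [hone]
  refine (abs_integral_le_integral_abs).trans (integral_mono (hJ.sub hi1).abs
    ((integrable_const 1).sub hi2) fun ξ' => ?_)
  simp only
  rw [P.integral_newMeas_mixOn g a hf h0 h1]
  set w : Fin (K + 1) → ℝ := fun i => (P.wt g (particleNoise ξ' i) : ℝ) with hw
  have hw0 : ∀ i, 0 ≤ w i := fun i => NNReal.coe_nonneg _
  have hs1 : snis (P.wt g) (fun _ => 1) (fun i => particleNoise ξ' i) = (∑ i, w i) / ∑ i, w i := by
    simp [snis, hw]
  have hs2 : snis (P.wt g) φ (fun i => particleNoise ξ' i) =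
      (∑ i, w i * φ (particleNoise ξ' i)) / ∑ i, w i := rfl
  rcases (Finset.sum_nonneg fun i _ => hw0 i : 0 ≤ ∑ i, w i).eq_or_lt with h | h
  · rw [hs1, hs2, ← h, div_zero, div_zero]
    rw [sub_zero, sub_zero]
    exact abs_integral_drawSample_le w (fun i => φ (particleNoise ξ' i)) (fun i => (hφ01 _).1)
      (fun i => (hφ01 _).2)
  · rw [hs1, hs2, integral_drawSample hw0 h (fun i => φ (particleNoise ξ' i)), div_self h.ne']
    simp

/-- Two applications of `tendsto_integral_snis`: the sensor means give the limit, and the constant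
`1` shows that the probability of vanishing weights tends to `0`. -/
theorem tendsto_integral_newMeas_of_unit {g : Hist A Z} (hg : P.Nondegenerate g) (a : A) {f : Z → ℝ}
    (hf : Measurable f) (h0 : ∀ z, 0 ≤ f z) (h1 : ∀ z, f z ≤ 1) :
    Tendsto (fun K : ℕ => ∫ ξ, f (P.newMeas g a ξ) ∂noiseLaw K) atTop
      (𝓝 (∫ z, f z ∂P.pred g a)) := by
  have hpos : 0 < ∫ u, (P.wt g u : ℝ) ∂particleLaw := by
    rw [P.integral_wt]; exact ENNReal.toReal_pos hg.1 hg.2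
  have hint := P.integrable_wt hg.2
  have hφ01 : ∀ u, |∫ z, f z ∂P.M.obs (P.nextPos g a u)| ≤ 1 := fun u => by
    have := integral_mem_unit (P.M.obs (P.nextPos g a u)) hf h0 h1
    exact abs_le.2 ⟨by linarith, this.2⟩
  have t1 := tendsto_integral_snis (P.measurable_wt_right g) hint hpos
    (P.measurable_integral_obs hf g a) hφ01
  have t2 := tendsto_integral_snis (P.measurable_wt_right g) hint hpos
    (F := fun _ => 1) measurable_const (C := 1) (by simp)
  simp only [mul_one, div_self hpos.ne'] at t2
  rw [P.integral_pred a hf h0 h1]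
  have t3 := (tendsto_const_nhds (x := (1 : ℝ))).sub t2
  rw [sub_self] at t3
  have t4 := squeeze_zero_norm (fun K => by
    rw [Real.norm_eq_abs]; exact P.abs_integral_newMeas_sub_le g a hf h0 h1) t3
  simpa using t4.add t1

theorem integral_eq_of_rescaled {α : Type*} [MeasurableSpace α] {D : ℝ} (hD : 0 < D) (μ : Measure α)
    [IsProbabilityMeasure μ] {F : α → ℝ} (hF : Measurable F) (hFD : ∀ x, |F x| ≤ D) :
    ∫ x, F x ∂μ = 2 * D * (∫ x, (F x + D) / (2 * D) ∂μ) - D := by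
  have hFi : Integrable F μ := Integrable.of_bound hF.aestronglyMeasurable D
    (Eventually.of_forall hFD)
  rw [integral_div, integral_add hFi (integrable_const D), integral_const]
  simp only [probReal_univ, one_smul]
  field_simp
  ring

theorem tendsto_integral_newMeas {g : Hist A Z} (hg : P.Nondegenerate g) (a : A) {f : Z → ℝ}
    (hf : Measurable f) {C : ℝ} (hC : ∀ z, |f z| ≤ C) :
    Tendsto (fun K : ℕ => ∫ ξ, f (P.newMeas g a ξ) ∂noiseLaw K) atTop
      (𝓝 (∫ z, f z ∂P.pred g a)) := by
  have := P.isProbabilityMeasure_pred hg a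
  set D := |C| + 1 with hD
  have hD0 : 0 < D := by positivity
  have hfD : ∀ z, |f z| ≤ D := fun z => (hC z).trans ((le_abs_self C).trans (by linarith))
  have h := P.tendsto_integral_newMeas_of_unit hg a (f := fun z => (f z + D) / (2 * D))
    ((hf.add_const D).div_const _) (fun z => div_nonneg (by linarith [(abs_le.1 (hfD z)).1])
      (by linarith)) (fun z => (div_le_one (by linarith)).2 (by linarith [(abs_le.1 (hfD z)).2]))
  rw [integral_eq_of_rescaled hD0 _ hf hfD]
  refine ((h.const_mul (2 * D)).sub_const D).congr fun K => ?_
  exact (integral_eq_of_rescaled hD0 (noiseLaw K) (hf.comp (P.measurable_newMeas_right g a))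
    fun ξ => hfD _).symm

/-- Both the integrand and the law of the measurement vary with `K`. The tail suprema of the
integrands decouple them: for fixed `m` the supremum is one fixed function, whose means converge to
its predictive mean, and that is small for large `m` by dominated convergence. The speed of
convergence may therefore depend on `z`. -/
theorem tendsto_lintegral_newMeas_zero {g : Hist A Z} (hg : P.Nondegenerate g) (a : A)
    {β : ℕ → Z → ℝ≥0∞} (hβ : ∀ K, Measurable (β K)) (h1 : ∀ K z, β K z ≤ 1)
    (h : ∀ᵐ z ∂P.pred g a, Tendsto (fun K => β K z) atTop (𝓝 0)) :
    Tendsto (fun K : ℕ => ∫⁻ ξ, β K (P.newMeas g a ξ) ∂noiseLaw K) atTop (𝓝 0) := by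
  have := P.isProbabilityMeasure_pred hg a
  set γ : ℕ → Z → ℝ≥0∞ := fun m z => ⨆ K, ⨆ _ : m ≤ K, β K z with hγ
  have hγm : ∀ m, Measurable (γ m) := fun m =>
    Measurable.iSup fun K => Measurable.iSup fun _ => hβ K
  have hγ1 : ∀ m z, γ m z ≤ 1 := fun m z => iSup₂_le fun K _ => h1 K z
  have hlim : Tendsto (fun m => ∫⁻ z, γ m z ∂P.pred g a) atTop (𝓝 0) := by
    have := tendsto_lintegral_of_dominated_convergence (μ := P.pred g a) (F := γ) (f := fun _ => 0)
      (fun _ => 1) hγm (fun m => Eventually.of_forall fun z => hγ1 m z) (by simp) (by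
        filter_upwards [h] with z hz
        refine ENNReal.tendsto_atTop_zero.2 fun ε hε => ?_
        obtain ⟨N, hN⟩ := ENNReal.tendsto_atTop_zero.1 hz ε hε
        exact ⟨N, fun m hm => iSup₂_le fun K hK => hN K (hm.trans hK)⟩)
    simpa using this
  refine ENNReal.tendsto_atTop_zero.2 fun ε hε => ?_
  rcases eq_or_ne ε ∞ with rfl | hεt
  · exact ⟨0, fun _ _ => le_top⟩
  have hε2 : 0 < ε / 2 := ENNReal.half_pos hε.ne'
  obtain ⟨m, hm⟩ := ENNReal.tendsto_atTop_zero.1 hlim (ε / 2) hε2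
  have hm := hm m le_rfl
  have key := P.tendsto_integral_newMeas_of_unit hg a (f := fun z => (γ m z).toReal)
    (hγm m).ennreal_toReal (fun z => ENNReal.toReal_nonneg)
    (fun z => ENNReal.toReal_le_of_le_ofReal zero_le_one (by simpa using hγ1 m z))
  have hne : ∀ z, γ m z ≠ ∞ := fun z => ((hγ1 m z).trans_lt ENNReal.one_lt_top).ne
  rw [integral_toReal (hγm m).aemeasurable (Eventually.of_forall fun z => (hne z).lt_top)] at key
  have hlt : (∫⁻ z, γ m z ∂P.pred g a).toReal < ε.toReal := by
    refine (ENNReal.toReal_lt_toReal (hm.trans_lt (ENNReal.half_lt_self hε.ne' hεt |>.trans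
      hεt.lt_top)).ne hεt).2 (hm.trans_lt (ENNReal.half_lt_self hε.ne' hεt))
  obtain ⟨K0, hK0⟩ := eventually_atTop.1 (key.eventually_lt_const hlt)
  refine ⟨max m K0, fun K hK => ?_⟩
  have h2 := hK0 K ((le_max_right _ _).trans hK)
  have hmK : Measurable fun ξ : Noise K => γ m (P.newMeas g a ξ) :=
    (hγm m).comp (P.measurable_newMeas_right g a)
  rw [integral_toReal hmK.aemeasurable (Eventually.of_forall fun z => (hne _).lt_top)] at h2
  have hfin : ∫⁻ ξ, γ m (P.newMeas g a ξ) ∂noiseLaw K ≠ ∞ := by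
    refine ((lintegral_mono fun ξ => hγ1 m _).trans_lt ?_).ne
    simp
  calc ∫⁻ ξ, β K (P.newMeas g a ξ) ∂noiseLaw K ≤ ∫⁻ ξ, γ m (P.newMeas g a ξ) ∂noiseLaw K :=
        lintegral_mono fun ξ => le_iSup₂_of_le K ((le_max_left _ _).trans hK) le_rfl
    _ ≤ ε := ((ENNReal.toReal_lt_toReal hfin hεt).1 h2).le

end Planner

/-! ### Values as weighted means over samples -/

/-- Resampling one of the random numbers of a sample. -/
theorem measurePreserving_update (d : ℕ) :
    MeasurePreserving (fun p : unitInterval × (ℕ → unitInterval) => Function.update p.2 d p.1)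
      ((volume : Measure unitInterval).prod particleLaw) particleLaw := by
  classical
  have h1 := measurePreserving_mixOn {d} (fun _ : ℕ => (volume : Measure unitInterval))
  have h2 : MeasurePreserving (Prod.map (fun u : ℕ → unitInterval => u d) id)
      (particleLaw.prod particleLaw) ((volume : Measure unitInterval).prod particleLaw) :=
    (measurePreserving_eval_infinitePi (fun _ : ℕ => (volume : Measure unitInterval)) d).prod
      (MeasurePreserving.id _)
  have hm : Measurable fun p : unitInterval × (ℕ → unitInterval) => Function.update p.2 d p.1 := by
    refine measurable_pi_lambda _ fun i => ?_
    by_cases hi : i = d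
    · subst hi; simpa using measurable_fst
    · simpa [hi, Function.comp_def] using (measurable_pi_apply i).comp
        (measurable_snd (α := unitInterval) (β := ℕ → unitInterval))
  refine ⟨hm, ?_⟩
  rw [← h2.map_eq, Measure.map_map hm h2.measurable]
  refine Eq.trans ?_ h1.map_eq
  rw [particleLaw]
  congr 1
  funext p i
  by_cases hi : i = d
  · subst hi; simp [mixOn]
  · simp [mixOn, hi]

/-- Integrates out a single seed of a sample. With `d = |g| + 1` this is the seed of the transition
after the history `g`, on which the state, weight and rewards up to `g` do not depend. -/
theorem lintegral_update (d : ℕ) {Φ : (ℕ → unitInterval) → ℝ≥0∞} (hΦ : Measurable Φ) :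
    ∫⁻ u, Φ u ∂particleLaw =
      ∫⁻ u, ∫⁻ v, Φ (Function.update u d v) ∂(volume : Measure unitInterval) ∂particleLaw := by
  have h := measurePreserving_update d
  rw [← h.lintegral_comp hΦ]
  exact lintegral_prod_symm _ (hΦ.comp h.measurable).aemeasurable

theorem integral_update (d : ℕ) {Φ : (ℕ → unitInterval) → ℝ} (hΦ : Integrable Φ particleLaw) :
    ∫ u, Φ u ∂particleLaw =
      ∫ u, ∫ v, Φ (Function.update u d v) ∂(volume : Measure unitInterval) ∂particleLaw := by
  have h := measurePreserving_update d
  have h2 := integral_map h.measurable.aemeasurable (f := Φ) (by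
    rw [h.map_eq]; exact hΦ.aestronglyMeasurable)
  rw [h.map_eq] at h2
  rw [h2]
  exact integral_prod_symm _ (h.integrable_comp_of_integrable hΦ)

theorem abs_integral_le_of_abs_le {α : Type*} [MeasurableSpace α] (μ : Measure α)
    [IsProbabilityMeasure μ] {f : α → ℝ} {C : ℝ} (h : ∀ x, |f x| ≤ C) : |∫ x, f x ∂μ| ≤ C := by
  have := norm_integral_le_of_norm_le_const (μ := μ) (f := f) (C := C) (Eventually.of_forall h)
  rwa [probReal_univ, mul_one] at this

theorem measurable_epsGreedy {A : Type*} [Fintype A] [Nonempty A] [MeasurableSpace A]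
    [DiscreteMeasurableSpace A] (εa : ℝ) (a : A) : Measurable fun v : A → ℝ => epsGreedy εa v a := by
  unfold epsGreedy
  refine Measurable.add_const (Measurable.const_mul (Measurable.ite ?_ measurable_const
    measurable_const) _) _
  have : MeasurableSet {v : A → ℝ | greedy v = a} := measurable_greedy (measurableSet_singleton a)
  simpa only [eq_comm] using this

namespace Planner

variable {X A Z : Type*} [MeasurableSpace X] [MeasurableSpace Z] [Fintype A] [Nonempty A]
  [MeasurableSpace A] [DiscreteMeasurableSpace A] (P : Planner X A Z) {K : ℕ}

theorem traj_congr (g : Hist A Z) {u u' : ℕ → unitInterval} (h : ∀ e ≤ g.length, u e = u' e) :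
    P.traj g u = P.traj g u' := by
  induction g using List.reverseRecOn with
  | nil => simp [traj, h 0 (Nat.zero_le _)]
  | append_singleton g az ih =>
    rw [List.length_append, List.length_singleton] at h
    have := ih fun e he => h e (by omega)
    have hf := P.traj_fst g u'
    rw [traj, traj, List.foldl_append, List.foldl_append, ← traj, ← traj, this]
    simp [advance, hf, h (g.length + 1) le_rfl]

theorem traj_update (g : Hist A Z) (u : ℕ → unitInterval) (v : unitInterval) :
    P.traj g (Function.update u (g.length + 1) v) = P.traj g u :=
  P.traj_congr g fun e he => Function.update_of_ne (by omega) _ _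

theorem pos_update (g : Hist A Z) (u : ℕ → unitInterval) (v : unitInterval) :
    P.pos g (Function.update u (g.length + 1) v) = P.pos g u := by rw [pos, traj_update, pos]

theorem wt_update (g : Hist A Z) (u : ℕ → unitInterval) (v : unitInterval) :
    P.wt g (Function.update u (g.length + 1) v) = P.wt g u := by rw [wt, traj_update, wt]

theorem acc_update (g : Hist A Z) (u : ℕ → unitInterval) (v : unitInterval) (d : ℕ) :
    P.acc g (Function.update u (g.length + 1) v) d = P.acc g u d := by rw [acc, traj_update, acc]

theorem nextPos_update (g : Hist A Z) (a : A) (u : ℕ → unitInterval) (v : unitInterval) :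
    P.nextPos g a (Function.update u (g.length + 1) v) = P.sim.move (P.pos g u) a v := by
  rw [nextPos, pos_update, Function.update_self]

theorem measurable_pos_right (g : Hist A Z) : Measurable (P.pos g) :=
  P.measurable_pos.comp measurable_prodMk_left

theorem measurable_acc_right (g : Hist A Z) (d : ℕ) : Measurable fun u => P.acc g u d :=
  (P.measurable_acc d).comp measurable_prodMk_left

theorem measurable_move_right (x : X) (a : A) : Measurable (P.sim.move x a) :=
  (P.sim.measurable_move a).comp measurable_prodMk_left

theorem integral_t (x : X) (a : A) {f : X → ℝ} (hf : Measurable f) :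
    ∫ x', f x' ∂P.M.t a x = ∫ v, f (P.sim.move x a v) ∂(volume : Measure unitInterval) := by
  rw [← P.sim.map_move, integral_map (P.measurable_move_right x a).aemeasurable
    hf.aestronglyMeasurable]

/-- The unnormalised belief is the weighted law of one sample. In the inductive step the seed `|g| +
1` is integrated out, which reproduces the transition kernel, and the weight picks up the
likelihood. -/
theorem lintegral_unnormBelief (g : Hist A Z) {f : X → ℝ≥0∞} (hf : Measurable f) :
    ∫⁻ x, f x ∂P.M.unnormBelief g = ∫⁻ u, P.wt g u * f (P.pos g u) ∂particleLaw := by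
  induction g using List.reverseRecOn generalizing f with
  | nil =>
    have h := measurePreserving_eval_infinitePi (fun _ : ℕ => (volume : Measure unitInterval)) 0
    have e : ∫⁻ x, f x ∂P.M.b₀ = ∫⁻ u, f (P.sim.start (u 0)) ∂particleLaw := by
      rw [← P.sim.map_start, lintegral_map hf P.sim.measurable_start]
      exact (h.lintegral_comp (hf.comp P.sim.measurable_start)).symm
    simpa [POMDP.unnormBelief] using e
  | append_singleton g az ih =>
    obtain ⟨a, z⟩ := az
    have ho : Measurable fun x => (P.M.o x z : ℝ≥0∞) :=
      (P.measurable_lik.comp (measurable_id.prodMk measurable_const)).coe_nnreal_ennreal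
    have hof : Measurable fun x => (P.M.o x z : ℝ≥0∞) * f x := ho.mul hf
    have e1 : ∫⁻ x, f x ∂P.M.unnormBelief (g ++ [(a, z)]) =
        ∫⁻ x, ∫⁻ x', P.M.o x' z * f x' ∂P.M.t a x ∂P.M.unnormBelief g := by
      rw [POMDP.unnormBelief, List.foldl_append, ← POMDP.unnormBelief]
      simp only [List.foldl_cons, List.foldl_nil]
      rw [lintegral_withDensity_eq_lintegral_mul _ ho hf]
      exact Measure.lintegral_bind (P.M.t a).measurable.aemeasurable hof.aemeasurable
    rw [e1, ih hof.lintegral_kernel]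
    have hm : Measurable fun u => (P.wt (g ++ [(a, z)]) u : ℝ≥0∞) * f (P.pos (g ++ [(a, z)]) u) :=
      (P.measurable_wt_right _).coe_nnreal_ennreal.mul (hf.comp (P.measurable_pos_right _))
    rw [lintegral_update (g.length + 1) hm]
    refine lintegral_congr fun u => ?_
    simp only [wt_snoc, pos_snoc, wt_update, nextPos_update, ENNReal.coe_mul, mul_assoc]
    rw [← P.sim.map_move, lintegral_map hof (P.measurable_move_right _ _)]
    exact (lintegral_const_mul _ (hof.comp (P.measurable_move_right _ _))).symm

theorem unnormBelief_eq_map (g : Hist A Z) : P.M.unnormBelief g =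
    (particleLaw.withDensity fun u => (P.wt g u : ℝ≥0∞)).map (P.pos g) := by
  refine Measure.ext_of_lintegral _ fun f hf => ?_
  rw [P.lintegral_unnormBelief g hf, lintegral_map hf (P.measurable_pos_right g)]
  exact (lintegral_withDensity_eq_lintegral_mul _ (P.measurable_wt_right g).coe_nnreal_ennreal
    (hf.comp (P.measurable_pos_right g))).symm

/-- The weighted mean over samples after the history `g`. -/
def postMean (g : Hist A Z) (f : (ℕ → unitInterval) → ℝ) : ℝ :=
  (∫ u, P.wt g u * f u ∂particleLaw) / (P.mass g).toReal

theorem integral_belief (g : Hist A Z) {f : X → ℝ} (hf : Measurable f) :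
    ∫ x, f x ∂P.M.belief g = P.postMean g fun u => f (P.pos g u) := by
  have hmass : P.M.unnormBelief g Set.univ = P.mass g := by
    have := P.lintegral_unnormBelief g (f := fun _ => 1) measurable_const
    simpa [mass] using this
  rw [POMDP.belief, integral_smul_measure, hmass, P.unnormBelief_eq_map,
    integral_map (P.measurable_pos_right g).aemeasurable hf.aestronglyMeasurable,
    integral_withDensity_eq_integral_smul (P.measurable_wt_right g), postMean, ENNReal.toReal_inv,
    smul_eq_mul, inv_mul_eq_div]
  rfl

theorem measurable_postMean {f : Hist A Z → (ℕ → unitInterval) → ℝ}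
    (hf : Measurable (Function.uncurry f)) : Measurable fun g => P.postMean g (f g) := by
  have : Measurable fun p : Hist A Z × (ℕ → unitInterval) => (P.wt p.1 p.2 : ℝ) * f p.1 p.2 :=
    P.measurable_wt.coe_nnreal_real.mul hf
  exact (this.stronglyMeasurable.integral_prod_right'.measurable).div
    P.measurable_mass.ennreal_toReal

theorem integrable_wt_mul {g : Hist A Z} (hg : P.mass g ≠ ∞) {f : (ℕ → unitInterval) → ℝ}
    (hf : Measurable f) {C : ℝ} (hC : ∀ u, |f u| ≤ C) :
    Integrable (fun u => (P.wt g u : ℝ) * f u) particleLaw :=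
  (P.integrable_wt hg).mul_bdd (c := C) hf.aestronglyMeasurable (Eventually.of_forall fun u => hC u)

theorem abs_postMean_le (g : Hist A Z) {f : (ℕ → unitInterval) → ℝ} {C : ℝ} (hC0 : 0 ≤ C)
    (hC : ∀ u, |f u| ≤ C) : |P.postMean g f| ≤ C := by
  rw [postMean, abs_div, abs_of_nonneg ENNReal.toReal_nonneg]
  by_cases hm : P.mass g = ∞
  -- For infinite mass `toReal` is `0` and the mean is `0` by convention.
  · simpa [hm] using hC0
  refine div_le_of_le_mul₀ ENNReal.toReal_nonneg hC0 ?_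
  rw [← P.integral_wt, ← integral_const_mul]
  refine abs_integral_le_integral_abs.trans ?_
  refine integral_mono_of_nonneg (Eventually.of_forall fun u => abs_nonneg _)
    ((P.integrable_wt hm).const_mul C) (Eventually.of_forall fun u => ?_)
  simp only [abs_mul, abs_of_nonneg (NNReal.coe_nonneg _)]
  rw [mul_comm]
  exact mul_le_mul_of_nonneg_right (hC u) (NNReal.coe_nonneg _)

theorem postMean_add {g : Hist A Z} (hg : P.mass g ≠ ∞) {f f' : (ℕ → unitInterval) → ℝ}
    (hf : Measurable f) (hf' : Measurable f') {C C' : ℝ} (hC : ∀ u, |f u| ≤ C)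
    (hC' : ∀ u, |f' u| ≤ C') :
    P.postMean g (fun u => f u + f' u) = P.postMean g f + P.postMean g f' := by
  simp only [postMean, mul_add]
  rw [integral_add (P.integrable_wt_mul hg hf hC) (P.integrable_wt_mul hg hf' hC'), add_div]

theorem postMean_const_mul (g : Hist A Z) (c : ℝ) (f : (ℕ → unitInterval) → ℝ) :
    P.postMean g (fun u => c * f u) = c * P.postMean g f := by
  simp only [postMean, mul_left_comm _ c]
  rw [integral_const_mul, mul_div_assoc]

/-- A bound on the rewards and the rollout returns. -/
theorem exists_bound : ∃ C : ℝ, 0 ≤ C ∧ (∀ x a x', |P.M.r x a x'| ≤ C) ∧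
    ∀ K d x w u i, |P.S.rollout K d x w u i| ≤ C := by
  obtain ⟨C, hC⟩ := P.M.bounded_r
  obtain ⟨C', hC'⟩ := P.S.bounded_rollout
  exact ⟨|C| + |C'|, by positivity, fun x a x' => (hC x a x').trans
    ((le_abs_self C).trans (by linarith [abs_nonneg C'])), fun K d x w u i =>
    (hC' K d x w u i).trans ((le_abs_self C').trans (by linarith [abs_nonneg C]))⟩

/-- A bound on the rewards and the rollout returns. -/
def bound : ℝ := P.exists_bound.choose

theorem bound_nonneg : 0 ≤ P.bound := P.exists_bound.choose_spec.1

theorem abs_reward_le (x : X) (a : A) (x' : X) : |P.M.r x a x'| ≤ P.bound :=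
  P.exists_bound.choose_spec.2.1 x a x'

theorem abs_rollout_le (K d : ℕ) (x : Fin (K + 1) → X) (w : Fin (K + 1) → ℝ)
    (u : ℕ → unitInterval) (i : Fin (K + 1)) : |P.S.rollout K d x w u i| ≤ P.bound :=
  P.exists_bound.choose_spec.2.2 K d x w u i

theorem abs_gamma_pow_mul_le (n : ℕ) {y C : ℝ} (h : |y| ≤ C) : |P.M.γ ^ n * y| ≤ C := by
  rw [abs_mul, abs_of_nonneg (pow_nonneg P.M.γ_pos.le n)]
  exact (mul_le_of_le_one_left (abs_nonneg _) (pow_le_one₀ P.M.γ_pos.le P.M.γ_lt_one.le)).trans h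

theorem abs_acc_le (g : Hist A Z) (u : ℕ → unitInterval) (d : ℕ) :
    |P.acc g u d| ≤ g.length * P.bound := by
  induction g using List.reverseRecOn with
  | nil => simp [acc, traj]
  | append_singleton g az ih =>
    rcases le_or_gt d g.length with h | h
    · rw [P.acc_snoc _ _ _ _ h, List.length_append, List.length_singleton]
      refine (abs_add_le _ _).trans ?_
      have := P.abs_gamma_pow_mul_le (g.length - d)
        (P.abs_reward_le (P.pos g u) az.1 (P.nextPos g az.1 u))
      push_cast
      linarith
    · rw [P.acc_of_length_le _ _ (by simpa using h), abs_zero]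
      exact mul_nonneg (Nat.cast_nonneg _) P.bound_nonneg

/-! ### Measurability of the values and of tree policies. -/

section Policies

variable {π : Policy A Z}

/-- The expected return is measurable and bounded. -/
theorem expReturn_spec (hπ : ∀ a, Measurable fun g => π g a) (hπ1 : ∀ g, ∑ a, |π g a| ≤ 1) (k : ℕ) :
    (∀ a, Measurable fun p : Hist A Z × X => P.M.expReturn π k p.1 a p.2) ∧
      ∀ h a x, |P.M.expReturn π k h a x| ≤ k * P.bound := by
  induction k with
  | zero => exact ⟨fun a => measurable_const, fun h a x => by simp [POMDP.expReturn]⟩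
  | succ k ih =>
    obtain ⟨ihm, ihb⟩ := ih
    have hG : ∀ a, Measurable fun p : Hist A Z × Z × X => ∑ a', π (p.1 ++ [(a, p.2.1)]) a' *
        P.M.expReturn π k (p.1 ++ [(a, p.2.1)]) a' p.2.2 := by
      intro a
      have hs : Measurable fun p : Hist A Z × Z × X => p.1 ++ [(a, p.2.1)] :=
        measurable_append_singleton.comp (measurable_fst.prodMk
          (measurable_const.prodMk measurable_snd.fst))
      exact Finset.measurable_sum _ fun a' _ => ((hπ a').comp hs).mul
        ((ihm a').comp (hs.prodMk measurable_snd.snd))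
    have hGb : ∀ a h z x, |∑ a', π (h ++ [(a, z)]) a' *
        P.M.expReturn π k (h ++ [(a, z)]) a' x| ≤ k * P.bound := by
      intro a h z x
      refine (Finset.abs_sum_le_sum_abs _ _).trans ?_
      calc ∑ a', |π (h ++ [(a, z)]) a' * P.M.expReturn π k (h ++ [(a, z)]) a' x|
          ≤ ∑ a', |π (h ++ [(a, z)]) a'| * (k * P.bound) := Finset.sum_le_sum fun a' _ => by
            rw [abs_mul]; exact mul_le_mul_of_nonneg_left (ihb _ _ _) (abs_nonneg _)
        _ ≤ 1 * (k * P.bound) := by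
            rw [← Finset.sum_mul]
            exact mul_le_mul_of_nonneg_right (hπ1 _) (mul_nonneg (Nat.cast_nonneg _) P.bound_nonneg)
        _ = k * P.bound := one_mul _
    have hin : ∀ a, Measurable fun p : (Hist A Z × X) × X =>
        ∫ z, (∑ a', π (p.1.1 ++ [(a, z)]) a' * P.M.expReturn π k (p.1.1 ++ [(a, z)]) a' p.2)
          ∂(P.M.obs p.2) := by
      intro a
      -- Written over the seed of the sensor, the integrating measure no longer depends on the
      -- state, so measurability in the parameters follows from joint measurability of the
      -- integrand.
      have h1 : ∀ p : (Hist A Z × X) × X, ∫ z, (∑ a', π (p.1.1 ++ [(a, z)]) a' *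
          P.M.expReturn π k (p.1.1 ++ [(a, z)]) a' p.2) ∂(P.M.obs p.2) =
          ∫ v, (∑ a', π (p.1.1 ++ [(a, P.sim.sense p.2 v)]) a' *
            P.M.expReturn π k (p.1.1 ++ [(a, P.sim.sense p.2 v)]) a' p.2)
              ∂(volume : Measure unitInterval) := fun p =>
        P.integral_obs p.2 ((hG a).comp (measurable_const.prodMk
          (measurable_id.prodMk measurable_const)))
      simp_rw [h1]
      have h2 : Measurable fun q : ((Hist A Z × X) × X) × unitInterval =>
          ∑ a', π (q.1.1.1 ++ [(a, P.sim.sense q.1.2 q.2)]) a' *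
            P.M.expReturn π k (q.1.1.1 ++ [(a, P.sim.sense q.1.2 q.2)]) a' q.1.2 :=
        (hG a).comp (measurable_fst.fst.fst.prodMk ((P.sim.measurable_sense.comp
          (measurable_fst.snd.prodMk measurable_snd)).prodMk measurable_fst.snd))
      exact h2.stronglyMeasurable.integral_prod_right'.measurable
    have hstage : ∀ a, Measurable fun p : (Hist A Z × X) × X => P.M.r p.1.2 a p.2 + P.M.γ *
        ∫ z, (∑ a', π (p.1.1 ++ [(a, z)]) a' * P.M.expReturn π k (p.1.1 ++ [(a, z)]) a' p.2)
          ∂(P.M.obs p.2) := fun a =>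
      ((P.M.measurable_r a).comp (measurable_fst.snd.prodMk measurable_snd)).add
        ((hin a).const_mul _)
    constructor
    · intro a
      have h1 : ∀ p : Hist A Z × X, P.M.expReturn π (k + 1) p.1 a p.2 =
          ∫ v, (P.M.r p.2 a (P.sim.move p.2 a v) + P.M.γ *
            ∫ z, (∑ a', π (p.1 ++ [(a, z)]) a' * P.M.expReturn π k (p.1 ++ [(a, z)]) a'
              (P.sim.move p.2 a v)) ∂(P.M.obs (P.sim.move p.2 a v)))
                ∂(volume : Measure unitInterval) := fun p => by
        rw [POMDP.expReturn]
        exact P.integral_t p.2 a ((hstage a).comp (measurable_prodMk_left (x := p)))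
      simp_rw [h1]
      have h2 := (hstage a).comp ((measurable_fst (α := Hist A Z × X) (β := unitInterval)).prodMk
        ((P.sim.measurable_move a).comp (measurable_fst.snd.prodMk measurable_snd)))
      exact h2.stronglyMeasurable.integral_prod_right'.measurable
    · intro h a x
      rw [POMDP.expReturn]
      refine abs_integral_le_of_abs_le _ fun x' => ?_
      refine (abs_add_le _ _).trans ?_
      have h3 : |∫ z, (∑ a', π (h ++ [(a, z)]) a' * P.M.expReturn π k (h ++ [(a, z)]) a' x')
          ∂(P.M.obs x')| ≤ k * P.bound :=
        abs_integral_le_of_abs_le _ fun z => hGb a h z x'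
      have h4 := P.abs_gamma_pow_mul_le 1 h3
      rw [pow_one] at h4
      push_cast
      linarith [P.abs_reward_le x a x']

theorem measurable_expReturn_horizon (hπ : ∀ a, Measurable fun g => π g a)
    (hπ1 : ∀ g, ∑ a, |π g a| ≤ 1) (H : ℕ) (a : A) :
    Measurable fun p : Hist A Z × X => P.M.expReturn π (H - p.1.length) p.1 a p.2 :=
  measurable_of_countable_choice (c := fun p : Hist A Z × X => p.1.length)
    (f := fun n p => P.M.expReturn π (H - n) p.1 a p.2) (measurable_length.comp measurable_fst)
    fun n => (P.expReturn_spec hπ hπ1 (H - n)).1 a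

theorem actionValue_eq_postMean (hπ : ∀ a, Measurable fun g => π g a)
    (hπ1 : ∀ g, ∑ a, |π g a| ≤ 1) (H : ℕ) (g : Hist A Z) (a : A) :
    P.M.actionValue H π g a =
      P.postMean g fun u => P.M.expReturn π (H - g.length) g a (P.pos g u) := by
  exact P.integral_belief g
    (((P.expReturn_spec hπ hπ1 _).1 a).comp (measurable_prodMk_left (x := g)))

theorem measurable_actionValue (hπ : ∀ a, Measurable fun g => π g a)
    (hπ1 : ∀ g, ∑ a, |π g a| ≤ 1) (H : ℕ) (a : A) :
    Measurable fun g => P.M.actionValue H π g a := by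
  simp_rw [P.actionValue_eq_postMean hπ hπ1]
  exact P.measurable_postMean ((P.measurable_expReturn_horizon hπ hπ1 H a).comp
    (measurable_fst.prodMk P.measurable_pos))

end Policies

theorem actionValue_congr {H : ℕ} {π π' : Policy A Z} {g : Hist A Z} (hg : g.length ≤ H)
    (h : ∀ g' : Hist A Z, g.length < g'.length → g'.length < H → π g' = π' g') :
    P.M.actionValue H π g = P.M.actionValue H π' g := by
  funext a
  unfold POMDP.actionValue
  congr 1
  funext x
  exact expReturn_congr P.M π π' H _ g (by omega) h a x

/-- A tree policy agrees, below the horizon, with a measurable one. -/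
theorem exists_measurable_policy {H : ℕ} {π : Policy A Z} (hπ : IsTreePolicy P.M H P.εa P.s π) :
    ∃ π' : Policy A Z, IsTreePolicy P.M H P.εa P.s π' ∧ (∀ g, g.length < H → π' g = π g) ∧
      (∀ a, Measurable fun g => π' g a) ∧ (∀ g, ∑ a, |π' g a| ≤ 1) ∧
      ∀ g, g.length < H → ∑ a, π' g a = 1 := by
  classical
  -- A tree policy is arbitrary, possibly not measurable, at and beyond the horizon. There it is
  -- replaced by `0`, which affects no value at a history of length below `H`.
  obtain ⟨cut, hcutlt, hcutge⟩ : ∃ cut : Policy A Z → Policy A Z,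
      (∀ (ρ : Policy A Z) (g : Hist A Z), g.length < H → cut ρ g = ρ g) ∧
      ∀ (ρ : Policy A Z) (g : Hist A Z), ¬ g.length < H → cut ρ g = fun _ => 0 :=
    ⟨fun ρ g => if g.length < H then ρ g else fun _ => 0, fun ρ g hg => if_pos hg,
      fun ρ g hg => if_neg hg⟩
  have hlen : MeasurableSet {g : Hist A Z | g.length < H} :=
    measurableSet_lt measurable_length measurable_const
  have hcutm : ∀ {v : Hist A Z → A → ℝ}, Measurable v → ∀ a,
      Measurable fun g => cut (fun g => epsGreedy P.εa (v g)) g a := by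
    intro v hv a
    refine measurable_of_cases hlen ((measurable_epsGreedy P.εa a).comp hv)
      (measurable_const (a := (0 : ℝ))) (fun g hg => ?_) fun g hg => ?_
    · rw [hcutlt _ _ hg]; rfl
    · rw [hcutge _ _ hg]
  have hcut1 : ∀ (v : Hist A Z → A → ℝ) (g : Hist A Z),
      ∑ a, |cut (fun g => epsGreedy P.εa (v g)) g a| ≤ 1 := by
    intro v g
    by_cases hg : g.length < H
    · rw [hcutlt _ _ hg]
      simp only [abs_of_nonneg (epsGreedy_nonneg P.εa_pos.le P.εa_lt.le _ _)]
      exact (sum_epsGreedy _ _).le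
    · simp [hcutge _ _ hg]
  have hval : ∀ g : Hist A Z, g.length < H →
      P.M.actionValue H (cut π) g = P.M.actionValue H π g := fun g hg =>
    P.actionValue_congr hg.le fun g' _ h' => hcutlt π g' h'
  have hpol : ∃ v : Hist A Z → A → ℝ, Measurable v ∧
      cut π = cut fun g => epsGreedy P.εa (v g) := by
    rcases hs : P.s with _ | ⟨Q, hQ⟩
    · rw [hs] at hπ
      -- Backward induction from the horizon: the action values at a history involve the policy only
      -- at longer histories, so each round extends the agreement with `π` by one level and keeps
      -- measurability.
      have key : ∀ n : ℕ, ∃ ρ : Policy A Z, (∀ a, Measurable fun g => ρ g a) ∧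
          (∀ g, ∑ a, |ρ g a| ≤ 1) ∧ ∀ g, H ≤ g.length + n → g.length < H → ρ g = π g := by
        intro n
        induction n with
        | zero => exact ⟨fun _ _ => 0, fun a => measurable_const, by simp, fun g h1 h2 => by omega⟩
        | succ n ih =>
          obtain ⟨ρ, h1, h2, h3⟩ := ih
          refine ⟨cut fun g => epsGreedy P.εa (P.M.actionValue H ρ g),
            hcutm (measurable_pi_lambda _ fun a => P.measurable_actionValue h1 h2 H a),
            hcut1 _, fun g hg hg' => ?_⟩
          rw [hcutlt _ _ hg', hπ g hg', P.actionValue_congr hg'.le fun g' e1 e2 =>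
            h3 g' (by omega) e2]
      obtain ⟨ρ, h1, h2, h3⟩ := key H
      refine ⟨P.M.actionValue H ρ,
        measurable_pi_lambda _ fun a => P.measurable_actionValue h1 h2 H a, ?_⟩
      funext g
      by_cases hg : g.length < H
      · rw [hcutlt _ _ hg, hcutlt _ _ hg, hπ g hg, P.actionValue_congr hg.le fun g' _ e2 =>
          (h3 g' (by omega) e2).symm]
      · simp [hcutge _ _ hg]
    · rw [hs] at hπ
      refine ⟨Q, measurable_pi_lambda _ fun a => measurable_hist_of_actions
        (f := fun g => Q g a) fun as => hQ as a, ?_⟩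
      funext g
      by_cases hg : g.length < H
      · rw [hcutlt _ _ hg, hcutlt _ _ hg, hπ g hg]
      · simp [hcutge _ _ hg]
  obtain ⟨v, hv, hcv⟩ := hpol
  refine ⟨cut π, ?_, hcutlt π, ?_, ?_, ?_⟩
  · rcases hs : P.s with _ | ⟨Q, hQ⟩
    · rw [hs] at hπ
      exact fun g hg => by rw [hcutlt _ _ hg, hval g hg]; exact hπ g hg
    · rw [hs] at hπ
      exact fun g hg => by rw [hcutlt _ _ hg]; exact hπ g hg
  · rw [hcv]; exact hcutm hv
  · rw [hcv]; exact hcut1 v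
  · intro g hg
    rw [hcv, hcutlt _ _ hg]
    exact sum_epsGreedy _ _

end Planner

/-! ### Recursive relations between the values of nodes -/

/-- A measurable policy that follows proper action probabilities below the horizon `H`. -/
structure MeasurablePolicy {A Z : Type*} [MeasurableSpace Z] [MeasurableSpace A] [Fintype A]
    (H : ℕ) (π : Policy A Z) : Prop where
  measurable : ∀ a, Measurable fun g => π g a
  sum_abs_le : ∀ g, ∑ a, |π g a| ≤ 1
  sum_eq : ∀ g, g.length < H → ∑ a, π g a = 1

namespace Planner

variable {X A Z : Type*} [MeasurableSpace X] [MeasurableSpace Z] [Fintype A] [Nonempty A]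
  [MeasurableSpace A] [DiscreteMeasurableSpace A] (P : Planner X A Z) {H : ℕ} {π : Policy A Z}

/-- The expected return when the policy is followed from the state `x` after the history `g`. -/
def stateValue (H : ℕ) (π : Policy A Z) (g : Hist A Z) (x : X) : ℝ :=
  ∑ a, π g a * P.M.expReturn π (H - g.length) g a x

/-- The expected discounted rewards from depth `d ≤ |g|`, given the history `g`, when the policy
is followed after `g`. -/
def nodeMean (H : ℕ) (π : Policy A Z) (d : ℕ) (g : Hist A Z) : ℝ :=
  P.postMean g fun u => P.acc g u d + P.M.γ ^ (g.length - d) * P.stateValue H π g (P.pos g u)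

/-- The expected discounted rewards from depth `d ≤ |g|`, given the history `g`, when the action
`a` is executed first. -/
def branchMean (H : ℕ) (π : Policy A Z) (d : ℕ) (g : Hist A Z) (a : A) : ℝ :=
  P.postMean g fun u => P.acc g u d +
    P.M.γ ^ (g.length - d) * P.M.expReturn π (H - g.length) g a (P.pos g u)

variable (hπ : MeasurablePolicy H π)

section

include hπ

theorem measurable_stateValue :
    Measurable fun p : Hist A Z × X => P.stateValue H π p.1 p.2 :=
  Finset.measurable_sum _ fun a _ => ((hπ.measurable a).comp measurable_fst).mul
    (P.measurable_expReturn_horizon hπ.measurable hπ.sum_abs_le H a)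

theorem abs_expReturn_le (g : Hist A Z) (a : A) (x : X) :
    |P.M.expReturn π (H - g.length) g a x| ≤ H * P.bound :=
  ((P.expReturn_spec hπ.measurable hπ.sum_abs_le _).2 g a x).trans
    (mul_le_mul_of_nonneg_right (by exact_mod_cast Nat.sub_le _ _) P.bound_nonneg)

theorem abs_stateValue_le (g : Hist A Z) (x : X) : |P.stateValue H π g x| ≤ H * P.bound := by
  have hb : 0 ≤ H * P.bound := mul_nonneg (Nat.cast_nonneg _) P.bound_nonneg
  refine (Finset.abs_sum_le_sum_abs _ _).trans ?_
  calc ∑ a, |π g a * P.M.expReturn π (H - g.length) g a x|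
      ≤ ∑ a, |π g a| * (H * P.bound) := Finset.sum_le_sum fun a _ => by
        rw [abs_mul]
        exact mul_le_mul_of_nonneg_left (P.abs_expReturn_le hπ g a x) (abs_nonneg _)
    _ ≤ H * P.bound := by
        rw [← Finset.sum_mul]
        exact mul_le_of_le_one_left hb (hπ.sum_abs_le g)

theorem measurable_nodeMean (d : ℕ) : Measurable (P.nodeMean H π d) := by
  refine P.measurable_postMean ?_
  have h1 : Measurable fun p : Hist A Z × (ℕ → unitInterval) => P.M.γ ^ (p.1.length - d) :=
    (measurable_from_top (f := fun n : ℕ => P.M.γ ^ (n - d))).comp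
      (measurable_length.comp measurable_fst)
  exact (P.measurable_acc d).add (h1.mul ((P.measurable_stateValue hπ).comp
    (measurable_fst.prodMk P.measurable_pos)))

theorem abs_total_le (g : Hist A Z) (d : ℕ) (u : ℕ → unitInterval) (x : X) :
    |P.acc g u d + P.M.γ ^ (g.length - d) * P.stateValue H π g x| ≤
      (g.length + H) * P.bound := by
  refine (abs_add_le _ _).trans ?_
  have := P.abs_gamma_pow_mul_le (g.length - d) (P.abs_stateValue_le hπ g x)
  linarith [P.abs_acc_le g u d]

theorem abs_nodeMean_le (d : ℕ) (g : Hist A Z) :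
    |P.nodeMean H π d g| ≤ (g.length + H) * P.bound :=
  P.abs_postMean_le g (mul_nonneg (by positivity) P.bound_nonneg) fun u =>
    P.abs_total_le hπ g d u _

theorem branchMean_self (g : Hist A Z) (a : A) :
    P.branchMean H π g.length g a = P.M.actionValue H π g a := by
  rw [P.actionValue_eq_postMean hπ.measurable hπ.sum_abs_le, branchMean]
  simp [P.acc_of_length_le g _ le_rfl]

/-- The accumulated part does not depend on `a`. Hence differences between actions are, up to a
power of `γ`, differences of action values at the node, whichever depth the return is measured from.
-/
theorem branchMean_eq {g : Hist A Z} (hg : P.mass g ≠ ∞) (d : ℕ) (a : A) :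
    P.branchMean H π d g a = P.postMean g (fun u => P.acc g u d) +
      P.M.γ ^ (g.length - d) * P.M.actionValue H π g a := by
  have hm : Measurable fun u => P.M.expReturn π (H - g.length) g a (P.pos g u) :=
    ((P.expReturn_spec hπ.measurable hπ.sum_abs_le _).1 a).comp
      ((measurable_const (a := g)).prodMk (P.measurable_pos_right g))
  rw [branchMean, P.postMean_add hg (P.measurable_acc_right g d) (hm.const_mul _)
    (fun u => P.abs_acc_le g u d)
    (fun u => P.abs_gamma_pow_mul_le _ (P.abs_expReturn_le hπ g a _)),
    P.postMean_const_mul, P.actionValue_eq_postMean hπ.measurable hπ.sum_abs_le]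

/-- The action probabilities sum to `1`, so the part accumulated before the node may be distributed
over the actions. -/
theorem nodeMean_eq_sum {g : Hist A Z} (hg : P.mass g ≠ ∞) (hH : g.length < H) (d : ℕ) :
    P.nodeMean H π d g = ∑ a, π g a * P.branchMean H π d g a := by
  simp only [nodeMean, branchMean, postMean, mul_div_assoc', ← integral_const_mul]
  rw [← Finset.sum_div, ← integral_finsetSum]
  · congr 1
    refine integral_congr_ae (Eventually.of_forall fun u => ?_)
    simp only [stateValue]
    have : ∀ a, π g a * (P.wt g u * (P.acc g u d + P.M.γ ^ (g.length - d) *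
        P.M.expReturn π (H - g.length) g a (P.pos g u))) = π g a * (P.wt g u * P.acc g u d) +
          P.wt g u * P.M.γ ^ (g.length - d) *
            (π g a * P.M.expReturn π (H - g.length) g a (P.pos g u)) := fun a => by ring
    simp only [this, Finset.sum_add_distrib, ← Finset.mul_sum, ← Finset.sum_mul]
    rw [hπ.sum_eq g hH]
    ring
  · intro a _
    have hm : Measurable fun u => P.M.expReturn π (H - g.length) g a (P.pos g u) :=
      ((P.expReturn_spec hπ.measurable hπ.sum_abs_le _).1 a).comp
        ((measurable_const (a := g)).prodMk (P.measurable_pos_right g))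
    refine (P.integrable_wt_mul hg ((P.measurable_acc_right g d).add (hm.const_mul _))
      (C := g.length * P.bound + H * P.bound) fun u => ?_).const_mul _
    exact (abs_add_le _ _).trans (add_le_add (P.abs_acc_le g u d)
      (P.abs_gamma_pow_mul_le _ (P.abs_expReturn_le hπ g a _)))

theorem nodeMean_self {g : Hist A Z} (hg : P.mass g ≠ ∞) (hH : g.length < H) :
    P.nodeMean H π g.length g = P.M.value H π g := by
  rw [P.nodeMean_eq_sum hπ hg hH, POMDP.value]
  simp only [P.branchMean_self hπ]

/-- The stage reward and the value of the next node. -/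
theorem expReturn_eq {g : Hist A Z} (hH : g.length < H) (a : A) (x : X) :
    P.M.expReturn π (H - g.length) g a x = ∫ x', (P.M.r x a x' + P.M.γ *
      ∫ z, P.stateValue H π (g ++ [(a, z)]) x' ∂P.M.obs x') ∂P.M.t a x := by
  obtain ⟨k, hk⟩ : ∃ k, H - g.length = k + 1 := ⟨H - g.length - 1, by omega⟩
  rw [hk, POMDP.expReturn]
  simp only [stateValue, List.length_append, List.length_singleton,
    show H - (g.length + 1) = k by omega]

/-- The mass after `z` in the predictive density cancels the normalisation of the posterior mean;
what is left is a double integral of a bounded function against integrable weights, where the order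
may be exchanged. -/
theorem integral_mass_snoc_nodeMean (d : ℕ) {g : Hist A Z} (hg : P.Nondegenerate g) (a : A) :
    ∫ z, P.nodeMean H π d (g ++ [(a, z)]) ∂P.pred g a =
      (∫ u, ∫ z, P.wt (g ++ [(a, z)]) u * (P.acc (g ++ [(a, z)]) u d +
        P.M.γ ^ (g.length + 1 - d) * P.stateValue H π (g ++ [(a, z)]) (P.nextPos g a u)) ∂P.M.ν
          ∂particleLaw) / (P.mass g).toReal := by
  have hs := measurable_snoc g a
  have hm : Measurable fun z => P.mass (g ++ [(a, z)]) := P.measurable_mass.comp hs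
  have hfin : ∀ᵐ z ∂P.M.ν, P.mass (g ++ [(a, z)]) < ∞ := by
    have h1 := P.lintegral_mass_snoc g a (f := fun _ => 1) measurable_const
    simp only [lintegral_one, measure_univ, mul_one] at h1
    exact ae_lt_top hm (h1.trans_ne hg.2)
  set R : Z → (ℕ → unitInterval) → ℝ := fun z u => P.acc (g ++ [(a, z)]) u d +
    P.M.γ ^ (g.length + 1 - d) * P.stateValue H π (g ++ [(a, z)]) (P.nextPos g a u) with hR
  have hgz : Measurable fun p : Z × (ℕ → unitInterval) => (g ++ [(a, p.1)], p.2) :=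
    (hs.comp measurable_fst).prodMk measurable_snd
  have hnext : Measurable fun p : Z × (ℕ → unitInterval) => P.nextPos g a p.2 :=
    (P.measurable_nextPos_right g a).comp measurable_snd
  have hRm : Measurable (Function.uncurry R) :=
    ((P.measurable_acc d).comp hgz).add (((P.measurable_stateValue hπ).comp
      (hgz.fst.prodMk hnext)).const_mul _)
  have hRb : ∀ z u, |R z u| ≤ ((g.length + 1 : ℕ) + H) * P.bound := by
    intro z u
    have := P.abs_total_le hπ (g ++ [(a, z)]) d u (P.nextPos g a u)
    simpa only [hR, List.length_append, List.length_singleton] using this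
  have hwm : Measurable fun p : Z × (ℕ → unitInterval) => P.wt (g ++ [(a, p.1)]) p.2 :=
    P.measurable_wt.comp hgz
  rw [pred, integral_withDensity_eq_integral_toReal_smul (hm.div_const _) (by
    filter_upwards [hfin] with z hz
    exact ENNReal.div_lt_top hz.ne hg.1)]
  have e1 : ∫ z, (P.mass (g ++ [(a, z)]) / P.mass g).toReal • P.nodeMean H π d (g ++ [(a, z)])
      ∂P.M.ν = ∫ z, (∫ u, P.wt (g ++ [(a, z)]) u * R z u ∂particleLaw) / (P.mass g).toReal
        ∂P.M.ν := by
    refine integral_congr_ae ?_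
    filter_upwards [hfin] with z hz
    have hpos : ∀ u, P.pos (g ++ [(a, z)]) u = P.nextPos g a u := fun u => P.pos_snoc g a z u
    simp only [nodeMean, postMean, hpos, List.length_append, List.length_singleton, smul_eq_mul,
      ENNReal.toReal_div, hR]
    -- Without mass there is nothing to cancel, but then the weights vanish almost surely and both
    -- sides are `0`.
    by_cases h0 : (P.mass (g ++ [(a, z)])).toReal = 0
    · have hz0 : P.mass (g ++ [(a, z)]) = 0 := by
        rcases (ENNReal.toReal_eq_zero_iff _).1 h0 with h | h
        · exact h
        · exact absurd h hz.ne
      have hw0 : ∀ᵐ u ∂particleLaw, P.wt (g ++ [(a, z)]) u = 0 := by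
        have := (lintegral_eq_zero_iff (P.measurable_wt_right _).coe_nnreal_ennreal).1 hz0
        filter_upwards [this] with u hu
        simpa using hu
      rw [h0, zero_div, zero_mul, integral_eq_zero_of_ae, zero_div]
      filter_upwards [hw0] with u hu
      simp [hu]
    · field_simp
  rw [e1, integral_div, integral_integral_swap]
  refine Integrable.mul_bdd (c := ((g.length + 1 : ℕ) + H) * P.bound) ?_ hRm.aestronglyMeasurable
    (Eventually.of_forall fun p => hRb _ _)
  refine ⟨hwm.coe_nnreal_real.aestronglyMeasurable, ?_⟩
  rw [hasFiniteIntegral_iff_ofReal (Eventually.of_forall fun u => NNReal.coe_nonneg _)]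
  simp only [ENNReal.ofReal_coe_nnreal]
  rw [lintegral_prod _ hwm.coe_nnreal_ennreal.aemeasurable]
  have h1 := P.lintegral_mass_snoc g a (f := fun _ => 1) measurable_const
  simp only [lintegral_one, measure_univ, mul_one] at h1
  exact lt_of_eq_of_lt h1 (lt_top_iff_ne_top.2 hg.2)

/-- The value of a belief-action node is the mean value of the belief nodes below it. -/
theorem integral_nodeMean {d : ℕ} {g : Hist A Z} (hg : P.Nondegenerate g) (hd : d ≤ g.length)
    (hH : g.length < H) (a : A) :
    ∫ z, P.nodeMean H π d (g ++ [(a, z)]) ∂P.pred g a = P.branchMean H π d g a := by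
  rw [P.integral_mass_snoc_nodeMean hπ d hg a, branchMean, postMean]
  congr 1
  have hsz : ∀ x', Measurable fun z => P.stateValue H π (g ++ [(a, z)]) x' := fun x' =>
    (P.measurable_stateValue hπ).comp ((measurable_snoc g a).prodMk measurable_const)
  set V : X → ℝ := fun x' => ∫ z, P.stateValue H π (g ++ [(a, z)]) x' ∂P.M.obs x' with hV
  have hVm : Measurable V := by
    simp_rw [hV, P.integral_obs _ (hsz _)]
    have : Measurable fun p : X × unitInterval =>
        P.stateValue H π (g ++ [(a, P.sim.sense p.1 p.2)]) p.1 :=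
      (P.measurable_stateValue hπ).comp (((measurable_snoc g a).comp
        P.sim.measurable_sense).prodMk measurable_fst)
    exact this.stronglyMeasurable.integral_prod_right'.measurable
  have hVb : ∀ x', |V x'| ≤ H * P.bound := fun x' =>
    abs_integral_le_of_abs_le _ fun z => P.abs_stateValue_le hπ _ x'
  -- For a fixed sample, the last factor of its weight is the density of the measurement law in its
  -- next state, so integrating against `ν` averages over the measurement.
  have inner : ∀ u, ∫ z, P.wt (g ++ [(a, z)]) u * (P.acc (g ++ [(a, z)]) u d +
      P.M.γ ^ (g.length + 1 - d) * P.stateValue H π (g ++ [(a, z)]) (P.nextPos g a u)) ∂P.M.ν =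
      P.wt g u * (P.acc g u d + P.M.γ ^ (g.length - d) *
        (P.M.r (P.pos g u) a (P.nextPos g a u) + P.M.γ * V (P.nextPos g a u))) := by
    intro u
    have ho : Measurable fun z => P.M.o (P.nextPos g a u) z :=
      P.measurable_lik.comp (measurable_prodMk_left (x := P.nextPos g a u))
    have e : ∀ z, (P.wt (g ++ [(a, z)]) u : ℝ) * (P.acc (g ++ [(a, z)]) u d +
        P.M.γ ^ (g.length + 1 - d) * P.stateValue H π (g ++ [(a, z)]) (P.nextPos g a u)) =
        P.wt g u * (P.M.o (P.nextPos g a u) z • (P.acc g u d + P.M.γ ^ (g.length - d) *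
          (P.M.r (P.pos g u) a (P.nextPos g a u) +
            P.M.γ * P.stateValue H π (g ++ [(a, z)]) (P.nextPos g a u)))) := by
      intro z
      rw [P.wt_snoc, P.acc_snoc _ _ _ _ hd, Nat.succ_sub hd, pow_succ, NNReal.smul_def, smul_eq_mul,
        NNReal.coe_mul]
      ring
    simp only [e]
    rw [integral_const_mul, ← integral_withDensity_eq_integral_smul ho, ← POMDP.obs]
    have hi : Integrable (fun z => P.stateValue H π (g ++ [(a, z)]) (P.nextPos g a u))
        (P.M.obs (P.nextPos g a u)) := Integrable.of_bound (hsz _).aestronglyMeasurable _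
      (Eventually.of_forall fun z => P.abs_stateValue_le hπ _ _)
    have hi2 : Integrable (fun z => P.M.γ ^ (g.length - d) * (P.M.r (P.pos g u) a (P.nextPos g a u) +
        P.M.γ * P.stateValue H π (g ++ [(a, z)]) (P.nextPos g a u)))
        (P.M.obs (P.nextPos g a u)) := ((integrable_const _).add (hi.const_mul _)).const_mul _
    rw [integral_add (integrable_const _) hi2, integral_const_mul, integral_add (integrable_const _) (hi.const_mul _), integral_const_mul]
    simp [hV]
  simp only [inner]
  have hb : ∀ u, |P.acc g u d + P.M.γ ^ (g.length - d) *
      (P.M.r (P.pos g u) a (P.nextPos g a u) + P.M.γ * V (P.nextPos g a u))| ≤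
      g.length * P.bound + (P.bound + H * P.bound) := fun u => by
    refine (abs_add_le _ _).trans (add_le_add (P.abs_acc_le g u d)
      (P.abs_gamma_pow_mul_le _ ((abs_add_le _ _).trans (add_le_add (P.abs_reward_le _ _ _) ?_))))
    have := P.abs_gamma_pow_mul_le 1 (hVb (P.nextPos g a u))
    rwa [pow_one] at this
  have hrm : Measurable fun u => P.M.r (P.pos g u) a (P.nextPos g a u) :=
    (P.M.measurable_r a).comp ((P.measurable_pos_right g).prodMk (P.measurable_nextPos_right g a))
  have hI := P.integrable_wt_mul hg.2 ((P.measurable_acc_right g d).add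
    ((hrm.add ((hVm.comp (P.measurable_nextPos_right g a)).const_mul P.M.γ)).const_mul
      (P.M.γ ^ (g.length - d)))) hb
  -- Resampling the seed of the last transition turns the next state into an integral over the
  -- transition kernel, which is the recursion defining `expReturn`.
  refine (integral_update (g.length + 1) hI).trans (integral_congr_ae
    (Eventually.of_forall fun u => ?_))
  simp only [Function.comp, Pi.add_apply, wt_update, acc_update, pos_update, nextPos_update]
  have hrm' : Measurable fun v => P.M.r (P.pos g u) a (P.sim.move (P.pos g u) a v) :=
    (P.M.measurable_r a).comp (measurable_const.prodMk (P.measurable_move_right _ a))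
  have hVm' : Measurable fun v => V (P.sim.move (P.pos g u) a v) :=
    hVm.comp (P.measurable_move_right _ a)
  have hi : Integrable (fun v => P.M.r (P.pos g u) a (P.sim.move (P.pos g u) a v) +
      P.M.γ * V (P.sim.move (P.pos g u) a v)) (volume : Measure unitInterval) :=
    (Integrable.of_bound hrm'.aestronglyMeasurable P.bound
      (Eventually.of_forall fun v => P.abs_reward_le _ _ _)).add
      ((Integrable.of_bound hVm'.aestronglyMeasurable _
        (Eventually.of_forall fun v => hVb _)).const_mul _)
  rw [integral_const_mul, integral_add (integrable_const _) (hi.const_mul _), integral_const_mul,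
    P.expReturn_eq hπ hH]
  have hst : Measurable fun x' => P.M.r (P.pos g u) a x' + P.M.γ * V x' :=
    ((P.M.measurable_r a).comp (measurable_prodMk_left (x := P.pos g u))).add (hVm.const_mul _)
  have := P.integral_t (P.pos g u) a hst
  simp only [hV] at this ⊢
  rw [this]
  simp

end

end Planner

/-! ### The evolution of the children of a node -/

theorem sum_branchProb {εz : ℝ} (n : ℕ) :
    ∑ j ∈ Finset.range (n + 1), branchProb εz n j = 1 := by
  rw [Finset.sum_range_succ]
  have h1 : ∑ j ∈ Finset.range n, branchProb εz n j =
      ∑ j ∈ Finset.range n, (1 - ((n : ℝ) + 1) ^ εz) / n :=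
    Finset.sum_congr rfl fun j hj => by simp [branchProb, Finset.mem_range.1 hj]
  rw [h1, Finset.sum_const, Finset.card_range, nsmul_eq_mul]
  simp only [branchProb, lt_irrefl, if_false]
  rcases Nat.eq_zero_or_pos n with rfl | hn
  · simp
  · have : (n : ℝ) ≠ 0 := by positivity
    field_simp
    ring

/-- An existing branch requires `n ≥ 1`, so the spawn probability is at most `2 ^ εz < 1`. For a new
branch, `-1 ≤ εz` gives `(n + 1) ^ εz ≥ 1 / (n + 1)`. The common order `1 / (n + 1)` is just large
enough for a divergent series. -/
theorem branchProb_ge {εz : ℝ} (h1 : -1 ≤ εz) (h0 : εz < 0) {n j : ℕ} (hj : j ≤ n) :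
    (1 - (2 : ℝ) ^ εz) / ((n : ℝ) + 1) ≤ branchProb εz n j := by
  have hn1 : (1 : ℝ) ≤ (n : ℝ) + 1 := by linarith [Nat.cast_nonneg (α := ℝ) n]
  have h2 : (2 : ℝ) ^ εz < 1 := Real.rpow_lt_one_of_one_lt_of_neg one_lt_two h0
  rcases hj.lt_or_eq with hj | rfl
  · rw [branchProb, if_pos hj]
    have hn : (1 : ℝ) ≤ n := by exact_mod_cast (show 1 ≤ n by omega)
    have h3 : ((n : ℝ) + 1) ^ εz ≤ 2 ^ εz :=
      Real.rpow_le_rpow_of_nonpos two_pos (by linarith) h0.le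
    exact div_le_div₀ (by linarith) (by linarith) (by linarith) (by linarith)
  · rw [branchProb, if_neg (lt_irrefl _)]
    have h3 : ((j : ℝ) + 1) ^ (-1 : ℝ) ≤ ((j : ℝ) + 1) ^ εz := Real.rpow_le_rpow_of_exponent_le hn1 h1
    rw [Real.rpow_neg_one] at h3
    refine le_trans ?_ h3
    rw [inv_eq_one_div]
    exact div_le_div_of_nonneg_right (by linarith [Real.rpow_pos_of_pos two_pos εz]) (by linarith)

/-- A history together with the search tree below it. -/
abbrev LocalState (A Z : Type*) := Hist A Z × SearchTree A Z

namespace Planner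

variable {X A Z : Type*} [MeasurableSpace X] [MeasurableSpace Z] [Fintype A] [Nonempty A]
  [MeasurableSpace A] [DiscreteMeasurableSpace A] (P : Planner X A Z) {K : ℕ}

/-- The initial tree. -/
def emptyTree : SearchTree A Z where
  nodes := ∅
  branches _ _ := []
  visits _ _ := P.S.visitsInit
  value _ _ := P.S.valueInit

/-- The tree after the first episode of `k` further steps. -/
def seedTree : ℕ → SearchTree A Z
  | 0 => P.emptyTree
  | _ + 1 => P.emptyTree.expand []

theorem run_emptyTree (k : ℕ) (g : Hist A Z) (ξ : Noise K) :
    (P.run k g P.emptyTree ξ).tree = P.seedTree k := by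
  cases k with
  | zero => rfl
  | succ k =>
    rw [P.run_of_not_mem k g (by simp [emptyTree])]
    rfl

/-- The trees that occur in episodes of `k` further steps, after the expansion of the root. -/
def Inv : ℕ → SearchTree A Z → Prop
  | 0, T => T = P.emptyTree
  | k + 1, T => [] ∈ T.nodes ∧
      (∀ a j, j < (T.branches [] a).length → Inv k (T.sub [(a, j)])) ∧
      (∀ a j, (T.branches [] a).length ≤ j → T.sub [(a, j)] = P.emptyTree) ∧
      ∀ a, P.S.visitsInit ≤ T.visits [] a

theorem inv_seedTree (k : ℕ) : P.Inv k (P.seedTree k) := by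
  cases k with
  | zero => rfl
  | succ k =>
    refine ⟨by simp [seedTree, SearchTree.expand], fun a j hj => ?_, fun a j _ => ?_, fun a => le_rfl⟩
    · simp [seedTree, SearchTree.expand, emptyTree] at hj
    · simp [seedTree, SearchTree.expand, emptyTree, SearchTree.sub]

/-- The number of branches of the action `a` at the root. -/
def numBranches (a : A) (q : LocalState A Z) : ℕ := (q.2.branches [] a).length

/-- The branch `j` of the action `a`, with the tree below it. -/
def kid (a : A) (j : ℕ) (q : LocalState A Z) : LocalState A Z :=
  (q.1 ++ [(a, (q.2.branches [] a).getD j (P.sim.sense (P.sim.start 0) 0))], q.2.sub [(a, j)])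

/-- The state after an episode that takes the branch `j` of the action `a`. -/
def stepTo (k : ℕ) (a : A) (j : ℕ) (q : LocalState A Z) (ξ : Noise K) : LocalState A Z :=
  (q.1, P.stepAt k q.1 q.2 a j ξ)

/-- The state of a newly created branch of the action `a`. -/
def newKid (k : ℕ) (g : Hist A Z) (a : A) (ξ : Noise K) : LocalState A Z :=
  (g ++ [(a, P.newMeas g a ξ)], P.seedTree k)

theorem measurable_numBranches (a : A) : Measurable (numBranches (Z := Z) a) :=
  measurable_length.comp ((SearchTree.measurable_branches [] a).comp measurable_snd)

theorem measurable_kid (a : A) (j : ℕ) : Measurable (P.kid a j) :=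
  (measurable_append_singleton.comp (measurable_fst.prodMk (measurable_const.prodMk
    ((measurable_getD_prod j).comp (((SearchTree.measurable_branches [] a).comp
      measurable_snd).prodMk measurable_const))))).prodMk
    ((SearchTree.measurable_sub _).comp measurable_snd)

theorem measurable_newKid (k : ℕ) (g : Hist A Z) (a : A) :
    Measurable (P.newKid k g a : Noise K → LocalState A Z) :=
  ((measurable_snoc g a).comp (P.measurable_newMeas_right g a)).prodMk measurable_const

theorem measurable_stepTo (k : ℕ) (a : A) (j : ℕ) :
    Measurable fun p : LocalState A Z × Noise K => P.stepTo k a j p.1 p.2 := by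
  have hin : Measurable fun p : LocalState A Z × Noise K => ((p.1.1, p.1.2, p.2) : RunInput A Z K) :=
    measurable_fst.fst.prodMk (measurable_fst.snd.prodMk measurable_snd)
  have hchild : Measurable fun p : RunInput A Z K =>
      ((p.1 ++ [(a, P.measAt p.1 p.2.1 a j p.2.2)], p.2.1.sub [(a, j)], p.2.2) :
        RunInput A Z K) :=
    (P.measurable_snoc_measAt a j).prodMk (((SearchTree.measurable_sub _).comp
      measurable_snd.fst).prodMk measurable_snd.snd)
  have hret : Measurable fun p : RunInput A Z K => P.returnAt k p.1 p.1.length p.2.1 a j p.2.2 :=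
    measurable_of_countable_choice (c := fun p : RunInput A Z K => p.1.length)
      (f := fun d p => P.returnAt k p.1 d p.2.1 a j p.2.2) (measurable_length.comp measurable_fst)
      fun d => P.measurable_returnAt k d a j
  exact measurable_fst.fst.prodMk ((SearchTree.measurable_graft measurable_snd.fst
    ((P.measurable_run k).2.2.comp hchild) (P.measurable_branchesAt a j) hret a j).comp hin)

theorem measurable_stepTo_right (k : ℕ) (a : A) (j : ℕ) (q : LocalState A Z) :
    Measurable fun ξ : Noise K => P.stepTo k a j q ξ :=
  (P.measurable_stepTo k a j).comp (measurable_prodMk_left (x := q))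

theorem localStep_succ (k : ℕ) {q : LocalState A Z} (hq : [] ∈ q.2.nodes) (ξ : Noise K) :
    P.localStep K (k + 1) q ξ = P.stepTo k (P.pick q.1 q.2 ξ)
      (P.pickBranch q.1 q.2 (P.pick q.1 q.2 ξ) ξ) q ξ := by
  rw [localStep, P.run_tree_succ k q.1 hq]
  rfl

/-! ### The effect of one episode on the branches and statistics of the root. -/

section Step

variable (k : ℕ) (a : A) (j : ℕ) (q : LocalState A Z) (ξ : Noise K)

theorem branchesAt_of_lt (h : j < numBranches a q) :
    P.branchesAt q.1 q.2 a j ξ = q.2.branches [] a := if_pos h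

theorem branchesAt_new : P.branchesAt q.1 q.2 a (numBranches a q) ξ =
    q.2.branches [] a ++ [P.newMeas q.1 a ξ] := if_neg (lt_irrefl _)

theorem stepTo_branches_self :
    (P.stepTo k a j q ξ).2.branches [] a = P.branchesAt q.1 q.2 a j ξ := by
  simp [stepTo, stepAt, SearchTree.graft]

theorem stepTo_branches_of_ne {b : A} (h : b ≠ a) :
    (P.stepTo k a j q ξ).2.branches [] b = q.2.branches [] b := by
  simp [stepTo, stepAt, SearchTree.graft, h]

theorem numBranches_stepTo_of_ne {b : A} (h : b ≠ a) :
    numBranches b (P.stepTo k a j q ξ) = numBranches b q := by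
  rw [numBranches, P.stepTo_branches_of_ne k a j q ξ h, numBranches]

theorem numBranches_stepTo_of_lt (h : j < numBranches a q) :
    numBranches a (P.stepTo k a j q ξ) = numBranches a q := by
  rw [numBranches, stepTo_branches_self, P.branchesAt_of_lt a j q ξ h, numBranches]

theorem numBranches_stepTo_new :
    numBranches a (P.stepTo k a (numBranches a q) q ξ) = numBranches a q + 1 := by
  rw [numBranches, stepTo_branches_self, branchesAt_new,
    List.length_append, List.length_singleton, numBranches]

theorem kid_stepTo_of_ne {b : A} {i : ℕ} (h : (b, i) ≠ (a, j)) (hi : i < numBranches b q) :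
    P.kid b i (P.stepTo k a j q ξ) = P.kid b i q := by
  have hs : (P.stepTo k a j q ξ).2.sub [(b, i)] = q.2.sub [(b, i)] :=
    SearchTree.sub_graft_of_ne _ _ _ _ _ _ h
  rw [kid, kid, hs]
  by_cases hb : b = a
  · subst hb
    have hi' : i < (q.2.branches [] b).length := hi
    rw [stepTo_branches_self, branchesAt]
    split_ifs
    · rfl
    · rw [List.getD_eq_getElem?_getD, List.getElem?_append_left hi', ← List.getD_eq_getElem?_getD]
      rfl
  · rw [P.stepTo_branches_of_ne k a j q ξ hb]; rfl

/-- This is the self-similarity behind the induction: a branch that is taken makes one step of its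
own iteration, driven by the same random numbers. -/
theorem kid_stepTo_self (h : j < numBranches a q) :
    P.kid a j (P.stepTo k a j q ξ) = P.localStep K k (P.kid a j q) ξ := by
  have hs : (P.stepTo k a j q ξ).2.sub [(a, j)] = (P.child k q.1 q.2 a j ξ).tree :=
    SearchTree.sub_graft_self _ _ _ _ _ _
  have hm : P.measAt q.1 q.2 a j ξ =
      (q.2.branches [] a).getD j (P.sim.sense (P.sim.start 0) 0) := by
    have h' : j < (q.2.branches [] a).length := h
    rw [measAt, List.getD_eq_getElem _ _ h', List.getD_eq_getElem _ _ h']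
  rw [kid, hs, stepTo_branches_self, P.branchesAt_of_lt a j q ξ h, localStep, child, hm]
  rfl

theorem kid_stepTo_new (h : q.2.sub [(a, numBranches a q)] = P.emptyTree) :
    P.kid a (numBranches a q) (P.stepTo k a (numBranches a q) q ξ) = P.newKid k q.1 a ξ := by
  have hs : (P.stepTo k a (numBranches a q) q ξ).2.sub [(a, numBranches a q)] =
      (P.child k q.1 q.2 a (numBranches a q) ξ).tree := SearchTree.sub_graft_self _ _ _ _ _ _
  rw [kid, hs, child, h, run_emptyTree, stepTo_branches_self, branchesAt_new,
    newKid]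
  have e : (q.2.branches [] a ++ [P.newMeas q.1 a ξ]).getD (numBranches a q)
      (P.sim.sense (P.sim.start 0) 0) = P.newMeas q.1 a ξ := by
    simp [numBranches, List.getD_eq_getElem?_getD]
  rw [e]
  rfl

theorem stepTo_visits_self : (P.stepTo k a j q ξ).2.visits [] a = q.2.visits [] a + 1 := by
  simp [stepTo, stepAt, SearchTree.graft]

theorem stepTo_visits_of_ne {b : A} (h : b ≠ a) :
    (P.stepTo k a j q ξ).2.visits [] b = q.2.visits [] b := by
  simp [stepTo, stepAt, SearchTree.graft, h]

theorem stepTo_value_self : (P.stepTo k a j q ξ).2.value [] a = q.2.value [] a +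
    (P.returnAt k q.1 q.1.length q.2 a j ξ - q.2.value [] a) / ((q.2.visits [] a + 1 : ℕ) : ℝ) := by
  simp [stepTo, stepAt, SearchTree.graft]

theorem stepTo_value_of_ne {b : A} (h : b ≠ a) :
    (P.stepTo k a j q ξ).2.value [] b = q.2.value [] b := by
  simp [stepTo, stepAt, SearchTree.graft, h]

end Step

/-- Only the subtree of the chosen branch changes: an existing one is preserved by the assumption
one level down, and the empty one of a new branch becomes `seedTree`, because its first episode does
no more than expand it. -/
theorem inv_stepTo (k : ℕ) {q : LocalState A Z} (hq : P.Inv (k + 1) q.2) (a : A) {j : ℕ}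
    (hjn : j ≤ numBranches a q) (ξ : Noise K)
    (ih : ∀ {q : LocalState A Z}, P.Inv k q.2 → P.Inv k (P.localStep K k q ξ).2) :
    P.Inv (k + 1) (P.stepTo k a j q ξ).2 := by
  obtain ⟨h1, h2, h3, h4⟩ := hq
  have hsub : ∀ {b i}, (b, i) ≠ (a, j) →
      (P.stepTo k a j q ξ).2.sub [(b, i)] = q.2.sub [(b, i)] := fun h =>
    SearchTree.sub_graft_of_ne _ _ _ _ _ _ h
  have hnum : ∀ b i, (b, i) ≠ (a, j) →
      (i < numBranches b (P.stepTo k a j q ξ) ↔ i < numBranches b q) := by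
    intro b i h
    by_cases hb : b = a
    · rw [hb] at h ⊢
      have hij : i ≠ j := fun hij => h (by rw [hij])
      rcases hjn.lt_or_eq with hlt | heq
      · rw [P.numBranches_stepTo_of_lt k a j q ξ hlt]
      · rw [heq, P.numBranches_stepTo_new k a q ξ]; omega
    · rw [P.numBranches_stepTo_of_ne k a j q ξ hb]
  refine ⟨?_, fun b i hi => ?_, fun b i hi => ?_, fun b => ?_⟩
  · simpa [stepTo, stepAt, SearchTree.graft] using h1
  · by_cases h : (b, i) = (a, j)
    · rw [h]
      rcases hjn.lt_or_eq with hlt | heq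
      · have h5 : (P.stepTo k a j q ξ).2.sub [(a, j)] = (P.localStep K k (P.kid a j q) ξ).2 :=
          congrArg Prod.snd (P.kid_stepTo_self k a j q ξ hlt)
        rw [h5]
        exact ih (h2 a j hlt)
      · have h5 : (P.stepTo k a (numBranches a q) q ξ).2.sub [(a, numBranches a q)] =
          P.seedTree k := congrArg Prod.snd (P.kid_stepTo_new k a q ξ (h3 a _ le_rfl))
        rw [heq, h5]
        exact P.inv_seedTree k
    · rw [hsub h]
      exact h2 b i ((hnum b i h).1 hi)
  · have h : (b, i) ≠ (a, j) := by
      intro h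
      obtain ⟨hb, hij⟩ := Prod.mk.inj h
      have hi2 : numBranches b (P.stepTo k a j q ξ) ≤ i := hi
      rw [hb, hij] at hi2
      rcases hjn.lt_or_eq with hlt | heq
      · rw [P.numBranches_stepTo_of_lt k a j q ξ hlt] at hi2; omega
      · rw [heq, P.numBranches_stepTo_new k a q ξ] at hi2; omega
    rw [hsub h]
    exact h3 b i (not_lt.1 fun hi' => not_lt.2 hi ((hnum b i h).2 hi'))
  · by_cases hb : b = a
    · rw [hb, stepTo_visits_self]
      exact (h4 a).trans (Nat.le_succ _)
    · rw [P.stepTo_visits_of_ne k a j q ξ hb]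
      exact h4 b

theorem inv_localStep (k : ℕ) {q : LocalState A Z} (hq : P.Inv k q.2) (ξ : Noise K) :
    P.Inv k (P.localStep K k q ξ).2 := by
  induction k generalizing q with
  | zero => exact hq
  | succ k ih =>
    rw [P.localStep_succ k hq.1]
    exact P.inv_stepTo k hq _ (branchIndex_le _ _ _ _) ξ ih

theorem inv_kid {k : ℕ} {q : LocalState A Z} (hq : P.Inv (k + 1) q.2) {a : A} {j : ℕ}
    (hj : j < numBranches a q) : P.Inv k (P.kid a j q).2 := hq.2.1 a j hj

/-- The number of episodes that have passed the root of the tree since its expansion. -/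
def clock (T : SearchTree A Z) : ℕ := ∑ a, (T.visits [] a - P.S.visitsInit)

theorem measurable_clock : Measurable P.clock :=
  Finset.measurable_sum _ fun a _ => (measurable_from_top (f := fun n : ℕ => n - P.S.visitsInit)).comp
    (SearchTree.measurable_visits [] a)

theorem clock_seedTree (k : ℕ) : P.clock (P.seedTree k) = 0 := by
  cases k <;> simp [clock, seedTree, emptyTree, SearchTree.expand]

/-- An episode increases the visit number of exactly one action. The lower bound on visits in the
invariant keeps the truncated subtraction exact. -/
theorem clock_localStep (k : ℕ) {q : LocalState A Z} (hq : P.Inv (k + 1) q.2) (ξ : Noise K) :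
    P.clock (P.localStep K (k + 1) q ξ).2 = P.clock q.2 + 1 := by
  classical
  rw [P.localStep_succ k hq.1]
  set a := P.pick q.1 q.2 ξ
  simp only [clock]
  rw [← Finset.add_sum_erase _ _ (Finset.mem_univ a),
    ← Finset.add_sum_erase _ (fun b => q.2.visits [] b - P.S.visitsInit) (Finset.mem_univ a),
    stepTo_visits_self]
  have := hq.2.2.2 a
  rw [Finset.sum_congr rfl fun b hb => by
    rw [P.stepTo_visits_of_ne k a _ q ξ (Finset.ne_of_mem_erase hb)]]
  omega

/-- The expectation over an episode is bounded if it is bounded given each first choice. -/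
theorem lintegral_localStep_le (k : ℕ) {q : LocalState A Z} (hq : [] ∈ q.2.nodes)
    {Θ : LocalState A Z → ℝ≥0∞} (hΘ : Measurable Θ) {c : ℝ≥0∞}
    (h : ∀ a, ∑ j ∈ Finset.range (numBranches a q + 1),
      ENNReal.ofReal (branchProb P.εz (numBranches a q) j) *
        ∫⁻ ξ, Θ (P.stepTo k a j q ξ) ∂noiseLaw K ≤ c) :
    ∫⁻ ξ, Θ (P.localStep K (k + 1) q ξ) ∂noiseLaw K ≤ c := by
  simp_rw [P.localStep_succ k hq]
  rw [P.lintegral_choice q.1 q.2 (Φ := fun a j ξ => Θ (P.stepTo k a j q ξ))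
    (fun a j => hΘ.comp (P.measurable_stepTo_right k a j q))
    (fun a j p => by simp only [stepTo, stepAt_mixOn])]
  calc _ ≤ ∑ a, ENNReal.ofReal (epsGreedy P.εa (steeringValues P.s q.2 [] q.1) a) * c :=
        Finset.sum_le_sum fun a _ => mul_le_mul_right (h a) _
    _ = c := by
        rw [← Finset.sum_mul, ← ENNReal.ofReal_sum_of_nonneg
          fun a _ => epsGreedy_nonneg P.εa_pos.le P.εa_lt.le _ a, sum_epsGreedy,
          ENNReal.ofReal_one, one_mul]

theorem sum_branchProb_mul_le {n : ℕ} {y : ℕ → ℝ≥0∞} {c : ℝ≥0∞} (h : ∀ j ≤ n, y j ≤ c) :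
    ∑ j ∈ Finset.range (n + 1), ENNReal.ofReal (branchProb P.εz n j) * y j ≤ c :=
  calc _ ≤ ∑ j ∈ Finset.range (n + 1), ENNReal.ofReal (branchProb P.εz n j) * c :=
        Finset.sum_le_sum fun j hj => mul_le_mul_right (h j (by simpa [Nat.lt_succ_iff] using hj)) _
    _ = c := by
        rw [← Finset.sum_mul, ← ENNReal.ofReal_sum_of_nonneg
          fun j _ => branchProb_nonneg P.εz_neg n j, sum_branchProb, ENNReal.ofReal_one, one_mul]

theorem lintegral_localStep_le_of_forall (k : ℕ) {q : LocalState A Z} (hq : [] ∈ q.2.nodes)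
    {Θ : LocalState A Z → ℝ≥0∞} (hΘ : Measurable Θ) {c : ℝ≥0∞}
    (h : ∀ a, ∀ j ≤ numBranches a q, ∫⁻ ξ, Θ (P.stepTo k a j q ξ) ∂noiseLaw K ≤ c) :
    ∫⁻ ξ, Θ (P.localStep K (k + 1) q ξ) ∂noiseLaw K ≤ c :=
  P.lintegral_localStep_le k hq hΘ fun a => P.sum_branchProb_mul_le (h a)

/-- A lower bound on the rate at which branches are selected. -/
def rate : ℝ := P.εa / Fintype.card A * (1 - (2 : ℝ) ^ P.εz)

theorem rate_pos : 0 < P.rate := by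
  have h2 : (2 : ℝ) ^ P.εz < 1 := Real.rpow_lt_one_of_one_lt_of_neg one_lt_two P.εz_neg
  have := P.εa_pos
  have hc : (0 : ℝ) < Fintype.card A := by exact_mod_cast Fintype.card_pos
  unfold rate
  exact mul_pos (by positivity) (by linarith)

/-- An event that excludes one particular choice misses at least the probability of that choice,
which exploration and `branchProb_ge` bound below by `rate / (n + 1)`. -/
theorem measure_le_of_choice (q : LocalState A Z) (a : A) {j : ℕ} (hj : j ≤ numBranches a q)
    {B : Set (Noise K)} (hB : ∀ ξ ∈ P.choiceEvent q.1 q.2 a j, ξ ∉ B) :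
    noiseLaw K B ≤ ENNReal.ofReal (1 - P.rate / ((numBranches a q : ℝ) + 1)) := by
  have hsub : B ⊆ (P.choiceEvent q.1 q.2 a j)ᶜ := fun ξ hξ h => hB ξ h hξ
  refine (measure_mono hsub).trans ?_
  rw [prob_compl_eq_one_sub (P.measurableSet_choiceEvent _ _ _ _), P.noiseLaw_choiceEvent _ _ _ hj,
    ENNReal.ofReal_sub _ (div_nonneg P.rate_pos.le (by positivity)), ENNReal.ofReal_one]
  refine tsub_le_tsub_left ?_ _
  rw [← ENNReal.ofReal_mul (epsGreedy_nonneg P.εa_pos.le P.εa_lt.le _ _)]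
  refine ENNReal.ofReal_le_ofReal ?_
  have h2 : (2 : ℝ) ^ P.εz < 1 := Real.rpow_lt_one_of_one_lt_of_neg one_lt_two P.εz_neg
  rw [rate, mul_div_assoc]
  exact mul_le_mul (epsGreedy_ge P.εa_lt.le _ _) (branchProb_ge P.εz_ge P.εz_neg hj)
    (div_nonneg (by linarith) (by positivity)) (epsGreedy_nonneg P.εa_pos.le P.εa_lt.le _ _)

theorem localStep_of_choice (k : ℕ) {q : LocalState A Z} (hq : [] ∈ q.2.nodes) {a : A} {j : ℕ}
    {ξ : Noise K} (h : ξ ∈ P.choiceEvent q.1 q.2 a j) :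
    P.localStep K (k + 1) q ξ = P.stepTo k a j q ξ := by
  obtain ⟨rfl, rfl⟩ := h
  exact P.localStep_succ k hq ξ

theorem numBranches_localStep (k : ℕ) {q : LocalState A Z} (hq : [] ∈ q.2.nodes) (a : A)
    (ξ : Noise K) : numBranches a q ≤ numBranches a (P.localStep K (k + 1) q ξ) ∧
      numBranches a (P.localStep K (k + 1) q ξ) ≤ numBranches a q + 1 := by
  rw [P.localStep_succ k hq]
  set b := P.pick q.1 q.2 ξ
  set j := P.pickBranch q.1 q.2 b ξ with hj
  have hjn : j ≤ numBranches b q := branchIndex_le _ _ _ _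
  by_cases h : a = b
  · rw [h]
    rcases hjn.lt_or_eq with hlt | heq
    · rw [P.numBranches_stepTo_of_lt k b j q ξ hlt]; omega
    · rw [heq, P.numBranches_stepTo_new k b q ξ]; omega
  · rw [P.numBranches_stepTo_of_ne k b j q ξ h]; omega

theorem inv_chain (k : ℕ) {q : LocalState A Z} (hq : P.Inv k q.2) (ω : ℕ → Noise K) (N : ℕ) :
    P.Inv k (chain (P.localStep K k) q ω N).2 :=
  chain_induction (I := fun q : LocalState A Z => P.Inv k q.2)
    (fun _ hs ξ => P.inv_localStep k hs ξ) hq ω N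

theorem chain_fst (k : ℕ) (q : LocalState A Z) (ω : ℕ → Noise K) (N : ℕ) :
    (chain (P.localStep K k) q ω N).1 = q.1 := by
  induction N with
  | zero => rfl
  | succ N ih => exact ih

/-- The number of branches tends to infinity. -/
theorem ae_tendsto_numBranches (k : ℕ) {q : LocalState A Z} (hq : P.Inv (k + 1) q.2) (a : A) :
    ∀ᵐ ω ∂seqLaw (noiseLaw K),
      Tendsto (fun N => numBranches a (chain (P.localStep K (k + 1)) q ω N)) atTop atTop := by
  refine ae_tendsto_atTop_of_prob_ge (noiseLaw K) (P.measurable_localStep (k + 1))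
    (I := fun q : LocalState A Z => P.Inv (k + 1) q.2)
    (fun s hs ξ => P.inv_localStep (k + 1) hs ξ) (measurable_numBranches a) (numBranches a)
    P.rate_pos (fun s hs ξ => (P.numBranches_localStep k hs.1 a ξ).1)
    (fun s hs ξ => (P.numBranches_localStep k hs.1 a ξ).2) (fun s hs => ?_) hq
  refine P.measure_le_of_choice s a le_rfl fun ξ hξ h => ?_
  have h' : numBranches a (P.localStep K (k + 1) s ξ) = numBranches a s := h
  rw [P.localStep_of_choice k hs.1 hξ, P.numBranches_stepTo_new] at h'
  omega

theorem kid_localStep (k : ℕ) {q : LocalState A Z} (hq : [] ∈ q.2.nodes) {a : A} {j : ℕ}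
    (hj : j < numBranches a q) (ξ : Noise K) :
    P.kid a j (P.localStep K (k + 1) q ξ) = P.kid a j q ∨
      P.kid a j (P.localStep K (k + 1) q ξ) = P.localStep K k (P.kid a j q) ξ := by
  rw [P.localStep_succ k hq]
  set b := P.pick q.1 q.2 ξ
  set i := P.pickBranch q.1 q.2 b ξ
  by_cases h : (a, j) = (b, i)
  · obtain ⟨h1, h2⟩ := Prod.mk.inj h
    right
    rw [← h1, ← h2]
    exact P.kid_stepTo_self k a j q ξ hj
  · exact Or.inl (P.kid_stepTo_of_ne k b i q ξ h hj)

/-- Every branch is created eventually, and is taken infinitely often. -/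
theorem ae_tendsto_clock_kid (k : ℕ) {q : LocalState A Z} (hq : P.Inv (k + 2) q.2) (a : A) (j : ℕ) :
    ∀ᵐ ω ∂seqLaw (noiseLaw K), (∀ᶠ N in atTop,
      j < numBranches a (chain (P.localStep K (k + 2)) q ω N)) ∧
      Tendsto (fun N => P.clock (P.kid a j (chain (P.localStep K (k + 2)) q ω N)).2) atTop atTop := by
  classical
  -- One counter for both phases: the number of branches, up to `j + 1`, until branch `j` exists,
  -- and afterwards the clock of that branch. In each phase some single choice makes it grow.
  set N : LocalState A Z → ℕ := fun q => min (numBranches a q) (j + 1) +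
    if j < numBranches a q then P.clock (P.kid a j q).2 else 0 with hN
  have hNm : Measurable N := by
    refine ((measurable_numBranches a).min measurable_const).add (Measurable.ite ?_
      (P.measurable_clock.comp (P.measurable_kid a j).snd) measurable_const)
    exact measurableSet_lt measurable_const (measurable_numBranches a)
  have hmono : ∀ s : LocalState A Z, P.Inv (k + 2) s.2 → ∀ ξ : Noise K,
      N s ≤ N (P.localStep K (k + 2) s ξ) := by
    intro s hs ξ
    obtain ⟨h1, h2⟩ := P.numBranches_localStep (k + 1) hs.1 a ξ
    simp only [hN]
    by_cases hj : j < numBranches a s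
    · rw [if_pos hj, if_pos (hj.trans_le h1)]
      have : P.clock (P.kid a j s).2 ≤ P.clock (P.kid a j (P.localStep K (k + 2) s ξ)).2 := by
        rcases P.kid_localStep (k + 1) hs.1 hj ξ with h | h
        · rw [h]
        · rw [h, P.clock_localStep k (P.inv_kid hs hj)]; omega
      exact add_le_add (min_le_min_right _ h1) this
    · rw [if_neg hj]
      exact (min_le_min_right _ h1).trans (Nat.le_add_right _ _)
  have key := ae_tendsto_atTop_of_prob_ge (noiseLaw K) (P.measurable_localStep (k + 2))
    (I := fun q : LocalState A Z => P.Inv (k + 2) q.2)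
    (fun s hs ξ => P.inv_localStep (k + 2) hs ξ) hNm (numBranches a) P.rate_pos hmono
    (fun s hs ξ => (P.numBranches_localStep (k + 1) hs.1 a ξ).2) (fun s hs => by
      rcases lt_or_ge j (numBranches a s) with hj | hj
      · refine P.measure_le_of_choice s a hj.le fun ξ hξ h => ?_
        have h' : N (P.localStep K (k + 2) s ξ) = N s := h
        rw [P.localStep_of_choice (k + 1) hs.1 hξ] at h'
        simp only [hN] at h'
        rw [P.numBranches_stepTo_of_lt _ a j s ξ hj, if_pos hj, if_pos hj,
          P.kid_stepTo_self _ a j s ξ hj, P.clock_localStep k (P.inv_kid hs hj)] at h'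
        omega
      · refine P.measure_le_of_choice s a le_rfl fun ξ hξ h => ?_
        have h' : N (P.localStep K (k + 2) s ξ) = N s := h
        rw [P.localStep_of_choice (k + 1) hs.1 hξ] at h'
        simp only [hN] at h'
        rw [P.numBranches_stepTo_new, if_neg (not_lt.2 hj)] at h'
        omega) hq
  filter_upwards [key, P.ae_tendsto_numBranches (k + 1) hq a] with ω h1 h2
  have h3 := h2.eventually_gt_atTop j
  refine ⟨h3, tendsto_atTop.2 fun b => ?_⟩
  filter_upwards [h3, h1.eventually_ge_atTop (b + (j + 1))] with n hn hb
  simp only [hN] at hb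
  rw [if_pos hn] at hb
  omega

end Planner

/-! ### Superharmonic functionals of the children of a node -/

/-- A potential that controls the fraction of rarely visited branches. -/
def visitPotential (η : ℝ) (n : ℕ) (S : ℝ) : ℝ :=
  (if η * n < S then Real.exp (S - 2 * η * n) else 0) +
    Real.exp 1 / (1 - Real.exp (-η)) * Real.exp (-η) ^ n

theorem exp_neg_half_le {x : ℝ} (h0 : 0 ≤ x) (h1 : x ≤ 1) : Real.exp (-(x / 2)) ≤ 1 - x / 4 := by
  have h := Real.add_one_le_exp (x / 2)
  rw [Real.exp_neg]
  refine inv_le_of_inv_le₀ (by linarith) ?_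
  refine le_trans ?_ h
  refine inv_le_of_inv_le₀ (by linarith) ?_
  rw [inv_eq_one_div, div_le_iff₀ (by linarith)]
  nlinarith

/-- Here `S` is the sum of `2 ^ (-clock)` over the `n` branches: taking branch `j` halves its term,
a new branch adds `1`. If `S > η n`, the exponential loses on average a fraction of about `η / 4` at
existing branches, which outweighs the gain by a factor of at most `e` with probability `q ≤ η /
16`. If `S ≤ η n`, the exponential can become positive only at a new branch, with value at most `e *
exp (-η n)`; the second summand pays for this, because its decrease from `n` to `n + 1` is exactly
that amount. -/
theorem visitPotential_superharmonic {η : ℝ} (h0 : 0 < η) (h1 : η ≤ 1) {n : ℕ} {q : ℝ} (hq0 : 0 ≤ q)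
    (hq : q ≤ η / 16) {φ : ℕ → ℝ} (hφ0 : ∀ j, 0 ≤ φ j) (hφ1 : ∀ j, φ j ≤ 1) :
    (∑ j ∈ Finset.range n, (1 - q) / n *
        visitPotential η n ((∑ i ∈ Finset.range n, φ i) - φ j / 2)) +
      q * visitPotential η (n + 1) ((∑ i ∈ Finset.range n, φ i) + 1) ≤
      visitPotential η n (∑ i ∈ Finset.range n, φ i) := by
  set S := ∑ i ∈ Finset.range n, φ i with hS
  set r := Real.exp (-η) with hr
  have hr1 : r < 1 := by rw [hr]; exact Real.exp_lt_one_iff.2 (by linarith)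
  have hr0 : 0 < r := Real.exp_pos _
  set C := Real.exp 1 / (1 - r) with hC
  have hC0 : 0 < C := div_pos (Real.exp_pos _) (by linarith)
  have hCr : C * (1 - r) = Real.exp 1 := div_mul_cancel₀ _ (by linarith)
  have hrn : r ^ n = Real.exp (-(η * n)) := by
    rw [hr, ← Real.exp_nat_mul]; congr 1; ring
  have hq1 : q ≤ 1 := by linarith
  have hn0 : (n : ℝ) = 0 ∨ 0 < (n : ℝ) := by
    rcases Nat.eq_zero_or_pos n with h | h
    · left; exact_mod_cast h
    · right; exact_mod_cast h
  have hmass : ∀ c : ℝ, 0 ≤ c → ∑ j ∈ Finset.range n, (1 - q) / n * c ≤ (1 - q) * c := by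
    intro c hc
    rw [Finset.sum_const, Finset.card_range, nsmul_eq_mul]
    rcases hn0 with h | h
    · rw [h, zero_mul]; exact mul_nonneg (by linarith) hc
    · rw [← mul_assoc, mul_div_cancel₀ _ h.ne']
  have hdiv : 0 ≤ (1 - q) / (n : ℝ) := div_nonneg (by linarith) (Nat.cast_nonneg n)
  have hpow : r ^ (n + 1) = r ^ n * r := pow_succ _ _
  have hrn0 : 0 < r ^ n := pow_pos hr0 n
  rcases lt_or_ge (η * n) S with hSn | hSn
  · have hnpos : 0 < (n : ℝ) := by
      rcases hn0 with h | h
      · exfalso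
        have : n = 0 := by exact_mod_cast h
        subst this
        simp [hS] at hSn
      · exact h
    set E := Real.exp (S - 2 * η * n) with hE
    have hE0 : 0 < E := Real.exp_pos _
    -- The gain at branch `j` is proportional to `φ j`, so the gains add up to a multiple of `S`,
    -- which exceeds `η n` here.
    have hj : ∀ j ∈ Finset.range n, (1 - q) / n * visitPotential η n (S - φ j / 2) ≤
        (1 - q) / n * (E + C * r ^ n) - (1 - q) / n * (E / 4) * φ j := by
      intro j _
      rw [mul_assoc, ← mul_sub]
      refine mul_le_mul_of_nonneg_left ?_ hdiv
      have h2 : (if η * n < S - φ j / 2 then Real.exp (S - φ j / 2 - 2 * η * n) else 0) ≤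
          E * (1 - φ j / 4) := by
        refine le_trans ?_ (mul_le_mul_of_nonneg_left (exp_neg_half_le (hφ0 j) (hφ1 j)) hE0.le)
        rw [hE, ← Real.exp_add]
        split_ifs
        · exact (congrArg Real.exp (by ring)).le
        · exact (Real.exp_pos _).le
      rw [visitPotential, ← hr, ← hC]
      linarith
    have hnew : visitPotential η (n + 1) (S + 1) ≤ E * Real.exp 1 + C * r ^ n := by
      rw [visitPotential, ← hr, ← hC, hpow]
      have h2 : (if η * (n + 1 : ℕ) < S + 1 then Real.exp (S + 1 - 2 * η * (n + 1 : ℕ)) else 0) ≤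
          E * Real.exp 1 := by
        rw [hE, ← Real.exp_add]
        split_ifs
        · refine Real.exp_le_exp.2 ?_
          push_cast
          linarith
        · exact (Real.exp_pos _).le
      have h3 : C * (r ^ n * r) ≤ C * r ^ n :=
        mul_le_mul_of_nonneg_left (mul_le_of_le_one_right hrn0.le hr1.le) hC0.le
      linarith
    have hsum := Finset.sum_le_sum hj
    have hmulS : ∑ x ∈ Finset.range n, (1 - q) / (n : ℝ) * (E / 4) * φ x =
        (1 - q) / n * (E / 4) * S := by rw [hS, Finset.mul_sum]
    rw [Finset.sum_sub_distrib, hmulS] at hsum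
    have hm := hmass (E + C * r ^ n) (by positivity)
    have hq2 := mul_le_mul_of_nonneg_left hnew hq0
    have h5 : (1 - q) * (E / 4) * η ≤ (1 - q) / n * (E / 4) * S := by
      have : (1 - q) / n * (E / 4) * S - (1 - q) * (E / 4) * η =
          (1 - q) / n * (E / 4) * (S - η * n) := by field_simp
      have h6 : 0 ≤ (1 - q) / n * (E / 4) * (S - η * n) :=
        mul_nonneg (mul_nonneg hdiv (by positivity)) (by linarith)
      linarith
    have hgoal : visitPotential η n S = E + C * r ^ n := by
      rw [visitPotential, if_pos hSn]
    rw [hgoal]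
    have he : Real.exp 1 < 3 := by linarith [Real.exp_one_lt_d9]
    have h7 : q * (E * Real.exp 1) ≤ q * (E * 3) :=
      mul_le_mul_of_nonneg_left (mul_le_mul_of_nonneg_left he.le hE0.le) hq0
    have h8 : q * E ≤ η / 16 * E := mul_le_mul_of_nonneg_right hq hE0.le
    have h9 : q * E * η ≤ η / 16 * E := by
      refine le_trans ?_ h8
      exact mul_le_of_le_one_right (mul_nonneg hq0 hE0.le) h1
    nlinarith
  · have hgoal : visitPotential η n S = C * r ^ n := by
      rw [visitPotential, if_neg (not_lt.2 hSn), zero_add]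
    have hj : ∀ j ∈ Finset.range n, (1 - q) / n * visitPotential η n (S - φ j / 2) ≤
        (1 - q) / n * (C * r ^ n) := by
      intro j _
      refine mul_le_mul_of_nonneg_left ?_ hdiv
      rw [visitPotential, if_neg (not_lt.2 (by linarith [hφ0 j])), zero_add]
    have hnew : visitPotential η (n + 1) (S + 1) ≤ C * r ^ n := by
      rw [visitPotential, ← hr, ← hC, hpow]
      have h2 : (if η * (n + 1 : ℕ) < S + 1 then Real.exp (S + 1 - 2 * η * (n + 1 : ℕ)) else 0) ≤
          Real.exp 1 * r ^ n := by
        rw [hrn, ← Real.exp_add]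
        split_ifs
        · refine Real.exp_le_exp.2 ?_
          push_cast
          linarith
        · exact (Real.exp_pos _).le
      rw [← hCr] at h2
      nlinarith
    rw [hgoal]
    have hm := hmass (C * r ^ n) (by positivity)
    have := Finset.sum_le_sum hj
    have hq2 := mul_le_mul_of_nonneg_left hnew hq0
    linarith

/-- If `S > 3 η n`, the exponential alone exceeds `S - 2 η n > η n ≥ c`. -/
theorem le_of_visitPotential_le {η S : ℝ} (h0 : 0 < η) {n : ℕ} {c : ℝ}
    (h : visitPotential η n S ≤ c) (hc : c ≤ η * n) : S ≤ 3 * η * n := by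
  have hn : 0 ≤ η * n := by positivity
  by_contra hS
  rw [not_le] at hS
  have hr1 : Real.exp (-η) < 1 := Real.exp_lt_one_iff.2 (by linarith)
  have hC0 : 0 ≤ Real.exp 1 / (1 - Real.exp (-η)) * Real.exp (-η) ^ n :=
    mul_nonneg (div_nonneg (Real.exp_pos _).le (by linarith)) (by positivity)
  rw [visitPotential, if_pos (by linarith)] at h
  have := Real.add_one_le_exp (S - 2 * η * n)
  linarith

namespace Planner

variable {X A Z : Type*} [MeasurableSpace X] [MeasurableSpace Z] [Fintype A] [Nonempty A]
  [MeasurableSpace A] [DiscreteMeasurableSpace A] (P : Planner X A Z) {K : ℕ}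

/-- The sum of a functional over the branches of the action `a`. -/
def kidSum (a : A) (φ : LocalState A Z → ℝ) (q : LocalState A Z) : ℝ :=
  ∑ j ∈ Finset.range (numBranches a q), φ (P.kid a j q)

theorem measurable_kidSum (a : A) {φ : LocalState A Z → ℝ} (hφ : Measurable φ) :
    Measurable (P.kidSum a φ) :=
  measurable_of_countable_choice (f := fun n q => ∑ j ∈ Finset.range n, φ (P.kid a j q))
    (measurable_numBranches a)
    fun _ => Finset.measurable_sum _ fun j _ => hφ.comp (P.measurable_kid a j)

section

variable (k : ℕ) (a : A) (q : LocalState A Z) (ξ : Noise K) (φ : LocalState A Z → ℝ)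

theorem kidSum_stepTo_of_ne {b : A} (h : a ≠ b) (j : ℕ) :
    P.kidSum a φ (P.stepTo k b j q ξ) = P.kidSum a φ q := by
  rw [kidSum, P.numBranches_stepTo_of_ne k b j q ξ h, kidSum]
  refine Finset.sum_congr rfl fun i hi => ?_
  rw [P.kid_stepTo_of_ne k b j q ξ (fun h' => h (Prod.mk.inj h').1) (Finset.mem_range.1 hi)]

theorem kidSum_stepTo_of_lt {j : ℕ} (hj : j < numBranches a q) :
    P.kidSum a φ (P.stepTo k a j q ξ) = P.kidSum a φ q - φ (P.kid a j q) +
      φ (P.localStep K k (P.kid a j q) ξ) := by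
  rw [kidSum, P.numBranches_stepTo_of_lt k a j q ξ hj, kidSum,
    ← Finset.add_sum_erase _ _ (Finset.mem_range.2 hj),
    ← Finset.add_sum_erase _ (fun i => φ (P.kid a i q)) (Finset.mem_range.2 hj),
    P.kid_stepTo_self k a j q ξ hj]
  have : ∑ i ∈ (Finset.range (numBranches a q)).erase j, φ (P.kid a i (P.stepTo k a j q ξ)) =
      ∑ i ∈ (Finset.range (numBranches a q)).erase j, φ (P.kid a i q) :=
    Finset.sum_congr rfl fun i hi => by
      rw [P.kid_stepTo_of_ne k a j q ξ (fun h' => Finset.ne_of_mem_erase hi (Prod.mk.inj h').2)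
        (Finset.mem_range.1 (Finset.mem_of_mem_erase hi))]
  rw [this]
  ring

theorem kidSum_stepTo_new (h : q.2.sub [(a, numBranches a q)] = P.emptyTree) :
    P.kidSum a φ (P.stepTo k a (numBranches a q) q ξ) =
      P.kidSum a φ q + φ (P.newKid k q.1 a ξ) := by
  rw [kidSum, P.numBranches_stepTo_new, Finset.sum_range_succ, P.kid_stepTo_new k a q ξ h, kidSum]
  congr 1
  refine Finset.sum_congr rfl fun i hi => ?_
  have hi' := Finset.mem_range.1 hi
  rw [P.kid_stepTo_of_ne k a _ q ξ (fun h' => hi'.ne (Prod.mk.inj h').2) hi']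

end

theorem tendsto_spawnProb : Tendsto (fun n : ℕ => ((n : ℝ) + 1) ^ P.εz) atTop (𝓝 0) := by
  have h1 := tendsto_rpow_neg_atTop (neg_pos.2 P.εz_neg)
  rw [neg_neg] at h1
  exact h1.comp (tendsto_atTop_add_const_right _ _ tendsto_natCast_atTop_atTop)

/-- Most branches have been visited often. -/
theorem ae_eventually_kidSum_clock_le (k : ℕ) {q : LocalState A Z} (hq : P.Inv (k + 2) q.2) (a : A)
    {η : ℝ} (hη : 0 < η) : ∀ᵐ ω ∂seqLaw (noiseLaw K), ∀ᶠ N in atTop,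
      P.kidSum a (fun s => (1 / 2 : ℝ) ^ P.clock s.2) (chain (P.localStep K (k + 2)) q ω N) ≤
        η * numBranches a (chain (P.localStep K (k + 2)) q ω N) := by
  -- The potential controls the sum up to `3 κ n`, and its superharmonicity requires `κ ≤ 1`.
  set κ := min η 1 / 3 with hκ
  have hκ0 : 0 < κ := by have := lt_min hη one_pos; positivity
  have hκ1 : κ ≤ 1 := by have := min_le_right η 1; linarith
  have hκη : 3 * κ ≤ η := by have := min_le_left η 1; linarith
  set φ : LocalState A Z → ℝ := fun s => (1 / 2 : ℝ) ^ P.clock s.2 with hφ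
  have hφm : Measurable φ := (measurable_from_top (f := fun n : ℕ => (1 / 2 : ℝ) ^ n)).comp
    (P.measurable_clock.comp measurable_snd)
  -- From `n1` branches on, a new branch is rare enough for the potential to be superharmonic; the
  -- trajectory eventually remains in that region.
  obtain ⟨n1, hn1⟩ := eventually_atTop.1
    (P.tendsto_spawnProb.eventually_le_const (show 0 < κ / 16 by positivity))
  set Θ : LocalState A Z → ℝ≥0∞ := fun s =>
    ENNReal.ofReal (visitPotential κ (numBranches a s) (P.kidSum a φ s)) with hΘ
  have hVm : Measurable fun p : ℕ × ℝ => visitPotential κ p.1 p.2 := by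
    refine measurable_from_prod_countable_right fun n => ?_
    have h2 : Measurable fun S : ℝ => if κ * n < S then Real.exp (S - 2 * κ * n) else 0 :=
      Measurable.ite measurableSet_Ioi (Real.measurable_exp.comp
        (by fun_prop : Measurable fun S : ℝ => S - 2 * κ * n)) measurable_const
    have h3 := h2.add_const (Real.exp 1 / (1 - Real.exp (-κ)) * Real.exp (-κ) ^ n)
    exact h3
  have hΘm : Measurable Θ :=
    (hVm.comp ((measurable_numBranches a).prodMk (P.measurable_kidSum a hφm))).ennreal_ofReal
  have hV0 : ∀ n S, 0 ≤ visitPotential κ n S := fun n S => by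
    have hr1 : Real.exp (-κ) < 1 := Real.exp_lt_one_iff.2 (by linarith)
    refine add_nonneg (by split_ifs <;> positivity)
      (mul_nonneg (div_nonneg (Real.exp_pos _).le (by linarith)) (by positivity))
  have key := ae_bounded_of_superharmonic (noiseLaw K) (P.measurable_localStep (k + 2))
    (I := fun s : LocalState A Z => P.Inv (k + 2) s.2)
    (fun s hs ξ => P.inv_localStep (k + 2) hs ξ) hΘm (fun s _ => ENNReal.ofReal_ne_top)
    (G := {s | n1 ≤ numBranches a s})
    (measurableSet_le measurable_const (measurable_numBranches a)) (fun s hs hn => by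
      refine P.lintegral_localStep_le (k + 1) hs.1 hΘm fun b => ?_
      by_cases hb : a = b
      · subst hb
        set n := numBranches a s with hnn
        have hn' : n1 ≤ n := hn
        set f : ℕ → ℝ := fun j => φ (P.kid a j s) with hf
        have e1 : ∀ j ∈ Finset.range n, ENNReal.ofReal (branchProb P.εz n j) *
            ∫⁻ ξ, Θ (P.stepTo (k + 1) a j s ξ) ∂noiseLaw K = ENNReal.ofReal
              ((1 - ((n : ℝ) + 1) ^ P.εz) / n *
                visitPotential κ n (P.kidSum a φ s - f j / 2)) := by
          intro j hj
          have hj' := Finset.mem_range.1 hj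
          have : ∀ ξ : Noise K, Θ (P.stepTo (k + 1) a j s ξ) = ENNReal.ofReal
              (visitPotential κ n (P.kidSum a φ s - f j / 2)) := by
            intro ξ
            simp only [hΘ]
            rw [P.numBranches_stepTo_of_lt (k + 1) a j s ξ hj',
              P.kidSum_stepTo_of_lt (k + 1) a s ξ φ hj']
            have : φ (P.localStep K (k + 1) (P.kid a j s) ξ) = f j / 2 := by
              simp only [hφ, hf]
              rw [P.clock_localStep k (P.inv_kid hs hj'), pow_succ]
              ring
            rw [this, ← hnn]
            congr 2
            ring
          simp_rw [this]
          rw [lintegral_const, measure_univ, mul_one, branchProb, if_pos hj',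
            ← ENNReal.ofReal_mul (div_nonneg (by linarith [(spawnProb_mem P.εz_neg n).2])
              (Nat.cast_nonneg n))]
        have e2 : ENNReal.ofReal (branchProb P.εz n n) *
            ∫⁻ ξ, Θ (P.stepTo (k + 1) a n s ξ) ∂noiseLaw K = ENNReal.ofReal
              (((n : ℝ) + 1) ^ P.εz * visitPotential κ (n + 1) (P.kidSum a φ s + 1)) := by
          have : ∀ ξ : Noise K, Θ (P.stepTo (k + 1) a n s ξ) = ENNReal.ofReal
              (visitPotential κ (n + 1) (P.kidSum a φ s + 1)) := by
            intro ξ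
            simp only [hΘ, hnn]
            rw [P.numBranches_stepTo_new,
              P.kidSum_stepTo_new (k + 1) a s ξ φ (hs.2.2.1 a _ le_rfl)]
            have : φ (P.newKid (k + 1) s.1 a ξ) = 1 := by
              simp [hφ, newKid, clock_seedTree]
            rw [this]
          simp_rw [this]
          rw [lintegral_const, measure_univ, mul_one, branchProb, if_neg (lt_irrefl _),
            ← ENNReal.ofReal_mul (spawnProb_mem P.εz_neg n).1]
        rw [Finset.sum_range_succ, Finset.sum_congr rfl e1, e2,
          ← ENNReal.ofReal_sum_of_nonneg fun j _ => mul_nonneg (div_nonneg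
            (by linarith [(spawnProb_mem P.εz_neg n).2]) (Nat.cast_nonneg n)) (hV0 _ _),
          ← ENNReal.ofReal_add (Finset.sum_nonneg fun j _ => mul_nonneg (div_nonneg
            (by linarith [(spawnProb_mem P.εz_neg n).2]) (Nat.cast_nonneg n)) (hV0 _ _))
            (mul_nonneg (spawnProb_mem P.εz_neg n).1 (hV0 _ _))]
        refine ENNReal.ofReal_le_ofReal ?_
        exact visitPotential_superharmonic hκ0 hκ1 (spawnProb_mem P.εz_neg n).1 (hn1 n hn')
          (φ := f) (fun j => by simp only [hf, hφ]; positivity)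
          (fun j => pow_le_one₀ (by norm_num) (by norm_num))
      · refine P.sum_branchProb_mul_le fun j _ => ?_
        have : ∀ ξ : Noise K, Θ (P.stepTo (k + 1) b j s ξ) = Θ s := fun ξ => by
          simp only [hΘ]
          rw [P.numBranches_stepTo_of_ne _ _ _ _ _ hb, P.kidSum_stepTo_of_ne _ _ _ _ _ hb]
        simp [this]) hq
  filter_upwards [key, P.ae_tendsto_numBranches (k + 1) hq a] with ω h1 h2
  obtain ⟨C, hC⟩ := h1 (h2.eventually_ge_atTop n1)
  -- The potential stays bounded by `C` while the number of branches grows, so that eventually `C ≤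
  -- κ n`.
  filter_upwards [hC, h2.eventually_ge_atTop ⌈(C : ℝ) / κ⌉₊] with N hN1 hN2
  set s := chain (P.localStep K (k + 2)) q ω N
  have h3 : visitPotential κ (numBranches a s) (P.kidSum a φ s) ≤ C := by
    have : ENNReal.ofReal (visitPotential κ (numBranches a s) (P.kidSum a φ s)) ≤ C := hN1
    rwa [ENNReal.ofReal_le_iff_le_toReal ENNReal.coe_ne_top] at this
  have h4 : (C : ℝ) ≤ κ * numBranches a s := by
    have := (Nat.le_ceil ((C : ℝ) / κ)).trans (Nat.cast_le.2 hN2)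
    rw [div_le_iff₀ hκ0] at this
    linarith
  exact (le_of_visitPotential_le hκ0 h3 h4).trans
    (mul_le_mul_of_nonneg_right hκη (Nat.cast_nonneg _))

theorem sub_sq_le_log {x : ℝ} (h0 : 0 ≤ x) : x - x ^ 2 ≤ Real.log (1 + x) := by
  have h := Real.one_sub_inv_le_log_of_pos (show 0 < 1 + x by linarith)
  refine le_trans ?_ h
  rw [le_sub_iff_add_le, ← le_sub_iff_add_le', inv_le_iff_one_le_mul₀ (by linarith)]
  nlinarith [mul_nonneg h0 (mul_nonneg h0 h0)]

/-- A functional of the branches that does not increase on average is, on average over the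
branches, eventually not larger than its mean over new branches. -/
theorem ae_eventually_kidSum_le (k : ℕ) {q : LocalState A Z} (hq : P.Inv (k + 1) q.2) (a : A)
    {ψ : LocalState A Z → ℝ≥0∞} (hψ : Measurable ψ)
    (h1 : ∀ z T, P.Inv k T → ψ (q.1 ++ [(a, z)], T) ≤ 1)
    (hsup : ∀ z T, P.Inv k T → ∫⁻ ξ, ψ (P.localStep K k (q.1 ++ [(a, z)], T) ξ) ∂noiseLaw K ≤
      ψ (q.1 ++ [(a, z)], T)) {p : ℝ} (hp : 0 ≤ p)
    (hnew : ∫⁻ ξ, ψ (P.newKid k q.1 a ξ) ∂noiseLaw K ≤ ENNReal.ofReal p) {η : ℝ} (hη : 0 < η) :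
    ∀ᵐ ω ∂seqLaw (noiseLaw K), ∀ᶠ N in atTop,
      P.kidSum a (fun s => (ψ s).toReal) (chain (P.localStep K (k + 1)) q ω N) ≤
        (p + η) * numBranches a (chain (P.localStep K (k + 1)) q ω N) := by
  set θ := min η 1 / 2 with hθ
  have hθ0 : 0 < θ := by have := lt_min hη one_pos; positivity
  have hθη : 2 * θ ≤ η := by have := min_le_left η 1; linarith
  have hp1 : 0 < 1 + θ * p := by positivity
  set φ : LocalState A Z → ℝ := fun s => Real.log (1 + θ * (ψ s).toReal) with hφ
  have hφm : Measurable φ :=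
    Real.measurable_log.comp ((hψ.ennreal_toReal.const_mul θ).const_add 1)
  have hexp : ∀ s, Real.exp (φ s) = 1 + θ * (ψ s).toReal := fun s =>
    Real.exp_log (by have := ENNReal.toReal_nonneg (a := ψ s); positivity)
  have hofReal : ∀ s, ψ s ≤ 1 → ENNReal.ofReal (Real.exp (φ s)) = 1 + ENNReal.ofReal θ * ψ s := by
    intro s hs
    have hne : ψ s ≠ ∞ := (hs.trans_lt ENNReal.one_lt_top).ne
    rw [hexp, ENNReal.ofReal_add zero_le_one (mul_nonneg hθ0.le ENNReal.toReal_nonneg),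
      ENNReal.ofReal_one, ENNReal.ofReal_mul hθ0.le, ENNReal.ofReal_toReal hne]
  set c := (ENNReal.ofReal (1 + θ * p))⁻¹ with hc
  have hc1 : c ≠ ∞ := ENNReal.inv_ne_top.2 (by simpa using hp1)
  have hcp : ENNReal.ofReal (1 + θ * p) * c = 1 :=
    ENNReal.mul_inv_cancel (by simpa using hp1) ENNReal.ofReal_ne_top
  -- This is the product of `1 + θ ψ` over the branches divided by `(1 + θ p) ^ n`. A step inside a
  -- branch changes one factor, whose mean does not increase; a new branch multiplies the product by
  -- a factor of mean at most `1 + θ p`, which the denominator compensates. Independence of the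
  -- branches is not needed.
  set Θ : LocalState A Z → ℝ≥0∞ := fun s =>
    ENNReal.ofReal (Real.exp (P.kidSum a φ s)) * c ^ numBranches a s with hΘ
  have hΘm : Measurable Θ :=
    (Real.measurable_exp.comp (P.measurable_kidSum a hφm)).ennreal_ofReal.mul
      ((measurable_from_top (f := fun n : ℕ => c ^ n)).comp (measurable_numBranches a))
  have key := ae_bounded_of_superharmonic (noiseLaw K) (P.measurable_localStep (k + 1))
    (I := fun s : LocalState A Z => P.Inv (k + 1) s.2 ∧ s.1 = q.1)
    (fun s hs ξ => ⟨P.inv_localStep (k + 1) hs.1 ξ, hs.2⟩) hΘm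
    (fun s _ => ENNReal.mul_ne_top ENNReal.ofReal_ne_top (ENNReal.pow_ne_top hc1))
    (G := Set.univ) MeasurableSet.univ (fun s hs _ => by
      obtain ⟨hs, hsq⟩ := hs
      refine P.lintegral_localStep_le_of_forall k hs.1 hΘm fun b j hj => ?_
      by_cases hb : a = b
      · subst hb
        set n := numBranches a s with hnn
        rcases hj.lt_or_eq with hlt | heq
        · set x := P.kid a j s with hx
          have hxk : ∃ z T, P.Inv k T ∧ x = (q.1 ++ [(a, z)], T) :=
            ⟨_, _, P.inv_kid hs hlt, by rw [hx, kid, hsq]⟩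
          obtain ⟨z, T, hT, hxz⟩ := hxk
          have e1 : ∀ ξ : Noise K, Θ (P.stepTo k a j s ξ) =
              (ENNReal.ofReal (Real.exp (P.kidSum a φ s - φ x)) * c ^ n) *
                (1 + ENNReal.ofReal θ * ψ (P.localStep K k x ξ)) := by
            intro ξ
            simp only [hΘ]
            rw [P.numBranches_stepTo_of_lt k a j s ξ hlt, P.kidSum_stepTo_of_lt k a s ξ φ hlt,
              Real.exp_add, ENNReal.ofReal_mul (Real.exp_pos _).le, hofReal, ← hnn]
            · ring
            · rw [← hx, hxz]
              exact h1 z _ (P.inv_localStep k (q := (q.1 ++ [(a, z)], T)) hT ξ)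
          simp_rw [e1]
          have hm1 : Measurable fun ξ : Noise K => ψ (P.localStep K k x ξ) :=
            hψ.comp ((P.measurable_localStep k).comp (measurable_prodMk_left (x := x)))
          rw [lintegral_const_mul _ ((hm1.const_mul _).const_add _),
            lintegral_add_left measurable_const, lintegral_const_mul _ hm1, lintegral_one,
            measure_univ]
          have h5 : ∫⁻ ξ, ψ (P.localStep K k x ξ) ∂noiseLaw K ≤ ψ x := by
            rw [hxz]; exact hsup z T hT
          calc _ ≤ (ENNReal.ofReal (Real.exp (P.kidSum a φ s - φ x)) * c ^ n) *
                (1 + ENNReal.ofReal θ * ψ x) := by gcongr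
            _ = Θ s := by
                rw [← hofReal x (by rw [hxz]; exact h1 z T hT)]
                simp only [hΘ]
                rw [mul_right_comm, ← ENNReal.ofReal_mul (Real.exp_pos _).le, ← Real.exp_add,
                  sub_add_cancel]
        · have e1 : ∀ ξ : Noise K, Θ (P.stepTo k a j s ξ) =
              (ENNReal.ofReal (Real.exp (P.kidSum a φ s)) * c ^ n * c) *
                (1 + ENNReal.ofReal θ * ψ (P.newKid k q.1 a ξ)) := by
            intro ξ
            simp only [hΘ]
            rw [heq, hnn, P.numBranches_stepTo_new,
              P.kidSum_stepTo_new k a s ξ φ (hs.2.2.1 a _ le_rfl),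
              Real.exp_add, ENNReal.ofReal_mul (Real.exp_pos _).le, hofReal, hsq, pow_succ]
            · ring
            · rw [newKid, hsq]
              exact h1 _ _ (P.inv_seedTree k)
          simp_rw [e1]
          have hm1 : Measurable fun ξ : Noise K => ψ (P.newKid k q.1 a ξ) :=
            hψ.comp (P.measurable_newKid k q.1 a)
          rw [lintegral_const_mul _ ((hm1.const_mul _).const_add _),
            lintegral_add_left measurable_const, lintegral_const_mul _ hm1, lintegral_one,
            measure_univ]
          calc _ ≤ (ENNReal.ofReal (Real.exp (P.kidSum a φ s)) * c ^ n * c) *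
                (1 + ENNReal.ofReal θ * ENNReal.ofReal p) := by gcongr
            _ = Θ s := by
                rw [← ENNReal.ofReal_mul hθ0.le, ← ENNReal.ofReal_one,
                  ← ENNReal.ofReal_add zero_le_one (by positivity), mul_assoc, mul_comm c, hcp,
                  mul_one]
      · have : ∀ ξ : Noise K, Θ (P.stepTo k b j s ξ) = Θ s := fun ξ => by
          simp only [hΘ]
          rw [P.numBranches_stepTo_of_ne _ _ _ _ _ hb, P.kidSum_stepTo_of_ne _ _ _ _ _ hb]
        simp [this]) ⟨hq, rfl⟩
  filter_upwards [key, P.ae_tendsto_numBranches k hq a] with ω hω h2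
  obtain ⟨C, hC⟩ := hω (Eventually.of_forall fun _ => Set.mem_univ _)
  filter_upwards [hC, h2.eventually_ge_atTop ⌈(C : ℝ) / θ / θ⌉₊] with N hN1 hN2
  have hinv := P.inv_chain (k + 1) hq ω N
  have hfst := P.chain_fst (k + 1) q ω N
  set s := chain (P.localStep K (k + 1)) q ω N
  set n := numBranches a s with hn
  have h3 : Real.exp (P.kidSum a φ s) ≤ C * (1 + θ * p) ^ n := by
    have h4 : ENNReal.ofReal (Real.exp (P.kidSum a φ s)) * c ^ n ≤ C := hN1
    have h5 : ENNReal.ofReal (Real.exp (P.kidSum a φ s)) ≤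
        ENNReal.ofReal (C * (1 + θ * p) ^ n) := by
      calc ENNReal.ofReal (Real.exp (P.kidSum a φ s))
          = ENNReal.ofReal (Real.exp (P.kidSum a φ s)) * c ^ n *
              ENNReal.ofReal (1 + θ * p) ^ n := by
            rw [mul_assoc, ← mul_pow, mul_comm c, hcp, one_pow, mul_one]
        _ ≤ C * ENNReal.ofReal (1 + θ * p) ^ n := by gcongr
        _ = _ := by
            rw [ENNReal.ofReal_mul (NNReal.coe_nonneg C), ENNReal.ofReal_pow hp1.le, ENNReal.ofReal_coe_nnreal]
    exact (ENNReal.ofReal_le_ofReal_iff (by have := C.2; positivity)).1 h5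
  have h6 : P.kidSum a φ s ≤ C + θ * p * n := by
    refine Real.exp_le_exp.1 (h3.trans ?_)
    rw [Real.exp_add]
    refine mul_le_mul ?_ ?_ (by positivity) (Real.exp_pos _).le
    · have := Real.add_one_le_exp (C : ℝ); linarith
    · have h7 : (1 + θ * p) ≤ Real.exp (θ * p) := by
        have := Real.add_one_le_exp (θ * p); linarith
      calc (1 + θ * p) ^ n ≤ Real.exp (θ * p) ^ n := pow_le_pow_left₀ hp1.le h7 n
        _ = _ := by rw [← Real.exp_nat_mul]; congr 1; ring
  -- Back from logarithms to the sum: `log (1 + x) ≥ x - x ^ 2`, with `x ≤ θ` because `ψ ≤ 1`.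
  have h8 : θ * P.kidSum a (fun s => (ψ s).toReal) s - θ ^ 2 * n ≤ P.kidSum a φ s := by
    have : θ ^ 2 * (n : ℝ) = ∑ _j ∈ Finset.range n, θ ^ 2 := by
      rw [Finset.sum_const, Finset.card_range, nsmul_eq_mul]; ring
    rw [kidSum, kidSum, ← hn, Finset.mul_sum, this, ← Finset.sum_sub_distrib]
    refine Finset.sum_le_sum fun j hj => ?_
    have hle : ψ (P.kid a j s) ≤ 1 := by
      rw [kid, hfst]; exact h1 _ _ (P.inv_kid hinv (Finset.mem_range.1 hj))
    have hle' : (ψ (P.kid a j s)).toReal ≤ 1 :=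
      ENNReal.toReal_le_of_le_ofReal zero_le_one (by simpa using hle)
    have h0 := ENNReal.toReal_nonneg (a := ψ (P.kid a j s))
    refine le_trans ?_ (sub_sq_le_log (x := θ * (ψ (P.kid a j s)).toReal) (by positivity))
    have : (θ * (ψ (P.kid a j s)).toReal) ^ 2 ≤ θ ^ 2 := by
      rw [mul_pow]
      exact mul_le_of_le_one_right (by positivity) (pow_le_one₀ h0 hle')
    linarith
  have h9 : (C : ℝ) ≤ θ * (θ * n) := by
    have := (Nat.le_ceil ((C : ℝ) / θ / θ)).trans (Nat.cast_le.2 hN2)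
    rw [div_le_iff₀ hθ0, div_le_iff₀ hθ0] at this
    linarith
  have h10 : θ * P.kidSum a (fun s => (ψ s).toReal) s ≤ θ * ((p + 2 * θ) * n) := by nlinarith
  have h11 := le_of_mul_le_mul_left h10 hθ0
  refine h11.trans (mul_le_mul_of_nonneg_right (by linarith) (Nat.cast_nonneg _))

end Planner

/-! ### From the branches to the node -/

theorem measurableSet_eventually_chain {E 𝒯 : Type*} [MeasurableSpace E] [MeasurableSpace 𝒯]
    {F : 𝒯 → E → 𝒯} (hF : Measurable (Function.uncurry F)) {B : Set 𝒯} (hB : MeasurableSet B) :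
    MeasurableSet {p : 𝒯 × (ℕ → E) | ∀ᶠ n in atTop, chain F p.1 p.2 n ∈ B} := by
  have : {p : 𝒯 × (ℕ → E) | ∀ᶠ n in atTop, chain F p.1 p.2 n ∈ B} =
      ⋃ i, ⋂ n, ⋂ (_ : i ≤ n), {p | chain F p.1 p.2 n ∈ B} := by
    ext p; simp [eventually_atTop]
  rw [this]
  exact MeasurableSet.iUnion fun i => MeasurableSet.iInter fun n => MeasurableSet.iInter fun _ =>
    measurable_chain hF n hB

namespace Planner

variable {X A Z : Type*} [MeasurableSpace X] [MeasurableSpace Z] [Fintype A] [Nonempty A]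
  [MeasurableSpace A] [DiscreteMeasurableSpace A] (P : Planner X A Z) {K : ℕ}

/-- The states outside `G` at times from `L` on (at all times, if the clock does not run). -/
def lateBad (k L : ℕ) (G : Set (LocalState A Z)) : Set (LocalState A Z) :=
  {q | (k = 0 ∨ L ≤ P.clock q.2) ∧ q ∉ G}

theorem measurableSet_lateBad (k L : ℕ) {G : Set (LocalState A Z)} (hG : MeasurableSet G) :
    MeasurableSet (P.lateBad k L G) :=
  ((MeasurableSet.const _).union (measurableSet_le measurable_const
    (P.measurable_clock.comp measurable_snd))).inter hG.compl

/-- The probability that the tree does not eventually remain in `G`. -/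
def badProb (K k : ℕ) (G : Set (LocalState A Z)) (q : LocalState A Z) : ℝ≥0∞ :=
  seqLaw (noiseLaw K) {ω | ¬ ∀ᶠ N in atTop, chain (P.localStep K k) q ω N ∈ G}

theorem measurable_badProb (k : ℕ) {G : Set (LocalState A Z)} (hG : MeasurableSet G) :
    Measurable (P.badProb K k G) :=
  measurable_measure_prodMk_left
    (measurableSet_eventually_chain (P.measurable_localStep k) hG).compl

theorem badProb_le_one (k : ℕ) (G : Set (LocalState A Z)) (q : LocalState A Z) :
    P.badProb K k G q ≤ 1 := prob_le_one

theorem chain_localStep_zero (q : LocalState A Z) (ω : ℕ → Noise K) (N : ℕ) :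
    chain (P.localStep K 0) q ω N = q := by
  induction N with
  | zero => rfl
  | succ N ih => rw [chain, ih]; rfl

/-- Lets the state itself tell the time, so that being bad at a late time is membership in a set of
states and its probability is a hitting probability. -/
theorem clock_chain (k : ℕ) {q : LocalState A Z} (hq : P.Inv (k + 1) q.2) (ω : ℕ → Noise K)
    (N : ℕ) : P.clock (chain (P.localStep K (k + 1)) q ω N).2 = P.clock q.2 + N := by
  induction N with
  | zero => rfl
  | succ N ih => rw [chain, P.clock_localStep k (P.inv_chain (k + 1) hq ω N), ih, add_assoc]

/-- The events decrease in `L`, and a trajectory that reaches all of these sets is outside `G` at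
arbitrarily late times, since from a seed tree the clock equals the time. For `k = 0` the state
never moves, so the condition on the clock is void there. -/
theorem exists_tendsto_hitProb_lateBad (k : ℕ) (g : Hist A Z) {G : Set (LocalState A Z)}
    (hG : MeasurableSet G) : ∃ l ≤ P.badProb K k G (g, P.seedTree k),
      Tendsto (fun L => hitProb (noiseLaw K) (P.localStep K k) (P.lateBad k L G)
        (g, P.seedTree k)) atTop (𝓝 l) := by
  set q : LocalState A Z := (g, P.seedTree k) with hq
  have hm : ∀ L, MeasurableSet {ω : ℕ → Noise K | ∃ n, chain (P.localStep K k) q ω n ∈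
      P.lateBad k L G} := fun L =>
    measurable_prodMk_left (x := q)
      (measurableSet_exists_chain (P.measurable_localStep k) (P.measurableSet_lateBad k L hG))
  refine ⟨_, ?_, tendsto_measure_iInter_atTop (fun L => (hm L).nullMeasurableSet) ?_
    ⟨0, measure_ne_top _ _⟩⟩
  · refine measure_mono fun ω hω hev => ?_
    rw [Set.mem_iInter] at hω
    obtain ⟨N, hN⟩ := eventually_atTop.1 hev
    obtain ⟨n, h1, h2⟩ := hω N
    cases k with
    | zero =>
      rw [chain_localStep_zero] at h2
      have := hN N le_rfl
      rw [chain_localStep_zero] at this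
      exact h2 this
    | succ k =>
      rw [P.clock_chain k (q := q) (P.inv_seedTree (k + 1)), hq, clock_seedTree, zero_add] at h1
      exact h2 (hN n (by simpa using h1))
  · rintro L L' hL ω ⟨n, h1, h2⟩
    exact ⟨n, h1.imp_right hL.trans, h2⟩

/-- Dominated convergence over the random new measurement provides one lateness `L` that serves all
branches on average. -/
theorem exists_lintegral_hitProb_le (k : ℕ) (g : Hist A Z) (a : A) {G : Set (LocalState A Z)}
    (hG : MeasurableSet G) {ε : ℝ≥0∞} (hε : ε ≠ 0) : ∃ L,
      ∫⁻ ξ, hitProb (noiseLaw K) (P.localStep K k) (P.lateBad k L G) (P.newKid k g a ξ)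
        ∂noiseLaw K ≤ (∫⁻ ξ, P.badProb K k G (P.newKid k g a ξ) ∂noiseLaw K) + ε := by
  have h : ∀ ξ : Noise K, ∃ l ≤ P.badProb K k G (P.newKid k g a ξ),
      Tendsto (fun L => hitProb (noiseLaw K) (P.localStep K k) (P.lateBad k L G)
        (P.newKid k g a ξ)) atTop (𝓝 l) := fun ξ =>
    P.exists_tendsto_hitProb_lateBad k _ hG
  choose l hl1 hl2 using h
  have hmeas : ∀ L, Measurable fun ξ : Noise K => hitProb (noiseLaw K) (P.localStep K k)
      (P.lateBad k L G) (P.newKid k g a ξ) := fun L =>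
    (measurable_hitProb (noiseLaw K) (P.measurable_localStep k)
      (P.measurableSet_lateBad k L hG)).comp (P.measurable_newKid k g a)
  have ht := tendsto_lintegral_of_dominated_convergence (μ := noiseLaw K) (bound := fun _ => 1)
    hmeas (fun L => Eventually.of_forall fun ξ => hitProb_le_one _ _ _ _) (by simp)
    (Eventually.of_forall hl2)
  have hle : ∫⁻ ξ, l ξ ∂noiseLaw K ≤ ∫⁻ ξ, P.badProb K k G (P.newKid k g a ξ) ∂noiseLaw K :=
    lintegral_mono hl1
  have hfin : ∫⁻ ξ, l ξ ∂noiseLaw K ≠ ∞ := by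
    refine ((hle.trans (lintegral_mono fun ξ => P.badProb_le_one k G _)).trans_lt ?_).ne
    simp
  obtain ⟨L, hL⟩ := (ht.eventually_le_const (ENNReal.lt_add_right hfin hε)).exists
  exact ⟨L, hL.trans (by gcongr)⟩

theorem numBranches_seedTree (k : ℕ) (g : Hist A Z) (a : A) :
    numBranches a (g, P.seedTree k) = 0 := by
  cases k <;> rfl

/-- A branch behaves like a tree that starts from a new measurement. -/
theorem prob_kid_le (k : ℕ) (g : Hist A Z) (a : A) (j : ℕ) {G : Set (LocalState A Z)}
    (hG : MeasurableSet G) :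
    seqLaw (noiseLaw K) {ω | ¬ ∀ᶠ N in atTop,
      j < numBranches a (chain (P.localStep K (k + 2)) (g, P.seedTree (k + 2)) ω N) ∧
      P.kid a j (chain (P.localStep K (k + 2)) (g, P.seedTree (k + 2)) ω N) ∈ G} ≤
      ∫⁻ ξ, P.badProb K (k + 1) G (P.newKid (k + 1) g a ξ) ∂noiseLaw K := by
  classical
  refine ENNReal.le_of_forall_pos_le_add fun ε hε _ => ?_
  obtain ⟨L, hL⟩ := P.exists_lintegral_hitProb_le (K := K) (k + 1) g a hG
    (ε := ε) (by simpa using hε.ne')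
  refine le_trans ?_ hL
  set B := P.lateBad (k + 1) L G with hB
  have hBm : MeasurableSet B := P.measurableSet_lateBad (k + 1) L hG
  set ψ := hitProb (noiseLaw K) (P.localStep K (k + 1)) B with hψ
  have hψm : Measurable ψ := measurable_hitProb _ (P.measurable_localStep (k + 1)) hBm
  set p := ∫⁻ ξ, ψ (P.newKid (k + 1) g a ξ) ∂noiseLaw K with hp
  set q : LocalState A Z := (g, P.seedTree (k + 2)) with hq
  have hqI : P.Inv (k + 2) q.2 := P.inv_seedTree (k + 2)
  -- The best available forecast of failure: before branch `j` exists, the mean `p` over a new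
  -- branch, which does not depend on when the branch is opened; afterwards the hitting probability
  -- of its current state. It starts at `p` and equals `1` on failure, so the maximal inequality at
  -- level `1` bounds the probability of failure by `p`.
  set Ψ : LocalState A Z → ℝ≥0∞ := fun s => if j < numBranches a s then ψ (P.kid a j s) else p
    with hΨ
  have hΨm : Measurable Ψ := Measurable.ite
    (measurableSet_lt measurable_const (measurable_numBranches a))
    (hψm.comp (P.measurable_kid a j)) measurable_const
  have hΨq : Ψ q = p := by
    rw [hΨ]; exact if_neg (by rw [hq, numBranches_seedTree]; omega)
  have hpos : ∀ s, j < numBranches a s → Ψ s = ψ (P.kid a j s) := fun s h => if_pos h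
  have hneg : ∀ s, ¬ j < numBranches a s → Ψ s = p := fun s h => if_neg h
  have key := prob_exists_le_of_superharmonic (noiseLaw K) (P.measurable_localStep (k + 2))
    (I := fun s : LocalState A Z => P.Inv (k + 2) s.2 ∧ s.1 = g)
    (fun s hs ξ => ⟨P.inv_localStep (k + 2) hs.1 ξ, hs.2⟩) hΨm MeasurableSet.univ
    (fun s hs _ => by
      obtain ⟨hs, hsg⟩ := hs
      refine P.lintegral_localStep_le_of_forall (k + 1) hs.1 hΨm fun b i hi => ?_
      have const : ∀ c : ℝ≥0∞, (∀ ξ : Noise K, Ψ (P.stepTo (k + 1) b i s ξ) = c) → c ≤ Ψ s →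
          ∫⁻ ξ, Ψ (P.stepTo (k + 1) b i s ξ) ∂noiseLaw K ≤ Ψ s := by
        intro c h1 h2
        simp_rw [h1]
        rw [lintegral_const, measure_univ, mul_one]
        exact h2
      by_cases hj : j < numBranches a s
      · by_cases hab : (a, j) = (b, i)
        · obtain ⟨h1, h2⟩ := Prod.mk.inj hab
          subst h1 h2
          have : ∀ ξ : Noise K, Ψ (P.stepTo (k + 1) a j s ξ) =
              ψ (P.localStep K (k + 1) (P.kid a j s) ξ) := fun ξ => by
            rw [hpos _ (by rwa [P.numBranches_stepTo_of_lt _ _ _ _ _ hj]),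
              P.kid_stepTo_self _ _ _ _ _ hj]
          simp_rw [this]
          rw [hpos s hj]
          exact lintegral_hitProb_le _ (P.measurable_localStep (k + 1)) hBm _
        · refine const (Ψ s) (fun ξ => ?_) le_rfl
          have hn : j < numBranches a (P.stepTo (k + 1) b i s ξ) := by
            by_cases hb : a = b
            · subst hb
              rcases hi.lt_or_eq with h | h
              · rwa [P.numBranches_stepTo_of_lt _ _ _ _ _ h]
              · rw [h, P.numBranches_stepTo_new]; omega
            · rwa [P.numBranches_stepTo_of_ne _ _ _ _ _ hb]
          rw [hpos _ hn, hpos s hj, P.kid_stepTo_of_ne _ _ _ _ _ hab hj]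
      · rw [hneg s hj] at const ⊢
        -- The only step that brings branch `j` into existence; there the mean of `Ψ` is `p` by
        -- definition.
        by_cases hnew : a = b ∧ i = numBranches a s ∧ j = numBranches a s
        · obtain ⟨h1, h2, h3⟩ := hnew
          subst h1
          have : ∀ ξ : Noise K, Ψ (P.stepTo (k + 1) a i s ξ) =
              ψ (P.newKid (k + 1) g a ξ) := fun ξ => by
            rw [h2, hpos _ (by rw [P.numBranches_stepTo_new]; omega), h3,
              P.kid_stepTo_new _ _ _ _ (hs.2.2.1 a _ le_rfl), hsg]
          simp_rw [this]
          exact le_rfl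
        · refine const p (fun ξ => hneg _ ?_) le_rfl
          by_cases hb : a = b
          · subst hb
            rcases hi.lt_or_eq with h | h
            · rwa [P.numBranches_stepTo_of_lt _ _ _ _ _ h]
            · rw [h, P.numBranches_stepTo_new]
              intro h'
              exact hnew ⟨rfl, h, by omega⟩
          · rwa [P.numBranches_stepTo_of_ne _ _ _ _ _ hb])
    one_ne_zero ENNReal.one_ne_top (s := q) ⟨hqI, rfl⟩
  rw [hΨq, div_one] at key
  refine le_trans (measure_mono_ae ?_) key
  -- The branch is taken infinitely often, so being bad again and again in the time of the parent
  -- means being bad at an arbitrarily late clock of its own.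
  filter_upwards [P.ae_tendsto_clock_kid (K := K) k hqI a j] with ω hω hbad
  obtain ⟨h1, h2⟩ := hω
  have h3 : ¬ ∀ᶠ N in atTop, P.kid a j (chain (P.localStep K (k + 2)) q ω N) ∈ G := fun h =>
    hbad (h1.and h)
  rw [not_eventually] at h3
  obtain ⟨N, hN1, hN2, hN3⟩ := (h3.and_eventually (h1.and (h2.eventually_ge_atTop L))).exists
  refine ⟨N, ?_, fun _ _ => Set.mem_univ _⟩
  rw [hpos _ hN2, hψ, hitProb_of_mem]
  exact ⟨Or.inr hN3, hN1⟩

end Planner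

/-! ### Averages over the branches -/

namespace Planner

variable {X A Z : Type*} [MeasurableSpace X] [MeasurableSpace Z] [Fintype A] [Nonempty A]
  [MeasurableSpace A] [DiscreteMeasurableSpace A] (P : Planner X A Z) {K : ℕ}

/-- An upper bound for the indicator of the trees that have been visited less than `L` times. -/
def earlyWeight (k L : ℕ) (s : LocalState A Z) : ℝ :=
  if k = 0 then 0 else 2 ^ L * (1 / 2 : ℝ) ^ P.clock s.2

theorem earlyWeight_nonneg (k L : ℕ) (s : LocalState A Z) : 0 ≤ P.earlyWeight k L s := by
  unfold earlyWeight; split_ifs <;> positivity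

theorem one_le_earlyWeight {k L : ℕ} (hk : k ≠ 0) {s : LocalState A Z} (h : P.clock s.2 ≤ L) :
    1 ≤ P.earlyWeight k L s := by
  rw [earlyWeight, if_neg hk, one_div, inv_pow, ← div_eq_mul_inv, one_le_div (by positivity)]
  exact pow_le_pow_right₀ one_le_two h

theorem ae_eventually_kidSum_earlyWeight_le (k L : ℕ) {q : LocalState A Z}
    (hq : P.Inv (k + 1) q.2) (a : A) {η : ℝ} (hη : 0 < η) :
    ∀ᵐ ω ∂seqLaw (noiseLaw K), ∀ᶠ N in atTop,
      P.kidSum a (P.earlyWeight k L) (chain (P.localStep K (k + 1)) q ω N) ≤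
        η * numBranches a (chain (P.localStep K (k + 1)) q ω N) := by
  cases k with
  | zero =>
    refine Eventually.of_forall fun ω => Eventually.of_forall fun N => ?_
    have : P.kidSum a (P.earlyWeight 0 L) (chain (P.localStep K (0 + 1)) q ω N) = 0 :=
      Finset.sum_eq_zero fun j _ => if_pos rfl
    rw [this]
    positivity
  | succ k =>
    filter_upwards [P.ae_eventually_kidSum_clock_le (K := K) k hq a
      (η := η / 2 ^ L) (by positivity)] with ω hω
    filter_upwards [hω] with N hN
    set s := chain (P.localStep K (k + 1 + 1)) q ω N
    have : P.kidSum a (P.earlyWeight (k + 1) L) s =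
        2 ^ L * P.kidSum a (fun s => (1 / 2 : ℝ) ^ P.clock s.2) s := by
      rw [kidSum, kidSum, Finset.mul_sum]
      exact Finset.sum_congr rfl fun j _ => if_neg (Nat.succ_ne_zero k)
    rw [this]
    calc _ ≤ 2 ^ L * (η / 2 ^ L * numBranches a s) := by gcongr
      _ = η * numBranches a s := by field_simp

/-- The average of a function of the measurements over the branches. -/
theorem ae_eventually_kidSum_fst_le (k : ℕ) {q : LocalState A Z} (hq : P.Inv (k + 1) q.2) (a : A)
    {u : Hist A Z → ℝ} (hu : Measurable u) {C : ℝ} (hC : 0 < C)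
    (huC : ∀ z, |u (q.1 ++ [(a, z)])| ≤ C) {η : ℝ} (hη : 0 < η) :
    ∀ᵐ ω ∂seqLaw (noiseLaw K), ∀ᶠ N in atTop,
      P.kidSum a (fun s => u s.1) (chain (P.localStep K (k + 1)) q ω N) ≤
        ((∫ ξ, u (q.1 ++ [(a, P.newMeas q.1 a ξ)]) ∂noiseLaw K) + η) *
          numBranches a (chain (P.localStep K (k + 1)) q ω N) := by
  set U := ∫ ξ, u (q.1 ++ [(a, P.newMeas q.1 a ξ)]) ∂noiseLaw K with hU
  -- Rescaled to the unit interval, a function of the history alone is constant along the evolution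
  -- of a branch, hence superharmonic, and the previous averaging result applies with `p` its exact
  -- mean.
  set ψ : LocalState A Z → ℝ≥0∞ := fun s => ENNReal.ofReal ((u s.1 + C) / (2 * C)) with hψ
  have hψm : Measurable ψ :=
    (((hu.comp measurable_fst).add_const C).div_const (2 * C)).ennreal_ofReal
  have h0 : ∀ z, 0 ≤ (u (q.1 ++ [(a, z)]) + C) / (2 * C) := fun z =>
    div_nonneg (by linarith [(abs_le.1 (huC z)).1]) (by linarith)
  have hum : Measurable fun ξ : Noise K => u (q.1 ++ [(a, P.newMeas q.1 a ξ)]) :=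
    hu.comp ((measurable_snoc q.1 a).comp (P.measurable_newMeas_right q.1 a))
  have hint : Integrable (fun ξ : Noise K => u (q.1 ++ [(a, P.newMeas q.1 a ξ)])) (noiseLaw K) :=
    Integrable.of_bound hum.aestronglyMeasurable C (Eventually.of_forall fun ξ => huC _)
  have hUC : |U| ≤ C := abs_integral_le_of_abs_le (noiseLaw K) fun ξ => huC _
  have hnew : ∫⁻ ξ, ψ (P.newKid k q.1 a ξ) ∂noiseLaw K = ENNReal.ofReal ((U + C) / (2 * C)) := by
    have e : (U + C) / (2 * C) =
        ∫ ξ, (u (q.1 ++ [(a, P.newMeas q.1 a ξ)]) + C) / (2 * C) ∂noiseLaw K := by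
      rw [integral_div, integral_add hint (integrable_const _), integral_const]
      simp [hU]
    rw [e]
    exact (ofReal_integral_eq_lintegral_ofReal ((hint.add (integrable_const C)).div_const _)
      (Eventually.of_forall fun ξ => h0 _)).symm
  filter_upwards [P.ae_eventually_kidSum_le (K := K) k hq a hψm
    (fun z T _ => by
      rw [hψ, ← ENNReal.ofReal_one]
      refine ENNReal.ofReal_le_ofReal ((div_le_one (by linarith)).2 ?_)
      linarith [(abs_le.1 (huC z)).2])
    (fun z T _ => by
      have : ∀ ξ : Noise K, ψ (P.localStep K k (q.1 ++ [(a, z)], T) ξ) = ψ (q.1 ++ [(a, z)], T) :=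
        fun ξ => rfl
      simp_rw [this]
      rw [lintegral_const, measure_univ, mul_one])
    (p := (U + C) / (2 * C)) (div_nonneg (by linarith [(abs_le.1 hUC).1]) (by linarith)) hnew.le
    (η := η / (2 * C)) (by positivity)] with ω hω
  filter_upwards [hω] with N hN
  have hfst := P.chain_fst (k + 1) q ω N
  set s := chain (P.localStep K (k + 1)) q ω N
  have e : P.kidSum a (fun s => (ψ s).toReal) s =
      (P.kidSum a (fun s => u s.1) s + C * numBranches a s) / (2 * C) := by
    have : C * (numBranches a s : ℝ) = ∑ _j ∈ Finset.range (numBranches a s), C := by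
      rw [Finset.sum_const, Finset.card_range, nsmul_eq_mul]; ring
    rw [kidSum, kidSum, this, ← Finset.sum_add_distrib, Finset.sum_div]
    refine Finset.sum_congr rfl fun j _ => ?_
    rw [hψ]
    refine ENNReal.toReal_ofReal ?_
    rw [kid, hfst]
    exact h0 _
  rw [e, div_le_iff₀ (by linarith)] at hN
  have : ((U + C) / (2 * C) + η / (2 * C)) * numBranches a s * (2 * C) =
      (U + C + η) * numBranches a s := by field_simp
  rw [this] at hN
  linarith

/-- If the trees below the branches eventually satisfy `y < u + δ`, up to a small probability, then
so does, approximately, the average over the branches. -/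
theorem ae_eventually_kidSum_le_of_badProb (k : ℕ) {q : LocalState A Z} (hq : P.Inv (k + 1) q.2)
    (a : A) {y : LocalState A Z → ℝ} (hy : Measurable y) {u : Hist A Z → ℝ} (hu : Measurable u)
    {C : ℝ} (hC : 0 < C) (hyC : ∀ z T, |y (q.1 ++ [(a, z)], T)| ≤ C)
    (huC : ∀ z, |u (q.1 ++ [(a, z)])| ≤ C) {δ η : ℝ} (hδ : 0 < δ) (hη : 0 < η)
    (hbad : ∫⁻ ξ, P.badProb K k {s | y s < u s.1 + δ} (P.newKid k q.1 a ξ) ∂noiseLaw K ≤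
      ENNReal.ofReal η) :
    ∀ᵐ ω ∂seqLaw (noiseLaw K), ∀ᶠ N in atTop,
      P.kidSum a y (chain (P.localStep K (k + 1)) q ω N) ≤
        ((∫ ξ, u (q.1 ++ [(a, P.newMeas q.1 a ξ)]) ∂noiseLaw K) + δ + 10 * C * η) *
          numBranches a (chain (P.localStep K (k + 1)) q ω N) := by
  set G : Set (LocalState A Z) := {s | y s < u s.1 + δ} with hG
  have hGm : MeasurableSet G := measurableSet_lt hy ((hu.comp measurable_fst).add_const δ)
  obtain ⟨L, hL⟩ := P.exists_lintegral_hitProb_le (K := K) k q.1 a hGm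
    (ε := ENNReal.ofReal η) (by simpa using hη)
  set B := P.lateBad k L G with hB
  have hBm : MeasurableSet B := P.measurableSet_lateBad k L hGm
  set ψ := hitProb (noiseLaw K) (P.localStep K k) B with hψ
  have hψm : Measurable ψ := measurable_hitProb _ (P.measurable_localStep k) hBm
  -- One `η` for never settling in `G`, the other for replacing this by the late hitting
  -- probability.
  have hnew : ∫⁻ ξ, ψ (P.newKid k q.1 a ξ) ∂noiseLaw K ≤ ENNReal.ofReal (2 * η) := by
    refine hL.trans ((add_le_add_left hbad _).trans ?_)
    rw [← ENNReal.ofReal_add hη.le hη.le, two_mul]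
  filter_upwards [P.ae_eventually_kidSum_le (K := K) k hq a hψm (fun z T _ => hitProb_le_one _ _ _ _)
    (fun z T _ => lintegral_hitProb_le _ (P.measurable_localStep k) hBm _) (by positivity) hnew hη,
    P.ae_eventually_kidSum_fst_le (K := K) k hq a hu hC huC (η := 2 * C * η) (by positivity),
    P.ae_eventually_kidSum_earlyWeight_le (K := K) k L hq a hη] with ω h1 h2 h3
  filter_upwards [h1, h2, h3] with N h1 h2 h3
  have hfst := P.chain_fst (k + 1) q ω N
  set s := chain (P.localStep K (k + 1)) q ω N
  set n := numBranches a s with hn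
  -- Each branch is in `G`, or late and bad, where `ψ = 1`, or early, where `earlyWeight ≥ 1`; in
  -- the last two cases the error is at most `2 C`. With averages `2 η + η` of `ψ` and `η` of the
  -- early weights, and the error `2 C η` in the average of `u`, the total is `10 C η`.
  have key : P.kidSum a y s ≤ P.kidSum a (fun s => u s.1) s + δ * n +
      2 * C * P.kidSum a (fun s => (ψ s).toReal) s + 2 * C * P.kidSum a (P.earlyWeight k L) s := by
    have hδn : δ * (n : ℝ) = ∑ _j ∈ Finset.range n, δ := by
      rw [Finset.sum_const, Finset.card_range, nsmul_eq_mul]; ring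
    simp only [kidSum]
    rw [hδn, Finset.mul_sum, Finset.mul_sum, ← hn, ← Finset.sum_add_distrib,
      ← Finset.sum_add_distrib, ← Finset.sum_add_distrib]
    refine Finset.sum_le_sum fun j _ => ?_
    set x := P.kid a j s with hx
    have hyx : |y x| ≤ C := by rw [hx, kid, hfst]; exact hyC _ _
    have hux : |u x.1| ≤ C := by rw [hx, kid, hfst]; exact huC _
    have hw := mul_nonneg (by linarith : 0 ≤ 2 * C) (P.earlyWeight_nonneg k L x)
    have hp := mul_nonneg (by linarith : 0 ≤ 2 * C) (ENNReal.toReal_nonneg (a := ψ x))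
    have hd : y x - u x.1 ≤ 2 * C := by linarith [(abs_le.1 hyx).2, (abs_le.1 hux).1]
    by_cases hxG : x ∈ G
    · have : y x < u x.1 + δ := hxG
      linarith
    · by_cases hxB : x ∈ B
      · have : ψ x = 1 := hitProb_of_mem _ _ hxB
        rw [this, ENNReal.toReal_one]
        linarith
      · have h4 : ¬ (k = 0 ∨ L ≤ P.clock x.2) := fun h => hxB ⟨h, hxG⟩
        rw [not_or, not_le] at h4
        have := mul_le_mul_of_nonneg_left (P.one_le_earlyWeight h4.1 h4.2.le)
          (by linarith : 0 ≤ 2 * C)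
        linarith
  have h5 := mul_le_mul_of_nonneg_left h1 (by linarith : 0 ≤ 2 * C)
  have h6 := mul_le_mul_of_nonneg_left h3 (by linarith : 0 ≤ 2 * C)
  linarith

end Planner

/-! ### Mean returns -/

namespace Planner

variable {X A Z : Type*} [MeasurableSpace X] [MeasurableSpace Z] [Fintype A] [Nonempty A]

variable [MeasurableSpace A] [DiscreteMeasurableSpace A] (P : Planner X A Z) {K : ℕ}

/-- At most `k` rewards and one rollout return enter, all with discount factors at most `1`. -/
theorem run_bounds (k : ℕ) (g : Hist A Z) (T : SearchTree A Z) (ξ : Noise K) (i : Fin (K + 1)) :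
    |(P.run k g T ξ).ret i| ≤ (k + 1) * P.bound ∧ 0 ≤ (P.run k g T ξ).lik i := by
  have hb := P.bound_nonneg
  induction k generalizing g T with
  | zero => simpa [run_zero] using hb
  | succ k ih =>
    by_cases hT : [] ∈ T.nodes
    · obtain ⟨hret, hlik, -⟩ := P.run_succ_aux k g hT ξ _ _ _ rfl rfl rfl
      rw [hret, hlik]
      set C := P.child k g T (P.pick g T ξ) (P.pickBranch g T (P.pick g T ξ) ξ) ξ with hC
      have h : |C.ret i| ≤ (k + 1) * P.bound ∧ 0 ≤ C.lik i := ih _ _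
      refine ⟨?_, mul_nonneg (NNReal.coe_nonneg _) h.2⟩
      refine (abs_add_le _ _).trans ?_
      have h1 := P.abs_gamma_pow_mul_le 1 h.1
      rw [pow_one] at h1
      have h2 := P.abs_reward_le (P.pos g (particleNoise ξ i)) (P.pick g T ξ)
        (P.nextPos g (P.pick g T ξ) (particleNoise ξ i))
      push_cast
      linarith
    · rw [P.run_of_not_mem k g hT]
      refine ⟨(P.abs_rollout_le _ _ _ _ _ _).trans ?_, zero_le_one⟩
      push_cast
      nlinarith [Nat.cast_nonneg (α := ℝ) k]

theorem abs_wavg_run_le (k : ℕ) (g : Hist A Z) (d : ℕ) (T : SearchTree A Z) (ξ : Noise K) :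
    |P.wavg g d (P.run k g T ξ) ξ| ≤ (g.length + k + 1) * P.bound := by
  refine abs_weighted_avg_le _
    (fun i => mul_nonneg (NNReal.coe_nonneg _) (P.run_bounds k g T ξ i).2) (fun i => ?_)
    (mul_nonneg (by positivity) P.bound_nonneg)
  refine (abs_add_le _ _).trans ?_
  have := P.abs_gamma_pow_mul_le (g.length - d) (P.run_bounds k g T ξ i).1
  linarith [P.abs_acc_le g (particleNoise ξ i) d]

theorem abs_returnAt_le (k : ℕ) (g : Hist A Z) (d : ℕ) (T : SearchTree A Z) (a : A) (j : ℕ)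
    (ξ : Noise K) : |P.returnAt k g d T a j ξ| ≤ (g.length + k + 2) * P.bound := by
  refine (P.abs_wavg_run_le k _ d _ ξ).trans (le_of_eq ?_)
  rw [List.length_append, List.length_singleton]
  push_cast
  ring

theorem measurable_runInput :
    Measurable fun p : LocalState A Z × Noise K => ((p.1.1, p.1.2, p.2) : RunInput A Z K) :=
  measurable_fst.fst.prodMk (measurable_fst.snd.prodMk measurable_snd)

theorem measurable_runInput_right (g : Hist A Z) (T : SearchTree A Z) :
    Measurable fun ξ : Noise K => ((g, T, ξ) : RunInput A Z K) :=
  measurable_const.prodMk (measurable_const.prodMk measurable_id)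

/-- The mean return from depth `d` of an episode in the tree. -/
def localMean (K k d : ℕ) (q : LocalState A Z) : ℝ :=
  ∫ ξ, P.wavg q.1 d (P.run k q.1 q.2 ξ) ξ ∂noiseLaw K

/-- The mean return from depth `d` of an episode in the tree that starts with the action `a`. -/
def actionMean (K k d : ℕ) (a : A) (q : LocalState A Z) : ℝ :=
  ∑ j ∈ Finset.range (numBranches a q + 1), branchProb P.εz (numBranches a q) j *
    ∫ ξ, P.returnAt k q.1 d q.2 a j ξ ∂noiseLaw K

theorem abs_localMean_le (k d : ℕ) (q : LocalState A Z) :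
    |P.localMean K k d q| ≤ (q.1.length + k + 1) * P.bound :=
  abs_integral_le_of_abs_le (noiseLaw K) fun ξ => P.abs_wavg_run_le k _ d _ ξ

theorem abs_integral_returnAt_le (k : ℕ) (g : Hist A Z) (d : ℕ) (T : SearchTree A Z) (a : A)
    (j : ℕ) : |∫ ξ, P.returnAt k g d T a j ξ ∂noiseLaw K| ≤ (g.length + k + 2) * P.bound :=
  abs_integral_le_of_abs_le (noiseLaw K) fun ξ => P.abs_returnAt_le k g d T a j ξ

theorem measurable_localMean (k d : ℕ) : Measurable (P.localMean K k d) := by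
  have h0 := P.measurable_wavg_run (K := K) k d
  have h1 := h0.comp (measurable_runInput (A := A) (Z := Z) (K := K))
  have h2 := h1.stronglyMeasurable.integral_prod_right' (ν := noiseLaw K)
  exact h2.measurable

theorem measurable_integral_returnAt (k d : ℕ) (a : A) (j : ℕ) : Measurable
    fun q : LocalState A Z => ∫ ξ, P.returnAt k q.1 d q.2 a j ξ ∂noiseLaw K := by
  have h0 := P.measurable_returnAt (K := K) k d a j
  have h1 := h0.comp (measurable_runInput (A := A) (Z := Z) (K := K))
  have h2 := h1.stronglyMeasurable.integral_prod_right' (ν := noiseLaw K)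
  exact h2.measurable

theorem measurable_actionMean (k d : ℕ) (a : A) : Measurable (P.actionMean K k d a) :=
  measurable_of_countable_choice (c := fun q => numBranches a q)
    (f := fun n q => ∑ j ∈ Finset.range (n + 1), branchProb P.εz n j *
      ∫ ξ, P.returnAt k q.1 d q.2 a j ξ ∂noiseLaw K) (measurable_numBranches a)
    fun _ => Finset.measurable_sum _ fun j _ => (P.measurable_integral_returnAt k d a j).const_mul _

theorem returnAt_of_lt (k d : ℕ) {a : A} {j : ℕ} {q : LocalState A Z} (h : j < numBranches a q)
    (ξ : Noise K) : P.returnAt k q.1 d q.2 a j ξ =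
      P.wavg (P.kid a j q).1 d (P.run k (P.kid a j q).1 (P.kid a j q).2 ξ) ξ := by
  have hm : P.measAt q.1 q.2 a j ξ =
      (q.2.branches [] a).getD j (P.sim.sense (P.sim.start 0) 0) := by
    have h' : j < (q.2.branches [] a).length := h
    rw [measAt, List.getD_eq_getElem _ _ h', List.getD_eq_getElem _ _ h']
  rw [returnAt, child, hm]
  rfl

theorem integral_returnAt_of_lt (k d : ℕ) {a : A} {j : ℕ} {q : LocalState A Z}
    (h : j < numBranches a q) :
    ∫ ξ, P.returnAt k q.1 d q.2 a j ξ ∂noiseLaw K = P.localMean K k d (P.kid a j q) := by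
  simp_rw [P.returnAt_of_lt k d h]
  rfl

theorem measurable_returnAt_right (k d : ℕ) (a : A) (j : ℕ) (q : LocalState A Z) :
    Measurable fun ξ : Noise K => P.returnAt k q.1 d q.2 a j ξ := by
  have h0 := P.measurable_returnAt (K := K) k d a j
  have h1 := h0.comp (measurable_runInput_right (A := A) (Z := Z) (K := K) q.1 q.2)
  exact h1

/-- The return below a fixed pair of an action and a branch does not read the seeds of that choice,
so the mean over the choice comes out as a weighted sum. -/
theorem localMean_succ (k : ℕ) {d : ℕ} {q : LocalState A Z} (hq : [] ∈ q.2.nodes)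
    (hd : d ≤ q.1.length) : P.localMean K (k + 1) d q =
      ∑ a, epsGreedy P.εa (steeringValues P.s q.2 [] q.1) a * P.actionMean K k d a q := by
  have : ∀ ξ : Noise K, P.wavg q.1 d (P.run (k + 1) q.1 q.2 ξ) ξ =
      P.returnAt k q.1 d q.2 (P.pick q.1 q.2 ξ) (P.pickBranch q.1 q.2 (P.pick q.1 q.2 ξ) ξ) ξ :=
    fun ξ => P.wavg_run_succ k q.1 hd hq ξ
  simp_rw [localMean, this]
  exact P.integral_choice q.1 q.2 (Φ := fun a j ξ => P.returnAt k q.1 d q.2 a j ξ)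
    (fun a j => P.measurable_returnAt_right k d a j q)
    (fun a j ξ => P.abs_returnAt_le k q.1 d q.2 a j ξ)
    fun a j p => P.returnAt_mixOn k q.1 d q.2 a j p

/-- The contribution of new branches to the mean return. -/
theorem abs_actionMean_sub_le (k d : ℕ) (a : A) (q : LocalState A Z) (hn : 0 < numBranches a q) :
    |P.actionMean K k d a q - P.kidSum a (P.localMean K k d) q / numBranches a q| ≤
      2 * ((q.1.length + k + 2) * P.bound) * ((numBranches a q : ℝ) + 1) ^ P.εz := by
  set n := numBranches a q with hnn
  set B := ((q.1.length : ℝ) + k + 2) * P.bound with hB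
  obtain ⟨hq0, hq1⟩ := spawnProb_mem P.εz_neg n
  set r := ((n : ℝ) + 1) ^ P.εz with hr
  have hn' : (0 : ℝ) < n := by exact_mod_cast hn
  have hB0 : 0 ≤ B := mul_nonneg (by positivity) P.bound_nonneg
  have hk : ∀ j, |P.localMean K k d (P.kid a j q)| ≤ B := fun j => by
    refine (P.abs_localMean_le k d _).trans (le_of_eq ?_)
    rw [kid, List.length_append, List.length_singleton, hB]
    push_cast
    ring
  -- Existing branches are equally likely, so the mean is the plain average over the branches mixed
  -- with one bounded term of weight `r`, the spawn probability.
  have e : P.actionMean K k d a q = (1 - r) * (P.kidSum a (P.localMean K k d) q / n) +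
      r * ∫ ξ, P.returnAt k q.1 d q.2 a n ξ ∂noiseLaw K := by
    rw [actionMean, ← hnn, Finset.sum_range_succ, branchProb, if_neg (lt_irrefl n)]
    congr 1
    rw [kidSum, ← hnn, Finset.sum_div, Finset.mul_sum]
    refine Finset.sum_congr rfl fun j hj => ?_
    have hj' := Finset.mem_range.1 hj
    rw [branchProb, if_pos hj', P.integral_returnAt_of_lt k d hj']
    ring
  have h1 : |P.kidSum a (P.localMean K k d) q / n| ≤ B := by
    rw [abs_div, Nat.abs_cast, div_le_iff₀ hn']
    refine (Finset.abs_sum_le_sum_abs _ _).trans ((Finset.sum_le_sum fun j _ => hk j).trans ?_)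
    rw [Finset.sum_const, Finset.card_range, nsmul_eq_mul, mul_comm]
  have h2 := P.abs_integral_returnAt_le (K := K) k q.1 d q.2 a n
  rw [e]
  have : (1 - r) * (P.kidSum a (P.localMean K k d) q / n) +
      r * (∫ ξ, P.returnAt k q.1 d q.2 a n ξ ∂noiseLaw K) -
        P.kidSum a (P.localMean K k d) q / n =
      ((∫ ξ, P.returnAt k q.1 d q.2 a n ξ ∂noiseLaw K) -
        P.kidSum a (P.localMean K k d) q / n) * r := by ring
  rw [this, abs_mul, abs_of_nonneg hq0]
  refine mul_le_mul_of_nonneg_right ((abs_sub _ _).trans ?_) hq0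
  linarith

/-- If the mean returns of the trees below the branches eventually satisfy an upper (`σ = 1`) or
lower (`σ = -1`) bound, up to a small probability, then so does the mean return of the action. -/
theorem ae_eventually_actionMean_le (k d : ℕ) {q : LocalState A Z} (hq : P.Inv (k + 1) q.2)
    (a : A) {σ : ℝ} (hσ : |σ| = 1) {u : Hist A Z → ℝ} (hu : Measurable u)
    {C : ℝ} (hC : 0 < C) (hyC : (q.1.length + k + 2) * P.bound ≤ C)
    (huC : ∀ z, |u (q.1 ++ [(a, z)])| ≤ C) {δ η : ℝ} (hδ : 0 < δ) (hη : 0 < η)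
    (hbad : ∫⁻ ξ, P.badProb K k {s | σ * P.localMean K k d s < u s.1 + δ}
      (P.newKid k q.1 a ξ) ∂noiseLaw K ≤ ENNReal.ofReal η) :
    ∀ᵐ ω ∂seqLaw (noiseLaw K), ∀ᶠ N in atTop,
      σ * P.actionMean K k d a (chain (P.localStep K (k + 1)) q ω N) ≤
        (∫ ξ, u (q.1 ++ [(a, P.newMeas q.1 a ξ)]) ∂noiseLaw K) + 2 * δ + 10 * C * η := by
  have hsp : Tendsto (fun n : ℕ => 2 * C * ((n : ℝ) + 1) ^ P.εz) atTop (𝓝 0) := by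
    simpa using P.tendsto_spawnProb.const_mul (2 * C)
  filter_upwards [P.ae_eventually_kidSum_le_of_badProb (K := K) k hq a
    (y := fun s => σ * P.localMean K k d s) ((P.measurable_localMean k d).const_mul σ) hu hC
    (fun z T => by
      rw [abs_mul, hσ, one_mul]
      refine (P.abs_localMean_le k d _).trans (le_trans (le_of_eq ?_) hyC)
      rw [List.length_append, List.length_singleton]
      push_cast
      ring) huC hδ hη hbad, P.ae_tendsto_numBranches (K := K) k hq a] with ω h1 h2
  filter_upwards [h1, h2.eventually_gt_atTop 0, h2.eventually (hsp.eventually_le_const hδ)]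
    with N hN1 hN2 hN3
  have hfst := P.chain_fst (k + 1) q ω N
  set s := chain (P.localStep K (k + 1)) q ω N
  have h3 := P.abs_actionMean_sub_le (K := K) k d a s hN2
  rw [hfst] at h3
  have hn : (0 : ℝ) < numBranches a s := by exact_mod_cast hN2
  have h4 : P.kidSum a (fun s => σ * P.localMean K k d s) s =
      σ * P.kidSum a (P.localMean K k d) s := by rw [kidSum, kidSum, Finset.mul_sum]
  rw [h4, ← div_le_iff₀ hn, mul_div_assoc] at hN1
  have h5 : σ * (P.actionMean K k d a s - P.kidSum a (P.localMean K k d) s / numBranches a s) ≤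
      δ := by
    refine (le_abs_self _).trans ?_
    rw [abs_mul, hσ, one_mul]
    refine h3.trans (le_trans ?_ hN3)
    gcongr
  linarith

end Planner

/-! ### The running estimates -/

theorem exp_le_one_add_add_sq {x D θ : ℝ} (hx : |x| ≤ D) (hθ : 0 ≤ θ)
    (hθD : θ * D ≤ 1) : Real.exp (θ * x) ≤ 1 + θ * x + (θ * D) ^ 2 := by
  have h0 : |θ * x| ≤ θ * D := by
    rw [abs_mul, abs_of_nonneg hθ]
    exact mul_le_mul_of_nonneg_left hx hθ
  have h1 := (abs_le.1 (Real.abs_exp_sub_one_sub_id_le (h0.trans hθD))).2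
  have h2 : (θ * x) ^ 2 ≤ (θ * D) ^ 2 := sq_le_sq' (by linarith [(abs_le.1 h0).1])
    (by linarith [(abs_le.1 h0).2])
  linarith

theorem integral_affine {α : Type*} [MeasurableSpace α] {μ : Measure α} [IsProbabilityMeasure μ]
    {f : α → ℝ} (hf : Integrable f μ) (b c : ℝ) :
    ∫ x, (b * f x + c) ∂μ = b * (∫ x, f x ∂μ) + c := by
  rw [integral_add (hf.const_mul b) (integrable_const c), integral_const_mul]
  simp

namespace Planner

variable {X A Z : Type*} [MeasurableSpace X] [MeasurableSpace Z] [Fintype A] [Nonempty A]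
  [MeasurableSpace A] [DiscreteMeasurableSpace A] (P : Planner X A Z) {K : ℕ}

theorem ae_tendsto_visits (k : ℕ) {q : LocalState A Z} (hq : P.Inv (k + 1) q.2) (a : A) :
    ∀ᵐ ω ∂seqLaw (noiseLaw K),
      Tendsto (fun N => (chain (P.localStep K (k + 1)) q ω N).2.visits [] a) atTop atTop := by
  refine ae_tendsto_atTop_of_prob_ge (noiseLaw K) (P.measurable_localStep (k + 1))
    (I := fun q : LocalState A Z => P.Inv (k + 1) q.2)
    (fun s hs ξ => P.inv_localStep (k + 1) hs ξ)
    (N := fun q : LocalState A Z => q.2.visits [] a)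
    ((SearchTree.measurable_visits [] a).comp measurable_snd) (numBranches a)
    P.rate_pos (fun s hs ξ => ?_)
    (fun s hs ξ => (P.numBranches_localStep k hs.1 a ξ).2) (fun s hs => ?_) hq
  · rw [P.localStep_succ k hs.1]
    by_cases h : a = P.pick s.1 s.2 ξ
    · rw [← h, stepTo_visits_self]; omega
    · rw [P.stepTo_visits_of_ne _ _ _ _ _ h]
  · refine P.measure_le_of_choice s a le_rfl fun ξ hξ h => ?_
    have h' : (P.localStep K (k + 1) s ξ).2.visits [] a = s.2.visits [] a := h
    rw [P.localStep_of_choice k hs.1 hξ, stepTo_visits_self] at h'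
    omega

/-- Undoes the running mean: multiplied by the visit number, the centred estimate is a random walk
whose increments are the centred returns. The initial statistics of the node only determine where it
starts. -/
theorem visits_mul_value_stepTo (k : ℕ) (a : A) (j : ℕ) (q : LocalState A Z) (ξ : Noise K)
    (σ c : ℝ) : ((P.stepTo k a j q ξ).2.visits [] a : ℝ) *
      (σ * (P.stepTo k a j q ξ).2.value [] a - c) =
      q.2.visits [] a * (σ * q.2.value [] a - c) +
        (σ * P.returnAt k q.1 q.1.length q.2 a j ξ - c) := by
  rw [stepTo_visits_self, stepTo_value_self]
  have : ((q.2.visits [] a + 1 : ℕ) : ℝ) ≠ 0 := by positivity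
  push_cast at this ⊢
  field_simp
  ring

/-- A running estimate inherits the asymptotic bounds of the conditional mean returns. -/
theorem ae_eventually_value_le (k : ℕ) {q : LocalState A Z} (hq : P.Inv (k + 1) q.2) (a : A)
    {σ : ℝ} (hσ : |σ| = 1) {c δ : ℝ} (hδ : 0 < δ)
    (h : ∀ᵐ ω ∂seqLaw (noiseLaw K), ∀ᶠ N in atTop,
      σ * P.actionMean K k q.1.length a (chain (P.localStep K (k + 1)) q ω N) ≤ c) :
    ∀ᵐ ω ∂seqLaw (noiseLaw K), ∀ᶠ N in atTop,
      σ * (chain (P.localStep K (k + 1)) q ω N).2.value [] a ≤ c + δ := by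
  set d := q.1.length with hd
  -- Centring at `c + δ / 2` gives the walk drift at most `-δ / 2` whenever the conditional mean is
  -- at most `c`.
  set c' := c + δ / 2 with hc'
  set B := ((q.1.length : ℝ) + k + 2) * P.bound with hB
  have hB0 : 0 ≤ B := mul_nonneg (by positivity) P.bound_nonneg
  set D := B + |c'| + 1 with hD
  have hD1 : 1 ≤ D := by have := abs_nonneg c'; linarith
  have hD0 : 0 < D := by linarith
  -- Small enough for the quadratic bound on the exponential and for its error `(θ D) ^ 2` to be
  -- dominated by the drift `θ δ / 2`.
  set θ := min (1 / D) (δ / (2 * D ^ 2)) with hθ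
  have hθ0 : 0 < θ := lt_min (by positivity) (by positivity)
  have hθD : θ * D ≤ 1 := by
    have := min_le_left (1 / D) (δ / (2 * D ^ 2))
    rwa [← hθ, le_div_iff₀ hD0] at this
  have hθδ : (θ * D) ^ 2 ≤ θ * (δ / 2) := by
    have := min_le_right (1 / D) (δ / (2 * D ^ 2))
    rw [← hθ, le_div_iff₀ (by positivity)] at this
    nlinarith
  set W : LocalState A Z → ℝ := fun s => s.2.visits [] a * (σ * s.2.value [] a - c') with hW
  have hWm : Measurable W :=
    ((measurable_from_top (f := fun n : ℕ => (n : ℝ))).comp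
      ((SearchTree.measurable_visits [] a).comp measurable_snd)).mul
      ((((SearchTree.measurable_value [] a).comp measurable_snd).const_mul σ).sub_const c')
  set Θ : LocalState A Z → ℝ≥0∞ := fun s => ENNReal.ofReal (Real.exp (θ * W s)) with hΘ
  have hΘm : Measurable Θ := (Real.measurable_exp.comp (hWm.const_mul θ)).ennreal_ofReal
  have key := ae_bounded_of_superharmonic (noiseLaw K) (P.measurable_localStep (k + 1))
    (I := fun s : LocalState A Z => P.Inv (k + 1) s.2 ∧ s.1 = q.1)
    (fun s hs ξ => ⟨P.inv_localStep (k + 1) hs.1 ξ, hs.2⟩) hΘm (fun s _ => ENNReal.ofReal_ne_top)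
    -- The exponential of the walk is superharmonic only while the conditional mean is at most `c`;
    -- by assumption this holds eventually along almost every trajectory.
    (G := {s | σ * P.actionMean K k d a s ≤ c})
    (measurableSet_le ((P.measurable_actionMean k d a).const_mul σ) measurable_const)
    (fun s hs hG => by
      obtain ⟨hs, hsq⟩ := hs
      have hG' : σ * P.actionMean K k d a s ≤ c := hG
      refine P.lintegral_localStep_le k hs.1 hΘm fun b => ?_
      by_cases hb : a = b
      · subst hb
        set n := numBranches a s with hn
        set E := Real.exp (θ * W s) with hE
        set y : ℕ → ℝ := fun j => ∫ ξ, P.returnAt k s.1 d s.2 a j ξ ∂noiseLaw K with hy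
        have hret : ∀ j (ξ : Noise K), |σ * P.returnAt k s.1 d s.2 a j ξ - c'| ≤ D := by
          intro j ξ
          refine (abs_sub _ _).trans ?_
          rw [abs_mul, hσ, one_mul]
          have := P.abs_returnAt_le k s.1 d s.2 a j ξ
          rw [hsq] at this ⊢
          linarith
        have hterm : ∀ j, ∫⁻ ξ, Θ (P.stepTo k a j s ξ) ∂noiseLaw K ≤
            ENNReal.ofReal (E * (1 + θ * (σ * y j - c') + (θ * D) ^ 2)) := by
          intro j
          have hm : Measurable fun ξ : Noise K => P.returnAt k s.1 d s.2 a j ξ :=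
            P.measurable_returnAt_right k d a j s
          have hi : Integrable (fun ξ : Noise K => P.returnAt k s.1 d s.2 a j ξ) (noiseLaw K) :=
            Integrable.of_bound hm.aestronglyMeasurable _
              (Eventually.of_forall fun ξ => P.abs_returnAt_le k s.1 d s.2 a j ξ)
          have hi1 : Integrable (fun ξ : Noise K => σ * P.returnAt k s.1 d s.2 a j ξ - c')
              (noiseLaw K) := (hi.const_mul σ).sub (integrable_const c')
          have hi2 : Integrable (fun ξ : Noise K =>
              E * (1 + θ * (σ * P.returnAt k s.1 d s.2 a j ξ - c') + (θ * D) ^ 2))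
              (noiseLaw K) :=
            (((integrable_const 1).add (hi1.const_mul θ)).add (integrable_const _)).const_mul E
          have hle : ∀ ξ : Noise K, Real.exp (θ * W (P.stepTo k a j s ξ)) ≤
              E * (1 + θ * (σ * P.returnAt k s.1 d s.2 a j ξ - c') + (θ * D) ^ 2) := by
            intro ξ
            have hw : W (P.stepTo k a j s ξ) =
                W s + (σ * P.returnAt k s.1 d s.2 a j ξ - c') := by
              rw [hd, ← hsq]
              exact P.visits_mul_value_stepTo k a j s ξ σ c'
            rw [hw, mul_add, Real.exp_add]
            exact mul_le_mul_of_nonneg_left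
              (exp_le_one_add_add_sq (hret j ξ) hθ0.le hθD) (Real.exp_pos _).le
          have hval : ∫ ξ, E * (1 + θ * (σ * P.returnAt k s.1 d s.2 a j ξ - c') + (θ * D) ^ 2)
              ∂noiseLaw K = E * (1 + θ * (σ * y j - c') + (θ * D) ^ 2) := by
            have e : ∀ ξ : Noise K,
                E * (1 + θ * (σ * P.returnAt k s.1 d s.2 a j ξ - c') + (θ * D) ^ 2) =
                E * θ * σ * P.returnAt k s.1 d s.2 a j ξ + E * (1 - θ * c' + (θ * D) ^ 2) :=
              fun ξ => by ring
            simp_rw [e]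
            rw [integral_affine hi]
            simp only [hy]
            ring
          rw [← hval, ofReal_integral_eq_lintegral_ofReal hi2
            (Eventually.of_forall fun ξ => (Real.exp_pos _).le.trans (hle ξ))]
          exact lintegral_mono fun ξ => ENNReal.ofReal_le_ofReal (hle ξ)
        have hnn : ∀ j, 0 ≤ E * (1 + θ * (σ * y j - c') + (θ * D) ^ 2) := by
          intro j
          refine mul_nonneg (Real.exp_pos _).le ?_
          have hyD : |σ * y j - c'| ≤ D := by
            refine (abs_sub _ _).trans ?_
            rw [abs_mul, hσ, one_mul]
            have := P.abs_integral_returnAt_le (K := K) k s.1 d s.2 a j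
            rw [hsq] at this
            simp only [hy, hsq]
            linarith
          exact (Real.exp_pos _).le.trans (exp_le_one_add_add_sq hyD hθ0.le hθD)
        calc _ ≤ ∑ j ∈ Finset.range (n + 1), ENNReal.ofReal (branchProb P.εz n j) *
              ENNReal.ofReal (E * (1 + θ * (σ * y j - c') + (θ * D) ^ 2)) :=
              Finset.sum_le_sum fun j _ => mul_le_mul_right (hterm j) _
          _ = ENNReal.ofReal (∑ j ∈ Finset.range (n + 1), branchProb P.εz n j *
              (E * (1 + θ * (σ * y j - c') + (θ * D) ^ 2))) := by
              rw [ENNReal.ofReal_sum_of_nonneg fun j _ =>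
                mul_nonneg (branchProb_nonneg P.εz_neg n j) (hnn j)]
              exact Finset.sum_congr rfl fun j _ =>
                (ENNReal.ofReal_mul (branchProb_nonneg P.εz_neg n j)).symm
          _ ≤ ENNReal.ofReal E := by
              refine ENNReal.ofReal_le_ofReal ?_
              have e1 : ∑ j ∈ Finset.range (n + 1), branchProb P.εz n j *
                  (E * (1 + θ * (σ * y j - c') + (θ * D) ^ 2)) =
                  (∑ j ∈ Finset.range (n + 1), branchProb P.εz n j) *
                    (E * (1 - θ * c' + (θ * D) ^ 2)) +
                  E * θ * σ * P.actionMean K k d a s := by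
                rw [actionMean, Finset.mul_sum, Finset.sum_mul, ← Finset.sum_add_distrib]
                refine Finset.sum_congr rfl fun j _ => ?_
                simp only [hy, hn]
                ring
              rw [e1, sum_branchProb, one_mul]
              have hE0 : 0 < E := Real.exp_pos _
              have e2 : E * (1 - θ * c' + (θ * D) ^ 2) + E * θ * σ * P.actionMean K k d a s =
                  E * (1 + θ * (σ * P.actionMean K k d a s - c') + (θ * D) ^ 2) := by ring
              rw [e2]
              refine mul_le_of_le_one_right hE0.le ?_
              have : θ * (σ * P.actionMean K k d a s - c') ≤ θ * (-(δ / 2)) :=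
                mul_le_mul_of_nonneg_left (by linarith) hθ0.le
              linarith
      · refine P.sum_branchProb_mul_le fun j _ => ?_
        have : ∀ ξ : Noise K, Θ (P.stepTo k b j s ξ) = Θ s := fun ξ => by
          simp only [hΘ, hW]
          rw [P.stepTo_visits_of_ne _ _ _ _ _ hb, P.stepTo_value_of_ne _ _ _ _ _ hb]
        simp_rw [this]
        rw [lintegral_const, measure_univ, mul_one]) ⟨hq, rfl⟩
  filter_upwards [key, h, P.ae_tendsto_visits (K := K) k hq a] with ω h1 h2 h3
  obtain ⟨C, hC⟩ := h1 h2
  filter_upwards [hC, h3.eventually_gt_atTop ⌈(C : ℝ) / θ / (δ / 2)⌉₊] with N hN1 hN2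
  set s := chain (P.localStep K (k + 1)) q ω N
  have h4 : Real.exp (θ * W s) ≤ C := by
    have : ENNReal.ofReal (Real.exp (θ * W s)) ≤ C := hN1
    rwa [ENNReal.ofReal_le_iff_le_toReal ENNReal.coe_ne_top] at this
  have h5 : θ * W s ≤ C := by linarith [Real.add_one_le_exp (θ * W s)]
  have hm : (0 : ℝ) < s.2.visits [] a := by exact_mod_cast (Nat.zero_le _).trans_lt hN2
  have h6 : (C : ℝ) / θ / (δ / 2) < s.2.visits [] a := Nat.lt_of_ceil_lt hN2
  rw [div_lt_iff₀ (by linarith)] at h6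
  -- The walk stays bounded above while the visits tend to infinity, so the estimate is eventually
  -- at most `c' + δ / 2 = c + δ`.
  have h7 : W s ≤ C / θ := by rwa [le_div_iff₀ hθ0, mul_comm]
  have h8 : (s.2.visits [] a : ℝ) * (σ * s.2.value [] a - c') ≤ s.2.visits [] a * (δ / 2) :=
    h7.trans h6.le
  have := le_of_mul_le_mul_left h8 hm
  linarith

end Planner

/-! ### Consistency of the mean returns -/

namespace Planner

variable {X A Z : Type*} [MeasurableSpace X] [MeasurableSpace Z] [Fintype A] [Nonempty A]
  [MeasurableSpace A] [DiscreteMeasurableSpace A] (P : Planner X A Z) {H : ℕ} {π : Policy A Z}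

/-- The mean return of the trees with the history `g` tends to its limit, as `N` and then `K` tend
to infinity. -/
def Consistent (H : ℕ) (π : Policy A Z) (k d : ℕ) (g : Hist A Z) : Prop :=
  ∀ δ : ℝ, 0 < δ → ∀ᶠ K in atTop, ∀ᵐ ω ∂seqLaw (noiseLaw K), ∀ᶠ N in atTop,
    |P.localMean K k d (chain (P.localStep K k) (g, P.seedTree k) ω N) - P.nodeMean H π d g| < δ

/-- The mean return of an action tends to its limit. -/
def ActionConsistent (H : ℕ) (π : Policy A Z) (k d : ℕ) (g : Hist A Z) (a : A) : Prop :=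
  ∀ δ : ℝ, 0 < δ → ∀ᶠ K in atTop, ∀ᵐ ω ∂seqLaw (noiseLaw K), ∀ᶠ N in atTop,
    |P.actionMean K k d a (chain (P.localStep K (k + 1)) (g, P.seedTree (k + 1)) ω N) -
      P.branchMean H π d g a| ≤ δ

/-- At the horizon the tree never changes and the return is the self-normalised average of the
accumulated rewards, whose bias vanishes as `K` grows. -/
theorem consistent_zero {g : Hist A Z} (hg : P.Nondegenerate g) (hH : g.length = H) (d : ℕ) :
    P.Consistent H π 0 d g := by
  have h1 : ∀ K, P.localMean K 0 d (g, P.seedTree 0) =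
      ∫ ξ, snis (P.wt g) (fun u => P.acc g u d) (fun i => particleNoise ξ i) ∂noiseLaw K := by
    intro K
    simp [localMean, wavg, run_zero, snis]
  have h2 : P.nodeMean H π d g = (∫ u, P.wt g u * P.acc g u d ∂particleLaw) /
      ∫ u, (P.wt g u : ℝ) ∂particleLaw := by
    rw [P.integral_wt]
    simp [nodeMean, stateValue, hH, POMDP.expReturn, postMean]
  have h3 := tendsto_integral_snis (P.measurable_wt_right g) (P.integrable_wt hg.2)
    (by rw [P.integral_wt]; exact ENNReal.toReal_pos hg.1 hg.2)
    (P.measurable_acc_right g d) (fun u => P.abs_acc_le g u d)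
  intro δ hδ
  filter_upwards [Metric.tendsto_nhds.1 h3 δ hδ] with K hK
  refine Eventually.of_forall fun ω => Eventually.of_forall fun N => ?_
  rw [chain_localStep_zero, h1, h2]
  simpa [Real.dist_eq] using hK

variable (hπ : MeasurablePolicy H π)

section

include hπ

/-- Combines three limits: branches with a nondegenerate measurement settle by the induction
hypothesis, the average over the branches tends to the mean over new measurements, and that mean
tends to the predictive mean, which is `branchMean`. The sign `σ` yields upper and lower bounds from
one argument, since the supermartingale method is one-sided. -/
theorem eventually_actionMean_le (k : ℕ) {d : ℕ} {g : Hist A Z} (hg : P.Nondegenerate g)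
    (hd : d ≤ g.length) (hH : g.length < H) (a : A)
    (ih : ∀ z, P.Nondegenerate (g ++ [(a, z)]) → P.Consistent H π k d (g ++ [(a, z)]))
    {σ : ℝ} (hσ : |σ| = 1) {δ : ℝ} (hδ : 0 < δ) :
    ∀ᶠ K in atTop, ∀ᵐ ω ∂seqLaw (noiseLaw K), ∀ᶠ N in atTop,
      σ * P.actionMean K k d a (chain (P.localStep K (k + 1)) (g, P.seedTree (k + 1)) ω N) ≤
        σ * P.branchMean H π d g a + δ := by
  have hb := P.bound_nonneg
  set C := ((g.length : ℝ) + k + H + 2) * P.bound + 1 with hC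
  have hC0 : 0 < C := by positivity
  set u : Hist A Z → ℝ := fun g' => σ * P.nodeMean H π d g' with hu
  have hum : Measurable u := (P.measurable_nodeMean hπ d).const_mul σ
  have huC : ∀ z, |u (g ++ [(a, z)])| ≤ C := by
    intro z
    have := P.abs_nodeMean_le hπ d (g ++ [(a, z)])
    rw [List.length_append, List.length_singleton] at this
    rw [hu, abs_mul, hσ, one_mul]
    refine this.trans ?_
    rw [hC]
    push_cast
    nlinarith [mul_nonneg (Nat.cast_nonneg (α := ℝ) k) hb]
  -- Makes `10 C η = δ / 4`. Two tolerances of `δ / 8` and another `δ / 4` for the mean over new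
  -- measurements bring the total to `3 δ / 4`.
  set η := δ / (40 * C) with hη
  have hη0 : 0 < η := by positivity
  have hη1 : 10 * C * η = δ / 4 := by rw [hη]; field_simp; ring
  set G : ℕ → Set (LocalState A Z) := fun K => {s | σ * P.localMean K k d s < u s.1 + δ / 8}
    with hG
  have hGm : ∀ K, MeasurableSet (G K) := fun K =>
    measurableSet_lt ((P.measurable_localMean k d).const_mul σ)
      ((hum.comp measurable_fst).add_const _)
  -- For each nondegenerate measurement the failure probability is exactly `0` for large `K`, but
  -- not uniformly in the measurement; `tendsto_lintegral_newMeas_zero` does not need uniformity.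
  have hbad : Tendsto (fun K => ∫⁻ ξ, P.badProb K k (G K) (P.newKid k g a ξ) ∂noiseLaw K)
      atTop (𝓝 0) := by
    refine P.tendsto_lintegral_newMeas_zero hg a
      (β := fun K z => P.badProb K k (G K) (g ++ [(a, z)], P.seedTree k))
      (fun K => (P.measurable_badProb k (hGm K)).comp
        ((measurable_snoc g a).prodMk measurable_const))
      (fun K z => P.badProb_le_one k _ _) ?_
    filter_upwards [P.ae_nondegenerate hg a] with z hz
    refine tendsto_const_nhds.congr' ?_
    filter_upwards [ih z hz (δ / 8) (by positivity)] with K hK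
    symm
    rw [badProb, ← ae_iff]
    filter_upwards [hK] with ω hω
    filter_upwards [hω] with N hN
    have hfst := P.chain_fst k (g ++ [(a, z)], P.seedTree k) ω N
    show σ * P.localMean K k d _ < u _ + δ / 8
    rw [hfst, hu]
    have : σ * (P.localMean K k d (chain (P.localStep K k) (g ++ [(a, z)], P.seedTree k) ω N) -
        P.nodeMean H π d (g ++ [(a, z)])) < δ / 8 := by
      refine (le_abs_self _).trans_lt ?_
      rwa [abs_mul, hσ, one_mul]
    simp only
    linarith
  have hlim : Tendsto (fun K => ∫ ξ, u (g ++ [(a, P.newMeas g a ξ)]) ∂noiseLaw K) atTop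
      (𝓝 (σ * P.branchMean H π d g a)) := by
    have := P.tendsto_integral_newMeas hg a (f := fun z => u (g ++ [(a, z)]))
      (hum.comp (measurable_snoc g a)) huC
    have e : ∫ z, u (g ++ [(a, z)]) ∂P.pred g a = σ * P.branchMean H π d g a := by
      rw [← P.integral_nodeMean hπ hg hd hH a, ← integral_const_mul]
    rwa [e] at this
  filter_upwards [hbad.eventually_le_const (ENNReal.ofReal_pos.2 hη0),
    hlim.eventually_le_const (show σ * P.branchMean H π d g a <
      σ * P.branchMean H π d g a + δ / 4 by linarith)] with K h1 h2
  filter_upwards [P.ae_eventually_actionMean_le (K := K) k d (q := (g, P.seedTree (k + 1)))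
    (P.inv_seedTree (k + 1)) a hσ hum hC0
    (by rw [hC]; nlinarith [mul_nonneg (Nat.cast_nonneg (α := ℝ) H) hb])
    huC (δ := δ / 8) (by positivity) hη0 h1] with ω hω
  filter_upwards [hω] with N hN
  rw [hη1] at hN
  linarith

theorem actionConsistent_succ (k : ℕ) {d : ℕ} {g : Hist A Z} (hg : P.Nondegenerate g)
    (hd : d ≤ g.length) (hH : g.length < H) (a : A)
    (ih : ∀ z, P.Nondegenerate (g ++ [(a, z)]) → P.Consistent H π k d (g ++ [(a, z)])) :
    P.ActionConsistent H π k d g a := by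
  intro δ hδ
  filter_upwards [P.eventually_actionMean_le hπ k hg hd hH a ih (σ := 1) (by simp) hδ,
    P.eventually_actionMean_le hπ k hg hd hH a ih (σ := -1) (by simp) hδ] with K h1 h2
  filter_upwards [h1, h2] with ω h1 h2
  filter_upwards [h1, h2] with N h1 h2
  rw [abs_le]
  constructor <;> linarith

/-- A maximiser of values that are accurate up to `δ` is optimal up to `2 δ`. The maximiser itself
is discontinuous at ties, so only its exact value is compared. -/
theorem abs_branchMean_greedy_sub_le {g : Hist A Z} (hg : P.mass g ≠ ∞) (d : ℕ) {v : A → ℝ}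
    {δ : ℝ} (hv : ∀ a, |v a - P.M.actionValue H π g a| ≤ δ) :
    |P.branchMean H π d g (greedy v) -
      P.branchMean H π d g (greedy (P.M.actionValue H π g))| ≤ 2 * δ := by
  set f := P.M.actionValue H π g with hf
  have e : P.branchMean H π d g (greedy v) - P.branchMean H π d g (greedy f) =
      P.M.γ ^ (g.length - d) * (f (greedy v) - f (greedy f)) := by
    rw [P.branchMean_eq hπ hg, P.branchMean_eq hπ hg]
    ring
  rw [e]
  refine P.abs_gamma_pow_mul_le _ ?_
  have h1 := le_greedy f (greedy v)
  have h2 := le_greedy v (greedy f)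
  have h3 := abs_le.1 (hv (greedy v))
  have h4 := abs_le.1 (hv (greedy f))
  rw [abs_le]
  constructor <;> linarith

/-- The action values of the tree are asymptotically as good as the exact ones. -/
theorem eventually_greedy (htree : IsTreePolicy P.M H P.εa P.s π) (k : ℕ) {d : ℕ} {g : Hist A Z}
    (hg : P.Nondegenerate g) (hH : g.length < H)
    (hac : ∀ a, P.ActionConsistent H π k g.length g a) {δ : ℝ} (hδ : 0 < δ) :
    ∃ f : A → ℝ, π g = epsGreedy P.εa f ∧
      ∀ᶠ K in atTop, ∀ᵐ ω ∂seqLaw (noiseLaw K), ∀ᶠ N in atTop,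
        |P.branchMean H π d g (greedy (steeringValues P.s
          (chain (P.localStep K (k + 1)) (g, P.seedTree (k + 1)) ω N).2 [] g)) -
            P.branchMean H π d g (greedy f)| ≤ δ := by
  rcases hs : P.s with _ | ⟨Q, hQ⟩
  · rw [hs] at htree
    refine ⟨P.M.actionValue H π g, htree g hH, ?_⟩
    -- Accuracy `δ / 4` of the means and another `δ / 4` for the running estimates give values
    -- accurate up to `δ / 2`, hence a loss of at most `δ`.
    filter_upwards [eventually_all.2 fun a => hac a (δ / 4) (by positivity)] with K hK
    have hval : ∀ σ : ℝ, |σ| = 1 → ∀ a, ∀ᵐ ω ∂seqLaw (noiseLaw K), ∀ᶠ N in atTop,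
        σ * (chain (P.localStep K (k + 1)) (g, P.seedTree (k + 1)) ω N).2.value [] a ≤
          σ * P.M.actionValue H π g a + δ / 4 + δ / 4 := by
      intro σ hσ a
      refine P.ae_eventually_value_le k (q := (g, P.seedTree (k + 1))) (P.inv_seedTree (k + 1)) a
        hσ (by positivity) ?_
      filter_upwards [hK a] with ω hω
      filter_upwards [hω] with N hN
      rw [P.branchMean_self hπ] at hN
      have : σ * (P.actionMean K k g.length a
          (chain (P.localStep K (k + 1)) (g, P.seedTree (k + 1)) ω N) -
            P.M.actionValue H π g a) ≤ δ / 4 := by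
        refine (le_abs_self _).trans ?_
        rwa [abs_mul, hσ, one_mul]
      linarith
    filter_upwards [ae_all_iff.2 (hval 1 (by simp)), ae_all_iff.2 (hval (-1) (by simp))]
      with ω h1 h2
    filter_upwards [eventually_all.2 h1, eventually_all.2 h2] with N h1 h2
    refine (P.abs_branchMean_greedy_sub_le hπ hg.2 d (δ := δ / 2) fun a => ?_).trans (by linarith)
    have h3 := h1 a
    have h4 := h2 a
    simp only [steeringValues]
    rw [abs_le]
    constructor <;> linarith
  · rw [hs] at htree
    refine ⟨Q g, htree g hH, ?_⟩
    refine Eventually.of_forall fun K => Eventually.of_forall fun ω => Eventually.of_forall fun N => ?_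
    simp only [steeringValues, sub_self, abs_zero]
    exact hδ.le

/-- The mean return is a mixture of action means by the current action probabilities. Replacing the
action means by their limits costs `δ / 3`, and replacing the greedy part of the current
probabilities by that of `π` another `δ / 3`; the exploring part is the same in both. -/
theorem consistent_succ (htree : IsTreePolicy P.M H P.εa P.s π) (k : ℕ) {d : ℕ} {g : Hist A Z}
    (hg : P.Nondegenerate g) (hd : d ≤ g.length) (hH : g.length < H)
    (hac : ∀ a, ∀ d ≤ g.length, P.ActionConsistent H π k d g a) :
    P.Consistent H π (k + 1) d g := by
  intro δ hδ
  obtain ⟨f, hf, hev⟩ := P.eventually_greedy hπ htree k (d := d) hg hH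
    (fun a => hac a _ le_rfl) (δ := δ / 3) (by positivity)
  filter_upwards [hev, eventually_all.2 fun a => hac a d hd (δ / 3) (by positivity)] with K h1 h2
  filter_upwards [h1, ae_all_iff.2 h2] with ω h1 h2
  filter_upwards [h1, eventually_all.2 h2] with N h1 h2
  have hinv := P.inv_chain (k + 1) (q := (g, P.seedTree (k + 1))) (P.inv_seedTree (k + 1)) ω N
  have hfst := P.chain_fst (k + 1) (g, P.seedTree (k + 1)) ω N
  set s := chain (P.localStep K (k + 1)) (g, P.seedTree (k + 1)) ω N
  rw [P.localMean_succ k hinv.1 (by rw [hfst]; exact hd), P.nodeMean_eq_sum hπ hg.2 hH, hfst, hf]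
  set v := steeringValues P.s s.2 [] g
  have e1 : |∑ a, epsGreedy P.εa v a * P.actionMean K k d a s -
      ∑ a, epsGreedy P.εa v a * P.branchMean H π d g a| ≤ δ / 3 := by
    rw [← Finset.sum_sub_distrib]
    refine (Finset.abs_sum_le_sum_abs _ _).trans ?_
    calc _ ≤ ∑ a, epsGreedy P.εa v a * (δ / 3) := Finset.sum_le_sum fun a _ => by
          rw [← mul_sub, abs_mul, abs_of_nonneg (epsGreedy_nonneg P.εa_pos.le P.εa_lt.le v a)]
          exact mul_le_mul_of_nonneg_left (h2 a) (epsGreedy_nonneg P.εa_pos.le P.εa_lt.le v a)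
      _ = δ / 3 := by rw [← Finset.sum_mul, sum_epsGreedy, one_mul]
  have e2 : |∑ a, epsGreedy P.εa v a * P.branchMean H π d g a -
      ∑ a, epsGreedy P.εa f a * P.branchMean H π d g a| ≤ δ / 3 := by
    rw [sum_epsGreedy_mul, sum_epsGreedy_mul, add_sub_add_right_eq_sub, ← mul_sub, abs_mul,
      abs_of_pos (by linarith [P.εa_lt])]
    exact (mul_le_of_le_one_left (abs_nonneg _) (by linarith [P.εa_pos])).trans h1
  have := abs_sub_le (∑ a, epsGreedy P.εa v a * P.actionMean K k d a s)
    (∑ a, epsGreedy P.εa v a * P.branchMean H π d g a)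
    (∑ a, epsGreedy P.εa f a * P.branchMean H π d g a)
  linarith

/-- The depth `d` has to vary in the induction: the returns at `g` itself, which feed the running
estimates there, and those seen from an ancestor are both needed of the same branches. -/
theorem consistent (htree : IsTreePolicy P.M H P.εa P.s π) (k : ℕ) {d : ℕ} {g : Hist A Z}
    (hg : P.Nondegenerate g) (hH : g.length + k = H) (hd : d ≤ g.length) :
    P.Consistent H π k d g := by
  induction k generalizing d g with
  | zero => exact P.consistent_zero hg hH d
  | succ k ih =>
    refine P.consistent_succ hπ htree k hg hd (by omega) fun a d' hd' => ?_
    refine P.actionConsistent_succ hπ k hg hd' (by omega) a fun z hz => ih hz ?_ ?_ <;>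
    · rw [List.length_append, List.length_singleton]; omega

theorem actionConsistent (htree : IsTreePolicy P.M H P.εa P.s π) (k : ℕ) {d : ℕ} {g : Hist A Z}
    (hg : P.Nondegenerate g) (hH : g.length + (k + 1) = H) (hd : d ≤ g.length) (a : A) :
    P.ActionConsistent H π k d g a := by
  refine P.actionConsistent_succ hπ k hg hd (by omega) a fun z hz => P.consistent hπ htree k hz ?_ ?_ <;>
  · rw [List.length_append, List.length_singleton]; omega

end

end Planner

/-! ### Nodes at arbitrary addresses -/

theorem SearchTree.historyFrom_eq_sub {A Z : Type*} (T : SearchTree A Z) (p l : Node A) :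
    T.historyFrom p l = (T.sub p).history l := by
  have key : ∀ (l p p' : Node A), T.historyFrom (p ++ p') l = (T.sub p).historyFrom p' l := by
    intro l
    induction l with
    | nil => intro p p'; rfl
    | cons x l ih =>
      intro p p'
      obtain ⟨a, j⟩ := x
      simp only [SearchTree.historyFrom, List.append_assoc, ih]
      rfl
  rw [SearchTree.history, ← key l p [], List.append_nil]

namespace Planner

variable {X A Z : Type*} [MeasurableSpace X] [MeasurableSpace Z] [Fintype A] [Nonempty A]
  [MeasurableSpace A] [DiscreteMeasurableSpace A] (P : Planner X A Z) {K : ℕ}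

/-- The node with the address `l`, with the tree below it. -/
def descend : Node A → LocalState A Z → LocalState A Z
  | [], q => q
  | (a, j) :: l, q => descend l (P.kid a j q)

/-- All branches on the path `l` exist, and the state at its end belongs to `G`. -/
def goodAt (G : Set (LocalState A Z)) : Node A → Set (LocalState A Z)
  | [] => G
  | (a, j) :: l => {q | j < numBranches a q ∧ P.kid a j q ∈ goodAt G l}

theorem measurableSet_goodAt {G : Set (LocalState A Z)} (hG : MeasurableSet G) (l : Node A) :
    MeasurableSet (P.goodAt G l) := by
  induction l with
  | nil => exact hG
  | cons x l ih =>
    exact (measurableSet_lt measurable_const (measurable_numBranches x.1)).inter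
      (P.measurable_kid x.1 x.2 ih)

theorem goodAt_iff {G : Set (LocalState A Z)} {l : Node A} {q : LocalState A Z} :
    q ∈ P.goodAt G l ↔ q ∈ P.goodAt Set.univ l ∧ P.descend l q ∈ G := by
  induction l generalizing q with
  | nil => simp [goodAt, descend]
  | cons x l ih =>
    show _ ∧ _ ↔ (_ ∧ _) ∧ _
    rw [ih, and_assoc]
    rfl

theorem inv_descend {k : ℕ} {l : Node A} {q : LocalState A Z} (hq : P.Inv (k + l.length + 1) q.2)
    (hl : q ∈ P.goodAt Set.univ l) : P.Inv (k + 1) (P.descend l q).2 := by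
  induction l generalizing q with
  | nil => exact hq
  | cons x l ih => exact ih (P.inv_kid (k := k + l.length + 1) hq hl.1) hl.2

theorem length_descend (l : Node A) (q : LocalState A Z) :
    (P.descend l q).1.length = q.1.length + l.length := by
  induction l generalizing q with
  | nil => rfl
  | cons x l ih =>
    rw [descend, ih, kid, List.length_append, List.length_singleton, List.length_cons]
    ring

theorem exists_history {l : Node A} {q : LocalState A Z} (hl : q ∈ P.goodAt Set.univ l) :
    ∃ g, q.2.history l = some g ∧ (P.descend l q).1 = q.1 ++ g := by
  induction l generalizing q with
  | nil => exact ⟨[], rfl, (List.append_nil _).symm⟩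
  | cons x l ih =>
    obtain ⟨a, j⟩ := x
    obtain ⟨h1, h2⟩ := hl
    obtain ⟨g, hg1, hg2⟩ := ih h2
    have h1' : j < (q.2.branches [] a).length := h1
    refine ⟨(a, (q.2.branches [] a)[j]) :: g, ?_, ?_⟩
    · have : q.2.historyFrom [(a, j)] l = some g := by
        rw [SearchTree.historyFrom_eq_sub]; exact hg1
      simp [SearchTree.history, SearchTree.historyFrom, this, h1']
    · rw [descend, hg2, kid, List.getD_eq_getElem _ _ h1', List.append_assoc]
      rfl

/-- Existence of the whole path: `prob_kid_le` passes the failure probability down one branch at a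
time, and below every possible new measurement it is `0`. -/
theorem badProb_goodAt_eq_zero {k : ℕ} (l : Node A) (g : Hist A Z) :
    P.badProb K (k + l.length + 1) (P.goodAt Set.univ l) (g, P.seedTree (k + l.length + 1)) =
      0 := by
  induction l generalizing g with
  | nil => simp [badProb, goodAt]
  | cons x l ih =>
    refine le_antisymm ((P.prob_kid_le (k + l.length) g x.1 x.2
      (P.measurableSet_goodAt MeasurableSet.univ l)).trans (le_of_eq ?_)) zero_le
    have : ∀ ξ : Noise K, P.badProb K (k + l.length + 1) (P.goodAt Set.univ l)
        (P.newKid (k + l.length + 1) g x.1 ξ) = 0 := fun ξ => ih _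
    simp_rw [this]
    exact lintegral_zero

/-- Descends along the address with `prob_kid_le`. At each level the failure probability is averaged
over a random new measurement, almost surely nondegenerate in the limit, and
`tendsto_lintegral_newMeas_zero` preserves convergence to `0`. -/
theorem tendsto_badProb_goodAt {H k : ℕ} {G : ℕ → Set (LocalState A Z)}
    (hG : ∀ K, MeasurableSet (G K))
    (h : ∀ g, P.Nondegenerate g → g.length + (k + 1) = H →
      Tendsto (fun K => P.badProb K (k + 1) (G K) (g, P.seedTree (k + 1))) atTop (𝓝 0))
    (l : Node A) {g : Hist A Z} (hg : P.Nondegenerate g) (hH : g.length + (k + l.length + 1) = H) :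
    Tendsto (fun K => P.badProb K (k + l.length + 1) (P.goodAt (G K) l)
      (g, P.seedTree (k + l.length + 1))) atTop (𝓝 0) := by
  induction l generalizing g with
  | nil => exact h g hg hH
  | cons x l ih =>
    refine tendsto_of_tendsto_of_tendsto_of_le_of_le tendsto_const_nhds ?_ (fun _ => zero_le)
      fun K => P.prob_kid_le (k + l.length) g x.1 x.2 (P.measurableSet_goodAt (hG K) l)
    refine P.tendsto_lintegral_newMeas_zero hg x.1
      (β := fun K z => P.badProb K (k + l.length + 1) (P.goodAt (G K) l)
        (g ++ [(x.1, z)], P.seedTree (k + l.length + 1)))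
      (fun K => (P.measurable_badProb _ (P.measurableSet_goodAt (hG K) l)).comp
        ((measurable_snoc g x.1).prodMk measurable_const))
      (fun K z => P.badProb_le_one _ _ _) ?_
    filter_upwards [P.ae_nondegenerate hg x.1] with z hz
    refine ih hz ?_
    rw [List.length_cons] at hH
    rw [List.length_append, List.length_singleton]
    omega

/-! ### The returns at a node -/

section Estimate

variable (k : ℕ) {q : LocalState A Z}

theorem est_nil_eq (hq : [] ∈ q.2.nodes) (Φ : Option (A × ℝ) → ℝ) (ξ : Noise K) :
    Φ ((P.run (k + 1) q.1 q.2 ξ).est []) = (fun a j ξ =>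
      Φ (some (a, P.returnAt k q.1 q.1.length q.2 a j ξ)))
        (P.pick q.1 q.2 ξ) (P.pickBranch q.1 q.2 (P.pick q.1 q.2 ξ) ξ) ξ := by
  rw [P.run_est_nil k q.1 hq]

theorem measurable_est_nil (hq : [] ∈ q.2.nodes) {Φ : Option (A × ℝ) → ℝ}
    (hΦ : ∀ a, Measurable fun r => Φ (some (a, r))) :
    Measurable fun ξ : Noise K => Φ ((P.run (k + 1) q.1 q.2 ξ).est []) := by
  have e : (fun ξ : Noise K => Φ ((P.run (k + 1) q.1 q.2 ξ).est [])) = _ := funext fun ξ =>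
    (P.est_nil_eq k hq Φ ξ).trans (P.sum_choice_indicator q.1 q.2
      (fun a j (ξ : Noise K) => Φ (some (a, P.returnAt k q.1 q.1.length q.2 a j ξ))) ξ)
  rw [e]
  exact Finset.measurable_sum _ fun a _ => Finset.measurable_sum _ fun j _ =>
    ((hΦ a).comp (P.measurable_returnAt_right k _ a j q)).indicator
      (P.measurableSet_choiceEvent q.1 q.2 a j)

theorem integral_est_nil (hq : [] ∈ q.2.nodes) {Φ : Option (A × ℝ) → ℝ}
    (hΦ : ∀ a, Measurable fun r => Φ (some (a, r))) {C : ℝ}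
    (hC : ∀ a r, |r| ≤ (q.1.length + k + 2) * P.bound → |Φ (some (a, r))| ≤ C) :
    ∫ ξ : Noise K, Φ ((P.run (k + 1) q.1 q.2 ξ).est []) ∂noiseLaw K =
      ∑ a, epsGreedy P.εa (steeringValues P.s q.2 [] q.1) a *
        ∑ j ∈ Finset.range (numBranches a q + 1), branchProb P.εz (numBranches a q) j *
          ∫ ξ, Φ (some (a, P.returnAt k q.1 q.1.length q.2 a j ξ)) ∂noiseLaw K := by
  simp_rw [P.est_nil_eq k hq Φ]
  exact P.integral_choice q.1 q.2
    (Φ := fun a j ξ => Φ (some (a, P.returnAt k q.1 q.1.length q.2 a j ξ)))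
    (fun a j => (hΦ a).comp (P.measurable_returnAt_right k _ a j q))
    (fun a j ξ => hC a _ (P.abs_returnAt_le k q.1 _ q.2 a j ξ))
    fun a j p => by simp only [returnAt_mixOn]

/-- The law of the return at a node of an episode is, up to a factor, that of an episode which
starts at this node. -/
theorem exists_est_factor (l : Node A) (hq : P.Inv (k + l.length + 1) q.2)
    (hl : q ∈ P.goodAt Set.univ l) : ∃ c : ℝ, 0 < c ∧ ∀ Φ : Option (A × ℝ) → ℝ,
      (∀ a, Measurable fun r => Φ (some (a, r))) → Φ none = 0 →
      (Measurable fun ξ : Noise K => Φ ((P.run (k + l.length + 1) q.1 q.2 ξ).est l)) ∧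
      ∫ ξ : Noise K, Φ ((P.run (k + l.length + 1) q.1 q.2 ξ).est l) ∂noiseLaw K =
        c * ∫ ξ : Noise K, Φ ((P.run (k + 1) (P.descend l q).1 (P.descend l q).2 ξ).est [])
          ∂noiseLaw K := by
  induction l generalizing q with
  | nil =>
    exact ⟨1, one_pos, fun Φ hΦ _ => ⟨P.measurable_est_nil k hq.1 hΦ, (one_mul _).symm⟩⟩
  | cons x l ih =>
    classical
    obtain ⟨a, j⟩ := x
    obtain ⟨h1, h2⟩ := hl
    obtain ⟨c, hc, hcΦ⟩ := ih (P.inv_kid (k := k + l.length + 1) hq h1) h2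
    have hj : j ≤ (q.2.branches [] a).length := le_of_lt h1
    -- The factor is the product of the probabilities of the choices along the path. The seeds of
    -- these choices are not read further down, so they contribute nothing else.
    refine ⟨epsGreedy P.εa (steeringValues P.s q.2 [] q.1) a *
      branchProb P.εz (numBranches a q) j * c, ?_, fun Φ hΦ hΦ0 => ?_⟩
    · have hr := P.rate_pos
      have h3 : 0 < branchProb P.εz (numBranches a q) j := by
        refine lt_of_lt_of_le ?_ (branchProb_ge P.εz_ge P.εz_neg hj)
        have : (2 : ℝ) ^ P.εz < 1 := Real.rpow_lt_one_of_one_lt_of_neg one_lt_two P.εz_neg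
        exact div_pos (by linarith) (by positivity)
      have h4 : 0 < epsGreedy P.εa (steeringValues P.s q.2 [] q.1) a := by
        refine lt_of_lt_of_le ?_ (epsGreedy_ge P.εa_lt.le _ _)
        have := P.εa_pos
        have hcard : (0 : ℝ) < Fintype.card A := by exact_mod_cast Fintype.card_pos
        positivity
      positivity
    · obtain ⟨hm, hi⟩ := hcΦ Φ hΦ hΦ0
      have hchild : ∀ ξ : Noise K, P.child (k + l.length + 1) q.1 q.2 a j ξ =
          P.run (k + l.length + 1) (P.kid a j q).1 (P.kid a j q).2 ξ := by
        intro ξ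
        have h' : j < (q.2.branches [] a).length := h1
        rw [child, kid, measAt, List.getD_eq_getElem _ _ h', List.getD_eq_getElem _ _ h']
      have e : (fun ξ : Noise K => Φ ((P.run (k + ((a, j) :: l).length + 1) q.1 q.2 ξ).est
          ((a, j) :: l))) = (P.choiceEvent q.1 q.2 a j).indicator fun ξ =>
            Φ ((P.child (k + l.length + 1) q.1 q.2 a j ξ).est l) := by
        funext ξ
        have := P.run_est_cons (k + l.length + 1) q.1 hq.1 ξ a j l
        by_cases h : ξ ∈ P.choiceEvent q.1 q.2 a j
        · rw [Set.indicator_of_mem h]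
          rw [if_pos (show P.pick q.1 q.2 ξ = a ∧ P.pickBranch q.1 q.2 a ξ = j from h)] at this
          exact congrArg Φ this
        · rw [Set.indicator_of_notMem h]
          rw [if_neg (show ¬ (P.pick q.1 q.2 ξ = a ∧ P.pickBranch q.1 q.2 a ξ = j) from h)] at this
          exact (congrArg Φ this).trans hΦ0
      have hm' : Measurable fun ξ : Noise K =>
          Φ ((P.child (k + l.length + 1) q.1 q.2 a j ξ).est l) := by
        simp_rw [hchild]; exact hm
      refine ⟨?_, ?_⟩
      · rw [e]
        exact hm'.indicator (P.measurableSet_choiceEvent q.1 q.2 a j)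
      · rw [e, noiseLaw, integral_indicator_of_mixOn (choiceSeeds K q.1.length) _
          (P.measurableSet_choiceEvent q.1 q.2 a j) (P.mixOn_mem_choiceEvent q.1 q.2 a j) hm'
          (fun p => by rw [child_mixOn]), ← noiseLaw, Measure.real,
          P.noiseLaw_choiceEvent q.1 q.2 a hj, ENNReal.toReal_mul,
          ENNReal.toReal_ofReal (epsGreedy_nonneg P.εa_pos.le P.εa_lt.le _ _),
          ENNReal.toReal_ofReal (branchProb_nonneg P.εz_neg _ _), mul_assoc]
        simp_rw [hchild]
        rw [hi, mul_assoc, mul_assoc]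
        rfl

end Estimate

end Planner

/-! ### Episodes and the search tree -/

theorem seqLaw_shift {E : Type*} [MeasurableSpace E] (ρ : Measure E) [IsProbabilityMeasure ρ]
    {B : Set (ℕ → E)} (hB : MeasurableSet B) :
    seqLaw ρ {ω | (fun n => ω (n + 1)) ∈ B} = seqLaw ρ B := by
  have hm : MeasurableSet {ω : ℕ → E | (fun n => ω (n + 1)) ∈ B} :=
    (measurable_pi_lambda _ fun n => measurable_pi_apply (n + 1)) hB
  rw [seqLaw_eq_lintegral ρ hm]
  have : ∀ ξ, seqLaw ρ {ω | consSeq (ξ, ω) ∈ {ω : ℕ → E | (fun n => ω (n + 1)) ∈ B}} =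
      seqLaw ρ B := fun ξ => rfl
  simp_rw [this]
  rw [lintegral_const, measure_univ, mul_one]

namespace Planner

variable {X A Z : Type*} [MeasurableSpace X] [MeasurableSpace Z] [Fintype A] [Nonempty A]
  [MeasurableSpace A] [DiscreteMeasurableSpace A] (P : Planner X A Z) {K : ℕ}

/-- The return at a node, conditionally on the event that the node is reached and that the chosen
action satisfies `p`. -/
theorem cond_est (k : ℕ) (l : Node A) {q : LocalState A Z} (hq : P.Inv (k + l.length + 1) q.2)
    (hl : q ∈ P.goodAt Set.univ l) (p : A → Prop) [DecidablePred p] {w : ℝ} (hw0 : 0 < w)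
    (hw : ∑ a, epsGreedy P.εa (steeringValues P.s (P.descend l q).2 [] (P.descend l q).1) a *
      (if p a then 1 else 0) = w) :
    0 < noiseLaw K {ξ | ∃ a r, p a ∧ (P.run (k + l.length + 1) q.1 q.2 ξ).est l = some (a, r)} ∧
    ∫ ξ, (((P.run (k + l.length + 1) q.1 q.2 ξ).est l).map Prod.snd).getD 0 ∂(ProbabilityTheory.cond
      (noiseLaw K)
      {ξ | ∃ a r, p a ∧ (P.run (k + l.length + 1) q.1 q.2 ξ).est l = some (a, r)}) =
      (∑ a, epsGreedy P.εa (steeringValues P.s (P.descend l q).2 [] (P.descend l q).1) a *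
        (if p a then P.actionMean K k (P.descend l q).1.length a (P.descend l q) else 0)) / w := by
  set E : Set (Noise K) :=
    {ξ | ∃ a r, p a ∧ (P.run (k + l.length + 1) q.1 q.2 ξ).est l = some (a, r)} with hE
  set v := epsGreedy P.εa (steeringValues P.s (P.descend l q).2 [] (P.descend l q).1) with hv
  obtain ⟨c, hc, hΦ⟩ := P.exists_est_factor (K := K) k l hq hl
  have hroot := (P.inv_descend hq hl).1
  -- With the constant `1` this gives the probability of the conditioning event, with the identity
  -- the numerator of the conditional mean; the path factor `c` appears in both and cancels.
  let Φ : (ℝ → ℝ) → Option (A × ℝ) → ℝ := fun f o => o.elim 0 fun x => if p x.1 then f x.2 else 0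
  have hΦm : ∀ f, Measurable f → ∀ a, Measurable fun r => Φ f (some (a, r)) := by
    intro f hf a
    by_cases h : p a
    · simpa [Φ, h] using hf
    · simp [Φ, h]
  have hb := P.bound_nonneg
  have h1 : ∫ ξ : Noise K, Φ (fun _ => 1) ((P.run (k + l.length + 1) q.1 q.2 ξ).est l)
      ∂noiseLaw K = c * w := by
    rw [(hΦ _ (hΦm _ measurable_const) rfl).2, P.integral_est_nil k hroot
      (hΦm _ measurable_const) (C := 1) (fun a r _ => by
        by_cases h : p a <;> simp [Φ, h]), ← hw]
    congr 1
    refine Finset.sum_congr rfl fun a _ => ?_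
    congr 1
    simp only [Φ, Option.elim_some, integral_const, probReal_univ, one_smul]
    rw [← Finset.sum_mul, sum_branchProb, one_mul]
  have h2 : ∫ ξ : Noise K, Φ id ((P.run (k + l.length + 1) q.1 q.2 ξ).est l) ∂noiseLaw K =
      c * ∑ a, v a *
        (if p a then P.actionMean K k (P.descend l q).1.length a (P.descend l q) else 0) := by
    rw [(hΦ _ (hΦm _ measurable_id) rfl).2, P.integral_est_nil k hroot (hΦm _ measurable_id)
      (C := ((P.descend l q).1.length + k + 2) * P.bound) (fun a r hr => by
        by_cases h : p a
        · simpa [Φ, h] using hr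
        · simpa [Φ, h] using mul_nonneg (by positivity) hb)]
    congr 1
    refine Finset.sum_congr rfl fun a _ => ?_
    congr 1
    by_cases h : p a
    · simp [Φ, h, actionMean]
    · simp [Φ, h]
  have hEΦ : ∀ ξ, Φ (fun _ => 1) ((P.run (k + l.length + 1) q.1 q.2 ξ).est l) =
      E.indicator (fun _ => 1) ξ := by
    intro ξ
    rcases ho : (P.run (k + l.length + 1) q.1 q.2 ξ).est l with _ | ⟨a, r⟩
    · rw [Set.indicator_of_notMem]
      · rfl
      · rintro ⟨a, r, -, h⟩; rw [ho] at h; cases h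
    · by_cases h : p a
      · rw [Set.indicator_of_mem (show ξ ∈ E from ⟨a, r, h, ho⟩)]; simp [Φ, h]
      · rw [Set.indicator_of_notMem]
        · simp [Φ, h]
        · rintro ⟨a', r', h', h''⟩
          rw [ho] at h''
          cases h''
          exact h h'
  have hEΦ2 : ∀ ξ, Φ id ((P.run (k + l.length + 1) q.1 q.2 ξ).est l) =
      E.indicator (fun ξ =>
        (((P.run (k + l.length + 1) q.1 q.2 ξ).est l).map Prod.snd).getD 0) ξ := by
    intro ξ
    rcases ho : (P.run (k + l.length + 1) q.1 q.2 ξ).est l with _ | ⟨a, r⟩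
    · rw [Set.indicator_of_notMem]
      · rfl
      · rintro ⟨a, r, -, h⟩; rw [ho] at h; cases h
    · by_cases h : p a
      · rw [Set.indicator_of_mem (show ξ ∈ E from ⟨a, r, h, ho⟩)]; simp [Φ, h, ho]
      · rw [Set.indicator_of_notMem]
        · simp [Φ, h]
        · rintro ⟨a', r', h', h''⟩
          rw [ho] at h''
          cases h''
          exact h h'
  have hEm : MeasurableSet E := by
    have : E = (fun ξ => Φ (fun _ => 1) ((P.run (k + l.length + 1) q.1 q.2 ξ).est l)) ⁻¹' {1} := by
      ext ξ
      rw [Set.mem_preimage, hEΦ, Set.mem_singleton_iff]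
      by_cases h : ξ ∈ E <;> simp [h]
    rw [this]
    exact (hΦ _ (hΦm _ measurable_const) rfl).1 (measurableSet_singleton 1)
  simp_rw [hEΦ] at h1
  simp_rw [hEΦ2] at h2
  rw [integral_indicator hEm] at h1 h2
  have h1' : (noiseLaw K E).toReal = c * w := by
    rw [← h1, setIntegral_const, smul_eq_mul, mul_one]; rfl
  have hcw : 0 < c * w := mul_pos hc hw0
  refine ⟨?_, ?_⟩
  · refine pos_iff_ne_zero.2 fun h0 => ?_
    rw [h0, ENNReal.toReal_zero] at h1'
    exact hcw.ne h1'
  · rw [ProbabilityTheory.cond, integral_smul_measure, ENNReal.toReal_inv, h1', h2, smul_eq_mul,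
      mul_inv, div_eq_inv_mul]
    field_simp

/-! ### Conditional means at a node as local means of the subtree. -/

section Root

variable {k : ℕ} {l : Node A} {T : SearchTree A Z}

theorem episode_eq (T : SearchTree A Z) (ξ : Noise K) :
    episode P.sim P.S P.s P.εa P.εz T ξ = P.run (horizon P.M.γ P.S.ε) [] T ξ := by
  have : (fun i : Fin (K + 1) => (P.wt [] (particleNoise ξ i) : ℝ)) = fun _ => 1 := by
    funext i; simp
  rw [run, this]
  rfl

variable (hk : k + l.length + 1 = horizon P.M.γ P.S.ε) (hT : P.Inv (k + l.length + 1) T)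
  (hl : (([], T) : LocalState A Z) ∈ P.goodAt Set.univ l)

include hk hT hl

theorem meanAtNode_eq : meanAtNode P.sim P.S P.s P.εa P.εz K T l =
    P.localMean K (k + 1) l.length (P.descend l ([], T)) := by
  have hlen : (P.descend l (([], T) : LocalState A Z)).1.length = l.length := by
    rw [length_descend]; simp
  have h := (P.cond_est (K := K) k l (q := ([], T)) hT hl (fun _ => True) one_pos
    (by simp [sum_epsGreedy])).2
  rw [P.localMean_succ k (P.inv_descend (q := ([], T)) hT hl).1 hlen.ge]
  simp only [if_true, div_one, true_and, hlen] at h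
  rw [← h]
  simp only [meanAtNode, estimateAt, traversesNode, episode_eq, hk]

theorem meanAtActionNode_eq (a : A) :
    0 < noiseLaw K (traversesActionNode P.sim P.S P.s P.εa P.εz K T l a) ∧
    meanAtActionNode P.sim P.S P.s P.εa P.εz K T l a =
      P.actionMean K k l.length a (P.descend l ([], T)) := by
  classical
  have hlen : (P.descend l (([], T) : LocalState A Z)).1.length = l.length := by
    rw [length_descend]; simp
  set v := epsGreedy P.εa (steeringValues P.s (P.descend l ([], T)).2 [] (P.descend l ([], T)).1)
    with hv
  have hv0 : 0 < v a := by
    refine lt_of_lt_of_le ?_ (epsGreedy_ge P.εa_lt.le _ _)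
    have := P.εa_pos
    have hcard : (0 : ℝ) < Fintype.card A := by exact_mod_cast Fintype.card_pos
    positivity
  obtain ⟨h1, h2⟩ := P.cond_est (K := K) k l (q := ([], T)) hT hl (fun b => b = a) hv0
    (by simp [hv])
  have hE : {ξ : Noise K | ∃ b r, b = a ∧ (P.run (k + l.length + 1) [] T ξ).est l = some (b, r)} =
      traversesActionNode P.sim P.S P.s P.εa P.εz K T l a := by
    ext ξ
    simp only [traversesActionNode, episode_eq, ← hk, Set.mem_ofPred_eq]
    constructor
    · rintro ⟨b, r, rfl, h⟩; exact ⟨r, h⟩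
    · rintro ⟨r, h⟩; exact ⟨a, r, rfl, h⟩
  simp only [hE, ← hv] at h1 h2
  refine ⟨h1, ?_⟩
  rw [hlen] at h2
  simp only [mul_ite, mul_zero, Finset.sum_ite_eq', Finset.mem_univ, if_true] at h2
  rw [mul_div_cancel_left₀ _ hv0.ne'] at h2
  rw [← h2]
  simp only [meanAtActionNode, estimateAt, episode_eq, ← hk]

end Root

/-- The first episode at most expands the root, whatever its random numbers are, and thereby
produces the seed tree. From then on the search is the local iteration with the empty history,
driven by the shifted noise. -/
theorem treeAfter_succ (ω : ℕ → Noise K) (N : ℕ) :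
    treeAfter P.sim P.S P.s P.εa P.εz ω (N + 1) = (chain (P.localStep K (horizon P.M.γ P.S.ε))
      ([], P.seedTree (horizon P.M.γ P.S.ε)) (fun n => ω (n + 1)) N).2 := by
  induction N with
  | zero =>
    rw [treeAfter, episode_eq]
    exact P.run_emptyTree _ [] (ω 0)
  | succ N ih =>
    rw [treeAfter, ih, episode_eq, chain, localStep, chain_fst]

theorem chain_eq_treeAfter (ω : ℕ → Noise K) (N : ℕ) :
    chain (P.localStep K (horizon P.M.γ P.S.ε)) ([], P.seedTree (horizon P.M.γ P.S.ε))
      (fun n => ω (n + 1)) N = ([], treeAfter P.sim P.S P.s P.εa P.εz ω (N + 1)) := by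
  rw [treeAfter_succ]
  exact Prod.ext (P.chain_fst _ _ _ _) rfl

theorem inv_treeAfter (ω : ℕ → Noise K) (N : ℕ) : P.Inv (horizon P.M.γ P.S.ε)
    (treeAfter P.sim P.S P.s P.εa P.εz ω (N + 1)) := by
  rw [treeAfter_succ]
  exact P.inv_chain _ (q := ([], P.seedTree (horizon P.M.γ P.S.ε))) (P.inv_seedTree _) _ N

/-- Discarding the first episode does not change the law of the noise, and an eventual property does
not notice the shift of time. -/
theorem runLaw_treeAfter {G : Set (LocalState A Z)} (hG : MeasurableSet G) :
    runLaw K {ω | ¬ ∀ᶠ N in atTop,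
      (([], treeAfter P.sim P.S P.s P.εa P.εz ω N) : LocalState A Z) ∈ G} =
      P.badProb K (horizon P.M.γ P.S.ε) G ([], P.seedTree (horizon P.M.γ P.S.ε)) := by
  set H := horizon P.M.γ P.S.ε with hH
  have hm : MeasurableSet {ω : ℕ → Noise K | ¬ ∀ᶠ N in atTop,
      chain (P.localStep K H) ([], P.seedTree H) ω N ∈ G} :=
    (measurable_prodMk_left (x := (([], P.seedTree H) : LocalState A Z))
      (measurableSet_eventually_chain (P.measurable_localStep (K := K) H) hG)).compl
  rw [badProb, ← seqLaw_shift (noiseLaw K) hm]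
  congr 1
  ext ω
  simp only [Set.mem_ofPred_eq, hH, chain_eq_treeAfter]
  rw [← map_add_atTop_eq_nat 1, eventually_map, map_add_atTop_eq_nat 1]

end Planner

/-! ### The theorem -/

namespace Planner

variable {X A Z : Type*} [MeasurableSpace X] [MeasurableSpace Z] [Fintype A] [Nonempty A]
  [MeasurableSpace A] [DiscreteMeasurableSpace A] (P : Planner X A Z)

theorem measurableSet_nondegenerate : MeasurableSet {g : Hist A Z | P.Nondegenerate g} :=
  (P.measurable_mass (measurableSet_singleton 0).compl).inter
    (P.measurable_mass (measurableSet_singleton ∞).compl)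

theorem ae_eventually_goodAt (K : ℕ) {k : ℕ} {l : Node A}
    (hk : k + l.length + 1 = horizon P.M.γ P.S.ε) :
    ∀ᵐ ω ∂runLaw K, ∀ᶠ N in atTop,
      P.Inv (k + l.length + 1) (treeAfter P.sim P.S P.s P.εa P.εz ω N) ∧
      (([], treeAfter P.sim P.S P.s P.εa P.εz ω N) : LocalState A Z) ∈ P.goodAt Set.univ l := by
  have h : ∀ᵐ ω ∂runLaw K, ∀ᶠ N in atTop,
      (([], treeAfter P.sim P.S P.s P.εa P.εz ω N) : LocalState A Z) ∈ P.goodAt Set.univ l := by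
    rw [ae_iff, P.runLaw_treeAfter (P.measurableSet_goodAt MeasurableSet.univ l), ← hk]
    exact P.badProb_goodAt_eq_zero l []
  filter_upwards [h] with ω hω
  filter_upwards [hω, eventually_ge_atTop 1] with N hN hN1
  obtain ⟨N, rfl⟩ := Nat.exists_eq_add_of_le' hN1
  exact ⟨hk ▸ P.inv_treeAfter ω N, hN⟩

/-- If functions of the local state at a node converge to a function of its history, then they do so
along the search tree. -/
theorem tendsto_runLaw {k : ℕ} {l : Node A} (hk : k + l.length + 1 = horizon P.M.γ P.S.ε)
    {F : ℕ → LocalState A Z → ℝ} (hF : ∀ K, Measurable (F K))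
    {v : Hist A Z → ℝ} (hv : Measurable v) {δ : ℝ}
    (h : ∀ g, P.Nondegenerate g → g.length = l.length →
      ∀ᶠ K in atTop, ∀ᵐ ω ∂seqLaw (noiseLaw K), ∀ᶠ N in atTop,
        |F K (chain (P.localStep K (k + 1)) (g, P.seedTree (k + 1)) ω N) - v g| < δ)
    {m : ℕ → SearchTree A Z → ℝ}
    (hm : ∀ K T, P.Inv (k + l.length + 1) T → (([], T) : LocalState A Z) ∈ P.goodAt Set.univ l →
      m K T = F K (P.descend l ([], T)))
    {v' : Hist A Z → ℝ} (hv' : ∀ g, g.length < horizon P.M.γ P.S.ε → v' g = v g) :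
    Tendsto (fun K : ℕ => runLaw K {ω | ¬ ∀ᶠ N in atTop,
      ∃ g, (treeAfter P.sim P.S P.s P.εa P.εz ω N).history l = some g ∧
        |m K (treeAfter P.sim P.S P.s P.εa P.εz ω N) - v' g| < δ}) atTop (𝓝 0) := by
  set G : ℕ → Set (LocalState A Z) := fun K => {s | P.Nondegenerate s.1 ∧ |F K s - v s.1| < δ}
  have hG : ∀ K, MeasurableSet (G K) := fun K =>
    (measurable_fst P.measurableSet_nondegenerate).inter
      (measurableSet_lt ((hF K).sub (hv.comp measurable_fst)).abs measurable_const)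
  have hlim := P.tendsto_badProb_goodAt (H := horizon P.M.γ P.S.ε) (k := k) hG (fun g hg hH => by
    refine tendsto_const_nhds.congr' ?_
    filter_upwards [h g hg (by omega)] with K hK
    symm
    rw [badProb, ← ae_iff]
    filter_upwards [hK] with ω hω
    filter_upwards [hω] with N hN
    exact ⟨by rwa [chain_fst], by rwa [chain_fst]⟩) l P.nondegenerate_nil (by simpa using hk)
  refine tendsto_of_tendsto_of_tendsto_of_le_of_le tendsto_const_nhds hlim
    (fun _ => zero_le) fun K => ?_
  beta_reduce
  rw [hk, ← P.runLaw_treeAfter (P.measurableSet_goodAt (hG K) l)]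
  -- Only this inclusion is needed, so the event formulated with `m` and `v'` need not be
  -- measurable; in particular `v'` may come from a policy that is not measurable.
  refine measure_mono fun ω hω hN => hω ?_
  filter_upwards [hN, eventually_ge_atTop 1] with N hN hN1
  obtain ⟨N, rfl⟩ := Nat.exists_eq_add_of_le' hN1
  have hT : P.Inv (k + l.length + 1) (treeAfter P.sim P.S P.s P.εa P.εz ω (N + 1)) :=
    hk ▸ P.inv_treeAfter ω N
  obtain ⟨h1, -, h2⟩ := P.goodAt_iff.1 hN
  obtain ⟨g, hg, hg'⟩ := P.exists_history h1
  rw [List.nil_append] at hg'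
  have hlen := P.length_descend l (([], treeAfter P.sim P.S P.s P.εa P.εz ω (N + 1)) : LocalState A Z)
  rw [hg', List.length_nil, zero_add] at hlen
  refine ⟨g, hg, ?_⟩
  rw [hm K _ hT h1, hv' g (by omega), ← hg']
  exact h2

section Policies

variable {k : ℕ} {l : Node A} (hk : k + l.length + 1 = horizon P.M.γ P.S.ε) {π π' : Policy A Z}
  (hMP : MeasurablePolicy (horizon P.M.γ P.S.ε) π')
  (htree : IsTreePolicy P.M (horizon P.M.γ P.S.ε) P.εa P.s π')
  (heq : ∀ g, g.length < horizon P.M.γ P.S.ε → π' g = π g)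

include heq in
theorem actionValue_congr_of_lt {g : Hist A Z} (hg : g.length < horizon P.M.γ P.S.ε) :
    P.M.actionValue (horizon P.M.γ P.S.ε) π g = P.M.actionValue (horizon P.M.γ P.S.ε) π' g :=
  P.actionValue_congr hg.le fun g' _ hg' => (heq g' hg').symm

include hk hMP htree heq

theorem tendsto_meanAtNode {δ : ℝ} (hδ : 0 < δ) :
    Tendsto (fun K : ℕ => runLaw K {ω | ¬ ∀ᶠ N in atTop,
      ∃ g, (treeAfter P.sim P.S P.s P.εa P.εz ω N).history l = some g ∧
        |meanAtNode P.sim P.S P.s P.εa P.εz K (treeAfter P.sim P.S P.s P.εa P.εz ω N) l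
          - P.M.value (horizon P.M.γ P.S.ε) π g| < δ}) atTop (𝓝 0) := by
  have hv : Measurable (P.M.value (horizon P.M.γ P.S.ε) π') :=
    Finset.measurable_sum _ fun a _ => (hMP.measurable a).mul
      (P.measurable_actionValue hMP.measurable hMP.sum_abs_le _ a)
  refine P.tendsto_runLaw hk (F := fun K => P.localMean K (k + 1) l.length)
    (fun K => P.measurable_localMean (k + 1) l.length) hv (fun g hg hgl => ?_)
    (m := fun K T => meanAtNode P.sim P.S P.s P.εa P.εz K T l)
    (fun K T hT hl => P.meanAtNode_eq hk hT hl) (fun g hg => ?_)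
  · filter_upwards [P.consistent hMP htree (k + 1) hg (by omega) le_rfl δ hδ] with K hK
    rwa [P.nodeMean_self hMP hg.2 (by omega), hgl] at hK
  · rw [POMDP.value, POMDP.value, P.actionValue_congr_of_lt heq hg, heq g hg]

theorem tendsto_meanAtActionNode (a : A) {δ : ℝ} (hδ : 0 < δ) :
    Tendsto (fun K : ℕ => runLaw K {ω | ¬ ∀ᶠ N in atTop,
      ∃ g, (treeAfter P.sim P.S P.s P.εa P.εz ω N).history l = some g ∧
        |meanAtActionNode P.sim P.S P.s P.εa P.εz K (treeAfter P.sim P.S P.s P.εa P.εz ω N) l a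
          - P.M.actionValue (horizon P.M.γ P.S.ε) π g a| < δ}) atTop (𝓝 0) := by
  refine P.tendsto_runLaw hk (F := fun K => P.actionMean K k l.length a)
    (fun K => P.measurable_actionMean k l.length a)
    (P.measurable_actionValue hMP.measurable hMP.sum_abs_le _ a) (fun g hg hgl => ?_)
    (m := fun K T => meanAtActionNode P.sim P.S P.s P.εa P.εz K T l a)
    (fun K T hT hl => (P.meanAtActionNode_eq hk hT hl a).2)
    (v' := fun g => P.M.actionValue (horizon P.M.γ P.S.ε) π g a)
    (fun g hg => congrFun (P.actionValue_congr_of_lt heq hg) a)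
  filter_upwards [P.actionConsistent hMP htree k hg (by omega) le_rfl a (δ / 2) (half_pos hδ)]
    with K hK
  rw [P.branchMean_self hMP, hgl] at hK
  filter_upwards [hK] with ω hω
  filter_upwards [hω] with N hN
  exact hN.trans_lt (half_lt_self hδ)

end Policies

end Planner

theorem theorem3 {X A Z : Type*} [MeasurableSpace X] [MeasurableSpace Z] [Fintype A] [Nonempty A]
    (M : POMDP X A Z) (sim : Simulator M) (S : Settings X) (s : Steering A Z)
    (εa εz : ℝ) (hεa : 0 < εa ∧ εa < 1) (hεz : -1 ≤ εz ∧ εz < 0)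
    (π : Policy A Z) (hπ : IsTreePolicy M (horizon M.γ S.ε) εa s π)
    (h : Node A) (hh : h.length < horizon M.γ S.ε) :
    -- every node eventually exists and is traversed with positive probability
    (∀ K : ℕ, ∀ᵐ ω ∂(runLaw K), ∀ᶠ N in atTop, ∀ a : A,
      0 < noiseLaw K
        (traversesActionNode sim S s εa εz K (treeAfter sim S s εa εz ω N) h a)) ∧
    -- belief nodes
    (∀ δ : ℝ, 0 < δ → Tendsto (fun K : ℕ => runLaw K {ω | ¬ ∀ᶠ N in atTop,
      ∃ g, (treeAfter sim S s εa εz ω N).history h = some g ∧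
        |meanAtNode sim S s εa εz K (treeAfter sim S s εa εz ω N) h
          - M.value (horizon M.γ S.ε) π g| < δ}) atTop (𝓝 0)) ∧
    -- belief-action nodes
    (∀ a : A, ∀ δ : ℝ, 0 < δ → Tendsto (fun K : ℕ => runLaw K {ω | ¬ ∀ᶠ N in atTop,
      ∃ g, (treeAfter sim S s εa εz ω N).history h = some g ∧
        |meanAtActionNode sim S s εa εz K (treeAfter sim S s εa εz ω N) h a
          - M.actionValue (horizon M.γ S.ε) π g a| < δ}) atTop (𝓝 0)) := by
  let : MeasurableSpace A := ⊤
  have : DiscreteMeasurableSpace A := ⟨fun _ => trivial⟩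
  let P : Planner X A Z := ⟨M, sim, S, s, εa, εz, hεa.1, hεa.2, hεz.1, hεz.2⟩
  obtain ⟨k, hk⟩ : ∃ k, k + h.length + 1 = horizon M.γ S.ε :=
    ⟨horizon M.γ S.ε - h.length - 1, by omega⟩
  -- The given policy is replaced by a measurable tree policy that agrees with it below the horizon;
  -- the values at histories of length below the horizon are the same for both.
  obtain ⟨π', htree, heq, hm, habs, hsum⟩ := P.exists_measurable_policy hπ
  have hMP : MeasurablePolicy (horizon M.γ S.ε) π' := ⟨hm, habs, hsum⟩
  refine ⟨fun K => ?_, fun δ hδ => P.tendsto_meanAtNode hk hMP htree heq hδ,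
    fun a δ hδ => P.tendsto_meanAtActionNode hk hMP htree heq a hδ⟩
  filter_upwards [P.ae_eventually_goodAt K hk] with ω hω
  filter_upwards [hω] with N hN a
  exact (P.meanAtActionNode_eq hk hN.1 hN.2 a).1
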